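/- **Setting.** Let $l>0$ and let $\Gamma\subset\{x'=(x_2,x_3): x_3<0\}$ be a bounded planar domain with Lipschitz boundary such that $\overline\Gamma\cap\{x_3=0\}=[-l,l]\times\{0\}$. Let $\Theta$ be a bounded subset of the canal $\mathbb R\times\Gamma\ni x=(x_1,x')$ with $\overline\Theta\subset\{x_3<0\}$, and let $\Pi=(\mathbb R\times\Gamma)\setminus\overline{\Theta}$ be connected, with Lipschitz boundary, and symmetric with respect to $x_2\mapsto-x_2$. (For a fixed $\varepsilon>0$ this is the case of the domain $\Pi(\varepsilon)$ with the body $\Theta=\Theta(\varepsilon)$.) Put $\Lambda=\mathbb R\times(-l,l)\times\{0\}$, $\Pi^+=\Pi\cap\{x_2>0\}$, $\Lambda^+=\Lambda\cap\{x_2>0\}$, $\Gamma^+=\Gamma\cap\{x_2>0\}$ and $\Pi^+(L)=\Pi^+\cap\{|x_1|<L\}$. Write $(\cdot,\cdot)_A$ for the $L^2(A)$ inner product; functions are complex valued and their values on $\Lambda$ are traces. Let $\mathcal H=H^1(\Pi)$ with the inner product $\langle\Phi,\Psi\rangle=(\nabla\Phi,\nabla\Psi)_{\Pi}+(\Phi,\Psi)_{\Lambda}$,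 and let $\mathcal H^0$ be its subspace of functions that are odd in $x_2$. For $\theta\in\mathbb R$ let $R_\theta=\exp(\theta(1+x_1^2)^{1/2})$, let $\mathcal W^0_\theta$ be the space of all functions $\Phi$ that are odd in $x_2$ and satisfy $R_\theta\Phi\in\mathcal H$, and let $\|\Phi;\mathcal W_\theta\|=\|R_\theta\Phi;\mathcal H\|$. The operator $T$ in $\mathcal H$ is defined by $\langle T\Phi,\Psi\rangle=(\Phi,\Psi)_{\Lambda}$ for $\Phi,\Psi\in\mathcal H$, and $T^0_\varepsilon$ is its restriction to $\mathcal H^0$. Let $\lambda^0_\Gamma$ be the first eigenvalue of the problem, understood in the weak sense in $H^1(\Gamma^+)$, $$-\Delta\varphi=0\ \text{in }\Gamma^+,\quad \varphi=0\ \text{on }\Gamma\cap\{x_2=0\},\quad \partial_{x_3}\varphi=\lambda\varphi\ \text{on }(0,l)\times\{0\},$$ with $\partial_n\varphi=0$ on the rest of $\partial\Gamma^+$, and let $\mu^0_\Gamma=(1+\lambda^0_\Gamma)^{-1}$. **Corollary 3.4.** Let $\mu\in(\mu_\Gamma^0,1]$ and $\lambda=\mu^{-1}-1$. For functions $\Phi,\Psi$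 and $M,L\in\mathbb R$ put $F(\Psi)=\lambda M(\Phi,\Psi)_{\Pi^+(L)}$. 1. Every eigenfunction $\Phi\in\mathcal H^0$ of $T^0_\varepsilon$ with the eigenvalue $\mu$ satisfies, for all $M,L\in\mathbb R$, $$(\nabla\Phi,\nabla\Psi)_{\Pi^+}+\lambda M(\Phi,\Psi)_{\Pi^+(L)}-\lambda(\Phi,\Psi)_{\Lambda^+}=F(\Psi),\qquad\Psi\in\mathcal H^0,$$ and the functional $F$ is continuous on $\mathcal W^0_{-\theta}$ for every $\theta\in\mathbb R$: there is a constant $C$ with $|F(\Psi)|\le C\|\Psi;\mathcal W_{-\theta}\|$ for all $\Psi\in\mathcal W^0_{-\theta}$. 2. There is $\theta_0>0$ such that, for every $\theta\in(0,\theta_0]$, every eigenfunction $\Phi\in\mathcal H^0$ of $T^0_\varepsilon$ with the eigenvalue $\mu$ belongs to $\mathcal W^0_\theta$ and satisfies, for all $M,L\in\mathbb R$, $$(\nabla\Phi,\nabla(R_\theta^2\Psi))_{\Pi^+}+\lambda M(\Phi,R_\theta^2\Psi)_{\Pi^+(L)}-\lambda(\Phi,R_\theta^2\Psi)_{\Lambda^+}=F(R_\theta^2\Psi),\qquad\Psi\in\mathcal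 W_\theta^0.$$ Hence $\Phi$ decays exponentially as $x_1\to\pm\infty$: there is a constant $C$ such that, for all $r\ge0$, $$\int_{\Pi\cap\{|x_1|\ge r\}}\bigl(|\Phi|^2+|\nabla\Phi|^2\bigr)\,dx+\int_{\Lambda\cap\{|x_1|\ge r\}}|\Phi|^2\,ds\le C e^{-2\theta r}.$$ -/

import Mathlib

open MeasureTheory Set
open scoped ContDiff NNReal ENNReal ComplexConjugate

namespace WaterCanal

noncomputable section

/-! ### Weak derivatives, first order Sobolev spaces and traces on a flat part of the boundary -/

section Generic

variable {E F ι : Type*} [NormedAddCommGroup E] [NormedSpace ℝ E] [MeasureSpace E]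
  [TopologicalSpace F] [MeasureSpace F]

/-- `φ` is a real test function, an element of `C_c^∞(E)`. -/
def IsTest (φ : E → ℝ) : Prop := ContDiff ℝ ∞ φ ∧ HasCompactSupport φ

/-- `g` is a weak derivative of `u` in the open set `Ω` in the direction `v`. -/
def IsWeakDeriv (Ω : Set E) (v : E) (u g : E → ℂ) : Prop :=
  LocallyIntegrableOn u Ω ∧ LocallyIntegrableOn g Ω ∧
    ∀ φ : E → ℝ, IsTest φ → tsupport φ ⊆ Ω →
      ∫ x in Ω, fderiv ℝ φ x v • u x = -∫ x in Ω, φ x • g x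

open Classical in
/-- The weak derivative of `u` in `Ω` in the direction `v` (unique up to a null set; `0` if there is
none). -/
def weakDeriv (Ω : Set E) (v : E) (u : E → ℂ) : E → ℂ :=
  if h : ∃ g, IsWeakDeriv Ω v u g then h.choose else 0

/-- `u ∈ H¹(Ω)`: both `u` and its weak derivatives in the coordinate directions `b i` are square
integrable over `Ω`. -/
def MemH1 (Ω : Set E) (b : ι → E) (u : E → ℂ) : Prop :=
  MemLp u 2 (volume.restrict Ω) ∧
    ∀ i, ∃ g, IsWeakDeriv Ω (b i) u g ∧ MemLp g 2 (volume.restrict Ω)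

/-- `(∇u, ∇v)_A`, where the weak gradients are taken in `Ω` and `A ⊆ Ω`. -/
def gradInner [Fintype ι] (Ω : Set E) (b : ι → E) (A : Set E) (u v : E → ℂ) : ℂ :=
  ∫ x in A, ∑ i, weakDeriv Ω (b i) u x * conj (weakDeriv Ω (b i) v x)

/-- The function `g` is the trace of `u` on the flat part `j '' S` of the boundary of `Ω`, which
has the constant outward unit normal `e`. The trace is given by the integration by parts formula
`∫_Ω (φ ∂ₑu + u ∂ₑφ) dx = ∫_{j '' S} g φ ds`, for all test functions `φ` that vanish near the rest of
the boundary. The map `j : F → E` is the parametrization by Cartesian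
coordinates of the line or plane that contains `j '' S`, and `S` is open. -/
def IsTrace (Ω : Set E) (e : E) (j : F → E) (S : Set F) (u : E → ℂ) (g : F → ℂ) : Prop :=
  LocallyIntegrableOn g S ∧
    ∀ φ : E → ℝ, IsTest φ → Disjoint (tsupport φ) (frontier Ω \ j '' S) →
      ∫ x in Ω, (φ x • weakDeriv Ω e u x + fderiv ℝ φ x e • u x) = ∫ y in S, φ (j y) • g y

open Classical in
/-- The trace of `u` on `j '' S` (unique up to a null set; `0` if there is none). -/
def trace (Ω : Set E) (e : E) (j : F → E) (S : Set F) (u : E → ℂ) : F → ℂ :=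
  if h : ∃ g, IsTrace Ω e j S u g then h.choose else 0

end Generic

/-- `Ω` has a Lipschitz boundary: near each of its boundary points it is, in suitable linear
coordinates with values in `F × ℝ`, the set of points below the graph of a Lipschitz function. -/
def HasLipschitzBoundary (F : Type*) [NormedAddCommGroup F] [NormedSpace ℝ F]
    {E : Type*} [NormedAddCommGroup E] [NormedSpace ℝ E] (Ω : Set E) : Prop :=
  ∀ x ∈ frontier Ω, ∃ (A : E ≃L[ℝ] F × ℝ) (K : ℝ≥0) (f : F → ℝ) (U : Set E),
    LipschitzWith K f ∧ IsOpen U ∧ x ∈ U ∧ ∀ y ∈ U, (y ∈ Ω ↔ (A y).2 < f (A y).1)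

/-! ### Geometry of the canal

Points of the plane are `x' = (x₂, x₃)`, points of the space are `x = (x₁, x₂, x₃) = (x₁, x')`.
(The product types carry the usual topology and the Lebesgue measure; their norm is never used
in a quantitative way.) -/

/-- The coordinate directions of the plane. -/
def e2 : Fin 2 → ℝ × ℝ := ![(1, 0), (0, 1)]

/-- The coordinate directions of the space. -/
def e3 : Fin 3 → ℝ × ℝ × ℝ := ![(1, 0, 0), (0, 1, 0), (0, 0, 1)]

/-- The infinite canal `Π = ℝ × Γ`. -/
def canal (Γ : Set (ℝ × ℝ)) : Set (ℝ × ℝ × ℝ) := {x | x.2 ∈ Γ}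

/-- The part of the canal occupied by water, `Π \ closure Θ`. -/
def water (Γ : Set (ℝ × ℝ)) (Θ : Set (ℝ × ℝ × ℝ)) : Set (ℝ × ℝ × ℝ) := canal Γ \ closure Θ

/-- Reflection in the plane `x₂ = 0`. -/
def refl (x : ℝ × ℝ × ℝ) : ℝ × ℝ × ℝ := (x.1, -x.2.1, x.2.2)

/-- The half space `x₂ > 0`. -/
def rightHalf : Set (ℝ × ℝ × ℝ) := {x | 0 < x.2.1}

/-- The canal with the cross-section `Γ` and the water surface `ℝ × (-l, l) × {0}`, together with a
submerged body `Θ`. -/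
structure IsCanalWithBody (Γ : Set (ℝ × ℝ)) (l : ℝ) (Θ : Set (ℝ × ℝ × ℝ)) : Prop where
  l_pos : 0 < l
  isOpen_section : IsOpen Γ
  isConnected_section : IsConnected Γ
  isBounded_section : Bornology.IsBounded Γ
  lipschitz_section : HasLipschitzBoundary ℝ Γ
  section_below : ∀ x ∈ Γ, x.2 < 0
  section_surface : closure Γ ∩ {x | x.2 = 0} = Icc (-l) l ×ˢ {0}
  isBounded_body : Bornology.IsBounded Θ
  body_subset : Θ ⊆ canal Γ
  body_submerged : ∀ x ∈ closure Θ, x.2.2 < 0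
  isConnected_water : IsConnected (water Γ Θ)
  lipschitz_water : HasLipschitzBoundary (ℝ × ℝ) (water Γ Θ)
  symmetric : ∀ x, refl x ∈ water Γ Θ ↔ x ∈ water Γ Θ

/-! ### The Steklov problem on the half `Γ⁺ = {x' ∈ Γ : x₂ > 0}` of the cross-section -/

/-- Trace on the interval `γ₀ = (-l, l) × {0}` of the boundary of `Γ`. -/
def sectionTrace (Γ : Set (ℝ × ℝ)) (l : ℝ) (φ : ℝ × ℝ → ℂ) : ℝ → ℂ :=
  trace Γ ((0, 1) : ℝ × ℝ) (fun y : ℝ => (y, (0 : ℝ))) (Ioo (-l) l) φ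

/-- The space of all `φ ∈ H¹(Γ⁺)` with `φ = 0` on `{x' ∈ Γ : x₂ = 0}`. A function on `Γ⁺`
satisfies this Dirichlet condition exactly when its extension by zero is in `H¹(Γ)`; we identify
it with this extension. -/
def MemSection0 (Γ : Set (ℝ × ℝ)) (φ : ℝ × ℝ → ℂ) : Prop :=
  MemH1 Γ e2 φ ∧ ∀ᵐ x ∂(volume.restrict Γ), x.1 ≤ 0 → φ x = 0

/-- The eigenvalues `lam` of the mixed Dirichlet-Neumann-Steklov problem on `Γ⁺`:
`-Δφ = 0` in `Γ⁺`, `φ = 0` for `x₂ = 0`, `∂₃φ = lam φ` on the surface `{0 < x₂ < l, x₃ = 0}`, and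
`∂ₙφ = 0` on the rest of the boundary, in the weak sense. -/
def steklovEigenvalues (Γ : Set (ℝ × ℝ)) (l : ℝ) : Set ℝ :=
  {lam | ∃ φ, MemSection0 Γ φ ∧ ¬ (φ =ᵐ[volume.restrict Γ] 0) ∧ ∀ ψ, MemSection0 Γ ψ →
    gradInner Γ e2 (Γ ∩ {x | 0 < x.1}) φ ψ =
      (lam : ℂ) * ∫ y in Ioo 0 l, sectionTrace Γ l φ y * conj (sectionTrace Γ l ψ y)}

/-- The first eigenvalue `λ_Γ⁰`. -/
def lambdaGamma (Γ : Set (ℝ × ℝ)) (l : ℝ) : ℝ := sInf (steklovEigenvalues Γ l)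

/-- The threshold `μ_Γ⁰ = (1 + λ_Γ⁰)⁻¹`. -/
def muGamma (Γ : Set (ℝ × ℝ)) (l : ℝ) : ℝ := (1 + lambdaGamma Γ l)⁻¹

/-! ### The spaces `ℋ`, `ℋ⁰`, `𝒲_θ`, `𝒲_θ⁰` and the operator `T⁰`

Below `Ω` is the domain occupied by water. Functions that agree almost everywhere in `Ω` are
regarded as equal. -/

/-- The parameter domain of the water surface `Λ = ℝ × (-l, l) × {0}`, in the coordinates
`(x₁, x₂)`. -/
def surface (l : ℝ) : Set (ℝ × ℝ) := univ ×ˢ Ioo (-l) l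

/-- Trace on the water surface `Λ`. -/
def surfaceTrace (Ω : Set (ℝ × ℝ × ℝ)) (l : ℝ) (Φ : ℝ × ℝ × ℝ → ℂ) : ℝ × ℝ → ℂ :=
  trace Ω ((0, 0, 1) : ℝ × ℝ × ℝ) (fun y : ℝ × ℝ => (y.1, y.2, (0 : ℝ))) (surface l) Φ

/-- `(Φ, Ψ)` over the part `B` of the surface `Λ`. -/
def surfaceInner (Ω : Set (ℝ × ℝ × ℝ)) (l : ℝ) (B : Set (ℝ × ℝ)) (Φ Ψ : ℝ × ℝ × ℝ → ℂ) : ℂ :=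
  ∫ y in B, surfaceTrace Ω l Φ y * conj (surfaceTrace Ω l Ψ y)

/-- The inner product `⟨Φ, Ψ⟩ = (∇Φ, ∇Ψ)_Ω + (Φ, Ψ)_Λ` of `ℋ`. -/
def innerH (Ω : Set (ℝ × ℝ × ℝ)) (l : ℝ) (Φ Ψ : ℝ × ℝ × ℝ → ℂ) : ℂ :=
  gradInner Ω e3 Ω Φ Ψ + surfaceInner Ω l (surface l) Φ Ψ

/-- The norm `(‖∇Φ; L²(Ω)‖² + ‖Φ; L²(Λ)‖²)^(1/2)` of `ℋ`. -/
def normH (Ω : Set (ℝ × ℝ × ℝ)) (l : ℝ) (Φ : ℝ × ℝ × ℝ → ℂ) : ℝ :=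
  Real.sqrt ((∫ x in Ω, ∑ i, ‖weakDeriv Ω (e3 i) Φ x‖ ^ 2) +
    ∫ y in surface l, ‖surfaceTrace Ω l Φ y‖ ^ 2)

/-- `Φ` is odd in `x₂`. -/
def IsOdd (Ω : Set (ℝ × ℝ × ℝ)) (Φ : ℝ × ℝ × ℝ → ℂ) : Prop :=
  ∀ᵐ x ∂(volume.restrict Ω), Φ (refl x) = -Φ x

/-- `Φ ∈ ℋ = H¹(Ω)`. -/
def MemH (Ω : Set (ℝ × ℝ × ℝ)) (Φ : ℝ × ℝ × ℝ → ℂ) : Prop := MemH1 Ω e3 Φ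

/-- `Φ ∈ ℋ⁰`. -/
def MemH0 (Ω : Set (ℝ × ℝ × ℝ)) (Φ : ℝ × ℝ × ℝ → ℂ) : Prop := MemH Ω Φ ∧ IsOdd Ω Φ

/-- The weight `R_θ(x) = exp (θ (1 + x₁²)^(1/2))`. -/
def weight (θ : ℝ) (x : ℝ × ℝ × ℝ) : ℝ := Real.exp (θ * Real.sqrt (1 + x.1 ^ 2))

/-- The product `R_θ Φ`. -/
def weighted (θ : ℝ) (Φ : ℝ × ℝ × ℝ → ℂ) : ℝ × ℝ × ℝ → ℂ := fun x => weight θ x • Φ x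

/-- `Φ ∈ 𝒲_θ⁰`: `Φ` is odd in `x₂` and `R_θ Φ ∈ ℋ`. -/
def MemW0 (Ω : Set (ℝ × ℝ × ℝ)) (θ : ℝ) (Φ : ℝ × ℝ × ℝ → ℂ) : Prop :=
  MemH Ω (weighted θ Φ) ∧ IsOdd Ω Φ

/-- The norm `‖Φ; 𝒲_θ‖ = ‖R_θ Φ; ℋ‖`. -/
def normW (Ω : Set (ℝ × ℝ × ℝ)) (l θ : ℝ) (Φ : ℝ × ℝ × ℝ → ℂ) : ℝ := normH Ω l (weighted θ Φ)

/-- The graph of the operator `T` in `ℋ`: `T Φ = Ξ` means that `⟨Ξ, Ψ⟩ = (Φ, Ψ)_Λ` for all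
`Ψ ∈ ℋ`. -/
def GraphT (Ω : Set (ℝ × ℝ × ℝ)) (l : ℝ) (Φ Ξ : ℝ × ℝ × ℝ → ℂ) : Prop :=
  MemH Ω Φ ∧ MemH Ω Ξ ∧ ∀ Ψ, MemH Ω Ψ → innerH Ω l Ξ Ψ = surfaceInner Ω l (surface l) Φ Ψ

/-- The graph of the restriction `T⁰` of `T` to `ℋ⁰`. -/
def GraphT0 (Ω : Set (ℝ × ℝ × ℝ)) (l : ℝ) (Φ Ξ : ℝ × ℝ × ℝ → ℂ) : Prop :=
  MemH0 Ω Φ ∧ GraphT Ω l Φ Ξ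

/-- `Φ` is an eigenfunction of `T⁰` with the eigenvalue `μ`. -/
def IsEigenfunctionT0 (Ω : Set (ℝ × ℝ × ℝ)) (l μ : ℝ) (Φ : ℝ × ℝ × ℝ → ℂ) : Prop :=
  ¬ (Φ =ᵐ[volume.restrict Ω] 0) ∧ GraphT0 Ω l Φ ((μ : ℂ) • Φ)

/-! ### The perturbed problem on the half `Ω⁺ = {x ∈ Ω : x₂ > 0}` -/

/-- `Ω⁺(L) = {x ∈ Ω⁺ : |x₁| < L}`. -/
def truncHalf (Ω : Set (ℝ × ℝ × ℝ)) (L : ℝ) : Set (ℝ × ℝ × ℝ) := Ω ∩ rightHalf ∩ {x | |x.1| < L}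

/-- `lam M (Φ, Ψ)` over `Ω⁺(L)`. -/
def perturbation (Ω : Set (ℝ × ℝ × ℝ)) (lam M L : ℝ) (Φ Ψ : ℝ × ℝ × ℝ → ℂ) : ℂ :=
  (lam : ℂ) * (M : ℂ) * ∫ x in truncHalf Ω L, Φ x * conj (Ψ x)

/-- The form `(∇Φ, ∇Ψ)_{Ω⁺} + lam M (Φ, Ψ)_{Ω⁺(L)} - lam (Φ, Ψ)_{Λ⁺}`, where
`Λ⁺ = {x ∈ Λ : x₂ > 0}`. -/
def perturbedForm (Ω : Set (ℝ × ℝ × ℝ)) (l lam M L : ℝ) (Φ Ψ : ℝ × ℝ × ℝ → ℂ) : ℂ :=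
  gradInner Ω e3 (Ω ∩ rightHalf) Φ Ψ + perturbation Ω lam M L Φ Ψ
    - (lam : ℂ) * surfaceInner Ω l (univ ×ˢ Ioo 0 l) Φ Ψ

/-! ### Exponential decay -/

/-- The energy `∫ (|Φ|² + |∇Φ|²) dx + ∫_Λ |Φ|² ds` over the part `|x₁| ≥ r` of the canal. -/
def tailEnergy (Ω : Set (ℝ × ℝ × ℝ)) (l r : ℝ) (Φ : ℝ × ℝ × ℝ → ℂ) : ℝ≥0∞ :=
  (∫⁻ x in Ω ∩ {x | r ≤ |x.1|}, (‖Φ x‖ₑ ^ 2 + ∑ i, ‖weakDeriv Ω (e3 i) Φ x‖ₑ ^ 2)) +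
    ∫⁻ y in surface l ∩ {y | r ≤ |y.1|}, ‖surfaceTrace Ω l Φ y‖ₑ ^ 2

end

end WaterCanal

open WaterCanal

open Filter Topology
set_option linter.unusedSectionVars false
set_option linter.style.haveILetI false

/-! Put λ = μ⁻¹ - 1. The assumption on μ says exactly that 0 ≤ λ < λ_Γ⁰ (`steklov_parameter`), and
this gap is the source of the decay.

The weak form on the half domain. The eigenvalue relation is (∇Φ, ∇Ψ)_Π = λ (Φ, Ψ)_Λ for all Ψ in ℋ.
An odd function has no jump across the plane x₂ = 0 when it is replaced by zero in the left half;
thus `cut Ψ` is again in ℋ (`IsWeakDeriv.cut`), and testing with it gives the identity on Π⁺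
(`half_form`). The terms with M are the same on both sides of the asserted identity and cancel. The
bound for F is a local Friedrichs inequality for `cut`, together with the boundedness of the weight
on |x₁| < L (`exists_perturbation_le`).

The decay is a weighted energy estimate. Let ρ = (R_{-θ} + ε)⁻¹, a bounded regularization of R_θ
with |ρ'| ≤ θρ, and let w = ρ cut Φ. Testing with ρ² cut Φ gives ‖∇w‖² = λ ‖w‖²_Λ + ‖ρ' cut Φ‖²
(`energy_identity`). Beyond the body the domain is a cylinder, and the inequality λ_Γ⁰ ‖φ‖² ≤ ‖∇φ‖²
for the cross-section gives λ_Γ⁰ ‖w‖²_Λ ≤ ‖∇w‖² up to a contribution of a bounded piece, on which ρ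
is bounded uniformly in ε. Poincaré's inequality bounds ‖w‖² in the same way. As λ / λ_Γ⁰ < 1, the
remaining terms are absorbed when θ is small (`absorb`, `exists_energy_bound`). Fatou's lemma for ε
→ 0 and the reflection x₂ ↦ -x₂ give R_θ Φ ∈ ℋ (`exists_memLp_axial`). The weighted identity then
follows by dominated convergence (`weighted_form`), and the tail estimate holds because R_θ² ≥
e^{2θr} for |x₁| ≥ r.

The Steklov inequality on the cross-section. Here λ_Γ⁰ is the infimum of the eigenvalues, not of a
Rayleigh quotient, so an eigenvalue has to be produced. The trace t from the Hilbert space of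
gradients to L² of the surface is compact (`exists_traceCLM`). If t ≠ 0, then ‖t‖⁻² is an
eigenvalue, hence λ_Γ⁰ ≤ ‖t‖⁻², which is the inequality (`lambdaGamma_mul_le`). For the compactness,
a trace is, up to a small multiple of the gradient, a combination of means over a thin layer; such a
mean varies little under tangential translation, so finitely many cell averages determine it up to a
small error.

From the cross-section to the cylinder. The inequality is applied to weighted means in x₁, which are
H¹ functions of x'; mollifier kernels are taken as weights, and Young's inequality and Fatou's lemma
remove the mollification (`l2sq_le_of_avg_le`).

Poincaré and Friedrichs inequalities come from comparing u(x + v) with u(x) along segments in the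
domain, starting from an open set where the function vanishes and using connectedness and the
Lipschitz boundary (`HasLipschitzBoundary.controls`). Traces are built as means along transversal
segments, by the fundamental theorem of calculus in integrated form (`FlatBoundary`). -/

namespace WaterCanal

/-! ### Square integrals -/

section SquareIntegral

variable {α : Type*} [MeasurableSpace α] {μ : Measure α}

/-- The square of the `L²` norm, as an extended nonnegative number. -/
noncomputable def l2sq {G : Type*} [NormedAddCommGroup G] (μ : Measure α) (f : α → G) : ℝ≥0∞ :=
  ∫⁻ x, ‖f x‖ₑ ^ 2 ∂μ

variable {G : Type*} [NormedAddCommGroup G] {f g : α → G}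

theorem eLpNorm_two_sq (f : α → G) : eLpNorm f 2 μ ^ 2 = l2sq μ f := by
  have h := eLpNorm_nnreal_pow_eq_lintegral (f := f) (μ := μ) (p := 2) (by norm_num)
  simpa [l2sq] using h

theorem memLp_two_iff_l2sq : MemLp f 2 μ ↔ AEStronglyMeasurable f μ ∧ l2sq μ f < ⊤ := by
  rw [← eLpNorm_two_sq, MemLp]
  simp

theorem l2sq_lt_top (hf : MemLp f 2 μ) : l2sq μ f < ⊤ := (memLp_two_iff_l2sq.1 hf).2

theorem l2sq_congr (h : f =ᵐ[μ] g) : l2sq μ f = l2sq μ g :=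
  lintegral_congr_ae (h.mono fun x hx => by simp only [hx])

theorem l2sq_mono {G' : Type*} [NormedAddCommGroup G'] {g : α → G'}
    (h : ∀ᵐ x ∂μ, ‖f x‖ ≤ ‖g x‖) : l2sq μ f ≤ l2sq μ g :=
  lintegral_mono_ae (h.mono fun x hx => by gcongr; exact enorm_le_iff_norm_le.2 hx)

theorem l2sq_restrict_mono {s t : Set α} (h : s ⊆ t) :
    l2sq (μ.restrict s) f ≤ l2sq (μ.restrict t) f := lintegral_mono_set h

theorem ennreal_add_sq_le (a b : ℝ≥0∞) : (a + b) ^ 2 ≤ 2 * a ^ 2 + 2 * b ^ 2 := by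
  rcases eq_or_ne a ∞ with rfl | ha
  · simp
  rcases eq_or_ne b ∞ with rfl | hb
  · simp
  lift a to ℝ≥0 using ha
  lift b to ℝ≥0 using hb
  norm_cast
  rw [← NNReal.coe_le_coe]
  push_cast
  nlinarith [sq_nonneg ((a : ℝ) - b)]

theorem l2sq_add_le (hf : AEStronglyMeasurable f μ) :
    l2sq μ (fun x => f x + g x) ≤ 2 * l2sq μ f + 2 * l2sq μ g := by
  unfold l2sq
  rw [← lintegral_const_mul' _ _ (by norm_num), ← lintegral_const_mul' _ _ (by norm_num),
    ← lintegral_add_left' (by fun_prop)]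
  refine lintegral_mono fun x => ?_
  refine le_trans ?_ (ennreal_add_sq_le _ _)
  gcongr
  exact enorm_add_le _ _

theorem l2sq_neg : l2sq μ (fun x => - f x) = l2sq μ f := by simp [l2sq]

theorem l2sq_sub_le (hf : AEStronglyMeasurable f μ) :
    l2sq μ (fun x => f x - g x) ≤ 2 * l2sq μ f + 2 * l2sq μ g := by
  have := l2sq_add_le (g := fun x => - g x) hf
  rw [l2sq_neg] at this
  simpa only [sub_eq_add_neg] using this

theorem l2sq_const_smul {𝕜 : Type*} [NormedField 𝕜] [NormedSpace 𝕜 G] (c : 𝕜) :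
    l2sq μ (fun x => c • f x) = ‖c‖ₑ ^ 2 * l2sq μ f := by
  simp only [l2sq, enorm_smul, mul_pow]
  rw [lintegral_const_mul' _ _ (by simp)]

theorem sq_lintegral_le (f : α → ℝ≥0∞) (hf : AEMeasurable f μ) :
    (∫⁻ x, f x ∂μ) ^ 2 ≤ μ univ * ∫⁻ x, f x ^ 2 ∂μ := by
  have h := ENNReal.lintegral_mul_le_Lp_mul_Lq μ Real.HolderConjugate.two_two
    (f := fun _ => 1) (g := f) aemeasurable_const hf
  simp only [Pi.mul_apply, one_mul, ENNReal.one_rpow, lintegral_const] at h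
  calc (∫⁻ x, f x ∂μ) ^ 2
      ≤ (μ univ ^ (1 / (2:ℝ)) * (∫⁻ x, f x ^ (2:ℝ) ∂μ) ^ (1 / (2:ℝ))) ^ 2 := by gcongr
    _ = μ univ * ∫⁻ x, f x ^ 2 ∂μ := by
      rw [mul_pow, ← ENNReal.rpow_natCast, ← ENNReal.rpow_natCast, ← ENNReal.rpow_mul,
        ← ENNReal.rpow_mul]
      simp

theorem enorm_integral_sq_le [NormedSpace ℝ G] (hf : AEStronglyMeasurable f μ) :
    ‖∫ x, f x ∂μ‖ₑ ^ 2 ≤ μ univ * l2sq μ f := by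
  refine le_trans ?_ (sq_lintegral_le _ hf.enorm)
  gcongr
  exact enorm_integral_le_lintegral_enorm _

/-- Hölder's inequality: pairing with a fixed L² function is continuous in L². It lets the defining
identity of a weak derivative pass to limits. -/
theorem tendsto_integral_smul_of_tendsto_l2sq [NormedSpace ℝ G] {φ : α → ℝ} (hφ : MemLp φ 2 μ)
    {u : ℕ → α → G} {v : α → G} (hu : ∀ n, MemLp (u n) 2 μ) (hv : MemLp v 2 μ)
    (h : Tendsto (fun n => l2sq μ (fun x => u n x - v x)) atTop (𝓝 0)) :
    Tendsto (fun n => ∫ x, φ x • u n x ∂μ) atTop (𝓝 (∫ x, φ x • v x ∂μ)) := by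
  have hint : ∀ w : α → G, MemLp w 2 μ → Integrable (fun x => φ x • w x) μ := fun w hw => by
    have := hw.smul (r := 1) hφ
    rw [memLp_one_iff_integrable] at this
    exact this
  have h1 : Tendsto (fun n => eLpNorm (fun x => u n x - v x) 2 μ) atTop (𝓝 0) := by
    have := (ENNReal.continuous_rpow_const (y := (1 / 2 : ℝ))).tendsto 0 |>.comp h
    simp only [one_div, ENNReal.zero_rpow_of_pos (by norm_num : (0:ℝ) < 2⁻¹)] at this
    refine this.congr fun n => ?_
    simp only [Function.comp, ← eLpNorm_two_sq]
    rw [← ENNReal.rpow_natCast, ← ENNReal.rpow_mul]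
    simp
  refine tendsto_integral_of_L1 _ (hint v hv).1 (Eventually.of_forall fun n => hint _ (hu n)) ?_
  have h2 : Tendsto (fun n => eLpNorm φ 2 μ * eLpNorm (fun x => u n x - v x) 2 μ) atTop (𝓝 0) := by
    simpa using ENNReal.Tendsto.const_mul h1 (Or.inr hφ.2.ne)
  refine tendsto_of_tendsto_of_tendsto_of_le_of_le tendsto_const_nhds h2 (fun _ => zero_le)
    fun n => ?_
  have h3 := eLpNorm_smul_le_mul_eLpNorm (p := 2) (q := 2) (r := 1)
    ((hu n).sub hv).1 hφ.1
  rw [eLpNorm_one_eq_lintegral_enorm] at h3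
  simpa [smul_sub, Pi.sub_def] using h3

end SquareIntegral

/-! ### Weak derivatives -/

section WeakDeriv

variable {E : Type*} [NormedAddCommGroup E] [NormedSpace ℝ E]

theorem IsTest.continuous {φ : E → ℝ} (h : IsTest φ) : Continuous φ := h.1.continuous

theorem IsTest.differentiable {φ : E → ℝ} (h : IsTest φ) : Differentiable ℝ φ :=
  h.1.differentiable (by simp)

theorem IsTest.fderiv_apply {φ : E → ℝ} (h : IsTest φ) (v : E) :
    IsTest (fun x => fderiv ℝ φ x v) :=
  ⟨(h.1.fderiv_right (m := ∞) (by simp)).clm_apply contDiff_const, h.2.fderiv_apply (𝕜 := ℝ) v⟩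

theorem tsupport_fderiv_apply (φ : E → ℝ) (v : E) :
    tsupport (fun x => fderiv ℝ φ x v) ⊆ tsupport φ := tsupport_fderiv_apply_subset ℝ v

theorem IsTest.mul_left {φ ρ : E → ℝ} (h : IsTest φ) (hρ : ContDiff ℝ ∞ ρ) :
    IsTest (fun x => ρ x * φ x) := ⟨hρ.mul h.1, h.2.mul_left⟩

theorem IsTest.add {φ ψ : E → ℝ} (h : IsTest φ) (h' : IsTest ψ) : IsTest (fun x => φ x + ψ x) :=
  ⟨h.1.add h'.1, h.2.add h'.2⟩

theorem IsTest.sub {φ ψ : E → ℝ} (h : IsTest φ) (h' : IsTest ψ) : IsTest (fun x => φ x - ψ x) :=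
  ⟨h.1.sub h'.1, h.2.sub h'.2⟩

theorem IsTest.exists_bound {φ : E → ℝ} (h : IsTest φ) : ∃ C, ∀ x, ‖φ x‖ ≤ C :=
  h.2.exists_bound_of_continuous h.continuous

variable [MeasureSpace E] [BorelSpace E] [FiniteDimensional ℝ E]

theorem integrable_test_smul {Ω : Set E} {u : E → ℂ} {φ : E → ℝ}
    (hu : LocallyIntegrableOn u Ω) (hφ : Continuous φ) (hc : HasCompactSupport φ)
    (hs : tsupport φ ⊆ Ω) : Integrable (fun x => φ x • u x) := by
  have : (tsupport φ).indicator (fun x ↦ φ x • u x) = (fun x ↦ φ x • u x) := by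
    apply indicator_eq_self.2
    apply Function.support_subset_iff'.2
    intro x hx
    simp [image_eq_zero_of_notMem_tsupport hx]
  rw [← this, indicator_smul]
  refine Integrable.smul_of_top_right (φ := φ) (f := (tsupport φ).indicator u) ?_ ?_
  · rw [integrable_indicator_iff (IsCompact.measurableSet hc)]
    exact hu.integrableOn_compact_subset hs hc
  · exact memLp_top_of_bound hφ.aestronglyMeasurable _
      (Eventually.of_forall (hc.exists_bound_of_continuous hφ).choose_spec)

theorem setIntegral_test_smul {Ω : Set E} {φ : E → ℝ} (hs : tsupport φ ⊆ Ω) (u : E → ℂ) :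
    ∫ x in Ω, φ x • u x = ∫ x, φ x • u x := by
  refine setIntegral_eq_integral_of_forall_compl_eq_zero fun x hx => ?_
  simp [image_eq_zero_of_notMem_tsupport fun h => hx (hs h)]

variable {Ω Ω' : Set E} {v w : E} {u u' g g' : E → ℂ}

theorem IsWeakDeriv.integral_eq (h : IsWeakDeriv Ω v u g) {φ : E → ℝ} (hφ : IsTest φ)
    (hs : tsupport φ ⊆ Ω) : ∫ x, fderiv ℝ φ x v • u x = -∫ x, φ x • g x := by
  have := h.2.2 φ hφ hs
  rwa [setIntegral_test_smul hs, setIntegral_test_smul ((tsupport_fderiv_apply φ v).trans hs)]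
    at this

/-- Test functions supported in Ω vanish elsewhere, so both integrals may be taken over the whole
space. In this form shrinking Ω or changing variables does not touch the domain of integration. -/
theorem isWeakDeriv_iff : IsWeakDeriv Ω v u g ↔ LocallyIntegrableOn u Ω ∧
    LocallyIntegrableOn g Ω ∧ ∀ φ : E → ℝ, IsTest φ → tsupport φ ⊆ Ω →
      ∫ x, fderiv ℝ φ x v • u x = -∫ x, φ x • g x := by
  constructor
  · exact fun h => ⟨h.1, h.2.1, fun φ hφ hs => h.integral_eq hφ hs⟩
  · rintro ⟨h1, h2, h3⟩
    refine ⟨h1, h2, fun φ hφ hs => ?_⟩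
    rw [setIntegral_test_smul hs, setIntegral_test_smul ((tsupport_fderiv_apply φ v).trans hs)]
    exact h3 φ hφ hs

theorem IsWeakDeriv.mono (h : IsWeakDeriv Ω v u g) (hs : Ω' ⊆ Ω) : IsWeakDeriv Ω' v u g := by
  rw [isWeakDeriv_iff] at h ⊢
  exact ⟨h.1.mono_set hs, h.2.1.mono_set hs, fun φ hφ hφs => h.2.2 φ hφ (hφs.trans hs)⟩

theorem IsWeakDeriv.congr (h : IsWeakDeriv Ω v u g) (hu : u =ᵐ[volume.restrict Ω] u')
    (hg : g =ᵐ[volume.restrict Ω] g') : IsWeakDeriv Ω v u' g' := by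
  refine ⟨h.1.congr hu, h.2.1.congr hg, fun φ hφ hs => ?_⟩
  have h1 : ∫ x in Ω, fderiv ℝ φ x v • u x = ∫ x in Ω, fderiv ℝ φ x v • u' x :=
    integral_congr_ae (hu.mono fun x hx => by simp only [hx])
  have h2 : ∫ x in Ω, φ x • g x = ∫ x in Ω, φ x • g' x :=
    integral_congr_ae (hg.mono fun x hx => by simp only [hx])
  rw [← h1, ← h2, h.2.2 φ hφ hs]

/-- The fundamental lemma of the calculus of variations, applied to the difference. It makes the
arbitrary choice in `weakDeriv` harmless. -/
theorem IsWeakDeriv.ae_unique (hΩ : IsOpen Ω) (h : IsWeakDeriv Ω v u g)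
    (h' : IsWeakDeriv Ω v u g') : g =ᵐ[volume.restrict Ω] g' := by
  have := hΩ.ae_eq_zero_of_integral_contDiff_smul_eq_zero (h.2.1.sub h'.2.1) (fun φ h1 h2 h3 => by
    simp only [Pi.sub_apply, smul_sub]
    rw [integral_sub (integrable_test_smul h.2.1 h1.continuous h2 h3)
      (integrable_test_smul h'.2.1 h1.continuous h2 h3), sub_eq_zero, ← neg_inj,
      ← h.integral_eq ⟨h1, h2⟩ h3, ← h'.integral_eq ⟨h1, h2⟩ h3])
  rw [Filter.EventuallyEq, ae_restrict_iff' hΩ.measurableSet]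
  filter_upwards [this] with x hx hxs
  simpa [sub_eq_zero] using hx hxs

theorem isWeakDeriv_weakDeriv (h : IsWeakDeriv Ω v u g) :
    IsWeakDeriv Ω v u (weakDeriv Ω v u) := by
  have hex : ∃ g, IsWeakDeriv Ω v u g := ⟨g, h⟩
  rw [weakDeriv, dif_pos hex]
  exact hex.choose_spec

theorem IsWeakDeriv.weakDeriv_ae (hΩ : IsOpen Ω) (h : IsWeakDeriv Ω v u g) :
    weakDeriv Ω v u =ᵐ[volume.restrict Ω] g := (isWeakDeriv_weakDeriv h).ae_unique hΩ h

theorem IsWeakDeriv.add (h : IsWeakDeriv Ω v u g) (h' : IsWeakDeriv Ω v u' g') :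
    IsWeakDeriv Ω v (u + u') (g + g') := by
  rw [isWeakDeriv_iff]
  refine ⟨h.1.add h'.1, h.2.1.add h'.2.1, fun φ hφ hs => ?_⟩
  have hd := hφ.fderiv_apply v
  have hds := (tsupport_fderiv_apply φ v).trans hs
  simp only [Pi.add_apply, smul_add]
  rw [integral_add (integrable_test_smul h.1 hd.continuous hd.2 hds)
    (integrable_test_smul h'.1 hd.continuous hd.2 hds),
    integral_add (integrable_test_smul h.2.1 hφ.continuous hφ.2 hs)
    (integrable_test_smul h'.2.1 hφ.continuous hφ.2 hs), h.integral_eq hφ hs, h'.integral_eq hφ hs]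
  ring

theorem IsWeakDeriv.const_smul (h : IsWeakDeriv Ω v u g) (c : ℂ) :
    IsWeakDeriv Ω v (c • u) (c • g) := by
  rw [isWeakDeriv_iff]
  refine ⟨h.1.smul c, h.2.1.smul c, fun φ hφ hs => ?_⟩
  simp only [Pi.smul_apply, smul_comm _ c, integral_smul]
  rw [h.integral_eq hφ hs, smul_neg]

theorem IsWeakDeriv.neg (h : IsWeakDeriv Ω v u g) : IsWeakDeriv Ω v (-u) (-g) := by
  simpa using h.const_smul (-1)

theorem IsWeakDeriv.add_dir (h : IsWeakDeriv Ω v u g) (h' : IsWeakDeriv Ω w u g') :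
    IsWeakDeriv Ω (v + w) u (g + g') := by
  rw [isWeakDeriv_iff]
  refine ⟨h.1, h.2.1.add h'.2.1, fun φ hφ hs => ?_⟩
  simp only [Pi.add_apply, smul_add, map_add, add_smul]
  rw [integral_add (integrable_test_smul h.1 (hφ.fderiv_apply v).continuous (hφ.fderiv_apply v).2
      ((tsupport_fderiv_apply φ v).trans hs))
    (integrable_test_smul h.1 (hφ.fderiv_apply w).continuous (hφ.fderiv_apply w).2
      ((tsupport_fderiv_apply φ w).trans hs)),
    integral_add (integrable_test_smul h.2.1 hφ.continuous hφ.2 hs)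
    (integrable_test_smul h'.2.1 hφ.continuous hφ.2 hs), h.integral_eq hφ hs, h'.integral_eq hφ hs]
  ring

theorem IsWeakDeriv.smul_dir (h : IsWeakDeriv Ω v u g) (c : ℝ) :
    IsWeakDeriv Ω (c • v) u ((c : ℂ) • g) := by
  rw [isWeakDeriv_iff]
  refine ⟨h.1, h.2.1.smul _, fun φ hφ hs => ?_⟩
  have := h.integral_eq hφ hs
  simp only [Pi.smul_apply, map_smul, smul_eq_mul, mul_smul, integral_smul, this]
  simp only [smul_comm _ (c : ℂ), ← smul_eq_mul (a := (c : ℂ)), integral_smul]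
  simp

theorem isWeakDeriv_zero_dir (h : LocallyIntegrableOn u Ω) : IsWeakDeriv Ω 0 u 0 := by
  rw [isWeakDeriv_iff]
  exact ⟨h, (locallyIntegrable_zero (ε'' := ℂ)).locallyIntegrableOn Ω,
    fun φ _ _ => by simp⟩

theorem IsWeakDeriv.sum_dir {ι : Type*} (s : Finset ι) {b : ι → E} {c : ι → ℝ} {G : ι → E → ℂ}
    (hu : LocallyIntegrableOn u Ω) (h : ∀ i ∈ s, IsWeakDeriv Ω (b i) u (G i)) :
    IsWeakDeriv Ω (∑ i ∈ s, c i • b i) u (∑ i ∈ s, (c i : ℂ) • G i) := by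
  classical
  induction s using Finset.induction_on with
  | empty => simpa using isWeakDeriv_zero_dir hu
  | insert i s hi ih =>
    rw [Finset.sum_insert hi, Finset.sum_insert hi]
    exact ((h i (by simp)).smul_dir _).add_dir (ih fun j hj => h j (by simp [hj]))

theorem locallyIntegrableOn_real_smul {ρ : E → ℝ} (hΩ : IsOpen Ω)
    (hu : LocallyIntegrableOn u Ω) (hρ : Continuous ρ) :
    LocallyIntegrableOn (fun x => ρ x • u x) Ω := by
  haveI : ProperSpace E := FiniteDimensional.proper ℝ E
  exact hu.continuousOn_smul hΩ.isLocallyClosed hρ.continuousOn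

/-- Leibniz' rule, obtained by using ρφ as a test function for u. No growth condition on ρ is
involved, so it also applies to the unbounded weight. -/
theorem IsWeakDeriv.smul_smooth (hΩ : IsOpen Ω) (h : IsWeakDeriv Ω v u g) {ρ : E → ℝ}
    (hρ : ContDiff ℝ ∞ ρ) :
    IsWeakDeriv Ω v (fun x => ρ x • u x) (fun x => ρ x • g x + fderiv ℝ ρ x v • u x) := by
  have hρ' : Continuous (fun x => fderiv ℝ ρ x v) :=
    (hρ.continuous_fderiv (by simp)).clm_apply continuous_const
  have e1 := locallyIntegrableOn_real_smul hΩ h.1 hρ.continuous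
  have e2 := locallyIntegrableOn_real_smul hΩ h.2.1 hρ.continuous
  have e3 := locallyIntegrableOn_real_smul hΩ h.1 hρ'
  rw [isWeakDeriv_iff]
  refine ⟨e1, e2.add e3, fun φ hφ hs => ?_⟩
  have hd := hφ.fderiv_apply v
  have hds := (tsupport_fderiv_apply φ v).trans hs
  have key := h.integral_eq (hφ.mul_left hρ) ((tsupport_mul_subset_right).trans hs)
  have hfd : ∀ x, fderiv ℝ (fun x => ρ x * φ x) x v = ρ x * fderiv ℝ φ x v + φ x * fderiv ℝ ρ x v := by
    intro x
    rw [fderiv_fun_mul (hρ.differentiable (by simp) x) (hφ.differentiable x)]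
    simp
  simp only [hfd, add_smul] at key
  have i1 := integrable_test_smul e1 hd.continuous hd.2 hds
  have i2 := integrable_test_smul e2 hφ.continuous hφ.2 hs
  have i3 := integrable_test_smul e3 hφ.continuous hφ.2 hs
  have s1 : (fun x => (ρ x * fderiv ℝ φ x v) • u x) = fun x => fderiv ℝ φ x v • ρ x • u x := by
    ext x; rw [mul_comm, mul_smul]
  have s2 : (fun x => (φ x * fderiv ℝ ρ x v) • u x) = fun x => φ x • fderiv ℝ ρ x v • u x := by
    ext x; rw [mul_smul]
  have s3 : (fun x => (ρ x * φ x) • g x) = fun x => φ x • ρ x • g x := by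
    ext x; rw [mul_comm, mul_smul]
  rw [integral_add (by rw [s1]; exact i1) (by rw [s2]; exact i3), s1, s2, s3] at key
  simp only [smul_add]
  rw [integral_add i2 i3]
  linear_combination key

/-- Transport the test function by `A.symm`; measure preservation removes the Jacobian. The case
needed is the reflection in the plane of symmetry. -/
theorem IsWeakDeriv.comp_equiv {E' : Type*} [NormedAddCommGroup E'] [NormedSpace ℝ E']
    [MeasureSpace E'] [BorelSpace E'] [FiniteDimensional ℝ E'] (A : E' ≃L[ℝ] E)
    (hA : MeasurePreserving A) (h : IsWeakDeriv Ω v u g) :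
    IsWeakDeriv (A ⁻¹' Ω) (A.symm v) (u ∘ A) (g ∘ A) := by
  have hloc : ∀ f : E → ℂ, LocallyIntegrableOn f Ω → LocallyIntegrableOn (f ∘ A) (A ⁻¹' Ω) := by
    intro f hf x hx
    obtain ⟨s, hs, hfs⟩ := hf (A x) hx
    refine ⟨A ⁻¹' s, ?_, ?_⟩
    · have : Tendsto A (𝓝[A ⁻¹' Ω] x) (𝓝[Ω] (A x)) :=
        (A.continuous.continuousWithinAt).tendsto_nhdsWithin (fun y hy => hy)
      exact this hs
    · exact (hA.integrableOn_comp_preimage A.toHomeomorph.measurableEmbedding).2 hfs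
  rw [isWeakDeriv_iff]
  refine ⟨hloc u h.1, hloc g h.2.1, fun φ hφ hs => ?_⟩
  have hψ : IsTest (φ ∘ A.symm) :=
    ⟨hφ.1.comp A.symm.contDiff, hφ.2.comp_homeomorph A.symm.toHomeomorph⟩
  have hψs : tsupport (φ ∘ A.symm) ⊆ Ω := by
    have : tsupport (φ ∘ A.symm) = A.symm ⁻¹' tsupport φ := by
      simpa using! tsupport_comp_eq_preimage φ A.symm.toHomeomorph
    rw [this]
    intro x hx
    simpa using hs hx
  have key := h.integral_eq hψ hψs
  rw [← hA.integral_comp A.toHomeomorph.measurableEmbedding,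
    ← hA.integral_comp A.toHomeomorph.measurableEmbedding] at key
  have hfd : ∀ x, fderiv ℝ (φ ∘ A.symm) (A x) v = fderiv ℝ φ x (A.symm v) := by
    intro x
    rw [fderiv_comp _ (hφ.differentiable _) A.symm.differentiableAt]
    simp [ContinuousLinearEquiv.fderiv]
  simpa [hfd] using key

theorem locallyIntegrableOn_of_memLp [(volume : Measure E).IsAddHaarMeasure]
    (hu : MemLp u 2 (volume.restrict Ω)) : LocallyIntegrableOn u Ω :=
  locallyIntegrableOn_of_locallyIntegrable_restrict (hu.locallyIntegrable (by norm_num))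

theorem IsTest.memLp {φ : E → ℝ} [(volume : Measure E).IsAddHaarMeasure] (h : IsTest φ)
    (p : ℝ≥0∞) (μ : Measure E) [IsFiniteMeasureOnCompacts μ] : MemLp φ p μ :=
  h.continuous.memLp_of_hasCompactSupport h.2

/-- Weak differentiation is a closed operator in L². This is what makes the space of gradients
complete. -/
theorem isWeakDeriv_of_tendsto [(volume : Measure E).IsAddHaarMeasure]
    {U G : ℕ → E → ℂ} (h : ∀ n, IsWeakDeriv Ω v (U n) (G n))
    (hU : ∀ n, MemLp (U n) 2 (volume.restrict Ω)) (hG : ∀ n, MemLp (G n) 2 (volume.restrict Ω))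
    (hu : MemLp u 2 (volume.restrict Ω)) (hg : MemLp g 2 (volume.restrict Ω))
    (hUu : Tendsto (fun n => l2sq (volume.restrict Ω) (fun x => U n x - u x)) atTop (𝓝 0))
    (hGg : Tendsto (fun n => l2sq (volume.restrict Ω) (fun x => G n x - g x)) atTop (𝓝 0)) :
    IsWeakDeriv Ω v u g := by
  refine ⟨locallyIntegrableOn_of_memLp hu, locallyIntegrableOn_of_memLp hg, fun φ hφ hs => ?_⟩
  have t1 := tendsto_integral_smul_of_tendsto_l2sq ((hφ.fderiv_apply v).memLp 2 _) hU hu hUu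
  have t2 := (tendsto_integral_smul_of_tendsto_l2sq (hφ.memLp 2 _) hG hg hGg).neg
  exact tendsto_nhds_unique t1 (t2.congr fun n => ((h n).2.2 φ hφ hs).symm)

end WeakDeriv

/-! ### Translations of functions with a weak derivative -/

section Translation

variable {E : Type*} [NormedAddCommGroup E] [NormedSpace ℝ E] [MeasureSpace E] [BorelSpace E]
  [FiniteDimensional ℝ E] [(volume : Measure E).IsAddHaarMeasure]

/-- The shear (s, x) ↦ (s, x + s v) preserves the product measure, since each slice is a
translation. It supplies the integrability for Fubini's theorem along segments. -/
theorem memLp_translate_prod {G : Type*} [NormedAddCommGroup G] {f : E → G} (hf : MemLp f 2)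
    (ν : Measure ℝ) [IsFiniteMeasure ν] (v : E) :
    MemLp (fun p : ℝ × E => f (p.2 + p.1 • v)) 2 (ν.prod volume) := by
  have h : MeasurePreserving (fun p : ℝ × E => (p.1, p.2 + p.1 • v)) (ν.prod volume)
      (ν.prod volume) := by
    refine (MeasurePreserving.id ν).skew_product (g := fun s x => x + s • v) (by fun_prop)
      (Eventually.of_forall fun s => ?_)
    exact map_add_right_eq_self _ _
  exact (hf.comp_snd ν).comp_measurePreserving h

theorem isTest_translate {φ : E → ℝ} (h : IsTest φ) (a : E) : IsTest (fun x => φ (x + a)) :=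
  ⟨h.1.comp (contDiff_id.add contDiff_const), h.2.comp_homeomorph (Homeomorph.addRight a)⟩

theorem tsupport_translate (φ : E → ℝ) (a : E) :
    tsupport (fun x => φ (x + a)) = (· + a) ⁻¹' tsupport φ := by
  simpa using! tsupport_comp_eq_preimage φ (Homeomorph.addRight a)

theorem fderiv_translate (φ : E → ℝ) (a x : E) :
    fderiv ℝ (fun x => φ (x + a)) x = fderiv ℝ φ (x + a) := fderiv_comp_add_right a

theorem integrable_smul_of_memLp_two {α : Type*} [MeasurableSpace α] {μ : Measure α}
    {f : α → ℝ} {g : α → ℂ} (hf : MemLp f 2 μ) (hg : MemLp g 2 μ) :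
    Integrable (fun x => f x • g x) μ :=
  (memLp_one_iff_integrable (f := f • g)).1 (hg.smul (r := 1) hf)

/-- The fundamental theorem of calculus along the segment from x to x + v. It is proved by duality:
the difference quotient is moved to the test function, where the classical theorem holds, and the
weak derivative is used for each translate of the test function separately. That V + s v stays in Ω
for every s in [0, 1] keeps these translates admissible. -/
theorem ae_translate_sub_eq {Ω V : Set E} {v : E} {U G : E → ℂ} (hV : IsOpen V)
    (hVΩ : ∀ x ∈ V, ∀ s ∈ Icc (0 : ℝ) 1, x + s • v ∈ Ω) (h : IsWeakDeriv Ω v U G)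
    (hU : MemLp U 2) (hG : MemLp G 2) :
    ∀ᵐ x, x ∈ V → U (x + v) - U x = ∫ s in Icc (0 : ℝ) 1, G (x + s • v) := by
  set ν : Measure ℝ := volume.restrict (Icc 0 1) with hν
  have hGp := memLp_translate_prod hG ν v
  have hUv : MemLp (fun x => U (x + v)) 2 :=
    hU.comp_measurePreserving (measurePreserving_add_right volume v)
  have hW : MemLp (fun x => ∫ s, G (x + s • v) ∂ν) 2 := by
    rw [memLp_two_iff_l2sq]
    refine ⟨(hGp.1.prod_swap).integral_prod_right', ?_⟩
    have h1 := (memLp_two_iff_l2sq.1 hGp).2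
    refine lt_of_le_of_lt ?_ h1
    unfold l2sq
    rw [lintegral_prod_symm _ (by have := hGp.1.enorm; fun_prop)]
    refine lintegral_mono_ae ?_
    filter_upwards [(hGp.1.prod_swap).prodMk_left] with x hx
    refine (enorm_integral_sq_le hx).trans ?_
    simp [hν, l2sq]
  have key := hV.ae_eq_zero_of_integral_contDiff_smul_eq_zero (μ := volume)
    (f := fun x => U (x + v) - U x - ∫ s, G (x + s • v) ∂ν)
    (((hUv.sub hU).sub hW).locallyIntegrable (by norm_num) |>.locallyIntegrableOn V)
    (fun φ h1 h2 h3 => ?_)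
  · filter_upwards [key] with x hx hxV
    exact sub_eq_zero.1 (hx hxV)
  have hφ : IsTest φ := ⟨h1, h2⟩
  have hφ2 := hφ.memLp 2 (volume : Measure E)
  have hd := hφ.fderiv_apply v
  simp only [smul_sub]
  have i0 : Integrable (fun x => φ x • U (x + v) - φ x • U x) :=
    (integrable_smul_of_memLp_two hφ2 hUv).sub (integrable_smul_of_memLp_two hφ2 hU)
  rw [integral_sub i0 (integrable_smul_of_memLp_two hφ2 hW),
    integral_sub (integrable_smul_of_memLp_two hφ2 hUv) (integrable_smul_of_memLp_two hφ2 hU),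
    sub_eq_zero]
  have e1 : ∫ x, φ x • U (x + v) = ∫ x, φ (x + -v) • U x := by
    rw [← integral_add_right_eq_self (fun x => φ (x + -v) • U x) v]
    simp
  -- The classical fundamental theorem for the smooth function s ↦ φ (x - s v).
  have e2 : ∀ x, φ (x + -v) - φ x = ∫ s, -(fderiv ℝ φ (x + s • -v) v) ∂ν := by
    intro x
    have hder : ∀ s ∈ uIcc (0 : ℝ) 1, HasDerivAt (fun s : ℝ => φ (x + s • -v))
        (-(fderiv ℝ φ (x + s • -v) v)) s := by
      intro s _
      have h1 : HasDerivAt (fun s : ℝ => x + s • -v) (-v) s := by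
        simpa using ((hasDerivAt_id s).smul_const (-v)).const_add x
      have := (hφ.differentiable (x + s • -v)).hasFDerivAt.comp_hasDerivAt s h1
      rw [map_neg] at this
      exact this
    have hc : Continuous fun s : ℝ => -(fderiv ℝ φ (x + s • -v) v) := by
      have := hd.continuous
      exact (this.comp (by fun_prop : Continuous fun s : ℝ => x + s • -v)).neg
    have := intervalIntegral.integral_eq_sub_of_hasDerivAt hder (hc.intervalIntegrable _ _)
    rw [intervalIntegral.integral_of_le zero_le_one, ← integral_Icc_eq_integral_Ioc] at this
    simpa using this.symm
  have i1 : Integrable (fun p : ℝ × E => -(fderiv ℝ φ (p.2 + p.1 • -v) v) • U p.2)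
      (ν.prod volume) :=
    integrable_smul_of_memLp_two (memLp_translate_prod (hd.memLp 2 volume) ν (-v)).neg
      (hU.comp_snd ν)
  have i2 : Integrable (fun p : ℝ × E => φ p.2 • G (p.2 + p.1 • v)) (ν.prod volume) :=
    integrable_smul_of_memLp_two (hφ2.comp_snd ν) hGp
  have hφv : MemLp (fun x => φ (x + -v)) 2 := hφ2.comp_measurePreserving
    (measurePreserving_add_right volume (-v))
  rw [e1, ← integral_sub (integrable_smul_of_memLp_two hφv hU) (integrable_smul_of_memLp_two hφ2 hU)]
  calc ∫ x, φ (x + -v) • U x - φ x • U x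
      = ∫ x, ∫ s, -(fderiv ℝ φ (x + s • -v) v) • U x ∂ν := by
        refine integral_congr_ae (Eventually.of_forall fun x => ?_)
        simp only
        rw [← sub_smul, e2, integral_smul_const]
    _ = ∫ s, (∫ x, -(fderiv ℝ φ (x + s • -v) v) • U x) ∂ν := (integral_integral_swap i1).symm
    -- For fixed s the translate φ (· - s v) is supported in Ω, so the definition of the weak
    -- derivative applies; translating back moves the shift to G.
    _ = ∫ s, (∫ x, φ x • G (x + s • v)) ∂ν := by
        refine setIntegral_congr_fun measurableSet_Icc fun s hs => ?_
        have ht : tsupport (fun x => φ (x + s • -v)) ⊆ Ω := by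
          rw [tsupport_translate]
          intro x hx
          have := hVΩ _ (h3 hx) s hs
          simpa using this
        have := h.integral_eq (isTest_translate hφ (s • -v)) ht
        simp only [fderiv_translate] at this
        simp only [neg_smul, integral_neg, this, neg_neg]
        rw [← integral_add_right_eq_self _ (s • v)]
        simp
    _ = ∫ x, ∫ s, φ x • G (x + s • v) ∂ν := integral_integral_swap i2
    _ = ∫ x, φ x • ∫ s, G (x + s • v) ∂ν := by simp only [integral_smul]

/-- Jensen's inequality in the segment parameter and translation invariance, applied to the integral
formula for u (x + v) - u x. Extension by zero makes all translates globally defined; the extended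
functions still form a weak derivative pair in Ω. -/
theorem l2sq_translate_sub_le {Ω V : Set E} {v : E} {u g : E → ℂ} (hΩ : IsOpen Ω) (hV : IsOpen V)
    (hVΩ : ∀ x ∈ V, ∀ s ∈ Icc (0 : ℝ) 1, x + s • v ∈ Ω) (h : IsWeakDeriv Ω v u g)
    (hu : MemLp u 2 (volume.restrict Ω)) (hg : MemLp g 2 (volume.restrict Ω)) :
    l2sq (volume.restrict V) (fun x => u (x + v) - u x) ≤ l2sq (volume.restrict Ω) g := by
  have hm := hΩ.measurableSet
  set U := Ω.indicator u
  set G := Ω.indicator g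
  have hU : MemLp U 2 := (memLp_indicator_iff_restrict hm).2 hu
  have hG : MemLp G 2 := (memLp_indicator_iff_restrict hm).2 hg
  have hUG : IsWeakDeriv Ω v U G := h.congr (indicator_ae_eq_restrict hm).symm
    (indicator_ae_eq_restrict hm).symm
  have key := ae_translate_sub_eq hV hVΩ hUG hU hG
  set ν : Measure ℝ := volume.restrict (Icc 0 1) with hν
  have hGp := memLp_translate_prod hG ν v
  have hΩG : l2sq (volume.restrict Ω) g = l2sq volume G := by
    rw [l2sq, ← lintegral_indicator hm, l2sq]
    congr 1 with x
    by_cases hx : x ∈ Ω <;> simp [G, hx]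
  calc l2sq (volume.restrict V) (fun x => u (x + v) - u x)
      ≤ ∫⁻ x in V, ∫⁻ s, ‖G (x + s • v)‖ₑ ^ 2 ∂ν := by
        unfold l2sq
        refine setLIntegral_mono_ae' hV.measurableSet ?_
        filter_upwards [key, (hGp.1.prod_swap).prodMk_left] with x hx hxm hxV
        have h0 : x ∈ Ω := by simpa using hVΩ x hxV 0 (by simp)
        have h1 : x + v ∈ Ω := by simpa using hVΩ x hxV 1 (by simp)
        have e := hx hxV
        simp only [U, indicator_of_mem h0, indicator_of_mem h1] at e
        rw [e]
        refine (enorm_integral_sq_le hxm).trans ?_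
        simp [hν, l2sq]
    _ ≤ ∫⁻ x, ∫⁻ s, ‖G (x + s • v)‖ₑ ^ 2 ∂ν := setLIntegral_le_lintegral _ _
    _ = ∫⁻ s, (∫⁻ x, ‖G (x + s • v)‖ₑ ^ 2) ∂ν := by
        refine (lintegral_lintegral_swap ?_).symm
        have := hGp.1.enorm
        exact this.pow_const 2
    _ = ∫⁻ _, l2sq volume G ∂ν := by
        refine lintegral_congr fun s => ?_
        exact lintegral_add_right_eq_self (fun x => ‖G x‖ₑ ^ 2) (s • v)
    _ = l2sq (volume.restrict Ω) g := by simp [hν, hΩG]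

end Translation

/-! ### Gradients and an inequality of Friedrichs type -/

section Gradient

variable {E : Type*} [NormedAddCommGroup E] [NormedSpace ℝ E] [MeasureSpace E] [BorelSpace E]
  [FiniteDimensional ℝ E] [(volume : Measure E).IsAddHaarMeasure]
  {ι : Type*} [Fintype ι]

/-- The weak gradient, as a function with values in the Euclidean space. -/
noncomputable def weakGrad (Ω : Set E) (b : ι → E) (u : E → ℂ) (x : E) : EuclideanSpace ℂ ι :=
  WithLp.toLp 2 fun i => weakDeriv Ω (b i) u x

theorem enorm_sq_toLp (a : ι → ℂ) : ‖(WithLp.toLp 2 a : EuclideanSpace ℂ ι)‖ₑ ^ 2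
    = ∑ i, ‖a i‖ₑ ^ 2 := by
  have h := EuclideanSpace.norm_sq_eq (WithLp.toLp 2 a : EuclideanSpace ℂ ι)
  simp only [← ofReal_norm, ← ENNReal.ofReal_pow (norm_nonneg _)]
  rw [h, ENNReal.ofReal_sum_of_nonneg (fun i _ => by positivity)]

theorem l2sq_weakGrad (μ : Measure E) (Ω : Set E) (b : ι → E) (u : E → ℂ) :
    l2sq μ (weakGrad Ω b u) = ∫⁻ x, ∑ i, ‖weakDeriv Ω (b i) u x‖ₑ ^ 2 ∂μ := by
  simp only [l2sq, weakGrad, enorm_sq_toLp]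

theorem memLp_weakDeriv {Ω : Set E} (hΩ : IsOpen Ω) {b : ι → E} {u : E → ℂ} (hu : MemH1 Ω b u)
    (i : ι) : IsWeakDeriv Ω (b i) u (weakDeriv Ω (b i) u) ∧
      MemLp (weakDeriv Ω (b i) u) 2 (volume.restrict Ω) := by
  obtain ⟨g, hg, hg2⟩ := hu.2 i
  exact ⟨isWeakDeriv_weakDeriv hg, (memLp_congr_ae (hg.weakDeriv_ae hΩ)).2 hg2⟩

theorem norm_sum_smul_le (c : ι → ℝ) (a : ι → ℂ) :
    ‖∑ i, (c i : ℂ) • a i‖ ≤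
      ‖(WithLp.toLp 2 c : EuclideanSpace ℝ ι)‖ * ‖(WithLp.toLp 2 a : EuclideanSpace ℂ ι)‖ := by
  refine (norm_sum_le _ _).trans ?_
  rw [EuclideanSpace.norm_eq, EuclideanSpace.norm_eq, ← Real.sqrt_mul (by positivity)]
  refine Real.le_sqrt_of_sq_le ?_
  simpa [norm_smul] using Finset.sum_mul_sq_le_sq_mul_sq Finset.univ (fun i => ‖c i‖)
    (fun i => ‖a i‖)

/-- Differentiation is linear in the direction, and Cauchy–Schwarz bounds the result pointwise by
the gradient. Oblique directions are needed because the transversals at the boundary need not be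
coordinate directions. -/
theorem MemH1.exists_weakDeriv_le {Ω : Set E} (hΩ : IsOpen Ω) {b : ι → E}
    (hb : ∀ v : E, ∃ c : ι → ℝ, v = ∑ i, c i • b i) (v : E) :
    ∃ C : ℝ≥0, ∀ u, MemH1 Ω b u → ∃ g, IsWeakDeriv Ω v u g ∧ MemLp g 2 (volume.restrict Ω) ∧
      ∀ s, l2sq (volume.restrict s) g ≤ C * l2sq (volume.restrict s) (weakGrad Ω b u) := by
  obtain ⟨c, rfl⟩ := hb v
  refine ⟨‖(WithLp.toLp 2 c : EuclideanSpace ℝ ι)‖₊ ^ 2, fun u hu =>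
    ⟨∑ i, (c i : ℂ) • weakDeriv Ω (b i) u, ?_, ?_, fun s => ?_⟩⟩
  · exact IsWeakDeriv.sum_dir _ (locallyIntegrableOn_of_memLp hu.1)
      fun i _ => (memLp_weakDeriv hΩ hu i).1
  · exact memLp_finsetSum' _ fun i _ => (memLp_weakDeriv hΩ hu i).2.const_smul _
  · have : l2sq (volume.restrict s) (∑ i, (c i : ℂ) • weakDeriv Ω (b i) u) ≤
        l2sq (volume.restrict s)
          (fun x => ‖(WithLp.toLp 2 c : EuclideanSpace ℝ ι)‖ • weakGrad Ω b u x) := by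
      refine l2sq_mono (Eventually.of_forall fun x => ?_)
      rw [norm_smul, norm_norm, Finset.sum_apply]
      exact norm_sum_smul_le c _
    rw [l2sq_const_smul] at this
    refine this.trans_eq ?_
    simp [← enorm_eq_nnnorm]

/-- The functions in `H¹(Ω)` are controlled on `W` by their values on `B` and their gradient. -/
def Controls (Ω : Set E) (b : ι → E) (B W : Set E) : Prop :=
  ∃ C : ℝ≥0, ∀ u, MemH1 Ω b u → l2sq (volume.restrict W) u ≤
    C * (l2sq (volume.restrict B) u + l2sq (volume.restrict Ω) (weakGrad Ω b u))

theorem Controls.mono {Ω : Set E} {b : ι → E} {B W W' : Set E} (h : Controls Ω b B W)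
    (hW : W' ⊆ W) : Controls Ω b B W' := by
  obtain ⟨C, hC⟩ := h
  exact ⟨C, fun u hu => (l2sq_restrict_mono hW).trans (hC u hu)⟩

theorem Controls.union {Ω : Set E} {b : ι → E} {B W W' : Set E} (h : Controls Ω b B W)
    (h' : Controls Ω b B W') : Controls Ω b B (W ∪ W') := by
  obtain ⟨C, hC⟩ := h
  obtain ⟨C', hC'⟩ := h'
  refine ⟨C + C', fun u hu => (lintegral_union_le _ _ _).trans ?_⟩
  rw [ENNReal.coe_add, add_mul]
  exact add_le_add (hC u hu) (hC' u hu)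

/-- Write u (x) = u (x + v) - (u (x + v) - u (x)): the first term is controlled on W, the second by
the gradient, as long as the segments stay in Ω. -/
theorem Controls.translate {Ω : Set E} (hΩ : IsOpen Ω) {b : ι → E}
    (hb : ∀ v : E, ∃ c : ι → ℝ, v = ∑ i, c i • b i) {B W V : Set E} (h : Controls Ω b B W)
    (hV : IsOpen V) {v : E} (hVΩ : ∀ x ∈ V, ∀ s ∈ Icc (0 : ℝ) 1, x + s • v ∈ Ω)
    (hVW : ∀ x ∈ V, x + v ∈ W) : Controls Ω b B V := by
  obtain ⟨C, hC⟩ := h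
  obtain ⟨C', hC'⟩ := MemH1.exists_weakDeriv_le hΩ hb v
  refine ⟨2 * C + 2 * C', fun u hu => ?_⟩
  obtain ⟨g, hg, hg2, hgle⟩ := hC' u hu
  have hT := l2sq_translate_sub_le hΩ hV hVΩ hg hu.1 hg2
  have h0 : V ⊆ Ω := fun x hx => by simpa using hVΩ x hx 0 (by simp)
  have hmap : MeasurePreserving (· + v) (volume.restrict ((· + v) ⁻¹' Ω)) (volume.restrict Ω) :=
    (measurePreserving_add_right volume v).restrict_preimage hΩ.measurableSet
  have hV' : V ⊆ (· + v) ⁻¹' Ω := fun x hx => by simpa using hVΩ x hx 1 (by simp)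
  have hum : AEStronglyMeasurable (fun x => u (x + v)) (volume.restrict V) :=
    (hu.1.1.comp_measurePreserving hmap).mono_measure (Measure.restrict_mono hV' le_rfl)
  have h1 : l2sq (volume.restrict V) u ≤ 2 * l2sq (volume.restrict V) (fun x => u (x + v)) +
      2 * l2sq (volume.restrict V) (fun x => u (x + v) - u x) := by
    have := l2sq_sub_le (g := fun x => u (x + v) - u x) hum
    simpa using this
  have h2 : l2sq (volume.restrict V) (fun x => u (x + v)) ≤ l2sq (volume.restrict W) u := by
    have hsub : V ⊆ (· + v) ⁻¹' W := hVW
    refine (l2sq_restrict_mono hsub).trans_eq ?_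
    exact (measurePreserving_add_right volume v).setLIntegral_comp_preimage_emb
      (measurableEmbedding_addRight v) (fun x => ‖u x‖ₑ ^ 2) W
  calc l2sq (volume.restrict V) u
      ≤ 2 * (C * (l2sq (volume.restrict B) u + l2sq (volume.restrict Ω) (weakGrad Ω b u))) +
        2 * (C' * l2sq (volume.restrict Ω) (weakGrad Ω b u)) := by
        refine h1.trans ?_
        gcongr
        · exact h2.trans (hC u hu)
        · exact hT.trans (hgle Ω)
    _ ≤ 2 * (C * (l2sq (volume.restrict B) u + l2sq (volume.restrict Ω) (weakGrad Ω b u))) +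
        2 * (C' * (l2sq (volume.restrict B) u + l2sq (volume.restrict Ω) (weakGrad Ω b u))) := by
        gcongr
        exact le_add_self
    _ = _ := by push_cast; ring

/-- Connectedness: the points with a controlled ball form an open set that contains B and is
relatively closed in Ω. -/
theorem controls_ball_of_mem {Ω : Set E} (hΩ : IsOpen Ω) (hc : IsPreconnected Ω) {b : ι → E}
    (hb : ∀ v : E, ∃ c : ι → ℝ, v = ∑ i, c i • b i) {B : Set E} (hB : IsOpen B)
    (hBn : B.Nonempty) (hBΩ : B ⊆ Ω) {p : E} (hp : p ∈ Ω) :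
    ∃ δ > 0, Controls Ω b B (Metric.ball p δ) := by
  set G : Set E := {p | ∃ δ > 0, Controls Ω b B (Metric.ball p δ)} with hG
  have hGo : IsOpen G := by
    rw [Metric.isOpen_iff]
    rintro p ⟨δ, hδ, h⟩
    refine ⟨δ / 2, by positivity, fun q hq => ⟨δ / 2, by positivity, h.mono ?_⟩⟩
    refine Metric.ball_subset_ball' ?_
    have := Metric.mem_ball.1 hq
    linarith
  refine hc.subset_of_closure_inter_subset hGo ?_ ?_ hp
  · obtain ⟨p, hp⟩ := hBn
    obtain ⟨δ, hδ, h⟩ := Metric.isOpen_iff.1 hB p hp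
    refine ⟨p, hBΩ hp, δ, hδ, 1, fun u hu => ?_⟩
    rw [ENNReal.coe_one, one_mul]
    exact (l2sq_restrict_mono h).trans le_self_add
  -- Relative closedness: a controlled point q within r / 2 of p exists, and translation by q - p
  -- carries a small ball at p into the controlled ball at q without leaving the ball of radius r in
  -- Ω.
  · rintro p ⟨hp, hpΩ⟩
    obtain ⟨r, hr, hrΩ⟩ := Metric.isOpen_iff.1 hΩ p hpΩ
    obtain ⟨q, ⟨δ, hδ, h⟩, hpq⟩ := Metric.mem_closure_iff.1 hp (r / 2) (by positivity)
    refine ⟨min δ (r / 2), by positivity, h.translate hΩ hb Metric.isOpen_ball (v := q - p)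
      (fun x hx s hs => hrΩ ?_) fun x hx => ?_⟩
    · rw [mem_ball_iff_norm] at hx ⊢
      have h1 : ‖x - p‖ < r / 2 := hx.trans_le (min_le_right _ _)
      have h2 : ‖s • (q - p)‖ ≤ r / 2 := by
        rw [norm_smul, Real.norm_of_nonneg hs.1]
        rw [dist_eq_norm, norm_sub_rev] at hpq
        nlinarith [hs.2, norm_nonneg (q - p)]
      calc ‖x + s • (q - p) - p‖ = ‖(x - p) + s • (q - p)‖ := by congr 1; abel
        _ ≤ _ := norm_add_le _ _
        _ < r := by linarith
    · rw [mem_ball_iff_norm] at hx ⊢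
      have : x + (q - p) - q = x - p := by abel
      rw [this]
      exact hx.trans_le (min_le_left _ _)

variable {F : Type*} [NormedAddCommGroup F] [NormedSpace ℝ F]

/-- In the local coordinates the domain lies below a graph, so lowering the last coordinate leads
from the closure strictly inside. The numbers δ and t are chosen to keep the whole motion within the
coordinate patch. -/
theorem HasLipschitzBoundary.exists_inward {Ω : Set E} (hL : HasLipschitzBoundary F Ω) {p : E}
    (hp : p ∈ frontier Ω) : ∃ e : E, ∃ t > (0 : ℝ), ∃ δ > 0, ∀ x ∈ Metric.ball p δ,
      x ∈ closure Ω → ∀ s : ℝ, 0 < s → s ≤ t → x - s • e ∈ Ω := by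
  obtain ⟨A, K, f, U, hf, hU, hpU, hA⟩ := hL p hp
  obtain ⟨r, hr, hrU⟩ := Metric.isOpen_iff.1 hU p hpU
  set e : E := A.symm (0, 1) with he
  have hAe : A e = (0, 1) := by simp [he]
  -- A point of the closure cannot lie strictly above the graph, since that region is open in U and
  -- does not meet Ω.
  have hcl : ∀ x ∈ U, x ∈ closure Ω → (A x).2 ≤ f (A x).1 := by
    intro x hx hxΩ
    by_contra! hlt
    have ho : IsOpen (U ∩ {y | f (A y).1 < (A y).2}) := by
      refine hU.inter (isOpen_lt ?_ ?_)
      · exact hf.continuous.comp (by fun_prop)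
      · fun_prop
    obtain ⟨y, ⟨hyU, hy⟩, hyΩ⟩ := mem_closure_iff.1 hxΩ _ ho ⟨hx, hlt⟩
    have := (hA y hyU).1 hyΩ
    exact absurd this (not_lt.2 (le_of_lt hy))
  have hn : 0 < ‖e‖ + 1 := by positivity
  refine ⟨e, r / (2 * (‖e‖ + 1)), by positivity, r / 2, by positivity, fun x hx hxΩ s hs hst => ?_⟩
  have hxr : ‖x - p‖ < r / 2 := mem_ball_iff_norm.1 hx
  have hse : ‖s • e‖ ≤ r / 2 := by
    rw [norm_smul, Real.norm_of_nonneg hs.le]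
    calc s * ‖e‖ ≤ r / (2 * (‖e‖ + 1)) * (‖e‖ + 1) := by gcongr; linarith
      _ = r / 2 := by field_simp
  have hxU : x ∈ U := hrU (mem_ball_iff_norm.2 (by linarith))
  have hxeU : x - s • e ∈ U := hrU <| mem_ball_iff_norm.2 <| by
    calc ‖x - s • e - p‖ = ‖(x - p) - s • e‖ := by congr 1; abel
      _ ≤ _ := norm_sub_le _ _
      _ < r := by linarith
  rw [hA _ hxeU]
  have := hcl x hxU hxΩ
  simp only [map_sub, map_smul, hAe, Prod.fst_sub, Prod.snd_sub, Prod.smul_mk, smul_zero, sub_zero,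
    smul_eq_mul, mul_one]
  linarith

/-- Compactness of K reduces this to a neighbourhood of a single point. An interior point has a
controlled ball by connectedness; near a boundary point the inward direction shifts the domain into
such a ball; a point outside the closure has a neighbourhood that misses Ω. -/
theorem HasLipschitzBoundary.controls {Ω : Set E} (hL : HasLipschitzBoundary F Ω) (hΩ : IsOpen Ω)
    (hc : IsPreconnected Ω) {b : ι → E}
    (hb : ∀ v : E, ∃ c : ι → ℝ, v = ∑ i, c i • b i) {B : Set E} (hB : IsOpen B)
    (hBn : B.Nonempty) (hBΩ : B ⊆ Ω) {K : Set E} (hK : IsCompact K) :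
    Controls Ω b B (Ω ∩ K) := by
  refine hK.induction_on (p := fun s => Controls Ω b B (Ω ∩ s)) ?_ ?_ ?_ ?_
  · exact ⟨0, fun u _ => by simp [l2sq]⟩
  · exact fun s t hst h => h.mono (inter_subset_inter_right _ hst)
  · intro s t hs ht
    rw [inter_union_distrib_left]
    exact hs.union ht
  · intro p _
    suffices h : ∃ δ > 0, Controls Ω b B (Ω ∩ Metric.ball p δ) by
      obtain ⟨δ, hδ, h⟩ := h
      exact ⟨Metric.ball p δ, mem_nhdsWithin_of_mem_nhds (Metric.ball_mem_nhds p hδ), h⟩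
    by_cases hp : p ∈ Ω
    · obtain ⟨δ, hδ, h⟩ := controls_ball_of_mem hΩ hc hb hB hBn hBΩ hp
      exact ⟨δ, hδ, h.mono inter_subset_right⟩
    by_cases hp' : p ∈ closure Ω
    · have hpf : p ∈ frontier Ω := by
        rw [hΩ.frontier_eq]
        exact ⟨hp', hp⟩
      obtain ⟨e, t, ht, δ, hδ, hin⟩ := hL.exists_inward hpf
      have hq : p - t • e ∈ Ω := hin p (Metric.mem_ball_self hδ) hp' t ht le_rfl
      obtain ⟨δ', hδ', h⟩ := controls_ball_of_mem hΩ hc hb hB hBn hBΩ hq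
      refine ⟨min δ δ', by positivity, h.translate hΩ hb (hΩ.inter Metric.isOpen_ball)
        (v := -(t • e)) (fun x hx s hs => ?_) fun x hx => ?_⟩
      -- The inward property is available for positive steps only; at s = 0 the point is x itself,
      -- which is in Ω.
      · rcases hs.1.eq_or_lt with rfl | hs0
        · simpa using hx.1
        · have := hin x (Metric.ball_subset_ball (min_le_left _ _) hx.2) (subset_closure hx.1)
            (s * t) (by positivity) (by nlinarith [hs.2])
          simpa [sub_eq_add_neg, mul_smul] using this
      · have := Metric.ball_subset_ball (min_le_right _ _) hx.2
        rw [mem_ball_iff_norm] at this ⊢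
        convert this using 2
        abel
    · rw [Metric.mem_closure_iff] at hp'
      push Not at hp'
      obtain ⟨δ, hδ, h⟩ := hp'
      refine ⟨δ, hδ, 0, fun u _ => ?_⟩
      have : Ω ∩ Metric.ball p δ = ∅ := by
        ext x
        simp only [mem_inter_iff, Metric.mem_ball, mem_empty_iff_false, iff_false, not_and, not_lt]
        intro hx
        rw [dist_comm]
        exact h x hx
      simp [this, l2sq]

end Gradient

/-! ### Fluxes through a flat part of the boundary -/

section Flux

variable {E : Type*} [NormedAddCommGroup E] [NormedSpace ℝ E]

/-- If the support avoids the boundary, cutting at the boundary is locally either no change or zero,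
hence smooth. This turns test functions on the whole space into test functions in Ω. -/
theorem isTest_indicator {Ω : Set E} (hΩ : IsOpen Ω) {φ : E → ℝ} (hφ : IsTest φ)
    (hd : Disjoint (tsupport φ) (frontier Ω)) :
    IsTest (Ω.indicator φ) ∧ tsupport (Ω.indicator φ) ⊆ Ω := by
  have hsub : tsupport (Ω.indicator φ) ⊆ tsupport φ :=
    closure_mono (by rw [Set.support_indicator]; exact inter_subset_right)
  have hsub' : tsupport (Ω.indicator φ) ⊆ closure Ω :=
    closure_mono (by rw [Set.support_indicator]; exact inter_subset_left)
  have hfr : ∀ x, x ∈ frontier Ω ↔ x ∈ closure Ω ∧ x ∉ Ω := fun x => by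
    rw [hΩ.frontier_eq]; rfl
  refine ⟨⟨contDiff_iff_contDiffAt.2 fun x => ?_, hφ.2.of_isClosed_subset (isClosed_tsupport _) hsub⟩,
    fun x hx => ?_⟩
  · by_cases hx : x ∈ Ω
    · refine hφ.1.contDiffAt.congr_of_eventuallyEq ?_
      filter_upwards [hΩ.mem_nhds hx] with y hy
      exact indicator_of_mem hy _
    · have hx' : x ∉ tsupport (Ω.indicator φ) := fun h =>
        disjoint_left.1 hd (hsub h) ((hfr x).2 ⟨hsub' h, hx⟩)
      refine contDiffAt_const (c := (0 : ℝ)) |>.congr_of_eventuallyEq ?_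
      exact notMem_tsupport_iff_eventuallyEq.1 hx'
  · by_contra hxΩ
    exact disjoint_left.1 hd (hsub hx) ((hfr x).2 ⟨hsub' hx, hxΩ⟩)

theorem exists_bound_deriv_smoothTransition :
    ∃ C : ℝ, 0 ≤ C ∧ ∀ t, |deriv Real.smoothTransition t| ≤ C := by
  have hs : ContDiff ℝ ∞ Real.smoothTransition := Real.smoothTransition.contDiff
  have hc : Continuous (deriv Real.smoothTransition) := hs.continuous_deriv (by simp)
  have hcomp : HasCompactSupport (deriv Real.smoothTransition) := by
    refine HasCompactSupport.intro (isCompact_Icc (a := (0 : ℝ)) (b := 1)) fun x hx => ?_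
    rw [mem_Icc, not_and_or, not_le, not_le] at hx
    rcases hx with hx | hx
    · have : Real.smoothTransition =ᶠ[𝓝 x] fun _ => 0 := by
        filter_upwards [Iio_mem_nhds hx] with y hy
        exact Real.smoothTransition.zero_of_nonpos (le_of_lt hy)
      rw [this.deriv_eq, deriv_const]
    · have : Real.smoothTransition =ᶠ[𝓝 x] fun _ => 1 := by
        filter_upwards [Ioi_mem_nhds hx] with y hy
        exact Real.smoothTransition.one_of_one_le (le_of_lt hy)
      rw [this.deriv_eq, deriv_const]
  obtain ⟨C, hC⟩ := hcomp.exists_bound_of_continuous hc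
  exact ⟨C, (norm_nonneg _).trans (hC 0), hC⟩

/-- A smooth cutoff that vanishes for `t ≤ 1 / n` and equals `1` for `t ≥ 2 / n`. -/
noncomputable def cutoff (n : ℕ) (t : ℝ) : ℝ := Real.smoothTransition (n * t - 1)

theorem cutoff_nonneg (n : ℕ) (t : ℝ) : 0 ≤ cutoff n t := Real.smoothTransition.nonneg _

theorem cutoff_le_one (n : ℕ) (t : ℝ) : cutoff n t ≤ 1 := Real.smoothTransition.le_one _

theorem contDiff_cutoff (n : ℕ) : ContDiff ℝ ∞ (cutoff n) :=
  Real.smoothTransition.contDiff.comp ((contDiff_const.mul contDiff_id).sub contDiff_const)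

theorem cutoff_eq_zero {n : ℕ} {t : ℝ} (h : n * t ≤ 1) : cutoff n t = 0 :=
  Real.smoothTransition.zero_of_nonpos (by linarith)

theorem eventually_cutoff_eq_one {t : ℝ} (ht : 0 < t) :
    ∀ᶠ n : ℕ in atTop, ∀ᶠ s in 𝓝 t, cutoff n s = 1 := by
  obtain ⟨N, hN⟩ := exists_nat_gt (4 / t)
  filter_upwards [eventually_ge_atTop N] with n hn
  have h1 : 4 / t < n := hN.trans_le (by exact_mod_cast hn)
  filter_upwards [Ioi_mem_nhds (half_lt_self ht)] with s hs
  refine Real.smoothTransition.one_of_one_le ?_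
  rw [div_lt_iff₀ ht] at h1
  have hs' : t / 2 < s := hs
  have : (0 : ℝ) ≤ n := by positivity
  nlinarith

/-- The derivative is of size n but lives where 0 ≤ n t ≤ 2, so multiplication by t gives a bound
independent of n. -/
theorem exists_bound_deriv_cutoff : ∃ C : ℝ, 0 ≤ C ∧ ∀ n t, |deriv (cutoff n) t| * |t| ≤ C := by
  obtain ⟨C, hC0, hC⟩ := exists_bound_deriv_smoothTransition
  refine ⟨C * 2, by positivity, fun n t => ?_⟩
  have hder : deriv (cutoff n) t = deriv Real.smoothTransition (n * t - 1) * n := by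
    have h1 : HasDerivAt (fun t : ℝ => n * t - 1) (n : ℝ) t := by
      simpa using ((hasDerivAt_id t).const_mul (n : ℝ)).sub_const 1
    have h2 : HasDerivAt Real.smoothTransition (deriv Real.smoothTransition (n * t - 1))
        (n * t - 1) :=
      ((Real.smoothTransition.contDiff (n := 1)).differentiable (by simp) _).hasDerivAt
    exact (h2.comp t h1).deriv
  by_cases ht : 0 ≤ n * t ∧ n * t ≤ 2
  · rw [hder, abs_mul, mul_assoc, ← abs_mul]
    exact mul_le_mul (hC _) (by rw [abs_le]; constructor <;> linarith) (abs_nonneg _) hC0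
  · have : deriv Real.smoothTransition (n * t - 1) = 0 := by
      rw [not_and_or, not_le, not_le] at ht
      rcases ht with ht | ht
      · have : Real.smoothTransition =ᶠ[𝓝 (n * t - 1)] fun _ => 0 := by
          filter_upwards [Iio_mem_nhds (show n * t - 1 < 0 by linarith)] with y hy
          exact Real.smoothTransition.zero_of_nonpos (le_of_lt hy)
        rw [this.deriv_eq, deriv_const]
      · have : Real.smoothTransition =ᶠ[𝓝 (n * t - 1)] fun _ => 1 := by
          filter_upwards [Ioi_mem_nhds (show 1 < n * t - 1 by linarith)] with y hy
          exact Real.smoothTransition.one_of_one_le (le_of_lt hy)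
        rw [this.deriv_eq, deriv_const]
    rw [hder, this]
    simp [hC0]

variable [MeasureSpace E] [BorelSpace E] [FiniteDimensional ℝ E]
  [(volume : Measure E).IsAddHaarMeasure]

theorem integrableOn_test_smul {Ω : Set E} {u : E → ℂ} {ψ : E → ℝ}
    (hu : MemLp u 2 (volume.restrict Ω)) (hψ : IsTest ψ) :
    Integrable (fun x => ψ x • u x) (volume.restrict Ω) :=
  integrable_smul_of_memLp_two (hψ.memLp 2 _) hu

/-- If the test function `ψ` is small near the plane `q = 0` and its support meets the boundary of
`Ω` only there, there is no boundary contribution in the integration by parts formula in the part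
of `Ω` with `0 < q`. -/
theorem flux_eq_zero {Ω : Set E} (hΩ : IsOpen Ω) {u g : E → ℂ} {v : E}
    (hw : IsWeakDeriv Ω v u g) (hu : MemLp u 2 (volume.restrict Ω))
    (hg : MemLp g 2 (volume.restrict Ω)) (q : E →L[ℝ] ℝ) {ψ : E → ℝ} (hψ : IsTest ψ)
    (hd : ∀ x ∈ tsupport ψ, x ∈ frontier Ω → q x ≤ 0) {M : ℝ}
    (hM : ∀ x ∈ Ω, |ψ x| * |q v| ≤ M * |q x|) :
    ∫ x in Ω ∩ {x | 0 < q x}, (ψ x • g x + fderiv ℝ ψ x v • u x) = 0 := by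
  obtain ⟨C, hC0, hC⟩ := exists_bound_deriv_cutoff
  set Ω' := Ω ∩ {x | 0 < q x} with hΩ'
  have hΩ'o : IsOpen Ω' := hΩ.inter (isOpen_lt continuous_const q.continuous)
  have hu' : MemLp u 2 (volume.restrict Ω') := hu.mono_measure (Measure.restrict_mono inter_subset_left le_rfl)
  have hg' : MemLp g 2 (volume.restrict Ω') := hg.mono_measure (Measure.restrict_mono inter_subset_left le_rfl)
  have hdψ := hψ.fderiv_apply v
  -- The integrand for the truncated test function `cutoff n (q x) * ψ x`, with the term from the
  -- derivative of the cutoff kept apart. Each truncated function is supported away from the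
  -- boundary, so its integral is zero; the claim is the limit n → ∞.
  set f : ℕ → E → ℂ := fun n x => cutoff n (q x) • (ψ x • g x + fderiv ℝ ψ x v • u x) +
    (ψ x * (deriv (cutoff n) (q x) * q v)) • u x with hf
  have hcut : ∀ n, IsTest (fun x => cutoff n (q x) * ψ x) := fun n =>
    hψ.mul_left ((contDiff_cutoff n).comp q.contDiff)
  have hfd : ∀ n x, fderiv ℝ (fun x => cutoff n (q x) * ψ x) x v =
      cutoff n (q x) * fderiv ℝ ψ x v + ψ x * (deriv (cutoff n) (q x) * q v) := by
    intro n x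
    have h1 : HasDerivAt (cutoff n) (deriv (cutoff n) (q x)) (q x) :=
      ((contDiff_cutoff n).differentiable (by simp) _).hasDerivAt
    have h2 := h1.comp_hasFDerivAt x q.hasFDerivAt
    have h3 : HasFDerivAt (fun x => cutoff n (q x) * ψ x) _ x :=
      h2.mul (hψ.differentiable x).hasFDerivAt
    rw [h3.fderiv]
    simp
  have hzero : ∀ n, ∫ x in Ω', f n x = 0 := by
    intro n
    -- For n = 0 the cutoff vanishes identically, so the support argument, which divides by n in
    -- effect, is not needed.
    rcases Nat.eq_zero_or_pos n with rfl | hn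
    · have h0 : ∀ t, cutoff 0 t = 0 := fun t => cutoff_eq_zero (by simp)
      have h0' : cutoff 0 = fun _ => 0 := funext h0
      simp [hf, h0']
    have hn' : (0 : ℝ) < n := by exact_mod_cast hn
    have hq : ∀ x ∈ tsupport (fun x => cutoff n (q x) * ψ x), 1 ≤ n * q x ∧ x ∈ tsupport ψ := by
      intro x hx
      refine ⟨?_, tsupport_mul_subset_right hx⟩
      have hcl : IsClosed {x | 1 ≤ (n : ℝ) * q x} := isClosed_le continuous_const (by fun_prop)
      refine closure_minimal (fun y hy => ?_) hcl hx
      by_contra hlt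
      rw [mem_ofPred_eq, not_le] at hlt
      exact hy (by simp [cutoff_eq_zero hlt.le])
    have hdis : Disjoint (tsupport (fun x => cutoff n (q x) * ψ x)) (frontier Ω) := by
      rw [disjoint_left]
      intro x hx hxf
      have := hd x (hq x hx).2 hxf
      nlinarith [(hq x hx).1]
    obtain ⟨ht, hts⟩ := isTest_indicator hΩ (hcut n) hdis
    have hts' : tsupport (Ω.indicator fun x => cutoff n (q x) * ψ x) ⊆ Ω' := by
      intro x hx
      refine ⟨hts hx, ?_⟩
      have : x ∈ tsupport (fun x => cutoff n (q x) * ψ x) :=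
        closure_mono (by rw [Set.support_indicator]; exact inter_subset_right) hx
      have := (hq x this).1
      by_contra hneg
      rw [mem_ofPred_eq, not_lt] at hneg
      nlinarith
    have hw' := hw.mono (inter_subset_left : Ω' ⊆ Ω)
    have key := hw'.2.2 _ ht hts'
    have e1 : ∫ x in Ω', fderiv ℝ (Ω.indicator fun x => cutoff n (q x) * ψ x) x v • u x =
        ∫ x in Ω', fderiv ℝ (fun x => cutoff n (q x) * ψ x) x v • u x := by
      refine setIntegral_congr_fun hΩ'o.measurableSet fun x hx => ?_
      have : (Ω.indicator fun x => cutoff n (q x) * ψ x) =ᶠ[𝓝 x] fun x => cutoff n (q x) * ψ x := by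
        filter_upwards [hΩ.mem_nhds hx.1] with y hy
        exact indicator_of_mem hy _
      simp only [this.fderiv_eq]
    have e2 : ∫ x in Ω', (Ω.indicator fun x => cutoff n (q x) * ψ x) x • g x =
        ∫ x in Ω', (cutoff n (q x) * ψ x) • g x := by
      refine setIntegral_congr_fun hΩ'o.measurableSet fun x hx => ?_
      simp only [indicator_of_mem hx.1]
    rw [e1, e2] at key
    have i1 := integrableOn_test_smul hu' ((hcut n).fderiv_apply v)
    have i2 := integrableOn_test_smul hg' (hcut n)
    have : ∫ x in Ω', f n x = ∫ x in Ω', ((cutoff n (q x) * ψ x) • g x +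
        fderiv ℝ (fun x => cutoff n (q x) * ψ x) x v • u x) := by
      refine integral_congr_ae (Eventually.of_forall fun x => ?_)
      simp only [hf, hfd, add_smul, smul_add, mul_smul]
      ring
    rw [this, integral_add i2 i1, key]
    ring
  have hlim : Tendsto (fun n => ∫ x in Ω', f n x) atTop
      (𝓝 (∫ x in Ω', (ψ x • g x + fderiv ℝ ψ x v • u x))) := by
    -- The smallness of ψ near the plane compensates the growth of the derivative of the cutoff. The
    -- bound does not depend on n and serves as an integrable majorant after multiplication by u.
    have hMC : ∀ n x, x ∈ Ω' → ‖ψ x * (deriv (cutoff n) (q x) * q v)‖ ≤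
        (tsupport ψ).indicator (fun _ => M * C) x := by
      intro n x hx
      by_cases hxs : x ∈ tsupport ψ
      · rw [indicator_of_mem hxs, norm_mul, norm_mul, Real.norm_eq_abs, Real.norm_eq_abs,
          Real.norm_eq_abs]
        have h1 := hM x hx.1
        have h2 := hC n (q x)
        have h3 : 0 < |q x| := abs_pos.2 (ne_of_gt hx.2)
        have hM0 : 0 ≤ M := by
          by_contra hneg
          have : 0 ≤ |ψ x| * |q v| := by positivity
          nlinarith
        calc |ψ x| * (|deriv (cutoff n) (q x)| * |q v|)
            = |ψ x| * |q v| * |deriv (cutoff n) (q x)| := by ring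
          _ ≤ M * |q x| * |deriv (cutoff n) (q x)| := by gcongr
          _ = M * (|deriv (cutoff n) (q x)| * |q x|) := by ring
          _ ≤ M * C := by gcongr
      · rw [indicator_of_notMem hxs, image_eq_zero_of_notMem_tsupport hxs]
        simp
    have i1 := integrableOn_test_smul hg' hψ
    have i2 := integrableOn_test_smul hu' hdψ
    have hψc : IsCompact (tsupport ψ) := hψ.2
    have i3 : Integrable (fun x => (tsupport ψ).indicator (fun _ => M * C) x • u x)
        (volume.restrict Ω') := by
      refine integrable_smul_of_memLp_two ?_ hu'
      rw [memLp_indicator_iff_restrict hψc.measurableSet]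
      haveI : IsFiniteMeasure ((volume.restrict Ω').restrict (tsupport ψ)) :=
        ⟨by
          rw [Measure.restrict_apply_univ]
          exact hψc.measure_lt_top⟩
      exact memLp_const _
    refine tendsto_integral_of_dominated_convergence
      (fun x => ‖ψ x • g x + fderiv ℝ ψ x v • u x‖ +
        ‖(tsupport ψ).indicator (fun _ => M * C) x • u x‖) (fun n => ?_)
      ((i1.add i2).norm.add i3.norm) (fun n => ?_) ?_
    · have c1 : Continuous fun x => cutoff n (q x) := (contDiff_cutoff n).continuous.comp q.continuous
      have c2 : Continuous fun x => ψ x * (deriv (cutoff n) (q x) * q v) :=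
        hψ.continuous.mul ((((contDiff_cutoff n).continuous_deriv (by simp)).comp
          q.continuous).mul continuous_const)
      exact (c1.aestronglyMeasurable.smul (i1.add i2).1).add (c2.aestronglyMeasurable.smul hu'.1)
    · rw [ae_restrict_iff' hΩ'o.measurableSet]
      refine Eventually.of_forall fun x hx => (norm_add_le _ _).trans ?_
      gcongr
      · rw [norm_smul]
        refine mul_le_of_le_one_left (norm_nonneg _) ?_
        rw [Real.norm_of_nonneg (cutoff_nonneg _ _)]
        exact cutoff_le_one _ _
      · rw [norm_smul, norm_smul]
        gcongr
        exact (hMC n x hx).trans (le_abs_self _)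
    · rw [ae_restrict_iff' hΩ'o.measurableSet]
      refine Eventually.of_forall fun x hx => ?_
      refine tendsto_const_nhds.congr' ?_
      filter_upwards [eventually_cutoff_eq_one hx.2] with n hn
      have h1 : deriv (cutoff n) (q x) = 0 := by
        have : cutoff n =ᶠ[𝓝 (q x)] fun _ => 1 := hn
        rw [this.deriv_eq, deriv_const]
      simp [hf, h1, hn.self_of_nhds]
  rw [funext hzero] at hlim
  exact (tendsto_nhds_unique hlim tendsto_const_nhds)

end Flux

/-! ### Traces on a flat part of the boundary -/

section Trace

theorem sq_lintegral_mul_le {α : Type*} [MeasurableSpace α] {μ : Measure α} {f g : α → ℝ≥0∞}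
    (hf : AEMeasurable f μ) (hg : AEMeasurable g μ) :
    (∫⁻ x, f x * g x ∂μ) ^ 2 ≤ (∫⁻ x, f x ^ 2 ∂μ) * ∫⁻ x, g x ^ 2 ∂μ := by
  have h := ENNReal.lintegral_mul_le_Lp_mul_Lq μ Real.HolderConjugate.two_two hf hg
  simp only [Pi.mul_apply] at h
  calc (∫⁻ x, f x * g x ∂μ) ^ 2
      ≤ ((∫⁻ x, f x ^ (2:ℝ) ∂μ) ^ (1 / (2:ℝ)) * (∫⁻ x, g x ^ (2:ℝ) ∂μ) ^ (1 / (2:ℝ))) ^ 2 := by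
        gcongr
    _ = (∫⁻ x, f x ^ 2 ∂μ) * ∫⁻ x, g x ^ 2 ∂μ := by
      rw [mul_pow, ← ENNReal.rpow_natCast, ← ENNReal.rpow_natCast, ← ENNReal.rpow_mul,
        ← ENNReal.rpow_mul]
      simp

variable {E F : Type*} [NormedAddCommGroup E] [NormedSpace ℝ E] [MeasureSpace E] [BorelSpace E]
  [FiniteDimensional ℝ E] [(volume : Measure E).IsAddHaarMeasure]
  [NormedAddCommGroup F] [NormedSpace ℝ F] [MeasureSpace F] [BorelSpace F]
  [FiniteDimensional ℝ F] [(volume : Measure F).IsAddHaarMeasure]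

/-- The involution `(y, s) ↦ (y - s τ, -s)`. -/
noncomputable def shearFlip (τ : F) : (F × ℝ) ≃L[ℝ] (F × ℝ) :=
  ContinuousLinearEquiv.equivOfInverse
    ((ContinuousLinearMap.fst ℝ F ℝ - (ContinuousLinearMap.snd ℝ F ℝ).smulRight τ).prod
      (-ContinuousLinearMap.snd ℝ F ℝ))
    ((ContinuousLinearMap.fst ℝ F ℝ - (ContinuousLinearMap.snd ℝ F ℝ).smulRight τ).prod
      (-ContinuousLinearMap.snd ℝ F ℝ))
    (fun p => by ext <;> simp) (fun p => by ext <;> simp)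

@[simp] theorem shearFlip_apply (τ : F) (p : F × ℝ) :
    shearFlip τ p = (p.1 - p.2 • τ, -p.2) := rfl

@[simp] theorem shearFlip_symm_apply (τ : F) (p : F × ℝ) :
    (shearFlip τ).symm p = (p.1 - p.2 • τ, -p.2) := rfl

theorem measurePreserving_shearFlip (τ : F) :
    MeasurePreserving (shearFlip τ) (volume : Measure (F × ℝ)) volume := by
  have h : MeasurePreserving (fun p : ℝ × F => (-p.1, p.2 - p.1 • τ))
      ((volume : Measure ℝ).prod volume) ((volume : Measure ℝ).prod volume) := by
    refine (Measure.measurePreserving_neg (volume : Measure ℝ)).skew_product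
      (g := fun s y => y - s • τ) (by fun_prop) (Eventually.of_forall fun s => ?_)
    simpa [sub_eq_add_neg] using map_add_right_eq_self (volume : Measure F) (-(s • τ))
  exact (Measure.measurePreserving_swap.comp h).comp Measure.measurePreserving_swap

/-- A flat part `{κ (y, 0) : y ∈ S}` of the boundary of the domain `Ω` lying below it, with finitely
many transversal directions that point from the flat part into `Ω`, and a partition of unity. -/
structure FlatBoundary (κ : (F × ℝ) ≃L[ℝ] E) (Ω : Set E) (S : Set F) where
  isOpen_domain : IsOpen Ω
  isOpen_base : IsOpen S
  below : ∀ x ∈ Ω, (κ.symm x).2 < 0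
  N : ℕ
  dir : Fin N → F
  dom : Fin N → Set F
  isOpen_dom : ∀ i, IsOpen (dom i)
  depth : ℝ
  depth_pos : 0 < depth
  chart_mem : ∀ i, ∀ y ∈ S ∩ dom i, ∀ s ∈ Ioo 0 depth, κ (y - s • dir i, -s) ∈ Ω
  part : Fin N → F → ℝ
  contDiff_part : ∀ i, ContDiff ℝ ∞ (part i)
  tsupport_part : ∀ i, tsupport (part i) ⊆ dom i
  abs_part_le : ∀ i y, |part i y| ≤ 1
  sum_part : ∀ y ∈ S, ∑ i, part i y = 1

/-- The test functions whose support meets the boundary of `Ω` only in the flat part. -/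
def IsAdmissible (κ : (F × ℝ) ≃L[ℝ] E) (Ω : Set E) (S : Set F) (φ : E → ℝ) : Prop :=
  IsTest φ ∧ Disjoint (tsupport φ) (frontier Ω \ (fun y => κ (y, 0)) '' S)

/-- A smooth cutoff function of the depth. -/
def IsDepthCutoff (h : ℝ) (k : ℝ → ℝ) : Prop :=
  ContDiff ℝ ∞ k ∧ k 0 = 1 ∧ tsupport k ⊆ Ioo (-h) h ∧ ∀ s, |k s| ≤ 1

theorem exists_isDepthCutoff {h : ℝ} (hh : 0 < h) : ∃ k, IsDepthCutoff h k := by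
  let b : ContDiffBump (0 : ℝ) := ⟨h / 3, h / 2, by positivity, by linarith⟩
  refine ⟨b, b.contDiff, b.one_of_mem_closedBall (by simp [b.rIn_pos.le]), ?_, fun s => ?_⟩
  · rw [b.tsupport_eq, Real.closedBall_eq_Icc]
    exact fun x hx => ⟨by have := hx.1; simp only [b] at this; linarith,
      by have := hx.2; simp only [b] at this; linarith⟩
  · rw [abs_of_nonneg b.nonneg]
    exact b.le_one

theorem IsDepthCutoff.mono {h h' : ℝ} {k : ℝ → ℝ} (hk : IsDepthCutoff h k) (hh : h ≤ h') :
    IsDepthCutoff h' k :=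
  ⟨hk.1, hk.2.1, hk.2.2.1.trans (Ioo_subset_Ioo (neg_le_neg hh) hh), hk.2.2.2⟩

theorem IsDepthCutoff.hasCompactSupport {h : ℝ} {k : ℝ → ℝ} (hk : IsDepthCutoff h k) :
    HasCompactSupport k :=
  (isCompact_Icc (a := -h) (b := h)).of_isClosed_subset (isClosed_tsupport _)
    (hk.2.2.1.trans Ioo_subset_Icc_self)

/-- The product of a function of `y` and a function of `s` in the coordinates `M`. -/
noncomputable def lift (M : (F × ℝ) ≃L[ℝ] E) (φ : F → ℝ) (k : ℝ → ℝ) (x : E) : ℝ :=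
  φ (M.symm x).1 * k (M.symm x).2

theorem tsupport_lift (M : (F × ℝ) ≃L[ℝ] E) (φ : F → ℝ) (k : ℝ → ℝ) {x : E}
    (hx : x ∈ tsupport (lift M φ k)) : (M.symm x).1 ∈ tsupport φ ∧ (M.symm x).2 ∈ tsupport k := by
  have hcl : IsClosed {x | (M.symm x).1 ∈ tsupport φ ∧ (M.symm x).2 ∈ tsupport k} :=
    ((isClosed_tsupport φ).preimage (continuous_fst.comp M.symm.continuous)).inter
      ((isClosed_tsupport k).preimage (continuous_snd.comp M.symm.continuous))
  refine closure_minimal (fun y hy => ?_) hcl hx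
  exact ⟨subset_tsupport _ (left_ne_zero_of_mul hy), subset_tsupport _ (right_ne_zero_of_mul hy)⟩

theorem isTest_lift (M : (F × ℝ) ≃L[ℝ] E) {φ : F → ℝ} (hφ : IsTest φ) {k : ℝ → ℝ}
    (hk : ContDiff ℝ ∞ k) (hkc : HasCompactSupport k) : IsTest (lift M φ k) := by
  refine ⟨(hφ.1.comp (contDiff_fst.comp M.symm.contDiff)).mul
    (hk.comp (contDiff_snd.comp M.symm.contDiff)), ?_⟩
  refine HasCompactSupport.intro ((hφ.2.isCompact.prod hkc.isCompact).image M.continuous)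
    fun x hx => ?_
  by_contra hne
  have := tsupport_lift M φ k (subset_tsupport _ hne)
  exact hx ⟨M.symm x, ⟨this.1, this.2⟩, by simp⟩

theorem fderiv_lift (M : (F × ℝ) ≃L[ℝ] E) {φ : F → ℝ} (hφ : IsTest φ) {k : ℝ → ℝ}
    (hk : ContDiff ℝ ∞ k) (hkc : HasCompactSupport k) (y : F) (s : ℝ) :
    fderiv ℝ (lift M φ k) (M (y, s)) (M (0, 1)) = φ y * deriv k s := by
  have h1 : HasDerivAt (fun t : ℝ => M (y, t)) (M (0, 1)) s := by
    have h2 : HasDerivAt (fun t : ℝ => (y, t)) ((0 : F), (1 : ℝ)) s :=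
      (hasDerivAt_const s y).prodMk (hasDerivAt_id s)
    exact M.toContinuousLinearMap.hasFDerivAt.comp_hasDerivAt s h2
  have h3 := ((isTest_lift M hφ hk hkc).differentiable (M (y, s))).hasFDerivAt.comp_hasDerivAt s h1
  have h4 : HasDerivAt (lift M φ k ∘ fun t : ℝ => M (y, t)) (φ y * deriv k s) s := by
    have : (lift M φ k ∘ fun t : ℝ => M (y, t)) = fun t => φ y * k t := by
      ext t; simp [lift]
    rw [this]
    exact ((hk.differentiable (by simp) s).hasDerivAt).const_mul _
  exact h3.unique h4

namespace FlatBoundary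

variable {κ : (F × ℝ) ≃L[ℝ] E} {Ω : Set E} {S : Set F}

/-- The coordinates along the transversal direction of index `i`. -/
noncomputable def chart (D : FlatBoundary κ Ω S) (i : Fin D.N) : (F × ℝ) ≃L[ℝ] E :=
  (shearFlip (D.dir i)).trans κ

/-- The transversal direction of index `i`, pointing out of `Ω`. -/
noncomputable def outward (D : FlatBoundary κ Ω S) (i : Fin D.N) : E :=
  κ (0, 1) + κ (D.dir i, 0)

/-- The depth below the flat part of the boundary. -/
noncomputable def depthOf (κ : (F × ℝ) ≃L[ℝ] E) : E →L[ℝ] ℝ :=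
  -(ContinuousLinearMap.snd ℝ F ℝ).comp κ.symm.toContinuousLinearMap

theorem depthOf_apply (x : E) : depthOf κ x = -(κ.symm x).2 := rfl

theorem chart_apply (D : FlatBoundary κ Ω S) (i : Fin D.N) (p : F × ℝ) :
    D.chart i p = κ (p.1 - p.2 • D.dir i, -p.2) := rfl

theorem chart_symm_snd (D : FlatBoundary κ Ω S) (i : Fin D.N) (x : E) : ((D.chart i).symm x).2 = depthOf κ x := rfl

theorem chart_zero_one (D : FlatBoundary κ Ω S) (i : Fin D.N) : D.chart i (0, 1) = -D.outward i := by
  rw [chart_apply, outward, ← map_add, ← map_neg]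
  simp

theorem measurePreserving_chart (D : FlatBoundary κ Ω S) (hκ : MeasurePreserving κ) (i : Fin D.N) :
    MeasurePreserving (D.chart i) := hκ.comp (measurePreserving_shearFlip _)

theorem pos_of_mem (D : FlatBoundary κ Ω S) {x : E} (hx : x ∈ Ω) : 0 < depthOf κ x := by
  rw [depthOf_apply]
  linarith [D.below x hx]

theorem nonneg_of_mem_closure (D : FlatBoundary κ Ω S) {x : E} (hx : x ∈ closure Ω) : 0 ≤ depthOf κ x :=
  closure_minimal (fun _ hy => (D.pos_of_mem hy).le)
    (isClosed_le continuous_const (depthOf κ).continuous) hx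

theorem exists_mem_dom (D : FlatBoundary κ Ω S) {y : F} (hy : y ∈ S) : ∃ i, y ∈ D.dom i := by
  by_contra! h
  have : ∑ i, D.part i y = 0 := Finset.sum_eq_zero fun i _ =>
    image_eq_zero_of_notMem_tsupport fun hi => h i (D.tsupport_part i hi)
  rw [D.sum_part y hy] at this
  exact one_ne_zero this

/-- The transversal segment at y runs inside Ω and shrinks to κ (y, 0), which itself has depth zero
and therefore is not in Ω. -/
theorem mem_frontier (D : FlatBoundary κ Ω S) {y : F} (hy : y ∈ S) : κ (y, 0) ∈ frontier Ω := by
  obtain ⟨i, hi⟩ := D.exists_mem_dom hy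
  rw [D.isOpen_domain.frontier_eq]
  refine ⟨?_, fun h => by simpa using D.below _ h⟩
  have ht : Tendsto (fun s : ℝ => κ (y - s • D.dir i, -s)) (𝓝[>] 0) (𝓝 (κ (y, 0))) := by
    have : Continuous fun s : ℝ => κ (y - s • D.dir i, -s) := by fun_prop
    have h := (this.tendsto 0).mono_left (nhdsWithin_le_nhds (s := Ioi 0))
    simpa using h
  refine mem_closure_of_tendsto ht ?_
  filter_upwards [Ioo_mem_nhdsGT D.depth_pos] with s hs
  exact D.chart_mem i y ⟨hy, hi⟩ s hs

/-- At positive depth the support lies in the region covered by the chart, hence inside Ω; at depth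
zero it lies over S. Negative depth does not occur in the closure of Ω. -/
theorem isAdmissible_lift (D : FlatBoundary κ Ω S) {i : Fin D.N} {φ : F → ℝ} (hφ : IsTest φ)
    (hs : tsupport φ ⊆ S ∩ D.dom i) {k : ℝ → ℝ} (hk : IsDepthCutoff D.depth k) :
    IsAdmissible κ Ω S (lift (D.chart i) φ k) := by
  refine ⟨isTest_lift _ hφ hk.1 hk.hasCompactSupport, disjoint_left.2 ?_⟩
  rintro x hx ⟨hxf, hxS⟩
  obtain ⟨h1, h2⟩ := tsupport_lift _ _ _ hx
  set p := (D.chart i).symm x with hp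
  have hxp : x = D.chart i p := by simp [hp]
  have hpos := D.nonneg_of_mem_closure (frontier_subset_closure hxf)
  rw [← D.chart_symm_snd i, ← hp] at hpos
  rcases hpos.eq_or_lt with h0 | h0
  · exact hxS ⟨p.1, (hs h1).1, by rw [hxp, chart_apply, ← h0]; simp⟩
  · rw [D.isOpen_domain.frontier_eq] at hxf
    refine hxf.2 ?_
    rw [hxp, chart_apply]
    exact D.chart_mem i p.1 (hs h1) p.2 ⟨h0, (hk.2.2.1 h2).2⟩

/-- The domain lies entirely on one side of the plane, so the general result on vanishing flux
applies to all of Ω. The bound on ψ is used in two ways: with M = 0 for tangential v, and for ψ that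
vanishes on the flat part. -/
theorem flux_eq_zero (D : FlatBoundary κ Ω S) {u g : E → ℂ} {v : E} (hw : IsWeakDeriv Ω v u g)
    (hu : MemLp u 2 (volume.restrict Ω)) (hg : MemLp g 2 (volume.restrict Ω)) {ψ : E → ℝ}
    (hψ : IsAdmissible κ Ω S ψ) {M : ℝ}
    (hM : ∀ x ∈ Ω, |ψ x| * |depthOf κ v| ≤ M * |depthOf κ x|) :
    ∫ x in Ω, (ψ x • g x + fderiv ℝ ψ x v • u x) = 0 := by
  have h := WaterCanal.flux_eq_zero D.isOpen_domain hw hu hg (depthOf κ) hψ.1 ?_ hM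
  · have hsub : Ω ⊆ {x | 0 < depthOf κ x} := fun x hx => D.pos_of_mem hx
    rwa [inter_eq_left.2 hsub] at h
  · intro x hx hxf
    by_contra hne
    refine disjoint_left.1 hψ.2 hx ⟨hxf, ?_⟩
    rintro ⟨y, _, rfl⟩
    exact hne (by simp [depthOf_apply])

/-- Below S, compare ψ with its zero value at the vertical projection, using the Lipschitz bound.
The rest of the support in the closure of Ω is compact and meets the plane nowhere, so the depth is
bounded below there. -/
theorem exists_le_of_vanish (D : FlatBoundary κ Ω S) {ψ : E → ℝ} (hψ : IsAdmissible κ Ω S ψ)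
    (h0 : ∀ y ∈ S, ψ (κ (y, 0)) = 0) : ∃ M, ∀ x ∈ Ω, |ψ x| ≤ M * |depthOf κ x| := by
  set W : Set E := {x | (κ.symm x).1 ∈ S} with hW
  have hWo : IsOpen W := D.isOpen_base.preimage (continuous_fst.comp κ.symm.continuous)
  have hK : IsCompact ((tsupport ψ ∩ closure Ω) \ W) :=
    (hψ.1.2.isCompact.inter_right isClosed_closure).diff hWo
  obtain ⟨δ, hδ, hδK⟩ := hK.exists_forall_le' (f := depthOf κ) (a := 0)
    (depthOf κ).continuous.continuousOn (by
      rintro x ⟨⟨hx, hxΩ⟩, hxW⟩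
      refine (D.nonneg_of_mem_closure hxΩ).lt_of_ne fun h => hxW ?_
      have hxf : x ∈ frontier Ω := by
        rw [D.isOpen_domain.frontier_eq]
        exact ⟨hxΩ, fun h' => (D.pos_of_mem h').ne h⟩
      by_contra hxS
      refine disjoint_left.1 hψ.2 hx ⟨hxf, ?_⟩
      rintro ⟨y, hy, rfl⟩
      exact hxS (by simpa [hW] using hy))
  obtain ⟨L, hL⟩ := hψ.1.1.lipschitzWith_of_hasCompactSupport hψ.1.2 (by simp)
  obtain ⟨B, hB⟩ := hψ.1.exists_bound
  have hB0 : 0 ≤ B := (norm_nonneg _).trans (hB 0)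
  refine ⟨L * ‖κ (0, 1)‖ + B / δ, fun x hx => ?_⟩
  by_cases hxs : x ∈ tsupport ψ
  · by_cases hxW : x ∈ W
    · have h1 := hL.dist_le_mul x (κ ((κ.symm x).1, 0))
      rw [h0 _ hxW, dist_zero_right, dist_eq_norm] at h1
      have h2 : x - κ ((κ.symm x).1, 0) = -(depthOf κ x) • κ (0, 1) := by
        apply κ.symm.injective
        ext <;> simp [depthOf_apply]
      rw [h2, norm_smul, norm_neg, Real.norm_eq_abs, Real.norm_eq_abs] at h1
      have : 0 ≤ B / δ * |depthOf κ x| := by positivity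
      linarith
    · have h1 := hδK x ⟨⟨hxs, subset_closure hx⟩, hxW⟩
      have h2 : δ ≤ |depthOf κ x| := h1.trans (le_abs_self _)
      have h3 : B ≤ B / δ * |depthOf κ x| := by
        rw [div_mul_eq_mul_div, le_div_iff₀ hδ]
        gcongr
      have : 0 ≤ L * ‖κ (0, 1)‖ * |depthOf κ x| := by positivity
      have := hB x
      rw [Real.norm_eq_abs] at this
      linarith
  · rw [image_eq_zero_of_notMem_tsupport hxs, abs_zero]
    positivity

/-- The weighted mean of a function over the segments along the direction of index `i`. -/
noncomputable def layerMean (D : FlatBoundary κ Ω S) (i : Fin D.N) (a : ℝ → ℝ) (w : E → ℂ) : F → ℂ :=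
  (S ∩ D.dom i).indicator fun y => ∫ s in Ioo 0 D.depth, a s • w (D.chart i (y, s))

/-- A chart preserves the measure and maps the box of depth `D.depth` over its base into Ω. -/
theorem memLp_comp_chart (D : FlatBoundary κ Ω S) (hκ : MeasurePreserving κ) (i : Fin D.N) {w : E → ℂ}
    (hw : MemLp w 2 (volume.restrict Ω)) :
    MemLp (fun p => w (D.chart i p)) 2
      ((volume.restrict (S ∩ D.dom i)).prod (volume.restrict (Ioo 0 D.depth))) ∧
    l2sq ((volume.restrict (S ∩ D.dom i)).prod (volume.restrict (Ioo 0 D.depth)))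
      (fun p => w (D.chart i p)) ≤ l2sq (volume.restrict Ω) w := by
  have hpre := (D.measurePreserving_chart hκ i).restrict_preimage
    D.isOpen_domain.measurableSet
  have hsub : (S ∩ D.dom i) ×ˢ Ioo 0 D.depth ⊆ D.chart i ⁻¹' Ω := fun p hp =>
    D.chart_mem i p.1 hp.1 p.2 hp.2
  rw [Measure.prod_restrict]
  refine ⟨(hw.comp_measurePreserving hpre).mono_measure (Measure.restrict_mono hsub le_rfl), ?_⟩
  refine (l2sq_restrict_mono hsub).trans_eq ?_
  exact (D.measurePreserving_chart hκ i).setLIntegral_comp_preimage_emb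
    (D.chart i).toHomeomorph.measurableEmbedding (fun x => ‖w x‖ₑ ^ 2) Ω

theorem measurableSet_dom (D : FlatBoundary κ Ω S) (i : Fin D.N) : MeasurableSet (S ∩ D.dom i) :=
  (D.isOpen_base.inter (D.isOpen_dom i)).measurableSet

/-- Cauchy–Schwarz on each segment, then Fubini. The factor is the square integral of the weight a,
which is small when a is bounded by 1 and supported in a thin layer. -/
theorem layerMean_memLp (D : FlatBoundary κ Ω S) (hκ : MeasurePreserving κ) (i : Fin D.N) {a : ℝ → ℝ} (ha : Continuous a)
    {w : E → ℂ} (hw : MemLp w 2 (volume.restrict Ω)) :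
    MemLp (D.layerMean i a w) 2 ∧ l2sq volume (D.layerMean i a w) ≤
      (∫⁻ s in Ioo 0 D.depth, ‖a s‖ₑ ^ 2) * l2sq (volume.restrict Ω) w := by
  obtain ⟨h1, h2⟩ := D.memLp_comp_chart hκ i hw
  have hm := D.measurableSet_dom i
  have hmeas : AEStronglyMeasurable (fun p : F × ℝ => a p.2 • w (D.chart i p))
      ((volume.restrict (S ∩ D.dom i)).prod (volume.restrict (Ioo 0 D.depth))) :=
    (ha.comp continuous_snd).aestronglyMeasurable.smul h1.1
  have hmeas2 := hmeas.integral_prod_right'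
  have hb : l2sq volume (D.layerMean i a w) ≤
      (∫⁻ s in Ioo 0 D.depth, ‖a s‖ₑ ^ 2) * l2sq (volume.restrict Ω) w := by
    have e : l2sq volume (D.layerMean i a w) = ∫⁻ y in S ∩ D.dom i,
        ‖∫ s in Ioo 0 D.depth, a s • w (D.chart i (y, s))‖ₑ ^ 2 := by
      rw [← lintegral_indicator hm, l2sq]
      congr 1 with y
      by_cases hy : y ∈ S ∩ D.dom i <;> simp [layerMean, hy]
    rw [e]
    refine le_trans ?_ (mul_le_mul_right h2 _)
    rw [l2sq, lintegral_prod _ (by have := h1.1.enorm; fun_prop),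
      ← lintegral_const_mul'' _ (by
        have := (h1.1.enorm.pow_const 2).lintegral_prod_right'; exact this)]
    refine lintegral_mono_ae ?_
    filter_upwards [h1.1.prodMk_left] with y hy
    calc ‖∫ s in Ioo 0 D.depth, a s • w (D.chart i (y, s))‖ₑ ^ 2
        ≤ (∫⁻ s in Ioo 0 D.depth, ‖a s‖ₑ * ‖w (D.chart i (y, s))‖ₑ) ^ 2 := by
          gcongr
          refine (enorm_integral_le_lintegral_enorm _).trans_eq ?_
          simp only [enorm_smul]
      _ ≤ _ := sq_lintegral_mul_le ha.aestronglyMeasurable.enorm hy.enorm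
  refine ⟨memLp_two_iff_l2sq.2 ⟨?_, hb.trans_lt ?_⟩, hb⟩
  · exact (aestronglyMeasurable_indicator_iff hm).2 hmeas2
  · refine ENNReal.mul_lt_top ?_ (l2sq_lt_top hw)
    have : IntegrableOn (fun s => ‖a s‖ ^ 2) (Ioo 0 D.depth) :=
      ((ha.norm.pow 2).integrableOn_Icc (a := 0) (b := D.depth)).mono_set Ioo_subset_Icc_self
    have h := this.2
    rw [hasFiniteIntegral_iff_enorm] at h
    simpa [enorm_pow] using h

/-- The trace, as a mean over the segments along the direction of index `i`. -/
noncomputable def chartTrace (D : FlatBoundary κ Ω S) (i : Fin D.N) (k : ℝ → ℝ) (u g : E → ℂ) (y : F) : ℂ :=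
  D.layerMean i k g y - D.layerMean i (deriv k) u y

/-- Along a transversal segment, u at depth zero equals -∫ ∂ₛ(k u) ds, because k (0) = 1 and k
vanishes at the bottom; the outward derivative is -∂ₛ, so this is the mean of k g - k' u. In chart
coordinates the flux of a product test function is this formula integrated against φ by Fubini. -/
theorem flux_lift (D : FlatBoundary κ Ω S) (hκ : MeasurePreserving κ) {i : Fin D.N} {u g : E → ℂ}
    (hu : MemLp u 2 (volume.restrict Ω))
    (hg : MemLp g 2 (volume.restrict Ω)) {φ : F → ℝ} (hφ : IsTest φ)
    (hs : tsupport φ ⊆ S ∩ D.dom i) {k : ℝ → ℝ} (hk : IsDepthCutoff D.depth k) :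
    ∫ x in Ω, (lift (D.chart i) φ k x • g x +
      fderiv ℝ (lift (D.chart i) φ k) x (D.outward i) • u x) =
      ∫ y in S, φ y • D.chartTrace i k u g y := by
  set M := D.chart i with hM
  have hmp := D.measurePreserving_chart hκ i
  have hm := D.measurableSet_dom i
  have hk' : Continuous (deriv k) := hk.1.continuous_deriv (by simp)
  obtain ⟨hg1, -⟩ := D.memLp_comp_chart hκ i hg
  obtain ⟨hu1, -⟩ := D.memLp_comp_chart hκ i hu
  have hφ2 : ∀ a : ℝ → ℝ, Continuous a → MemLp (fun p : F × ℝ => φ p.1 * a p.2) 2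
      ((volume.restrict (S ∩ D.dom i)).prod (volume.restrict (Ioo 0 D.depth))) := by
    intro a ha
    have h1 : MemLp (fun p : F × ℝ => φ p.1) 2
        ((volume.restrict (S ∩ D.dom i)).prod (volume.restrict (Ioo 0 D.depth))) :=
      (hφ.memLp 2 _).comp_fst _
    have h2 : MemLp (fun p : F × ℝ => a p.2) ⊤
        ((volume.restrict (S ∩ D.dom i)).prod (volume.restrict (Ioo 0 D.depth))) := by
      obtain ⟨C, hC⟩ := (isCompact_Icc (a := 0) (b := D.depth)).exists_bound_of_continuousOn
        ha.continuousOn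
      refine memLp_top_of_bound (ha.comp continuous_snd).aestronglyMeasurable C ?_
      rw [Measure.prod_restrict, ae_restrict_iff' (hm.prod measurableSet_Ioo)]
      exact Eventually.of_forall fun p hp => hC _ (Ioo_subset_Icc_self hp.2)
    exact h2.mul h1
  have hpt : ∀ y s, lift M φ k (M (y, s)) • g (M (y, s)) +
      fderiv ℝ (lift M φ k) (M (y, s)) (D.outward i) • u (M (y, s)) =
      (φ y * k s) • g (M (y, s)) - (φ y * deriv k s) • u (M (y, s)) := by
    intro y s
    have h1 : D.outward i = -M (0, 1) := by rw [hM, D.chart_zero_one, neg_neg]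
    rw [h1, map_neg, fderiv_lift M hφ hk.1 hk.hasCompactSupport]
    simp [lift, sub_eq_add_neg]
  have hI : Integrable (fun p : F × ℝ => (φ p.1 * k p.2) • g (M p) -
      (φ p.1 * deriv k p.2) • u (M p))
      ((volume.restrict (S ∩ D.dom i)).prod (volume.restrict (Ioo 0 D.depth))) :=
    (integrable_smul_of_memLp_two (hφ2 k hk.1.continuous) hg1).sub
      (integrable_smul_of_memLp_two (hφ2 _ hk') hu1)
  calc ∫ x in Ω, (lift M φ k x • g x + fderiv ℝ (lift M φ k) x (D.outward i) • u x)
      = ∫ p in M ⁻¹' Ω, (lift M φ k (M p) • g (M p) +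
          fderiv ℝ (lift M φ k) (M p) (D.outward i) • u (M p)) :=
        (hmp.setIntegral_preimage_emb M.toHomeomorph.measurableEmbedding _ Ω).symm
    _ = ∫ p in M ⁻¹' Ω, ((φ p.1 * k p.2) • g (M p) - (φ p.1 * deriv k p.2) • u (M p)) := by
        simp only [← hpt]
    _ = ∫ p in (S ∩ D.dom i) ×ˢ Ioo 0 D.depth,
          ((φ p.1 * k p.2) • g (M p) - (φ p.1 * deriv k p.2) • u (M p)) := by
        refine setIntegral_eq_of_subset_of_forall_sdiff_eq_zero
          (D.isOpen_domain.preimage M.continuous).measurableSet ?_ ?_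
        · exact fun p hp => D.chart_mem i p.1 hp.1 p.2 hp.2
        -- Points of Ω have positive depth, so a point outside the box either projects outside the
        -- support of φ or lies below the support of k.
        · rintro p ⟨hpΩ, hp⟩
          have hpos : 0 < p.2 := by
            have := D.pos_of_mem hpΩ
            rw [← D.chart_symm_snd i, ← hM] at this
            simpa using this
          by_cases h1 : p.1 ∈ tsupport φ
          · have h2 : p.2 ∉ tsupport k := fun h => hp ⟨hs h1, hpos, (hk.2.2.1 h).2⟩
            have h3 : p.2 ∉ tsupport (deriv k) := fun h => h2 (tsupport_deriv_subset h)
            simp [image_eq_zero_of_notMem_tsupport h2, image_eq_zero_of_notMem_tsupport h3]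
          · simp [image_eq_zero_of_notMem_tsupport h1]
    _ = ∫ y in S ∩ D.dom i, ∫ s in Ioo 0 D.depth,
          ((φ y * k s) • g (M (y, s)) - (φ y * deriv k s) • u (M (y, s))) := by
        have : (volume : Measure (F × ℝ)).restrict ((S ∩ D.dom i) ×ˢ Ioo 0 D.depth) =
          (volume.restrict (S ∩ D.dom i)).prod (volume.restrict (Ioo 0 D.depth)) :=
          (Measure.prod_restrict _ _).symm
        rw [this, integral_prod _ hI]
    _ = ∫ y in S ∩ D.dom i, φ y • D.chartTrace i k u g y := by
        refine setIntegral_congr_ae hm ?_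
        rw [← ae_restrict_iff' hm]
        have h1 := hg1.1.prodMk_left
        have h2 := (memLp_two_iff_l2sq.1 hg1).2
        have h3 := (memLp_two_iff_l2sq.1 hu1).2
        rw [l2sq, lintegral_prod _ (by have := hg1.1.enorm; fun_prop)] at h2
        rw [l2sq, lintegral_prod _ (by have := hu1.1.enorm; fun_prop)] at h3
        have h2' := ae_lt_top' (hg1.1.enorm.pow_const 2).lintegral_prod_right' h2.ne
        have h3' := ae_lt_top' (hu1.1.enorm.pow_const 2).lintegral_prod_right' h3.ne
        filter_upwards [hg1.1.prodMk_left, hu1.1.prodMk_left, h2', h3', ae_restrict_mem hm]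
          with y a1 a2 a3 a4 hy
        have m1 : MemLp (fun s => g (M (y, s))) 2 (volume.restrict (Ioo 0 D.depth)) :=
          memLp_two_iff_l2sq.2 ⟨a1, a3⟩
        have m2 : MemLp (fun s => u (M (y, s))) 2 (volume.restrict (Ioo 0 D.depth)) :=
          memLp_two_iff_l2sq.2 ⟨a2, a4⟩
        have mc : ∀ a : ℝ → ℝ, Continuous a → MemLp a 2 (volume.restrict (Ioo 0 D.depth)) := by
          intro a ha
          obtain ⟨C, hC⟩ := (isCompact_Icc (a := 0) (b := D.depth)).exists_bound_of_continuousOn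
            ha.continuousOn
          exact MemLp.of_bound ha.aestronglyMeasurable C ((ae_restrict_mem measurableSet_Ioo).mono
            fun s hs => hC s (Ioo_subset_Icc_self hs))
        have i1 := integrable_smul_of_memLp_two (mc k hk.1.continuous) m1
        have i2 := integrable_smul_of_memLp_two (mc _ hk') m2
        simp only [mul_smul]
        have e0 := integral_sub (i1.fun_smul (φ y)) (i2.fun_smul (φ y))
        rw [e0, integral_smul, integral_smul, ← smul_sub]
        simp only [chartTrace, layerMean, indicator_of_mem hy]
        rfl
    _ = ∫ y in S, φ y • D.chartTrace i k u g y := by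
        refine (setIntegral_eq_of_subset_of_forall_sdiff_eq_zero D.isOpen_base.measurableSet
          inter_subset_left ?_).symm
        rintro y ⟨_, hy⟩
        rw [image_eq_zero_of_notMem_tsupport fun h => hy (hs h), zero_smul]

end FlatBoundary

end Trace

/-! ### Existence and locality of traces on the flat part -/

section TraceExistence

variable {E F : Type*} [NormedAddCommGroup E] [NormedSpace ℝ E] [MeasureSpace E] [BorelSpace E]
  [FiniteDimensional ℝ E] [(volume : Measure E).IsAddHaarMeasure]
  [NormedAddCommGroup F] [NormedSpace ℝ F] [MeasureSpace F] [BorelSpace F]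
  [FiniteDimensional ℝ F] [(volume : Measure F).IsAddHaarMeasure]

theorem isTest_finsetSum {ι : Type*} (s : Finset ι) {f : ι → E → ℝ} (h : ∀ i ∈ s, IsTest (f i)) :
    IsTest (fun x => ∑ i ∈ s, f i x) := by
  classical
  induction s using Finset.induction_on with
  | empty =>
    simp only [Finset.sum_empty]
    exact ⟨contDiff_const, HasCompactSupport.zero⟩
  | insert i s hi ih =>
    simp only [Finset.sum_insert hi]
    exact (h i (by simp)).add (ih fun j hj => h j (by simp [hj]))

theorem tsupport_finsetSum {ι : Type*} (s : Finset ι) (f : ι → E → ℝ) :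
    tsupport (fun x => ∑ i ∈ s, f i x) ⊆ ⋃ i ∈ s, tsupport (f i) := by
  refine closure_minimal (fun x hx => ?_) ?_
  · obtain ⟨i, hi, hne⟩ := Finset.exists_ne_zero_of_sum_ne_zero hx
    exact mem_biUnion hi (subset_tsupport _ hne)
  · exact s.finite_toSet.isClosed_biUnion fun i _ => isClosed_tsupport _

namespace FlatBoundary

variable {κ : (F × ℝ) ≃L[ℝ] E} {Ω : Set E} {S : Set F}

/-- The trace, glued from the traces along the transversal directions. -/
noncomputable def traceFun (D : FlatBoundary κ Ω S) (k : ℝ → ℝ) (u : E → ℂ) (G : Fin D.N → E → ℂ)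
    (y : F) : ℂ := ∑ i, D.part i y • D.chartTrace i k u (G i) y

theorem memLp_chartTrace (D : FlatBoundary κ Ω S) (hκ : MeasurePreserving κ) {k : ℝ → ℝ}
    (hk : IsDepthCutoff D.depth k) {u g : E → ℂ} (hu : MemLp u 2 (volume.restrict Ω))
    (hg : MemLp g 2 (volume.restrict Ω)) (i : Fin D.N) : MemLp (D.chartTrace i k u g) 2 :=
  (D.layerMean_memLp hκ i hk.1.continuous hg).1.sub
    (D.layerMean_memLp hκ i (hk.1.continuous_deriv (by simp)) hu).1

theorem memLp_part_smul (D : FlatBoundary κ Ω S) (i : Fin D.N) {f : F → ℂ} {μ : Measure F}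
    (hf : MemLp f 2 μ) : MemLp (fun y => D.part i y • f y) 2 μ := by
  have h1 : MemLp (D.part i) ⊤ μ :=
    memLp_top_of_bound (D.contDiff_part i).continuous.aestronglyMeasurable 1
      (Eventually.of_forall fun y => D.abs_part_le i y)
  exact hf.smul (r := 2) h1

theorem memLp_traceFun (D : FlatBoundary κ Ω S) (hκ : MeasurePreserving κ) {k : ℝ → ℝ}
    (hk : IsDepthCutoff D.depth k) {u : E → ℂ} {G : Fin D.N → E → ℂ}
    (hu : MemLp u 2 (volume.restrict Ω)) (hG : ∀ i, MemLp (G i) 2 (volume.restrict Ω)) :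
    MemLp (D.traceFun k u G) 2 :=
  memLp_finsetSum _ fun i _ => D.memLp_part_smul i (D.memLp_chartTrace hκ hk hu (hG i) i)

/-- The normal and an oblique outward direction differ by a tangential vector, and tangential
derivatives have no flux through the flat part. -/
theorem flux_outward_eq (D : FlatBoundary κ Ω S) {u g G : E → ℂ} (i : Fin D.N)
    (hu : MemLp u 2 (volume.restrict Ω)) (hg : IsWeakDeriv Ω (κ (0, 1)) u g)
    (hg2 : MemLp g 2 (volume.restrict Ω)) (hG : IsWeakDeriv Ω (D.outward i) u G)
    (hG2 : MemLp G 2 (volume.restrict Ω)) {φ : E → ℝ} (hφ : IsAdmissible κ Ω S φ) :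
    ∫ x in Ω, (φ x • g x + fderiv ℝ φ x (κ (0, 1)) • u x) =
      ∫ x in Ω, (φ x • G x + fderiv ℝ φ x (D.outward i) • u x) := by
  have hw : IsWeakDeriv Ω (κ (D.dir i, 0)) u (G + ((-1 : ℝ) : ℂ) • g) := by
    have := hG.add_dir (hg.smul_dir (-1))
    have e : D.outward i + (-1 : ℝ) • κ (0, 1) = κ (D.dir i, 0) := by
      rw [outward]; module
    rwa [e] at this
  have hw2 : MemLp (G + ((-1 : ℝ) : ℂ) • g) 2 (volume.restrict Ω) := hG2.add (hg2.const_smul _)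
  have h0 := D.flux_eq_zero hw hu hw2 hφ (M := 0) (fun x _ => by simp [depthOf_apply])
  have i1 := integrableOn_test_smul hG2 hφ.1
  have i2 := integrableOn_test_smul hg2 hφ.1
  have i3 := integrableOn_test_smul hu (hφ.1.fderiv_apply (D.outward i))
  have i4 := integrableOn_test_smul hu (hφ.1.fderiv_apply (κ (0, 1)))
  have j1 : Integrable (fun x => φ x • G x + fderiv ℝ φ x (D.outward i) • u x)
    (volume.restrict Ω) := i1.add i3
  have j2 : Integrable (fun x => φ x • g x + fderiv ℝ φ x (κ (0, 1)) • u x)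
    (volume.restrict Ω) := i2.add i4
  rw [eq_comm, ← sub_eq_zero, ← integral_sub j1 j2, ← h0]
  refine integral_congr_ae (Eventually.of_forall fun x => ?_)
  simp only [outward, map_add, Pi.add_apply, Pi.smul_apply, add_smul, smul_add]
  simp
  ring

/-- Replace φ by the sum of the lifts of its localized boundary values. The difference vanishes on
the flat part, hence carries no flux. For each lift the normal may be exchanged for the transversal
direction of its own chart, in which the flux is an explicit boundary integral. -/
theorem isTrace_traceFun (D : FlatBoundary κ Ω S) (hκ : MeasurePreserving κ) {k : ℝ → ℝ}
    (hk : IsDepthCutoff D.depth k) {u g : E → ℂ} {G : Fin D.N → E → ℂ}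
    (hu : MemLp u 2 (volume.restrict Ω)) (hg : IsWeakDeriv Ω (κ (0, 1)) u g)
    (hg2 : MemLp g 2 (volume.restrict Ω)) (hG : ∀ i, IsWeakDeriv Ω (D.outward i) u (G i))
    (hG2 : ∀ i, MemLp (G i) 2 (volume.restrict Ω)) :
    IsTrace Ω (κ (0, 1)) (fun y => κ (y, 0)) S u (D.traceFun k u G) := by
  refine ⟨locallyIntegrableOn_of_memLp ((D.memLp_traceFun hκ hk hu hG2).restrict S),
    fun φ hφ hd => ?_⟩
  have hadm : IsAdmissible κ Ω S φ := ⟨hφ, hd⟩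
  have hwd := hg.weakDeriv_ae D.isOpen_domain
  have e0 : ∫ x in Ω, (φ x • weakDeriv Ω (κ (0, 1)) u x + fderiv ℝ φ x (κ (0, 1)) • u x) =
      ∫ x in Ω, (φ x • g x + fderiv ℝ φ x (κ (0, 1)) • u x) :=
    integral_congr_ae (hwd.mono fun x hx => by simp only [hx])
  rw [e0]
  have hj : Continuous fun y : F => κ (y, 0) := by fun_prop
  have hjc : IsClosedEmbedding fun y : F => κ (y, 0) :=
    κ.toHomeomorph.isClosedEmbedding.comp
      (.of_continuous_injective_isClosedMap (by fun_prop)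
        (fun a b h => (Prod.ext_iff.1 h).1) (isClosedMap_prodMk_right (y := (0 : ℝ))))
  have hφj : IsTest fun y : F => φ (κ (y, 0)) :=
    ⟨hφ.1.comp (κ.contDiff.comp (contDiff_id.prodMk contDiff_const)), hφ.2.comp_isClosedEmbedding hjc⟩
  have hφjs : ∀ y, y ∈ tsupport (fun y : F => φ (κ (y, 0))) → κ (y, 0) ∈ tsupport φ := fun y hy =>
    tsupport_comp_subset_preimage φ hj hy
  have hfr : ∀ y ∈ closure S, κ (y, 0) ∈ frontier Ω := fun y hy =>
    closure_minimal (t := (fun y : F => κ (y, 0)) ⁻¹' frontier Ω)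
      (fun z hz => D.mem_frontier hz) (isClosed_frontier.preimage hj) hy
  have hinj : ∀ y, κ (y, 0) ∈ (fun y : F => κ (y, 0)) '' S → y ∈ S := by
    rintro y ⟨z, hz, h⟩
    have := hjc.injective h
    rwa [← this]
  obtain ⟨hT, hTs⟩ := isTest_indicator D.isOpen_base hφj (disjoint_left.2 fun y hy hyf =>
    disjoint_left.1 hd (hφjs y hy) ⟨hfr y (frontier_subset_closure hyf), fun h => by
      rw [D.isOpen_base.frontier_eq] at hyf
      exact hyf.2 (hinj y h)⟩)
  -- The indicator of S discards values of φ at points of the plane outside S. It does not destroy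
  -- smoothness, because the support of φ avoids the boundary points over the frontier of S.
  set φi : Fin D.N → F → ℝ := fun i y =>
    D.part i y * S.indicator (fun y : F => φ (κ (y, 0))) y with hφi
  have hφiT : ∀ i, IsTest (φi i) := fun i => hT.mul_left (D.contDiff_part i)
  have hφis : ∀ i, tsupport (φi i) ⊆ S ∩ D.dom i := fun i => subset_inter
    (tsupport_mul_subset_right.trans hTs) (tsupport_mul_subset_left.trans (D.tsupport_part i))
  set Φ : Fin D.N → E → ℝ := fun i => lift (D.chart i) (φi i) k with hΦ
  have hΦa : ∀ i, IsAdmissible κ Ω S (Φ i) := fun i => D.isAdmissible_lift (hφiT i) (hφis i) hk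
  have hsum : IsTest fun x => ∑ i, Φ i x := isTest_finsetSum _ fun i _ => (hΦa i).1
  set ψ : E → ℝ := fun x => φ x - ∑ i, Φ i x with hψ
  have hψa : IsAdmissible κ Ω S ψ := by
    refine ⟨hφ.sub hsum, disjoint_left.2 fun x hx hxf => ?_⟩
    have : tsupport ψ ⊆ tsupport φ ∪ tsupport fun x => ∑ i, Φ i x := tsupport_sub _ _
    rcases this hx with h | h
    · exact disjoint_left.1 hd h hxf
    · obtain ⟨i, _, hi⟩ := mem_iUnion₂.1 (tsupport_finsetSum _ _ h)
      exact disjoint_left.1 (hΦa i).2 hi hxf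
  have hψ0 : ∀ y ∈ S, ψ (κ (y, 0)) = 0 := by
    intro y hy
    have h1 : ∀ i, Φ i (κ (y, 0)) = D.part i y * φ (κ (y, 0)) := by
      intro i
      have : (D.chart i).symm (κ (y, 0)) = (y, 0) := by
        rw [ContinuousLinearEquiv.symm_apply_eq, D.chart_apply]; simp
      simp [hΦ, lift, this, hk.2.1, hφi, hy]
    simp only [hψ, h1, ← Finset.sum_mul, D.sum_part y hy]
    ring
  -- The partition of unity sums to one on S and the depth cutoff is one at depth zero, so ψ
  -- vanishes on the flat part and is bounded by a multiple of the depth.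
  obtain ⟨M, hM⟩ := D.exists_le_of_vanish hψa hψ0
  have hflux0 := D.flux_eq_zero hg hu hg2 hψa (M := M * |depthOf κ (κ (0, 1))|) (fun x hx => by
    have := mul_le_mul_of_nonneg_right (hM x hx) (abs_nonneg (depthOf κ (κ (0, 1))))
    linarith)
  have hint : ∀ f : E → ℝ, IsTest f → Integrable
      (fun x => f x • g x + fderiv ℝ f x (κ (0, 1)) • u x) (volume.restrict Ω) := fun f hf =>
    (integrableOn_test_smul hg2 hf).add (integrableOn_test_smul hu (hf.fderiv_apply _))
  have e1 : ∫ x in Ω, (φ x • g x + fderiv ℝ φ x (κ (0, 1)) • u x) =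
      ∑ i, ∫ x in Ω, (Φ i x • g x + fderiv ℝ (Φ i) x (κ (0, 1)) • u x) := by
    rw [← integral_finsetSum _ fun i _ => hint _ (hΦa i).1, ← sub_eq_zero,
      ← integral_sub (hint φ hφ) (integrable_finsetSum _ fun i _ => hint _ (hΦa i).1), ← hflux0]
    refine integral_congr_ae (Eventually.of_forall fun x => ?_)
    have hd1 : fderiv ℝ ψ x = fderiv ℝ φ x - ∑ i, fderiv ℝ (Φ i) x := by
      have h1 : HasFDerivAt (fun x => ∑ i, Φ i x) (∑ i, fderiv ℝ (Φ i) x) x :=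
        HasFDerivAt.fun_sum fun i _ => ((hΦa i).1.differentiable x).hasFDerivAt
      exact ((hφ.differentiable x).hasFDerivAt.sub h1).fderiv
    have hd2 : fderiv ℝ ψ x (κ (0, 1)) =
        fderiv ℝ φ x (κ (0, 1)) - ∑ i, fderiv ℝ (Φ i) x (κ (0, 1)) := by
      rw [hd1, sub_apply, sum_apply]
    have hd3 : ψ x = φ x - ∑ i, Φ i x := rfl
    simp only [hd2, hd3, sub_smul, Finset.sum_smul, Finset.sum_add_distrib]
    ring
  rw [e1]
  have hint2 : ∀ i, Integrable (fun y => φi i y • D.chartTrace i k u (G i) y)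
      (volume.restrict S) := fun i => integrable_smul_of_memLp_two ((hφiT i).memLp 2 _)
        ((D.memLp_chartTrace hκ hk hu (hG2 i) i).restrict S)
  have e2 : ∀ i, ∫ x in Ω, (Φ i x • g x + fderiv ℝ (Φ i) x (κ (0, 1)) • u x) =
      ∫ y in S, φi i y • D.chartTrace i k u (G i) y := by
    intro i
    rw [D.flux_outward_eq i hu hg hg2 (hG i) (hG2 i) (hΦa i)]
    exact D.flux_lift hκ hu (hG2 i) (hφiT i) (hφis i) hk
  simp only [e2]
  rw [← integral_finsetSum _ fun i _ => hint2 i]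
  refine setIntegral_congr_fun D.isOpen_base.measurableSet fun y hy => ?_
  simp only [traceFun, Finset.smul_sum, hφi, indicator_of_mem hy]
  refine Finset.sum_congr rfl fun i _ => ?_
  rw [smul_smul, mul_comm]

/-- Traces are unique, and local. -/
theorem ae_eq_zero_of_forall_admissible (D : FlatBoundary κ Ω S) {g : F → ℂ}
    (hg : LocallyIntegrableOn g S) {O : Set E} (hO : IsOpen O)
    (h : ∀ φ, IsAdmissible κ Ω S φ → tsupport φ ⊆ O → ∫ y in S, φ (κ (y, 0)) • g y = 0) :
    ∀ᵐ y, y ∈ S → κ (y, 0) ∈ O → g y = 0 := by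
  have hj : Continuous fun y : F => κ (y, 0) := by fun_prop
  have key : ∀ i, ∀ᵐ y, y ∈ (S ∩ D.dom i) ∩ (fun y : F => κ (y, 0)) ⁻¹' O → g y = 0 := by
    intro i
    refine ((D.isOpen_base.inter (D.isOpen_dom i)).inter
      (hO.preimage hj)).ae_eq_zero_of_integral_contDiff_smul_eq_zero
      (hg.mono_set (inter_subset_left.trans inter_subset_left)) fun φ h1 h2 h3 => ?_
    have hφ : IsTest φ := ⟨h1, h2⟩
    have hφS : tsupport φ ⊆ S ∩ D.dom i := h3.trans inter_subset_left
    -- The support of φ is compact, so a uniformly thin layer over it stays in O. The depth cutoff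
    -- is then chosen within this layer.
    obtain ⟨V, W, hV, hW, hVs, hWs, hVW⟩ := generalized_tube_lemma (s := tsupport φ)
      (t := {(0 : ℝ)}) h2.isCompact isCompact_singleton
      (hO.preimage (D.chart i).continuous) (by
        rintro ⟨y, s⟩ ⟨hy, hs⟩
        obtain rfl : s = 0 := hs
        have := (h3 hy).2
        simp only [mem_preimage] at this ⊢
        rw [D.chart_apply]
        simpa using this)
    obtain ⟨r, hr, hrW⟩ := Metric.isOpen_iff.1 hW 0 (hWs rfl)
    obtain ⟨k, hk⟩ := exists_isDepthCutoff (lt_min hr D.depth_pos)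
    have ha := D.isAdmissible_lift hφ hφS (hk.mono (min_le_right _ _))
    have hs : tsupport (lift (D.chart i) φ k) ⊆ O := by
      intro x hx
      obtain ⟨hx1, hx2⟩ := tsupport_lift _ _ _ hx
      have hx3 := (hk.mono (min_le_left _ _)).2.2.1 hx2
      have : ((D.chart i).symm x) ∈ D.chart i ⁻¹' O := by
        refine hVW ⟨hVs hx1, hrW ?_⟩
        rw [Real.ball_eq_Ioo]
        simpa using hx3
      simpa using this
    have := h _ ha hs
    have e : ∀ y, lift (D.chart i) φ k (κ (y, 0)) = φ y := by
      intro y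
      have : (D.chart i).symm (κ (y, 0)) = (y, 0) := by
        rw [ContinuousLinearEquiv.symm_apply_eq, D.chart_apply]; simp
      simp [lift, this, hk.2.1]
    simp only [e] at this
    rwa [setIntegral_eq_integral_of_forall_compl_eq_zero] at this
    intro y hy
    rw [image_eq_zero_of_notMem_tsupport fun h => hy (hφS h).1, zero_smul]
  filter_upwards [ae_all_iff.2 key] with y hy hyS hyO
  obtain ⟨i, hi⟩ := D.exists_mem_dom hyS
  exact hy i ⟨⟨hyS, hi⟩, hyO⟩

/-- Admissibility keeps the support of the boundary values away from the frontier of S: within the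
closure of S it is a compact subset of S, where local integrability suffices. -/
theorem integrableOn_admissible_smul (D : FlatBoundary κ Ω S) {g : F → ℂ}
    (hg : LocallyIntegrableOn g S) {φ : E → ℝ} (hφ : IsAdmissible κ Ω S φ) :
    Integrable (fun y => φ (κ (y, 0)) • g y) (volume.restrict S) := by
  have hj : Continuous fun y : F => κ (y, 0) := by fun_prop
  have hjc : IsClosedEmbedding fun y : F => κ (y, 0) :=
    κ.toHomeomorph.isClosedEmbedding.comp
      (.of_continuous_injective_isClosedMap (by fun_prop)
        (fun a b h => (Prod.ext_iff.1 h).1) (isClosedMap_prodMk_right (y := (0 : ℝ))))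
  have hφc : HasCompactSupport fun y : F => φ (κ (y, 0)) := hφ.1.2.comp_isClosedEmbedding hjc
  have hK : IsCompact (tsupport (fun y : F => φ (κ (y, 0))) ∩ closure S) :=
    hφc.isCompact.inter_right isClosed_closure
  have hKS : tsupport (fun y : F => φ (κ (y, 0))) ∩ closure S ⊆ S := by
    rintro y ⟨hy, hyS⟩
    have h1 : κ (y, 0) ∈ frontier Ω :=
      closure_minimal (t := (fun y : F => κ (y, 0)) ⁻¹' frontier Ω)
        (fun z hz => D.mem_frontier hz) (isClosed_frontier.preimage hj) hyS
    by_contra hne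
    refine disjoint_left.1 hφ.2 (tsupport_comp_subset_preimage φ hj hy) ⟨h1, ?_⟩
    rintro ⟨z, hz, h⟩
    exact hne (hjc.injective h ▸ hz)
  have hgi := (hg.integrableOn_compact_subset hKS hK)
  obtain ⟨C, hC⟩ := hφ.1.exists_bound
  have h1 : IntegrableOn (fun y => φ (κ (y, 0)) • g y)
      (tsupport (fun y : F => φ (κ (y, 0))) ∩ closure S) :=
    Integrable.bdd_smul (φ := fun y => φ (κ (y, 0))) hgi C
      (hφ.1.continuous.comp hj).aestronglyMeasurable (Eventually.of_forall fun y => hC _)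
  refine (IntegrableOn.of_forall_sdiff_eq_zero h1 D.isOpen_base.measurableSet ?_)
  rintro y ⟨hyS, hy⟩
  have : y ∉ tsupport (fun y : F => φ (κ (y, 0))) := fun h => hy ⟨h, subset_closure hyS⟩
  have h0 : φ (κ (y, 0)) = 0 :=
    image_eq_zero_of_notMem_tsupport (f := fun y : F => φ (κ (y, 0))) this
  rw [h0, zero_smul]

end FlatBoundary

end TraceExistence

/-! ### Algebra, locality and L² bounds of traces of H¹ functions -/

section TraceSobolev

variable {E F : Type*} [NormedAddCommGroup E] [NormedSpace ℝ E] [MeasureSpace E] [BorelSpace E]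
  [FiniteDimensional ℝ E] [(volume : Measure E).IsAddHaarMeasure]
  [NormedAddCommGroup F] [NormedSpace ℝ F] [MeasureSpace F] [BorelSpace F]
  [FiniteDimensional ℝ F] [(volume : Measure F).IsAddHaarMeasure]

theorem enorm_sum_sq_le {ι G : Type*} [NormedAddCommGroup G] (s : Finset ι) (a : ι → G) :
    ‖∑ i ∈ s, a i‖ₑ ^ 2 ≤ s.card * ∑ i ∈ s, ‖a i‖ₑ ^ 2 := by
  have h : ‖∑ i ∈ s, a i‖ ^ 2 ≤ s.card * ∑ i ∈ s, ‖a i‖ ^ 2 :=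
    (pow_le_pow_left₀ (norm_nonneg _) (norm_sum_le _ _) 2).trans sq_sum_le_card_mul_sum_sq
  simp only [← ofReal_norm, ← ENNReal.ofReal_pow (norm_nonneg _)]
  rw [← ENNReal.ofReal_sum_of_nonneg (fun i _ => by positivity), ← ENNReal.ofReal_natCast,
    ← ENNReal.ofReal_mul (by positivity)]
  exact ENNReal.ofReal_le_ofReal h

theorem l2sq_finsetSum_le {α ι G : Type*} [MeasurableSpace α] {μ : Measure α}
    [NormedAddCommGroup G] (s : Finset ι) {f : ι → α → G}
    (hf : ∀ i ∈ s, AEStronglyMeasurable (f i) μ) :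
    l2sq μ (fun x => ∑ i ∈ s, f i x) ≤ s.card * ∑ i ∈ s, l2sq μ (f i) := by
  unfold l2sq
  rw [← lintegral_finsetSum' _ fun i hi => ((hf i hi).enorm.pow_const 2),
    ← lintegral_const_mul' _ _ (by simp)]
  exact lintegral_mono fun x => enorm_sum_sq_le s _

section MemH1

variable {ι : Type*} [Fintype ι] {Ω : Set E} {b : ι → E} {u v : E → ℂ}

theorem MemH1.congr (hu : MemH1 Ω b u) (h : u =ᵐ[volume.restrict Ω] v) : MemH1 Ω b v := by
  refine ⟨(memLp_congr_ae h).1 hu.1, fun i => ?_⟩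
  obtain ⟨g, hg, hg2⟩ := hu.2 i
  exact ⟨g, hg.congr h (ae_eq_refl g), hg2⟩

theorem MemH1.add (hu : MemH1 Ω b u) (hv : MemH1 Ω b v) : MemH1 Ω b (u + v) := by
  refine ⟨hu.1.add hv.1, fun i => ?_⟩
  obtain ⟨g, hg, hg2⟩ := hu.2 i
  obtain ⟨g', hg', hg2'⟩ := hv.2 i
  exact ⟨g + g', hg.add hg', hg2.add hg2'⟩

theorem MemH1.const_smul (hu : MemH1 Ω b u) (c : ℂ) : MemH1 Ω b (c • u) := by
  refine ⟨hu.1.const_smul c, fun i => ?_⟩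
  obtain ⟨g, hg, hg2⟩ := hu.2 i
  exact ⟨c • g, hg.const_smul c, hg2.const_smul c⟩

theorem memLp_real_smul {ρ : E → ℝ} (hρ : Continuous ρ) {C : ℝ} (hb : ∀ x, ‖ρ x‖ ≤ C)
    {μ : Measure E} (hu : MemLp u 2 μ) : MemLp (fun x => ρ x • u x) 2 μ := by
  have h1 : MemLp ρ ⊤ μ := memLp_top_of_bound hρ.aestronglyMeasurable C (Eventually.of_forall hb)
  exact hu.smul (r := 2) h1

theorem MemH1.smul_smooth (hΩ : IsOpen Ω) (hu : MemH1 Ω b u) {ρ : E → ℝ} (hρ : ContDiff ℝ ∞ ρ)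
    {C : ℝ} (hC : ∀ x, ‖ρ x‖ ≤ C) (hd : ∀ i, ∃ C, ∀ x, ‖fderiv ℝ ρ x (b i)‖ ≤ C) :
    MemH1 Ω b (fun x => ρ x • u x) := by
  refine ⟨memLp_real_smul hρ.continuous hC hu.1, fun i => ?_⟩
  obtain ⟨g, hg, hg2⟩ := hu.2 i
  obtain ⟨C', hC'⟩ := hd i
  exact ⟨_, hg.smul_smooth hΩ hρ, (memLp_real_smul hρ.continuous hC hg2).add
    (memLp_real_smul ((hρ.continuous_fderiv (by simp)).clm_apply continuous_const) hC' hu.1)⟩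

theorem weakDeriv_congr (hΩ : IsOpen Ω) (i : ι) (hu : MemH1 Ω b u)
    (h : u =ᵐ[volume.restrict Ω] v) :
    weakDeriv Ω (b i) u =ᵐ[volume.restrict Ω] weakDeriv Ω (b i) v :=
  (memLp_weakDeriv hΩ hu i).1.ae_unique hΩ
    ((memLp_weakDeriv hΩ (hu.congr h) i).1.congr h.symm (ae_eq_refl _))

theorem weakDeriv_add (hΩ : IsOpen Ω) (i : ι) (hu : MemH1 Ω b u) (hv : MemH1 Ω b v) :
    weakDeriv Ω (b i) (u + v) =ᵐ[volume.restrict Ω] weakDeriv Ω (b i) u + weakDeriv Ω (b i) v :=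
  ((memLp_weakDeriv hΩ hu i).1.add (memLp_weakDeriv hΩ hv i).1).weakDeriv_ae hΩ

theorem weakDeriv_const_smul (hΩ : IsOpen Ω) (i : ι) (hu : MemH1 Ω b u) (c : ℂ) :
    weakDeriv Ω (b i) (c • u) =ᵐ[volume.restrict Ω] c • weakDeriv Ω (b i) u :=
  ((memLp_weakDeriv hΩ hu i).1.const_smul c).weakDeriv_ae hΩ

theorem memLp_weakGrad (hΩ : IsOpen Ω) (hu : MemH1 Ω b u) :
    MemLp (weakGrad Ω b u) 2 (volume.restrict Ω) := by
  rw [memLp_two_iff_l2sq, l2sq_weakGrad]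
  have h := fun i => (memLp_weakDeriv hΩ hu i).2
  refine ⟨(PiLp.continuous_toLp 2 _).comp_aestronglyMeasurable
    (aemeasurable_pi_lambda _ fun i => (h i).1.aemeasurable).aestronglyMeasurable, ?_⟩
  rw [lintegral_finsetSum' _ fun i _ => ((h i).1.enorm.pow_const 2)]
  exact ENNReal.sum_lt_top.2 fun i _ => l2sq_lt_top (h i)

theorem weakGrad_ae_eq {w : E → EuclideanSpace ℂ ι} {s : Set E}
    (h : ∀ i, ∀ᵐ x ∂(volume.restrict s), weakDeriv Ω (b i) u x = w x i) :
    weakGrad Ω b u =ᵐ[volume.restrict s] w := by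
  filter_upwards [ae_all_iff.2 h] with x hx
  ext i
  simp [weakGrad, hx]

end MemH1

/-- Restrict both pairs to the open set Ω ∩ O and use uniqueness there. -/
theorem IsWeakDeriv.ae_eq_of_ae_eq {Ω O : Set E} (hΩ : IsOpen Ω) (hO : IsOpen O) {v : E}
    {u u' g g' : E → ℂ} (h : IsWeakDeriv Ω v u g) (h' : IsWeakDeriv Ω v u' g')
    (huu : ∀ᵐ x ∂(volume.restrict Ω), x ∈ O → u x = u' x) :
    ∀ᵐ x ∂(volume.restrict Ω), x ∈ O → g x = g' x := by
  have hm := (hΩ.inter hO).measurableSet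
  have h1 := (h.mono (inter_subset_left (t := O))).ae_unique (hΩ.inter hO) (g' := g')
    ((h'.mono inter_subset_left).congr (by
      rw [Filter.EventuallyEq, ae_restrict_iff' hm]
      rw [ae_restrict_iff' hΩ.measurableSet] at huu
      filter_upwards [huu] with x hx hxs using (hx hxs.1 hxs.2).symm) (ae_eq_refl _))
  rw [Filter.EventuallyEq, ae_restrict_iff' hm] at h1
  rw [ae_restrict_iff' hΩ.measurableSet]
  filter_upwards [h1] with x hx h1 h2 using hx ⟨h1, h2⟩

section IsTrace

variable {Ω : Set E} {e : E} {j : F → E} {S : Set F} {u u' g g' : E → ℂ} {w w' : F → ℂ}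

theorem isTrace_trace (h : IsTrace Ω e j S u w) : IsTrace Ω e j S u (trace Ω e j S u) := by
  have hex : ∃ w, IsTrace Ω e j S u w := ⟨w, h⟩
  rw [trace, dif_pos hex]
  exact hex.choose_spec

theorem IsTrace.const_smul (hΩ : IsOpen Ω) (h : IsTrace Ω e j S u w) (hu : IsWeakDeriv Ω e u g)
    (c : ℂ) : IsTrace Ω e j S (c • u) (c • w) := by
  refine ⟨h.1.smul c, fun φ hφ hd => ?_⟩
  have h1 := h.2 φ hφ hd
  have e1 : ∫ x in Ω, (φ x • weakDeriv Ω e (c • u) x + fderiv ℝ φ x e • (c • u) x) =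
      ∫ x in Ω, c • (φ x • weakDeriv Ω e u x + fderiv ℝ φ x e • u x) := by
    refine integral_congr_ae ?_
    filter_upwards [((isWeakDeriv_weakDeriv hu).const_smul c).weakDeriv_ae hΩ] with x hx
    rw [hx]
    simp only [Pi.smul_apply, smul_add, smul_comm c]
  rw [e1, integral_smul, h1, ← integral_smul]
  simp only [Pi.smul_apply, smul_comm c]

end IsTrace

namespace FlatBoundary

variable {κ : (F × ℝ) ≃L[ℝ] E} {Ω : Set E} {S : Set F} {ι : Type*} [Fintype ι] {b : ι → E}

/-- Locality and uniqueness in one statement: the boundary integral of w - w' against a test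
function supported in O only sees u - u' in O. With O the whole space this says that the choice in
`trace` does not matter. -/
theorem isTrace_ae_eq (D : FlatBoundary κ Ω S) {u u' g g' : E → ℂ} {w w' : F → ℂ}
    (h : IsTrace Ω (κ (0, 1)) (fun y => κ (y, 0)) S u w)
    (h' : IsTrace Ω (κ (0, 1)) (fun y => κ (y, 0)) S u' w')
    (hu : IsWeakDeriv Ω (κ (0, 1)) u g) (hu' : IsWeakDeriv Ω (κ (0, 1)) u' g')
    {O : Set E} (hO : IsOpen O) (huu : ∀ᵐ x ∂(volume.restrict Ω), x ∈ O → u x = u' x) :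
    ∀ᵐ y, y ∈ S → κ (y, 0) ∈ O → w y = w' y := by
  have hgg := (isWeakDeriv_weakDeriv hu).ae_eq_of_ae_eq D.isOpen_domain hO
    (isWeakDeriv_weakDeriv hu') huu
  have := D.ae_eq_zero_of_forall_admissible (h.1.sub h'.1) hO fun φ hφ hφO => by
    have i1 := D.integrableOn_admissible_smul h.1 hφ
    have i2 := D.integrableOn_admissible_smul h'.1 hφ
    simp only [Pi.sub_apply, smul_sub]
    rw [integral_sub i1 i2, sub_eq_zero, ← h.2 φ hφ.1 hφ.2, ← h'.2 φ hφ.1 hφ.2]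
    refine integral_congr_ae ?_
    filter_upwards [hgg, huu] with x h1 h2
    by_cases hx : x ∈ O
    · rw [h1 hx, h2 hx]
    · have e1 : φ x = 0 := image_eq_zero_of_notMem_tsupport fun h => hx (hφO h)
      have e2 : fderiv ℝ φ x (κ (0, 1)) = 0 :=
        image_eq_zero_of_notMem_tsupport (f := fun x => fderiv ℝ φ x (κ (0, 1)))
          fun h => hx (hφO (tsupport_fderiv_apply φ _ h))
      rw [e1, e2]
      simp
  filter_upwards [this] with y hy h1 h2
  exact sub_eq_zero.1 (hy h1 h2)

/-- The trace on the flat part of the boundary. -/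
noncomputable abbrev tr (_ : FlatBoundary κ Ω S) (u : E → ℂ) : F → ℂ :=
  trace Ω (κ (0, 1)) (fun y => κ (y, 0)) S u

theorem isTrace_tr (D : FlatBoundary κ Ω S) (hκ : MeasurePreserving κ)
    (hb : ∀ v : E, ∃ c : ι → ℝ, v = ∑ i, c i • b i) {u : E → ℂ} (hu : MemH1 Ω b u) :
    IsTrace Ω (κ (0, 1)) (fun y => κ (y, 0)) S u (D.tr u) := by
  obtain ⟨k, hk⟩ := exists_isDepthCutoff D.depth_pos
  choose C hC using fun v => MemH1.exists_weakDeriv_le D.isOpen_domain hb v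
  choose G hG hG2 _ using fun v => hC v u hu
  exact isTrace_trace (D.isTrace_traceFun hκ hk hu.1 (hG _) (hG2 _) (fun i => hG (D.outward i))
    fun i => hG2 _)

theorem tr_ae_eq (D : FlatBoundary κ Ω S) (hκ : MeasurePreserving κ)
    (hb : ∀ v : E, ∃ c : ι → ℝ, v = ∑ i, c i • b i) {u : E → ℂ} (hu : MemH1 Ω b u)
    {w : F → ℂ} (hw : IsTrace Ω (κ (0, 1)) (fun y => κ (y, 0)) S u w) :
    D.tr u =ᵐ[volume.restrict S] w := by
  obtain ⟨C, hC⟩ := MemH1.exists_weakDeriv_le D.isOpen_domain hb (κ (0, 1))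
  obtain ⟨g, hg, -⟩ := hC u hu
  have := D.isTrace_ae_eq (D.isTrace_tr hκ hb hu) hw hg hg isOpen_univ (by simp)
  rw [Filter.EventuallyEq, ae_restrict_iff' D.isOpen_base.measurableSet]
  filter_upwards [this] with y hy hyS using hy hyS (mem_univ _)

theorem tr_ae_eq_of_ae_eq (D : FlatBoundary κ Ω S) (hκ : MeasurePreserving κ)
    (hb : ∀ v : E, ∃ c : ι → ℝ, v = ∑ i, c i • b i) {u u' : E → ℂ} (hu : MemH1 Ω b u)
    (hu' : MemH1 Ω b u') {O : Set E} (hO : IsOpen O)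
    (huu : ∀ᵐ x ∂(volume.restrict Ω), x ∈ O → u x = u' x) :
    ∀ᵐ y, y ∈ S → κ (y, 0) ∈ O → D.tr u y = D.tr u' y := by
  obtain ⟨C, hC⟩ := MemH1.exists_weakDeriv_le D.isOpen_domain hb (κ (0, 1))
  obtain ⟨g, hg, -⟩ := hC u hu
  obtain ⟨g', hg', -⟩ := hC u' hu'
  exact D.isTrace_ae_eq (D.isTrace_tr hκ hb hu) (D.isTrace_tr hκ hb hu') hg hg' hO huu

theorem tr_congr (D : FlatBoundary κ Ω S) (hκ : MeasurePreserving κ)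
    (hb : ∀ v : E, ∃ c : ι → ℝ, v = ∑ i, c i • b i) {u u' : E → ℂ} (hu : MemH1 Ω b u)
    (huu : u =ᵐ[volume.restrict Ω] u') : D.tr u =ᵐ[volume.restrict S] D.tr u' := by
  have := D.tr_ae_eq_of_ae_eq hκ hb hu (hu.congr huu) isOpen_univ (huu.mono fun x hx _ => hx)
  rw [Filter.EventuallyEq, ae_restrict_iff' D.isOpen_base.measurableSet]
  filter_upwards [this] with y hy hyS using hy hyS (mem_univ _)

theorem tr_const_smul (D : FlatBoundary κ Ω S) (hκ : MeasurePreserving κ)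
    (hb : ∀ v : E, ∃ c : ι → ℝ, v = ∑ i, c i • b i) {u : E → ℂ} (hu : MemH1 Ω b u) (c : ℂ) :
    D.tr (c • u) =ᵐ[volume.restrict S] c • D.tr u := by
  obtain ⟨C, hC⟩ := MemH1.exists_weakDeriv_le D.isOpen_domain hb (κ (0, 1))
  obtain ⟨g, hg, -⟩ := hC u hu
  exact D.tr_ae_eq hκ hb (hu.const_smul c)
    ((D.isTrace_tr hκ hb hu).const_smul D.isOpen_domain hg c)

theorem tr_add (D : FlatBoundary κ Ω S) (hκ : MeasurePreserving κ)
    (hb : ∀ v : E, ∃ c : ι → ℝ, v = ∑ i, c i • b i) {u u' : E → ℂ} (hu : MemH1 Ω b u)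
    (hu' : MemH1 Ω b u') : D.tr (u + u') =ᵐ[volume.restrict S] D.tr u + D.tr u' := by
  have h := D.isTrace_tr hκ hb hu
  have h' := D.isTrace_tr hκ hb hu'
  obtain ⟨C, hC⟩ := MemH1.exists_weakDeriv_le D.isOpen_domain hb (κ (0, 1))
  obtain ⟨g, hg, hg2, -⟩ := hC u hu
  obtain ⟨g', hg', hg2', -⟩ := hC u' hu'
  refine D.tr_ae_eq hκ hb (hu.add hu') ⟨h.1.add h'.1, fun φ hφ hd => ?_⟩
  have hmem : ∀ {u g : E → ℂ}, IsWeakDeriv Ω (κ (0, 1)) u g → MemLp g 2 (volume.restrict Ω) →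
      MemLp u 2 (volume.restrict Ω) → Integrable (fun x => φ x • weakDeriv Ω (κ (0, 1)) u x +
      fderiv ℝ φ x (κ (0, 1)) • u x) (volume.restrict Ω) := fun h1 h2 h3 =>
    (integrableOn_test_smul ((memLp_congr_ae (h1.weakDeriv_ae D.isOpen_domain)).2 h2) hφ).add
      (integrableOn_test_smul h3 (hφ.fderiv_apply _))
  have i1 := D.integrableOn_admissible_smul h.1 ⟨hφ, hd⟩
  have i2 := D.integrableOn_admissible_smul h'.1 ⟨hφ, hd⟩
  simp only [Pi.add_apply, smul_add]
  rw [integral_add i1 i2, ← h.2 φ hφ hd, ← h'.2 φ hφ hd,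
    ← integral_add (hmem hg hg2 hu.1) (hmem hg' hg2' hu'.1)]
  refine integral_congr_ae ?_
  filter_upwards [((isWeakDeriv_weakDeriv hg).add (isWeakDeriv_weakDeriv hg')).weakDeriv_ae
    D.isOpen_domain] with x hx
  rw [hx]
  simp only [Pi.add_apply, smul_add]
  ring

/-- Use ρφ as a test function for the trace of u. As in Leibniz' rule, ρ may be unbounded, and ρ u
need not be in H¹. -/
theorem tr_smul_smooth (D : FlatBoundary κ Ω S) (hκ : MeasurePreserving κ)
    (hb : ∀ v : E, ∃ c : ι → ℝ, v = ∑ i, c i • b i) {u : E → ℂ} (hu : MemH1 Ω b u) {ρ : E → ℝ}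
    (hρ : ContDiff ℝ ∞ ρ) :
    D.tr (fun x => ρ x • u x) =ᵐ[volume.restrict S] fun y => ρ (κ (y, 0)) • D.tr u y := by
  have h := D.isTrace_tr hκ hb hu
  obtain ⟨C, hC⟩ := MemH1.exists_weakDeriv_le D.isOpen_domain hb (κ (0, 1))
  obtain ⟨g, hg, -⟩ := hC u hu
  have hT : IsTrace Ω (κ (0, 1)) (fun y => κ (y, 0)) S (fun x => ρ x • u x)
      (fun y => ρ (κ (y, 0)) • D.tr u y) := by
    refine ⟨locallyIntegrableOn_real_smul D.isOpen_base h.1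
      (hρ.continuous.comp (by fun_prop)), fun φ hφ hd => ?_⟩
    have h1 := h.2 _ (hφ.mul_left hρ) (hd.mono_left tsupport_mul_subset_right)
    simp only [smul_smul, mul_comm (φ _)]
    rw [← h1]
    refine integral_congr_ae ?_
    filter_upwards [((isWeakDeriv_weakDeriv hg).smul_smooth D.isOpen_domain hρ).weakDeriv_ae
      D.isOpen_domain] with x hx
    rw [hx, fderiv_fun_mul (hρ.differentiable (by simp) x) (hφ.differentiable x)]
    simp only [smul_add, smul_smul, add_apply, smul_apply, smul_eq_mul, add_smul]
    rw [mul_comm (φ x) (ρ x), mul_comm (fderiv ℝ φ x _) (ρ x)]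
    ring
  have hw := hg.smul_smooth D.isOpen_domain hρ
  have := D.isTrace_ae_eq (isTrace_trace hT) hT hw hw isOpen_univ (Eventually.of_forall fun _ _ => rfl)
  rw [Filter.EventuallyEq, ae_restrict_iff' D.isOpen_base.measurableSet]
  filter_upwards [this] with y hy hyS using hy hyS (mem_univ _)

/-- Traces in terms of averages over thin layers. -/
theorem exists_l2sq_tr_le (D : FlatBoundary κ Ω S) (hκ : MeasurePreserving κ)
    (hb : ∀ v : E, ∃ c : ι → ℝ, v = ∑ i, c i • b i) :
    ∃ C : ℝ≥0, ∀ k, IsDepthCutoff D.depth k → ∀ u, MemH1 Ω b u →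
      l2sq (volume.restrict S) (D.tr u) ≤
        C * (∫⁻ s in Ioo 0 D.depth, ‖k s‖ₑ ^ 2) * l2sq (volume.restrict Ω) (weakGrad Ω b u) +
        C * ∑ i, l2sq volume (D.layerMean i (deriv k) u) := by
  choose C hC using fun v => MemH1.exists_weakDeriv_le D.isOpen_domain hb v
  -- The factor `D.N` comes from squaring the sum over the charts, the factor 2 from splitting a
  -- chart trace into its two means. The constant is independent of k: a thin layer makes the
  -- coefficient of the gradient small, which is what compactness of the trace needs.
  refine ⟨D.N * 2 * ∑ i, C (D.outward i) + D.N * 2, fun k hk u hu => ?_⟩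
  choose G hG hG2 hGC using fun v => hC v u hu
  have h1 := D.tr_ae_eq hκ hb hu (D.isTrace_traceFun hκ hk hu.1 (hG _) (hG2 _)
    (fun i => hG (D.outward i)) fun i => hG2 _)
  have hm : ∀ i, MemLp (fun y => D.part i y • D.chartTrace i k u (G (D.outward i)) y) 2 volume :=
    fun i => D.memLp_part_smul i (D.memLp_chartTrace hκ hk hu.1 (hG2 _) i)
  have h2 : l2sq volume (D.traceFun k u fun i => G (D.outward i)) ≤ D.N * ∑ i,
      l2sq volume (fun y => D.part i y • D.chartTrace i k u (G (D.outward i)) y) := by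
    have := l2sq_finsetSum_le Finset.univ fun i _ => (hm i).1
    rwa [Finset.card_fin] at this
  have h3 : ∀ i, l2sq volume (fun y => D.part i y • D.chartTrace i k u (G (D.outward i)) y) ≤
      2 * (C (D.outward i) * (∫⁻ s in Ioo 0 D.depth, ‖k s‖ₑ ^ 2) *
        l2sq (volume.restrict Ω) (weakGrad Ω b u)) +
      2 * l2sq volume (D.layerMean i (deriv k) u) := by
    intro i
    obtain ⟨m1, m2⟩ := D.layerMean_memLp hκ i hk.1.continuous (hG2 (D.outward i))
    calc _ ≤ l2sq volume (D.chartTrace i k u (G (D.outward i))) := by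
          refine l2sq_mono (Eventually.of_forall fun y => ?_)
          rw [norm_smul]
          exact mul_le_of_le_one_left (norm_nonneg _) (D.abs_part_le i y)
      _ ≤ _ := l2sq_sub_le m1.1
      _ ≤ _ := by
          gcongr
          refine m2.trans ?_
          rw [mul_comm (C _ : ℝ≥0∞), mul_assoc]
          gcongr
          exact hGC _ _
  rw [l2sq_congr h1]
  refine (lintegral_mono' Measure.restrict_le_self le_rfl).trans (h2.trans ?_)
  refine (mul_le_mul_right (Finset.sum_le_sum fun i _ => h3 i) _).trans ?_
  rw [Finset.sum_add_distrib, ← Finset.mul_sum, ← Finset.mul_sum, mul_add]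
  simp only [mul_assoc, ← Finset.sum_mul]
  push_cast
  refine add_le_add ?_ ?_
  · rw [add_mul]
    refine le_trans (le_of_eq ?_) le_self_add
    ring
  · rw [add_mul, ← mul_assoc]
    exact le_add_self

theorem memLp_tr (D : FlatBoundary κ Ω S) (hκ : MeasurePreserving κ)
    (hb : ∀ v : E, ∃ c : ι → ℝ, v = ∑ i, c i • b i) {u : E → ℂ} (hu : MemH1 Ω b u) :
    MemLp (D.tr u) 2 (volume.restrict S) := by
  obtain ⟨k, hk⟩ := exists_isDepthCutoff D.depth_pos
  choose C hC using fun v => MemH1.exists_weakDeriv_le D.isOpen_domain hb v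
  choose G hG hG2 _ using fun v => hC v u hu
  exact (memLp_congr_ae (D.tr_ae_eq hκ hb hu (D.isTrace_traceFun hκ hk hu.1 (hG _) (hG2 _)
    (fun i => hG (D.outward i)) fun i => hG2 _))).2
    ((D.memLp_traceFun hκ hk hu.1 fun i => hG2 _).restrict S)

end FlatBoundary

end TraceSobolev

/-! ### Charts of the water surface; Poincaré and Friedrichs inequalities -/

section Geometry

instance isAddHaarMeasure_plane : (volume : Measure (ℝ × ℝ)).IsAddHaarMeasure :=
  Measure.prod.instIsAddHaarMeasure (volume : Measure ℝ) (volume : Measure ℝ)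

instance isAddHaarMeasure_space : (volume : Measure (ℝ × ℝ × ℝ)).IsAddHaarMeasure :=
  Measure.prod.instIsAddHaarMeasure (volume : Measure ℝ) (volume : Measure (ℝ × ℝ))

/-- The coordinates `((x₁, x₂), x₃)` of the space. -/
noncomputable def spaceCoord : ((ℝ × ℝ) × ℝ) ≃L[ℝ] ℝ × ℝ × ℝ := ContinuousLinearEquiv.prodAssoc ℝ ℝ ℝ ℝ

@[simp] theorem spaceCoord_apply (p : (ℝ × ℝ) × ℝ) : spaceCoord p = (p.1.1, p.1.2, p.2) := rfl

@[simp] theorem spaceCoord_symm_apply (x : ℝ × ℝ × ℝ) : spaceCoord.symm x = ((x.1, x.2.1), x.2.2) := rfl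

theorem measurePreserving_spaceCoord : MeasurePreserving spaceCoord :=
  measurePreserving_prodAssoc (volume : Measure ℝ) (volume : Measure ℝ) (volume : Measure ℝ)

theorem exists_sum_e2 (v : ℝ × ℝ) : ∃ c : Fin 2 → ℝ, v = ∑ i, c i • e2 i :=
  ⟨![v.1, v.2], by simp [e2, Fin.sum_univ_two]⟩

theorem exists_sum_e3 (v : ℝ × ℝ × ℝ) : ∃ c : Fin 3 → ℝ, v = ∑ i, c i • e3 i :=
  ⟨![v.1, v.2.1, v.2.2], by simp [e3, Fin.sum_univ_three]⟩

variable {Γ : Set (ℝ × ℝ)} {l : ℝ} {Θ : Set (ℝ × ℝ × ℝ)}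

/-- The flat part of the boundary of the cross-section. -/
abbrev SectionBoundary (Γ : Set (ℝ × ℝ)) (l : ℝ) :=
  FlatBoundary (ContinuousLinearEquiv.refl ℝ (ℝ × ℝ)) Γ (Ioo (-l) l)

/-- The flat part of the boundary of the water domain. -/
abbrev WaterBoundary (Γ : Set (ℝ × ℝ)) (l : ℝ) (Θ : Set (ℝ × ℝ × ℝ)) :=
  FlatBoundary spaceCoord (water Γ Θ) (surface l)

theorem isOpen_water (hG : IsCanalWithBody Γ l Θ) : IsOpen (water Γ Θ) :=
  (hG.isOpen_section.preimage continuous_snd).sdiff isClosed_closure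

theorem isOpen_surface (l : ℝ) : IsOpen (surface l) := isOpen_univ.prod isOpen_Ioo

/-- The inward direction at a surface point must point downwards, since Γ lies below the surface.
Dividing by its vertical component makes the depth the parameter. The endpoints ±l are included;
there a vertical segment need not stay in Γ, hence the slope τ. -/
theorem exists_oblique (hG : IsCanalWithBody Γ l Θ) {p : ℝ} (hp : p ∈ Icc (-l) l) :
    ∃ τ : ℝ, ∃ h > (0 : ℝ), ∃ δ > 0, ∀ y ∈ Icc (-l) l, y ∈ Ioo (p - δ) (p + δ) →
      ∀ s ∈ Ioo 0 h, (y - s * τ, -s) ∈ Γ := by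
  have hmem : ∀ y ∈ Icc (-l) l, (y, (0 : ℝ)) ∈ closure Γ := fun y hy => by
    have : (y, (0 : ℝ)) ∈ Icc (-l) l ×ˢ {(0 : ℝ)} := ⟨hy, rfl⟩
    rw [← hG.section_surface] at this
    exact this.1
  have hfr : (p, (0 : ℝ)) ∈ frontier Γ := by
    rw [hG.isOpen_section.frontier_eq]
    exact ⟨hmem p hp, fun h => by simpa using hG.section_below _ h⟩
  obtain ⟨e, t, ht, δ, hδ, he⟩ := hG.lipschitz_section.exists_inward hfr
  have he2 : 0 < e.2 := by
    have h1 := hG.section_below _ (he _ (Metric.mem_ball_self hδ) (hmem p hp) t ht le_rfl)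
    simp only [Prod.snd_sub, Prod.smul_snd, smul_eq_mul, zero_sub] at h1
    exact pos_of_mul_pos_right (by linarith) ht.le
  refine ⟨e.1 / e.2, t * e.2, by positivity, δ, hδ, fun y hy hyp s hs => ?_⟩
  have h1 := he (y, 0) (by
    rw [Metric.mem_ball, Prod.dist_eq, max_lt_iff, Real.dist_eq]
    exact ⟨abs_lt.2 ⟨by linarith [hyp.1], by linarith [hyp.2]⟩, by simpa using hδ⟩) (hmem y hy)
    (s / e.2) (div_pos hs.1 he2) ((div_le_iff₀ he2).2 hs.2.le)
  convert h1 using 1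
  ext
  · simp; ring
  · simp; field_simp

/-- Cover the compact interval [-l, l], including its endpoints, by finitely many patches with fixed
slopes, take the smallest depth and a subordinate partition of unity. A bound on the depth is built
in so that the charts can avoid the body, and interval domains are recorded for the later argument
with tangential translations. -/
theorem exists_sectionBoundary (hG : IsCanalWithBody Γ l Θ) {h₀ : ℝ} (hh₀ : 0 < h₀) :
    ∃ D : SectionBoundary Γ l, D.depth ≤ h₀ ∧ ∀ i, ∃ a b, D.dom i = Ioo a b := by
  choose! τ h hh δ hδ H using fun p (hp : p ∈ Icc (-l) l) => exists_oblique hG hp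
  obtain ⟨t, ht, hcov⟩ := isCompact_Icc.elim_nhds_subcover (s := Icc (-l) l)
    (fun p => Ioo (p - δ p) (p + δ p)) (fun p hp => Ioo_mem_nhds (by linarith [hδ p hp])
      (by linarith [hδ p hp]))
  let c : Fin t.card → ℝ := fun i => t.equivFin.symm i
  have hc : ∀ i, c i ∈ Icc (-l) l := fun i => ht _ (t.equivFin.symm i).2
  obtain ⟨d, ⟨hd, hdh⟩, hd0⟩ := ((((eventually_all (l := 𝓝[>] (0 : ℝ))).2 fun i : Fin t.card =>
    eventually_nhdsWithin_of_eventually_nhds (eventually_le_nhds (hh _ (hc i)))).and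
    (eventually_nhdsWithin_of_eventually_nhds (eventually_le_nhds hh₀))).and
    self_mem_nhdsWithin).exists
  obtain ⟨f, hf⟩ := SmoothPartitionOfUnity.exists_isSubordinate (modelWithCornersSelf ℝ ℝ)
    (isClosed_Icc (a := -l) (b := l))
    (fun i : Fin t.card => Ioo (c i - δ (c i)) (c i + δ (c i))) (fun i => isOpen_Ioo) (by
      intro y hy
      obtain ⟨p, hp, hyp⟩ := mem_iUnion₂.1 (hcov hy)
      refine mem_iUnion.2 ⟨t.equivFin ⟨p, hp⟩, ?_⟩
      simpa [c] using hyp)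
  refine ⟨{ isOpen_domain := hG.isOpen_section
            isOpen_base := isOpen_Ioo
            below := hG.section_below
            N := t.card
            dir := fun i => τ (c i)
            dom := fun i => Ioo (c i - δ (c i)) (c i + δ (c i))
            isOpen_dom := fun i => isOpen_Ioo
            depth := d
            depth_pos := hd0
            chart_mem := fun i y hy s hs =>
              H _ (hc i) y (Ioo_subset_Icc_self hy.1) hy.2 s ⟨hs.1, hs.2.trans_le (hd i)⟩
            part := fun i => f i
            contDiff_part := fun i => (f i).contMDiff.contDiff
            tsupport_part := hf
            abs_part_le := fun i y => by
              rw [abs_of_nonneg (f.nonneg i y)]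
              exact f.le_one i y
            sum_part := fun y hy => by
              have := f.sum_eq_one (Ioo_subset_Icc_self hy)
              rwa [finsum_eq_sum_of_fintype] at this }, hdh, fun i => ⟨_, _, rfl⟩⟩

/-- The charts of the surface of the cross-section provide charts of the water surface, if they do
not meet the body. -/
noncomputable def SectionBoundary.toWater (hG : IsCanalWithBody Γ l Θ) (D : SectionBoundary Γ l)
    (hd : ∀ x ∈ closure Θ, x.2.2 ≤ -D.depth) : WaterBoundary Γ l Θ where
  isOpen_domain := isOpen_water hG
  isOpen_base := isOpen_surface l
  below := fun x hx => hG.section_below _ hx.1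
  N := D.N
  dir := fun i => (0, D.dir i)
  dom := fun i => Prod.snd ⁻¹' D.dom i
  isOpen_dom := fun i => (D.isOpen_dom i).preimage continuous_snd
  depth := D.depth
  depth_pos := D.depth_pos
  chart_mem := fun i y hy s hs => by
    refine ⟨D.chart_mem i y.2 ⟨hy.1.2, hy.2⟩ s hs, fun h => ?_⟩
    have := hd _ h
    simp only [spaceCoord_apply] at this
    linarith [hs.2]
  part := fun i y => D.part i y.2
  contDiff_part := fun i => (D.contDiff_part i).comp contDiff_snd
  tsupport_part := fun i => (tsupport_comp_subset_preimage (D.part i) continuous_snd).trans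
    (preimage_mono (D.tsupport_part i))
  abs_part_le := fun i y => D.abs_part_le i y.2
  sum_part := fun y hy => D.sum_part y.2 hy.2

theorem isCompact_closure_body (hG : IsCanalWithBody Γ l Θ) : IsCompact (closure Θ) :=
  hG.isBounded_body.isCompact_closure

theorem exists_body_depth (hG : IsCanalWithBody Γ l Θ) :
    ∃ h > (0 : ℝ), ∀ x ∈ closure Θ, x.2.2 ≤ -h := by
  obtain ⟨h, hh, H⟩ := (isCompact_closure_body hG).exists_forall_le' (f := fun x => -x.2.2) (a := 0)
    (by fun_prop) (fun x hx => by linarith [hG.body_submerged x hx])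
  exact ⟨h, hh, fun x hx => by linarith [H x hx]⟩

theorem exists_body_length (hG : IsCanalWithBody Γ l Θ) :
    ∃ R : ℝ, 0 < R ∧ ∀ x ∈ closure Θ, |x.1| < R := by
  obtain ⟨C, hC⟩ := (isCompact_closure_body hG).exists_bound_of_continuousOn (f := fun x => x.1)
    continuous_fst.continuousOn
  exact ⟨max C 0 + 1, by positivity, fun x hx => (hC x hx).trans_lt (by
    linarith [le_max_left C 0])⟩

/-- The symmetry is assumed for the water domain only; a cross-section beyond the body is a copy of
Γ and inherits it. -/
theorem section_symmetric (hG : IsCanalWithBody Γ l Θ) {x : ℝ × ℝ} (hx : x ∈ Γ) :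
    (-x.1, x.2) ∈ Γ := by
  obtain ⟨R, hR0, hR⟩ := exists_body_length hG
  have : (R, x) ∈ water Γ Θ := ⟨hx, fun h => (lt_irrefl R) (by
    simpa [abs_of_pos hR0] using hR _ h)⟩
  exact ((hG.symmetric _).2 this).1

theorem exists_section_left (hG : IsCanalWithBody Γ l Θ) :
    ∃ B : Set (ℝ × ℝ), IsOpen B ∧ B.Nonempty ∧ B ⊆ Γ ∩ {x | x.1 < 0} := by
  refine ⟨Γ ∩ {x | x.1 < 0}, hG.isOpen_section.inter (isOpen_lt continuous_fst continuous_const),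
    ?_, le_rfl⟩
  obtain ⟨x, hx⟩ := hG.isConnected_section.nonempty
  rcases lt_trichotomy x.1 0 with h | h | h
  · exact ⟨x, hx, h⟩
  -- A point on the axis is moved slightly to the left, which is possible because Γ is open.
  · have hc : Continuous fun t : ℝ => (x.1 - t, x.2) := by fun_prop
    obtain ⟨t, ht1, ht2⟩ := (((hc.continuousAt (x := 0)).eventually_mem
      (hG.isOpen_section.mem_nhds (by simpa using hx))).filter_mono
      (nhdsWithin_le_nhds (s := Ioi 0))).and self_mem_nhdsWithin |>.exists
    exact ⟨_, ht1, by simp only [mem_ofPred_eq, h]; simpa using ht2⟩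
  · exact ⟨_, section_symmetric hG hx, by simpa using h⟩

/-- Poincaré's inequality in the half of the cross-section. -/
theorem exists_section_poincare (hG : IsCanalWithBody Γ l Θ) :
    ∃ C : ℝ≥0, ∀ φ, MemSection0 Γ φ →
      l2sq (volume.restrict Γ) φ ≤ C * l2sq (volume.restrict Γ) (weakGrad Γ e2 φ) := by
  obtain ⟨B, hB, hBn, hBs⟩ := exists_section_left hG
  have hBΓ : B ⊆ Γ := hBs.trans inter_subset_left
  obtain ⟨C, hC⟩ := hG.lipschitz_section.controls hG.isOpen_section
    hG.isConnected_section.isPreconnected exists_sum_e2 hB hBn hBΓ hG.isBounded_section.isCompact_closure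
  refine ⟨C, fun φ hφ => ?_⟩
  have h1 := hC φ hφ.1
  -- The controlling set lies in the left half, where φ vanishes, so only the gradient remains.
  have h2 : l2sq (volume.restrict B) φ = 0 := by
    have : φ =ᵐ[volume.restrict B] 0 := by
      rw [Filter.EventuallyEq, ae_restrict_iff' hB.measurableSet]
      have := hφ.2
      rw [ae_restrict_iff' hG.isOpen_section.measurableSet] at this
      filter_upwards [this] with x hx hxB using hx (hBs hxB).1 (le_of_lt (hBs hxB).2)
    rw [l2sq_congr this]
    simp [l2sq]
  rwa [inter_eq_left.2 subset_closure, h2, zero_add] at h1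

/-- Friedrichs' inequality for functions that vanish in the left half of the canal. -/
theorem exists_water_friedrichs (hG : IsCanalWithBody Γ l Θ) (L : ℝ) :
    ∃ C : ℝ≥0, ∀ u, MemH1 (water Γ Θ) e3 u →
      (∀ᵐ x ∂(volume.restrict (water Γ Θ)), x ∉ rightHalf → u x = 0) →
      l2sq (volume.restrict (water Γ Θ ∩ {x | |x.1| ≤ L})) u ≤
        C * l2sq (volume.restrict (water Γ Θ)) (weakGrad (water Γ Θ) e3 u) := by
  obtain ⟨B, hB, hBn, hBs⟩ := exists_section_left hG
  obtain ⟨R, hR0, hR⟩ := exists_body_length hG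
  -- The controlling set is placed beyond the body, where the whole left half of the cross-section
  -- is filled with water.
  have hBΩ : Ioo R (R + 1) ×ˢ B ⊆ water Γ Θ := fun x hx => ⟨(hBs hx.2).1, fun h => by
    have h1 := hR x h
    have h2 := hx.1.1
    linarith [le_abs_self x.1]⟩
  have hBo : IsOpen (Ioo R (R + 1) ×ˢ B) := isOpen_Ioo.prod hB
  obtain ⟨C, hC⟩ := hG.lipschitz_water.controls (isOpen_water hG)
    hG.isConnected_water.isPreconnected exists_sum_e3 hBo
    ((nonempty_Ioo.2 (by linarith)).prod hBn) hBΩ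
    ((isCompact_Icc (a := -L) (b := L)).prod hG.isBounded_section.isCompact_closure)
  refine ⟨C, fun u hu h0 => ?_⟩
  have h1 := hC u hu
  have h2 : l2sq (volume.restrict (Ioo R (R + 1) ×ˢ B)) u = 0 := by
    have : u =ᵐ[volume.restrict (Ioo R (R + 1) ×ˢ B)] 0 := by
      rw [Filter.EventuallyEq, ae_restrict_iff' hBo.measurableSet]
      rw [ae_restrict_iff' (isOpen_water hG).measurableSet] at h0
      filter_upwards [h0] with x hx hxB
      exact hx (hBΩ hxB) fun h : 0 < x.2.1 => absurd h (not_lt.2 (le_of_lt (hBs hxB.2).2))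
    rw [l2sq_congr this]
    simp [l2sq]
  rw [h2, zero_add] at h1
  refine (l2sq_restrict_mono ?_).trans h1
  exact fun x hx => ⟨hx.1, abs_le.1 hx.2, subset_closure hx.1.1⟩

end Geometry

/-! ### Compact operators and the attained norm -/

section Spectral

/-- The image of the bounded unit ball under p is totally bounded, since its target is
finite-dimensional; a finite net for it lifts to a finite net for the image under t, up to an error
proportional to ε. -/
theorem isCompactOperator_of_approx {K L : Type*} [NormedAddCommGroup K] [NormedSpace ℂ K]
    [NormedAddCommGroup L] [NormedSpace ℂ L] [CompleteSpace L] (t : K →L[ℂ] L)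
    (h : ∀ ε > (0 : ℝ), ∃ (ι : Type) (_ : Fintype ι) (p : K →L[ℂ] ι → ℂ), ∀ f,
      ‖t f‖ ≤ ε * ‖f‖ + ‖p f‖) :
    IsCompactOperator t := by
  refine (isCompactOperator_iff_isCompact_closure_image_closedBall (t : K →ₗ[ℂ] L) one_pos).2 ?_
  refine TotallyBounded.isCompact_of_isClosed (TotallyBounded.closure ?_) isClosed_closure
  rw [Metric.totallyBounded_iff]
  intro ε hε
  -- Two elements of the unit ball differ by at most 2 in norm, so the total error is less than 2 ·
  -- ε / 4 + ε / 4 < ε.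
  obtain ⟨ι, _, p, hp⟩ := h (ε / 4) (by positivity)
  have hb : Bornology.IsBounded (p '' Metric.closedBall 0 1) :=
    p.lipschitz.isBounded_image Metric.isBounded_closedBall
  obtain ⟨s, hs, hsf, hcov⟩ := Metric.finite_approx_of_totallyBounded
    (hb.isCompact_closure.totallyBounded.subset subset_closure) (ε / 4) (by positivity)
  choose! g hg hpg using fun a (ha : a ∈ s) => hs ha
  refine ⟨t '' (g '' s), (hsf.image g).image t, ?_⟩
  rintro _ ⟨f, hf, rfl⟩
  obtain ⟨y, hy, hff⟩ := mem_iUnion₂.1 (hcov ⟨f, hf, rfl⟩)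
  refine mem_iUnion₂.2 ⟨t (g y), mem_image_of_mem t (mem_image_of_mem g hy), ?_⟩
  rw [← hpg y hy] at hff
  set f' := g y with hf'
  have h1 := hp (f - f')
  have h2 : ‖f - f'‖ ≤ 2 := by
    have a := mem_closedBall_zero_iff.1 hf
    have b := mem_closedBall_zero_iff.1 (hg y hy)
    linarith [norm_sub_le f f']
  rw [Metric.mem_ball, dist_eq_norm, ← map_sub] at hff
  rw [Metric.mem_ball, dist_eq_norm]
  change ‖t f - t f'‖ < ε
  rw [← map_sub]
  nlinarith

/-- The operator t* t is compact, positive and of norm ‖t‖², and this norm is its largest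
eigenvalue. The stated identity is the eigenvalue equation in weak form, with t* moved back. -/
theorem exists_eigenvector_of_compact {K L : Type*} [NormedAddCommGroup K]
    [InnerProductSpace ℂ K] [CompleteSpace K] [NormedAddCommGroup L] [InnerProductSpace ℂ L]
    [CompleteSpace L] (t : K →L[ℂ] L) (ht : IsCompactOperator t) (h0 : t ≠ 0) :
    0 < ‖t‖ ∧ ∃ f : K, f ≠ 0 ∧ ∀ ψ, ((‖t‖ ^ 2 : ℝ) : ℂ) * inner ℂ ψ f = inner ℂ (t ψ) (t f) := by
  set T : K →L[ℂ] K := t.adjoint ∘L t with hT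
  have hTn : ‖T‖ = ‖t‖ ^ 2 := by rw [hT, ContinuousLinearMap.norm_adjoint_comp_self, sq]
  have htpos : 0 < ‖t‖ := norm_pos_iff.2 h0
  refine ⟨htpos, ?_⟩
  have hTc : IsCompactOperator T := ht.clm_comp t.adjoint
  haveI : Nontrivial K := by
    by_contra hK
    rw [not_nontrivial_iff_subsingleton] at hK
    exact h0 (ContinuousLinearMap.ext fun x => by rw [Subsingleton.elim x 0]; simp)
  rcases hTc.hasEigenvalue_or_mem_resolventSet (μ := algebraMap ℝ ℂ ‖T‖)
    (by simpa [hTn] using h0) with h | h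
  · obtain ⟨f, hf⟩ := h.exists_hasEigenvector
    refine ⟨f, hf.2, fun ψ => ?_⟩
    have h1 : T f = (algebraMap ℝ ℂ ‖T‖) • f := hf.apply_eq_smul
    rw [← ContinuousLinearMap.adjoint_inner_right, ← hTn]
    change _ = inner ℂ ψ (T f)
    rw [h1, inner_smul_right]
    rfl
  -- If ‖t* t‖ were in the resolvent set, the Rayleigh quotient would stay below ‖t‖² - ε, which
  -- would give ‖t‖² ≤ ‖t‖² - ε.
  · exfalso
    obtain ⟨ε, hε, H⟩ := T.rayleighQuotient_le_of_norm_mem_resolventSet h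
    have h1 : ∀ x, ‖t x‖ ^ 2 ≤ (‖t‖ ^ 2 - ε) * ‖x‖ ^ 2 := by
      intro x
      rcases eq_or_ne x 0 with rfl | hx
      · simp
      have := H x
      rw [ContinuousLinearMap.rayleighQuotient, div_le_iff₀ (by positivity), hTn] at this
      refine le_trans (le_of_eq ?_) this
      rw [ContinuousLinearMap.reApplyInnerSelf_apply, hT, ContinuousLinearMap.comp_apply,
        ContinuousLinearMap.adjoint_inner_left, inner_self_eq_norm_sq]
    have h2 : 0 ≤ ‖t‖ ^ 2 - ε := by
      obtain ⟨x, hx⟩ := exists_ne (0 : K)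
      have := (sq_nonneg _).trans (h1 x)
      exact nonneg_of_mul_nonneg_left this (by positivity)
    have h3 : ‖t‖ ≤ Real.sqrt (‖t‖ ^ 2 - ε) := t.opNorm_le_bound (Real.sqrt_nonneg _) fun x => by
      refine Real.le_sqrt_of_sq_le (h1 x) |>.trans (le_of_eq ?_)
      rw [Real.sqrt_mul h2, Real.sqrt_sq (norm_nonneg _)]
    have h4 := pow_le_pow_left₀ (norm_nonneg t) h3 2
    rw [Real.sq_sqrt h2] at h4
    linarith

end Spectral

/-! ### Approximation by averages over small cells -/

section Cells

/-- A function of one variable is approximated by its averages over small cells. -/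
theorem l2sq_le_of_translate {α β A : ℝ} (hA : 0 ≤ A) {f : ℝ → ℂ}
    (hf : MemLp f 2 (volume.restrict (Ioo α β)))
    (h : ∀ τ, l2sq (volume.restrict (Ioo α β ∩ (fun y => y + τ) ⁻¹' Ioo α β))
      (fun y => f (y + τ) - f y) ≤ ENNReal.ofReal (τ ^ 2 * A)) {n : ℕ} {d : ℝ}
    (hd : 0 < d) (hdn : d * n = β - α) :
    l2sq (volume.restrict (Ioo α β)) f ≤ ENNReal.ofReal (4 * d ^ 2 * A) +
      ENNReal.ofReal (2 / d) * ∑ m : Fin n, ‖∫ y in Ioo (α + m * d) (α + (m + 1) * d), f y‖ₑ ^ 2 := by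
  set J := Ioo α β with hJ
  set I : Fin n → Set ℝ := fun m => Ioo (α + m * d) (α + (m + 1) * d) with hI
  have hdn' : ∀ m : Fin n, ((m : ℕ) + 1 : ℝ) * d ≤ β - α := fun m => by
    rw [← hdn, mul_comm d]
    gcongr
    exact_mod_cast m.2
  have hIJ : ∀ m, I m ⊆ J := fun m => Ioo_subset_Ioo (by
    have : 0 ≤ (m : ℕ) * d := by positivity
    linarith) (by linarith [hdn' m])
  have hvol : ∀ m, volume (I m) = ENNReal.ofReal d := fun m => by
    rw [hI, Real.volume_Ioo]
    congr 1
    ring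
  have hcov : J ⊆ ⋃ m : Fin n, Ico (α + m * d) (α + (m + 1) * d) := by
    intro y hy
    have h0 : 0 ≤ (y - α) / d := div_nonneg (by linarith [hy.1]) hd.le
    have h1 : (y - α) / d < n := by
      rw [div_lt_iff₀ hd, mul_comm, hdn]
      linarith [hy.2]
    refine mem_iUnion.2 ⟨⟨⌊(y - α) / d⌋₊, (Nat.floor_lt h0).2 h1⟩, ?_, ?_⟩
    · have := (le_div_iff₀ hd).1 (Nat.floor_le h0)
      simp only
      linarith
    · have := (div_lt_iff₀ hd).1 (Nat.lt_floor_add_one ((y - α) / d))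
      simp only
      linarith
  have hdisj : Pairwise (Function.onFun Disjoint I) := by
    intro m m' hmm
    refine disjoint_left.2 fun y h1 h2 => hmm (Fin.ext ?_)
    have a1 : (m : ℝ) < (m' : ℕ) + 1 := lt_of_mul_lt_mul_right (by linarith [h1.1, h2.2]) hd.le
    have a2 : (m' : ℝ) < (m : ℕ) + 1 := lt_of_mul_lt_mul_right (by linarith [h2.1, h1.2]) hd.le
    norm_cast at a1 a2
    omega
  -- Pairs of points at distance less than d. Every pair from a common cell is of this kind, so the
  -- oscillation in all cells together is bounded by one double integral over W.
  set W : Set (ℝ × ℝ) := (J ×ˢ J) ∩ {p | |p.1 - p.2| < d} with hW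
  have hWm : MeasurableSet W := ((isOpen_Ioo.prod isOpen_Ioo).inter
    (isOpen_lt (by fun_prop) continuous_const)).measurableSet
  set G : ℝ × ℝ → ℝ≥0∞ := W.indicator fun p => ‖f p.1 - f p.2‖ₑ ^ 2 with hG
  have hGm : AEMeasurable G (volume : Measure (ℝ × ℝ)) := by
    refine (aemeasurable_indicator_iff hWm).2 ?_
    have h1 : AEStronglyMeasurable (fun p : ℝ × ℝ => f p.1 - f p.2)
        ((volume.restrict J).prod (volume.restrict J)) := hf.1.comp_fst.sub hf.1.comp_snd
    have h2 : AEStronglyMeasurable (fun p : ℝ × ℝ => f p.1 - f p.2)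
        ((volume : Measure (ℝ × ℝ)).restrict W) := h1.mono_measure (by
      rw [Measure.prod_restrict]
      exact Measure.restrict_mono inter_subset_left le_rfl)
    exact h2.enorm.pow_const 2
  -- Substitute z = y + τ. For |τ| < d the inner integral is at most d² A, and τ ranges over an
  -- interval of length 2 d.
  have htot : ∫⁻ y, ∫⁻ z, G (y, z) ≤ ENNReal.ofReal (2 * d ^ 3 * A) := by
    have e1 : ∀ y, ∫⁻ z, G (y, z) = ∫⁻ τ, G (y, y + τ) := fun y =>
      (lintegral_add_left_eq_self (fun z => G (y, z)) y).symm
    have hGm' : AEMeasurable (fun p : ℝ × ℝ => G (p.1, p.1 + p.2))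
        ((volume : Measure ℝ).prod volume) :=
      hGm.comp_quasiMeasurePreserving
        (measurePreserving_prod_add (volume : Measure ℝ) (volume : Measure ℝ)).quasiMeasurePreserving
    simp only [e1]
    rw [lintegral_lintegral_swap hGm']
    have e2 : ∀ τ, ∫⁻ y, G (y, y + τ) ≤
        (Ioo (-d) d).indicator (fun _ => ENNReal.ofReal (d ^ 2 * A)) τ := by
      intro τ
      by_cases hτ : τ ∈ Ioo (-d) d
      · rw [indicator_of_mem hτ]
        have hm : MeasurableSet (J ∩ (fun y => y + τ) ⁻¹' J) :=
          measurableSet_Ioo.inter (measurable_add_const τ measurableSet_Ioo)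
        refine le_trans (le_of_eq ?_) ((h τ).trans (ENNReal.ofReal_le_ofReal ?_))
        · rw [l2sq, ← lintegral_indicator hm]
          refine lintegral_congr fun y => ?_
          have : (y, y + τ) ∈ W ↔ y ∈ J ∩ (fun y => y + τ) ⁻¹' J := by
            simp only [hW, mem_inter_iff, mem_prod, mem_preimage, mem_ofPred_eq, and_iff_left_iff_imp]
            intro _
            rw [sub_add_cancel_left, abs_neg]
            exact abs_lt.2 hτ
          by_cases hy : y ∈ J ∩ (fun y => y + τ) ⁻¹' J
          · rw [indicator_of_mem hy, hG, indicator_of_mem (this.2 hy), ← enorm_neg]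
            simp
          · rw [indicator_of_notMem hy, hG, indicator_of_notMem (fun h => hy (this.1 h))]
        · have : τ ^ 2 ≤ d ^ 2 := sq_le_sq' hτ.1.le hτ.2.le
          gcongr
      · rw [indicator_of_notMem hτ]
        refine (lintegral_eq_zero_of_ae_eq_zero (Eventually.of_forall fun y => ?_)).le
        refine indicator_of_notMem (fun hy => hτ ?_) _
        have := hy.2
        simp only [mem_ofPred_eq, sub_add_cancel_left, abs_neg] at this
        exact abs_lt.1 this
    refine (lintegral_mono e2).trans (le_of_eq ?_)
    rw [lintegral_indicator measurableSet_Ioo, setLIntegral_const, Real.volume_Ioo,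
      ← ENNReal.ofReal_mul (by positivity)]
    congr 1
    ring
  have hsum : ∑ m, ∫⁻ y in I m, ∫⁻ z in I m, ‖f y - f z‖ₑ ^ 2 ≤
      ENNReal.ofReal (2 * d ^ 3 * A) := by
    calc ∑ m, ∫⁻ y in I m, ∫⁻ z in I m, ‖f y - f z‖ₑ ^ 2
        ≤ ∑ m, ∫⁻ y in I m, ∫⁻ z, G (y, z) := by
          refine Finset.sum_le_sum fun m _ => setLIntegral_mono' measurableSet_Ioo fun y hy => ?_
          rw [← lintegral_indicator measurableSet_Ioo]
          refine lintegral_mono fun z => ?_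
          by_cases hz : z ∈ I m
          · rw [indicator_of_mem hz, hG, indicator_of_mem]
            exact ⟨⟨hIJ m hy, hIJ m hz⟩, abs_lt.2 (show -d < y - z ∧ y - z < d from
              ⟨by linarith [hy.1, hz.2], by linarith [hy.2, hz.1]⟩)⟩
          · rw [indicator_of_notMem hz]
            exact zero_le
      _ = ∫⁻ y in ⋃ m, I m, ∫⁻ z, G (y, z) := by
          rw [lintegral_iUnion (fun m => measurableSet_Ioo) hdisj, tsum_fintype]
      _ ≤ _ := (setLIntegral_le_lintegral _ _).trans htot
  have hcell : ∀ m, ∫⁻ y in I m, ‖f y‖ₑ ^ 2 ≤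
      ENNReal.ofReal (2 / d) * (∫⁻ y in I m, ∫⁻ z in I m, ‖f y - f z‖ₑ ^ 2) +
        ENNReal.ofReal (2 / d) * ‖∫ y in I m, f y‖ₑ ^ 2 := by
    intro m
    have hfm : MemLp f 2 (volume.restrict (I m)) := hf.mono_measure (Measure.restrict_mono (hIJ m) le_rfl)
    haveI : IsFiniteMeasure (volume.restrict (I m)) := ⟨by simp [hvol]⟩
    have hint : Integrable f (volume.restrict (I m)) := hfm.integrable (by norm_num)
    set a : ℂ := (d⁻¹ : ℝ) • ∫ y in I m, f y with ha
    have hreal : (volume.restrict (I m)).real univ = d := by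
      simp [Measure.real, hvol, hd.le]
    -- Split f y into its deviation from the cell average a and a itself. The deviation is the
    -- average of f y - f z over z in the cell, estimated by Cauchy–Schwarz.
    have h1 : ∀ y, ‖f y‖ₑ ^ 2 ≤ 2 * (ENNReal.ofReal d⁻¹ * ∫⁻ z in I m, ‖f y - f z‖ₑ ^ 2) +
        2 * ‖a‖ₑ ^ 2 := by
      intro y
      have e1 : f y - a = (d⁻¹ : ℝ) • ∫ z in I m, (f y - f z) := by
        rw [integral_sub (integrable_const _) hint, integral_const, hreal, smul_sub, smul_smul,
          inv_mul_cancel₀ hd.ne', one_smul]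
      have e2 : ‖f y - a‖ₑ ^ 2 ≤ ENNReal.ofReal d⁻¹ * ∫⁻ z in I m, ‖f y - f z‖ₑ ^ 2 := by
        rw [e1, enorm_smul, mul_pow]
        have := enorm_integral_sq_le (μ := volume.restrict (I m)) (f := fun z => f y - f z)
          (aestronglyMeasurable_const.sub hfm.1)
        rw [Measure.restrict_apply_univ, hvol] at this
        refine (mul_le_mul_right this _).trans (le_of_eq ?_)
        rw [← mul_assoc, Real.enorm_of_nonneg (by positivity), ← ENNReal.ofReal_pow (by positivity),
          ← ENNReal.ofReal_mul (by positivity)]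
        congr 2
        field_simp
      calc ‖f y‖ₑ ^ 2 = ‖(f y - a) + a‖ₑ ^ 2 := by rw [sub_add_cancel]
        _ ≤ (‖f y - a‖ₑ + ‖a‖ₑ) ^ 2 := by gcongr; exact enorm_add_le _ _
        _ ≤ 2 * ‖f y - a‖ₑ ^ 2 + 2 * ‖a‖ₑ ^ 2 := ennreal_add_sq_le _ _
        _ ≤ _ := by gcongr
    refine (lintegral_mono h1).trans ?_
    rw [lintegral_add_right _ measurable_const, lintegral_const_mul' _ _ (by simp),
      lintegral_const_mul' _ _ (by simp), ← mul_assoc, setLIntegral_const, hvol]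
    refine add_le_add (le_of_eq ?_) (le_of_eq ?_)
    · congr 1
      rw [← ENNReal.ofReal_ofNat, ← ENNReal.ofReal_mul (by norm_num)]
      rfl
    · rw [ha, enorm_smul, mul_pow, Real.enorm_of_nonneg (by positivity),
        ← ENNReal.ofReal_pow (by positivity), ← ENNReal.ofReal_ofNat, ← mul_assoc, mul_right_comm,
        ← ENNReal.ofReal_mul (by norm_num), ← ENNReal.ofReal_mul (by positivity)]
      congr 2
      field_simp
  -- Half-open cells are used to cover the interval, open cells to be consistent with the rest; they
  -- differ by null sets.
  have hJI : l2sq (volume.restrict J) f ≤ ∑ m, ∫⁻ y in I m, ‖f y‖ₑ ^ 2 := by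
    refine (lintegral_mono_set hcov).trans ((lintegral_iUnion_le _ _).trans (le_of_eq ?_))
    rw [tsum_fintype]
    exact Finset.sum_congr rfl fun m _ => setLIntegral_congr Ioo_ae_eq_Ico.symm
  refine hJI.trans ((Finset.sum_le_sum fun m _ => hcell m).trans ?_)
  rw [Finset.sum_add_distrib, ← Finset.mul_sum, ← Finset.mul_sum]
  gcongr
  -- Here (2 / d) · 2 d³ A = 4 d² A.
  refine (mul_le_mul_right hsum _).trans (le_of_eq ?_)
  rw [← ENNReal.ofReal_mul (by positivity)]
  congr 1
  field_simp
  ring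

end Cells

/-! ### Linearity of layer means -/

section LayerMean

variable {E F : Type*} [NormedAddCommGroup E] [NormedSpace ℝ E] [MeasureSpace E] [BorelSpace E]
  [FiniteDimensional ℝ E] [(volume : Measure E).IsAddHaarMeasure]
  [NormedAddCommGroup F] [NormedSpace ℝ F] [MeasureSpace F] [BorelSpace F]
  [FiniteDimensional ℝ F] [(volume : Measure F).IsAddHaarMeasure]

theorem memLp_two_Ioo {a : ℝ → ℝ} (ha : Continuous a) (h : ℝ) :
    MemLp a 2 (volume.restrict (Ioo 0 h)) := by
  obtain ⟨C, hC⟩ := isCompact_Icc.exists_bound_of_continuousOn (s := Icc 0 h) ha.continuousOn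
  exact MemLp.of_bound ha.aestronglyMeasurable C
    ((ae_restrict_iff' measurableSet_Ioo).2 (Eventually.of_forall fun x hx =>
      hC x (Ioo_subset_Icc_self hx)))

namespace FlatBoundary

variable {κ : (F × ℝ) ≃L[ℝ] E} {Ω : Set E} {S : Set F}

theorem ae_integrable_layer (D : FlatBoundary κ Ω S) (hκ : MeasurePreserving κ) (i : Fin D.N)
    {a : ℝ → ℝ} (ha : Continuous a) {w : E → ℂ} (hw : MemLp w 2 (volume.restrict Ω)) :
    ∀ᵐ y ∂(volume.restrict (S ∩ D.dom i)),
      IntegrableOn (fun s => a s • w (D.chart i (y, s))) (Ioo 0 D.depth) := by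
  obtain ⟨h1, -⟩ := D.memLp_comp_chart hκ i hw
  have h2 := (memLp_two_iff_l2sq.1 h1).2
  rw [l2sq, lintegral_prod _ (by have := h1.1.enorm; fun_prop)] at h2
  have h3 := ae_lt_top' (h1.1.enorm.pow_const 2).lintegral_prod_right' h2.ne
  have ha2 := memLp_two_Ioo ha D.depth
  filter_upwards [h1.1.prodMk_left, h3] with y hy1 hy2
  exact integrable_smul_of_memLp_two ha2 (memLp_two_iff_l2sq.2 ⟨hy1, hy2⟩)

theorem layerMean_add (D : FlatBoundary κ Ω S) (hκ : MeasurePreserving κ) (i : Fin D.N)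
    {a : ℝ → ℝ} (ha : Continuous a) {w w' : E → ℂ} (hw : MemLp w 2 (volume.restrict Ω))
    (hw' : MemLp w' 2 (volume.restrict Ω)) :
    D.layerMean i a (w + w') =ᵐ[volume] D.layerMean i a w + D.layerMean i a w' := by
  have h1 := D.ae_integrable_layer hκ i ha hw
  have h2 := D.ae_integrable_layer hκ i ha hw'
  rw [ae_restrict_iff' (D.measurableSet_dom i)] at h1 h2
  filter_upwards [h1, h2] with y h1 h2
  by_cases hy : y ∈ S ∩ D.dom i
  · simp only [layerMean, Pi.add_apply, indicator_of_mem hy, smul_add]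
    exact integral_add (h1 hy) (h2 hy)
  · simp [layerMean, hy]

theorem layerMean_const_smul (D : FlatBoundary κ Ω S) (i : Fin D.N) (a : ℝ → ℝ) (w : E → ℂ)
    (c : ℂ) : D.layerMean i a (c • w) = c • D.layerMean i a w := by
  ext y
  by_cases hy : y ∈ S ∩ D.dom i
  · simp only [layerMean, Pi.smul_apply, indicator_of_mem hy]
    rw [← integral_smul]
    simp only [smul_comm c]
  · simp [layerMean, hy]

/-- By linearity the difference is the mean of a function that vanishes almost everywhere, and the
L² bound for means makes it zero. This avoids tracking null sets through the chart. -/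
theorem layerMean_congr (D : FlatBoundary κ Ω S) (hκ : MeasurePreserving κ) (i : Fin D.N)
    {a : ℝ → ℝ} (ha : Continuous a) {w w' : E → ℂ} (hw : MemLp w 2 (volume.restrict Ω))
    (h : w =ᵐ[volume.restrict Ω] w') : D.layerMean i a w =ᵐ[volume] D.layerMean i a w' := by
  have hw' := (memLp_congr_ae h).1 hw
  have h1 := D.layerMean_add hκ i ha hw (hw'.const_smul (-1 : ℂ))
  obtain ⟨m1, m2⟩ := D.layerMean_memLp hκ i ha (hw.add (hw'.const_smul (-1 : ℂ)))
  have h2 : l2sq (volume.restrict Ω) (w + (-1 : ℂ) • w') = 0 := by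
    have : w + (-1 : ℂ) • w' =ᵐ[volume.restrict Ω] 0 := h.mono fun x hx => by simp [hx]
    rw [l2sq_congr this]
    simp [l2sq]
  rw [h2, mul_zero, nonpos_iff_eq_zero, l2sq, lintegral_eq_zero_iff' (m1.1.enorm.pow_const 2)] at m2
  filter_upwards [h1, m2] with y h1 h2
  rw [D.layerMean_const_smul] at h1
  simp only [Pi.zero_apply, ne_eq, OfNat.ofNat_ne_zero, not_false_eq_true, pow_eq_zero_iff,
    enorm_eq_zero, h1, Pi.add_apply, Pi.smul_apply] at h2
  linear_combination h2

end FlatBoundary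

end LayerMean

/-! ### Tangential regularity of layer means in the cross-section -/

section SectionLayer

variable {Γ : Set (ℝ × ℝ)} {l : ℝ}

theorem l2sq_weakDeriv_le {E ι : Type*} [NormedAddCommGroup E] [NormedSpace ℝ E] [MeasureSpace E]
    [BorelSpace E] [FiniteDimensional ℝ E] [(volume : Measure E).IsAddHaarMeasure]
    [Fintype ι] (μ : Measure E) (Ω : Set E) (b : ι → E) (u : E → ℂ) (i : ι) :
    l2sq μ (weakDeriv Ω (b i) u) ≤ l2sq μ (weakGrad Ω b u) := by
  rw [l2sq_weakGrad]
  exact lintegral_mono fun x => Finset.single_le_sum (f := fun i => ‖weakDeriv Ω (b i) u x‖ₑ ^ 2)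
    (fun _ _ => zero_le) (Finset.mem_univ i)

/-- Tangential translations of averages over a layer. -/
theorem layerMean_translate (D : SectionBoundary Γ l) (i : Fin D.N) {α β : ℝ}
    (hJ : Ioo (-l) l ∩ D.dom i = Ioo α β) {a : ℝ → ℝ} (ha : Continuous a) {u : ℝ × ℝ → ℂ}
    (hu : MemH1 Γ e2 u) (τ : ℝ) :
    l2sq (volume.restrict (Ioo α β ∩ (fun y => y + τ) ⁻¹' Ioo α β))
      (fun y => D.layerMean i a u (y + τ) - D.layerMean i a u y) ≤
      (∫⁻ s in Ioo 0 D.depth, ‖a s‖ₑ ^ 2) *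
        (ENNReal.ofReal (τ ^ 2) * l2sq (volume.restrict Γ) (weakGrad Γ e2 u)) := by
  have hκ : MeasurePreserving (ContinuousLinearEquiv.refl ℝ (ℝ × ℝ)) := MeasurePreserving.id _
  set I := Ioo α β ∩ (fun y => y + τ) ⁻¹' Ioo α β with hI
  have hIo : IsOpen I := isOpen_Ioo.inter (isOpen_Ioo.preimage (by fun_prop))
  set v : ℝ × ℝ := (τ, 0) with hv
  have hch : ∀ y s, D.chart i (y, s) = (y - s * D.dir i, -s) := fun y s => D.chart_apply i (y, s)
  -- The part of the layer that remains in the layer after translation by τ. The horizontal segments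
  -- joining the two positions stay in the layer because the base is an interval, and the layer is
  -- contained in Γ.
  set V : Set (ℝ × ℝ) := D.chart i '' (I ×ˢ Ioo 0 D.depth) with hV
  have hVo : IsOpen V := (D.chart i).toHomeomorph.isOpenMap _ (hIo.prod isOpen_Ioo)
  have hVΓ : ∀ x ∈ V, ∀ s ∈ Icc (0 : ℝ) 1, x + s • v ∈ Γ := by
    rintro _ ⟨⟨y, t⟩, ⟨hy, ht⟩, rfl⟩ s hs
    have h1 : y + s * τ ∈ Ioo α β := by
      have := (convex_Ioo α β).add_smul_mem hy.1 hy.2 hs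
      simpa using this
    have h2 := D.chart_mem i (y + s * τ) (hJ ▸ h1) t ht
    convert h2 using 1
    rw [hch, hv]
    ext
    · simp; ring
    · simp
  set U := Γ.indicator u with hU
  have hm := D.isOpen_domain.measurableSet
  have hUL : MemLp U 2 := (memLp_indicator_iff_restrict hm).2 hu.1
  have hUv : MemLp (fun x => U (x + v)) 2 :=
    hUL.comp_measurePreserving (measurePreserving_add_right volume v)
  -- The translation difference, set to zero outside V. Its layer mean is the difference of the
  -- layer means of u over I, so the L² bounds for means and for translations combine.
  set W : ℝ × ℝ → ℂ := V.indicator fun x => U (x + v) - U x with hW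
  have hWL : MemLp W 2 := (hUv.sub hUL).indicator hVo.measurableSet
  obtain ⟨m1, m2⟩ := D.layerMean_memLp hκ i ha (hWL.restrict Γ)
  have hVsub : V ⊆ Γ := fun x hx => by simpa using hVΓ x hx 0 (by simp)
  have hshift : ∀ x ∈ V, U (x + v) = u (x + v) := fun x hx =>
    indicator_of_mem (by simpa using hVΓ x hx 1 (by simp)) _
  have hWl : l2sq (volume.restrict Γ) W = l2sq (volume.restrict V) (fun x => u (x + v) - u x) := by
    have e1 : (fun x => ‖W x‖ₑ ^ 2) = V.indicator fun x => ‖u (x + v) - u x‖ₑ ^ 2 := by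
      ext x
      by_cases hx : x ∈ V
      · have hx2 : U x = u x := indicator_of_mem (hVsub hx) _
        simp only [hW, indicator_of_mem hx, hshift x hx, hx2]
      · simp [hW, hx]
    rw [l2sq, e1, lintegral_indicator hVo.measurableSet, Measure.restrict_restrict hVo.measurableSet,
      inter_eq_left.2 hVsub]
    rfl
  have hder : IsWeakDeriv Γ v u ((τ : ℂ) • weakDeriv Γ (e2 0) u) := by
    have := (memLp_weakDeriv D.isOpen_domain hu 0).1.smul_dir τ
    have e : τ • e2 0 = v := by simp [e2, hv]
    rwa [e] at this
  have htr := l2sq_translate_sub_le D.isOpen_domain hVo hVΓ hder hu.1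
    ((memLp_weakDeriv D.isOpen_domain hu 0).2.const_smul _)
  have hgr : l2sq (volume.restrict Γ) ((τ : ℂ) • weakDeriv Γ (e2 0) u) ≤
      ENNReal.ofReal (τ ^ 2) * l2sq (volume.restrict Γ) (weakGrad Γ e2 u) := by
    refine (l2sq_const_smul (f := weakDeriv Γ (e2 0) u) (τ : ℂ)).le.trans ?_
    rw [← ofReal_norm, Complex.norm_real, ← ENNReal.ofReal_pow (norm_nonneg _), Real.norm_eq_abs,
      sq_abs]
    gcongr
    exact l2sq_weakDeriv_le _ _ _ _ _
  have key : ∀ᵐ y ∂(volume.restrict I),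
      D.layerMean i a u (y + τ) - D.layerMean i a u y = D.layerMean i a W y := by
    have i1 := D.ae_integrable_layer hκ i ha ((hUv.restrict Γ))
    have i2 := D.ae_integrable_layer hκ i ha ((hUL.restrict Γ))
    rw [hJ, ae_restrict_iff' measurableSet_Ioo] at i1 i2
    rw [ae_restrict_iff' hIo.measurableSet]
    filter_upwards [i1, i2] with y i1 i2 hy
    have hyJ : y ∈ Ioo (-l) l ∩ D.dom i := hJ ▸ hy.1
    have hyJ' : y + τ ∈ Ioo (-l) l ∩ D.dom i := hJ ▸ hy.2
    simp only [FlatBoundary.layerMean, indicator_of_mem hyJ, indicator_of_mem hyJ']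
    have hxV : ∀ s ∈ Ioo 0 D.depth, D.chart i (y, s) ∈ V := fun s hs =>
      mem_image_of_mem _ ⟨hy, hs⟩
    have e1 : ∫ s in Ioo 0 D.depth, a s • u (D.chart i (y + τ, s)) =
        ∫ s in Ioo 0 D.depth, a s • U (D.chart i (y, s) + v) :=
      setIntegral_congr_fun measurableSet_Ioo fun s hs => by
        simp only [hshift _ (hxV s hs)]
        congr 2
        rw [hch, hch, hv]
        ext
        · simp; ring
        · simp
    have e2 : ∫ s in Ioo 0 D.depth, a s • u (D.chart i (y, s)) =
        ∫ s in Ioo 0 D.depth, a s • U (D.chart i (y, s)) :=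
      setIntegral_congr_fun measurableSet_Ioo fun s hs => by
        simp only [hU, indicator_of_mem (hVsub (hxV s hs))]
    have e3 : ∫ s in Ioo 0 D.depth, a s • W (D.chart i (y, s)) =
        ∫ s in Ioo 0 D.depth, (a s • U (D.chart i (y, s) + v) - a s • U (D.chart i (y, s))) :=
      setIntegral_congr_fun measurableSet_Ioo fun s hs => by
        simp only [hW, indicator_of_mem (hxV s hs), smul_sub]
    rw [e1, e2, e3, integral_sub (i1 hy.1) (i2 hy.1)]
  rw [l2sq_congr key]
  refine (lintegral_mono' Measure.restrict_le_self le_rfl).trans (m2.trans ?_)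
  rw [hWl]
  gcongr
  exact htr.trans hgr

/-- Up to an error controlled by the gradient, averages over a layer are determined by finitely many
numbers. -/
theorem exists_layerMean_cells (D : SectionBoundary Γ l) (i : Fin D.N) {α β : ℝ}
    (hJ : Ioo (-l) l ∩ D.dom i = Ioo α β) {a : ℝ → ℝ} (ha : Continuous a) {ε : ℝ} (hε : 0 < ε) :
    ∃ (n : ℕ) (I : Fin n → Set ℝ) (c : ℝ≥0), (∀ m, volume (I m) < ⊤) ∧ ∀ u, MemH1 Γ e2 u →
      l2sq volume (D.layerMean i a u) ≤
        ENNReal.ofReal ε * l2sq (volume.restrict Γ) (weakGrad Γ e2 u) +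
        c * ∑ m, ‖∫ y in I m, D.layerMean i a u y‖ₑ ^ 2 := by
  have hκ : MeasurePreserving (ContinuousLinearEquiv.refl ℝ (ℝ × ℝ)) := MeasurePreserving.id _
  have hrestr : ∀ u, l2sq volume (D.layerMean i a u) =
      l2sq (volume.restrict (Ioo α β)) (D.layerMean i a u) := fun u => by
    rw [l2sq, l2sq, ← lintegral_indicator measurableSet_Ioo]
    refine lintegral_congr fun y => ?_
    by_cases hy : y ∈ Ioo α β
    · rw [indicator_of_mem hy]
    · rw [indicator_of_notMem hy, FlatBoundary.layerMean, hJ, indicator_of_notMem hy]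
      simp
  rcases le_or_gt β α with hαβ | hαβ
  · refine ⟨0, fun _ => ∅, 0, by simp, fun u hu => ?_⟩
    rw [hrestr, Ioo_eq_empty (not_lt.2 hαβ)]
    simp [l2sq]
  set A := l2sq (volume.restrict (Ioo 0 D.depth)) a with hA
  have hAt : A ≠ ⊤ := (l2sq_lt_top (memLp_two_Ioo ha D.depth)).ne
  -- The error coefficient 4 d² A with cell length d = (β - α) / n can be made smaller than ε.
  have hlim : Tendsto (fun n : ℕ => 4 * ((β - α) / n) ^ 2 * A.toReal) atTop (𝓝 0) := by
    have := ((tendsto_const_div_atTop_nhds_zero_nat (β - α)).pow 2).const_mul 4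
    simpa using this.mul_const A.toReal
  obtain ⟨n, hn, hn0⟩ := ((hlim.eventually (gt_mem_nhds hε)).and (eventually_gt_atTop 0)).exists
  have hn' : (0 : ℝ) < n := by exact_mod_cast hn0
  set d := (β - α) / n with hd
  have hd0 : 0 < d := div_pos (by linarith) hn'
  refine ⟨n, fun m => Ioo (α + m * d) (α + (m + 1) * d), (2 / d).toNNReal,
    fun m => by simp [Real.volume_Ioo], fun u hu => ?_⟩
  set B := l2sq (volume.restrict Γ) (weakGrad Γ e2 u) with hB
  have hBt : B ≠ ⊤ := (l2sq_lt_top (memLp_weakGrad D.isOpen_domain hu)).ne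
  have h1 := l2sq_le_of_translate (A := A.toReal * B.toReal) (by positivity)
    ((D.layerMean_memLp hκ i ha hu.1).1.restrict (Ioo α β)) (fun τ => by
      refine (layerMean_translate D i hJ ha hu τ).trans (le_of_eq ?_)
      rw [ENNReal.ofReal_mul (by positivity), ENNReal.ofReal_mul (by positivity),
        ENNReal.ofReal_toReal hAt, ENNReal.ofReal_toReal hBt]
      change A * _ = _
      ring) hd0 (show d * n = β - α by rw [hd]; field_simp)
  rw [hrestr]
  refine h1.trans (add_le_add ?_ le_rfl)
  rw [← mul_assoc, ENNReal.ofReal_mul (by positivity), ENNReal.ofReal_toReal hBt]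
  gcongr

end SectionLayer

/-! ### The Hilbert space of gradients -/

section EnergySpace

theorem l2sq_coe_Lp {α G : Type*} [MeasurableSpace α] {μ : Measure α} [NormedAddCommGroup G]
    (f : Lp G 2 μ) : l2sq μ f = ENNReal.ofReal (‖f‖ ^ 2) := by
  rw [← eLpNorm_two_sq, Lp.norm_def, ← ENNReal.toReal_pow,
    ENNReal.ofReal_toReal (ENNReal.pow_ne_top (Lp.eLpNorm_ne_top f))]

theorem l2sq_toLp {α G : Type*} [MeasurableSpace α] {μ : Measure α} [NormedAddCommGroup G]
    {f : α → G} (hf : MemLp f 2 μ) : ENNReal.ofReal (‖hf.toLp f‖ ^ 2) = l2sq μ f := by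
  rw [← l2sq_coe_Lp]
  exact l2sq_congr hf.coeFn_toLp

theorem norm_le_of_ofReal_sq_le {a b : ℝ} (hb : 0 ≤ b) {C : ℝ≥0}
    (h : ENNReal.ofReal (a ^ 2) ≤ C * ENNReal.ofReal (b ^ 2)) : a ≤ Real.sqrt C * b := by
  have h : ENNReal.ofReal (a ^ 2) ≤ ENNReal.ofReal (C * b ^ 2) := by
    rwa [ENNReal.ofReal_mul C.coe_nonneg, ENNReal.ofReal_coe_nnreal]
  rw [ENNReal.ofReal_le_ofReal_iff (by positivity)] at h
  refine (le_abs_self a).trans (abs_le_of_sq_le_sq ?_ (by positivity))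
  rwa [mul_pow, Real.sq_sqrt C.coe_nonneg]

theorem weakGrad_add {E ι : Type*} [NormedAddCommGroup E] [NormedSpace ℝ E] [MeasureSpace E]
    [BorelSpace E] [FiniteDimensional ℝ E] [(volume : Measure E).IsAddHaarMeasure] [Fintype ι]
    {Ω : Set E} {b : ι → E} {u v : E → ℂ} (hΩ : IsOpen Ω) (hu : MemH1 Ω b u) (hv : MemH1 Ω b v) :
    weakGrad Ω b (u + v) =ᵐ[volume.restrict Ω] weakGrad Ω b u + weakGrad Ω b v :=
  weakGrad_ae_eq fun i => (weakDeriv_add hΩ i hu hv).mono fun x hx => by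
    rw [hx]; rfl

theorem weakGrad_const_smul {E ι : Type*} [NormedAddCommGroup E] [NormedSpace ℝ E] [MeasureSpace E]
    [BorelSpace E] [FiniteDimensional ℝ E] [(volume : Measure E).IsAddHaarMeasure] [Fintype ι]
    {Ω : Set E} {b : ι → E} {u : E → ℂ} (hΩ : IsOpen Ω) (hu : MemH1 Ω b u) (c : ℂ) :
    weakGrad Ω b (c • u) =ᵐ[volume.restrict Ω] c • weakGrad Ω b u :=
  weakGrad_ae_eq fun i => (weakDeriv_const_smul hΩ i hu c).mono fun x hx => by
    rw [hx]; rfl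

variable {Γ : Set (ℝ × ℝ)} {l : ℝ} {Θ : Set (ℝ × ℝ × ℝ)}

theorem MemSection0.add {u v : ℝ × ℝ → ℂ} (hu : MemSection0 Γ u) (hv : MemSection0 Γ v) :
    MemSection0 Γ (u + v) :=
  ⟨hu.1.add hv.1, by
    filter_upwards [hu.2, hv.2] with x h1 h2 hx
    simp [h1 hx, h2 hx]⟩

theorem MemSection0.const_smul {u : ℝ × ℝ → ℂ} (hu : MemSection0 Γ u) (c : ℂ) :
    MemSection0 Γ (c • u) :=
  ⟨hu.1.const_smul c, by
    filter_upwards [hu.2] with x h1 hx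
    simp [h1 hx]⟩

theorem memSection0_zero : MemSection0 Γ 0 :=
  ⟨⟨MemLp.zero, fun i => ⟨0, by
    rw [isWeakDeriv_iff]
    exact ⟨(locallyIntegrable_zero (ε'' := ℂ)).locallyIntegrableOn Γ,
      (locallyIntegrable_zero (ε'' := ℂ)).locallyIntegrableOn Γ, fun φ _ _ => by simp⟩,
    MemLp.zero⟩⟩, by simp⟩

/-- The Hilbert space of gradients of functions in `H¹` of the cross-section that vanish in its left
half. -/
noncomputable def energySpace (hΓ : IsOpen Γ) :
    Submodule ℂ (Lp (EuclideanSpace ℂ (Fin 2)) 2 (volume.restrict Γ)) where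
  carrier := {f | ∃ u, MemSection0 Γ u ∧ f =ᵐ[volume.restrict Γ] weakGrad Γ e2 u}
  zero_mem' := ⟨(0 : ℂ) • 0, memSection0_zero.const_smul 0, by
    filter_upwards [weakGrad_const_smul hΓ memSection0_zero.1 0, Lp.coeFn_zero
      (EuclideanSpace ℂ (Fin 2)) 2 (volume.restrict Γ)] with x h1 h2
    rw [h1, h2]
    simp⟩
  add_mem' := by
    rintro f g ⟨u, hu, hf⟩ ⟨v, hv, hg⟩
    refine ⟨u + v, hu.add hv, ?_⟩
    filter_upwards [Lp.coeFn_add f g, weakGrad_add hΓ hu.1 hv.1, hf, hg] with x h1 h2 h3 h4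
    rw [h1, h2, Pi.add_apply, Pi.add_apply, h3, h4]
  smul_mem' := by
    rintro c f ⟨u, hu, hf⟩
    refine ⟨c • u, hu.const_smul c, ?_⟩
    filter_upwards [Lp.coeFn_smul c f, weakGrad_const_smul hΓ hu.1 c, hf] with x h1 h2 h3
    rw [h1, h2, Pi.smul_apply, Pi.smul_apply, h3]

/-- The potential of a gradient. -/
noncomputable def potential (hΓ : IsOpen Γ) (f : energySpace hΓ) : ℝ × ℝ → ℂ := f.2.choose

theorem potential_mem (hΓ : IsOpen Γ) (f : energySpace hΓ) : MemSection0 Γ (potential hΓ f) :=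
  f.2.choose_spec.1

theorem potential_grad (hΓ : IsOpen Γ) (f : energySpace hΓ) :
    f.1 =ᵐ[volume.restrict Γ] weakGrad Γ e2 (potential hΓ f) := f.2.choose_spec.2

theorem l2sq_weakGrad_potential (hΓ : IsOpen Γ) (f : energySpace hΓ) :
    l2sq (volume.restrict Γ) (weakGrad Γ e2 (potential hΓ f)) = ENNReal.ofReal (‖f‖ ^ 2) := by
  rw [← l2sq_congr (potential_grad hΓ f), l2sq_coe_Lp]
  rfl

theorem ae_eq_zero_of_l2sq_eq_zero {α G : Type*} [MeasurableSpace α] {μ : Measure α}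
    [NormedAddCommGroup G] {f : α → G} (hf : AEStronglyMeasurable f μ) (h : l2sq μ f = 0) :
    f =ᵐ[μ] 0 := by
  rw [l2sq, lintegral_eq_zero_iff' (hf.enorm.pow_const 2)] at h
  filter_upwards [h] with x hx
  simpa using hx

/-- By Poincaré's inequality a function with zero gradient that vanishes in the left half is zero.
Hence the chosen potential depends linearly on the gradient, up to null sets. -/
theorem potential_unique (hG : IsCanalWithBody Γ l Θ) (f : energySpace hG.isOpen_section)
    {u : ℝ × ℝ → ℂ} (hu : MemSection0 Γ u)
    (hf : f.1 =ᵐ[volume.restrict Γ] weakGrad Γ e2 u) :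
    potential hG.isOpen_section f =ᵐ[volume.restrict Γ] u := by
  obtain ⟨C, hC⟩ := exists_section_poincare hG
  have hp := potential_mem hG.isOpen_section f
  have hd := hp.add (hu.const_smul (-1))
  have h1 := hC _ hd
  have h2 : weakGrad Γ e2 (potential hG.isOpen_section f + (-1 : ℂ) • u) =ᵐ[volume.restrict Γ] 0 := by
    filter_upwards [weakGrad_add hG.isOpen_section hp.1 (hu.const_smul (-1)).1,
      weakGrad_const_smul hG.isOpen_section hu.1 (-1), hf, potential_grad hG.isOpen_section f]
      with x h1 h2 h3 h4
    rw [h1, Pi.add_apply, h2, Pi.smul_apply, ← h3, ← h4]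
    simp
  rw [l2sq_congr h2] at h1
  have h3 := ae_eq_zero_of_l2sq_eq_zero hd.1.1.1
    (nonpos_iff_eq_zero.1 (h1.trans (by simp [l2sq])))
  filter_upwards [h3] with x hx
  simp only [Pi.add_apply, Pi.smul_apply, Pi.zero_apply] at hx
  linear_combination hx

theorem potential_add (hG : IsCanalWithBody Γ l Θ) (f g : energySpace hG.isOpen_section) :
    potential hG.isOpen_section (f + g) =ᵐ[volume.restrict Γ]
      potential hG.isOpen_section f + potential hG.isOpen_section g := by
  have hf := potential_mem hG.isOpen_section f
  have hg := potential_mem hG.isOpen_section g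
  refine potential_unique hG _ (hf.add hg) ?_
  filter_upwards [Lp.coeFn_add f.1 g.1, weakGrad_add hG.isOpen_section hf.1 hg.1,
    potential_grad hG.isOpen_section f, potential_grad hG.isOpen_section g] with x h1 h2 h3 h4
  rw [h2, Pi.add_apply, ← h3, ← h4]
  exact h1

theorem potential_smul (hG : IsCanalWithBody Γ l Θ) (c : ℂ) (f : energySpace hG.isOpen_section) :
    potential hG.isOpen_section (c • f) =ᵐ[volume.restrict Γ]
      c • potential hG.isOpen_section f := by
  have hf := potential_mem hG.isOpen_section f
  refine potential_unique hG _ (hf.const_smul c) ?_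
  filter_upwards [Lp.coeFn_smul c f.1, weakGrad_const_smul hG.isOpen_section hf.1 c,
    potential_grad hG.isOpen_section f] with x h1 h2 h3
  rw [h2, Pi.smul_apply, ← h3]
  exact h1

/-- The potential as a linear map. -/
noncomputable def potentialLM (hG : IsCanalWithBody Γ l Θ) :
    energySpace hG.isOpen_section →ₗ[ℂ] Lp ℂ 2 (volume.restrict Γ) where
  toFun f := (potential_mem hG.isOpen_section f).1.1.toLp _
  map_add' f g := by
    rw [← MemLp.toLp_add]
    exact MemLp.toLp_congr _ _ (potential_add hG f g)
  map_smul' c f := by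
    rw [RingHom.id_apply, ← MemLp.toLp_const_smul]
    exact MemLp.toLp_congr _ _ (potential_smul hG c f)

theorem potentialLM_ae_eq (hG : IsCanalWithBody Γ l Θ) (f : energySpace hG.isOpen_section) :
    potentialLM hG f =ᵐ[volume.restrict Γ] potential hG.isOpen_section f :=
  MemLp.coeFn_toLp (potential_mem hG.isOpen_section f).1.1

theorem exists_potentialLM_le (hG : IsCanalWithBody Γ l Θ) :
    ∃ C : ℝ, ∀ f, ‖potentialLM hG f‖ ≤ C * ‖f‖ := by
  obtain ⟨C, hC⟩ := exists_section_poincare hG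
  refine ⟨Real.sqrt C, fun f => norm_le_of_ofReal_sq_le (norm_nonneg _) ?_⟩
  rw [← l2sq_weakGrad_potential, ← l2sq_coe_Lp, l2sq_congr (potentialLM_ae_eq hG f)]
  exact hC _ (potential_mem hG.isOpen_section f)

theorem tendsto_l2sq_of_tendsto_Lp {α G : Type*} [MeasurableSpace α] {μ : Measure α}
    [NormedAddCommGroup G] {F : ℕ → Lp G 2 μ} {f : Lp G 2 μ} (h : Tendsto F atTop (𝓝 f)) :
    Tendsto (fun n => l2sq μ (fun x => F n x - f x)) atTop (𝓝 0) := by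
  have h1 : Tendsto (fun n => ENNReal.ofReal (‖F n - f‖ ^ 2)) atTop (𝓝 0) := by
    have := ENNReal.tendsto_ofReal ((tendsto_iff_norm_sub_tendsto_zero.1 h).pow 2)
    simpa using this
  refine h1.congr fun n => ?_
  rw [← l2sq_coe_Lp]
  exact l2sq_congr (Lp.coeFn_sub (F n) f)

/-- Poincaré's inequality makes the potentials of a convergent sequence of gradients a Cauchy
sequence, and the limit is a potential because weak differentiation is closed. -/
theorem isClosed_energySpace (hG : IsCanalWithBody Γ l Θ) :
    IsClosed (energySpace hG.isOpen_section : Set (Lp (EuclideanSpace ℂ (Fin 2)) 2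
      (volume.restrict Γ))) := by
  have hΓ := hG.isOpen_section
  obtain ⟨C, hC⟩ := exists_potentialLM_le hG
  refine IsSeqClosed.isClosed fun F f hF hf => ?_
  set F' : ℕ → energySpace hΓ := fun n => ⟨F n, hF n⟩ with hF'
  have hc : CauchySeq F' := by
    have := hf.cauchySeq
    rw [Metric.cauchySeq_iff] at this ⊢
    exact this
  have hc2 : CauchySeq fun n => potentialLM hG (F' n) :=
    ((potentialLM hG).mkContinuous C hC).uniformContinuous.comp_cauchySeq hc
  obtain ⟨U, hU⟩ := cauchySeq_tendsto_of_complete hc2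
  have hp := fun n => potential_mem hΓ (F' n)
  have t1 : Tendsto (fun n => l2sq (volume.restrict Γ) (fun x => potential hΓ (F' n) x - U x))
      atTop (𝓝 0) := (tendsto_l2sq_of_tendsto_Lp hU).congr fun n =>
        l2sq_congr ((potentialLM_ae_eq hG (F' n)).mono fun x hx => by simp only [hx])
  have t2 : ∀ i, Tendsto (fun n => l2sq (volume.restrict Γ)
      (fun x => weakDeriv Γ (e2 i) (potential hΓ (F' n)) x - f x i)) atTop (𝓝 0) := fun i => by
    refine tendsto_of_tendsto_of_tendsto_of_le_of_le tendsto_const_nhds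
      (tendsto_l2sq_of_tendsto_Lp hf) (fun n => zero_le) fun n => l2sq_mono ?_
    filter_upwards [potential_grad hΓ (F' n)] with x hx
    have : weakDeriv Γ (e2 i) (potential hΓ (F' n)) x - f x i = (F n x - f x) i := by
      change _ = F n x i - f x i
      rw [show F n x = _ from hx]
      rfl
    rw [this]
    exact PiLp.norm_apply_le _ i
  have hfi : ∀ i, MemLp (fun x => f x i) 2 (volume.restrict Γ) := fun i =>
    (Lp.memLp f).of_le ((EuclideanSpace.proj (𝕜 := ℂ) i).continuous.comp_aestronglyMeasurable
      (Lp.aestronglyMeasurable f)) (Eventually.of_forall fun x => PiLp.norm_apply_le _ i)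
  have hw : ∀ i, IsWeakDeriv Γ (e2 i) U (fun x => f x i) := fun i =>
    isWeakDeriv_of_tendsto (fun n => (memLp_weakDeriv hΓ (hp n).1 i).1) (fun n => (hp n).1.1)
      (fun n => (memLp_weakDeriv hΓ (hp n).1 i).2) (Lp.memLp U) (hfi i) t1 (t2 i)
  refine ⟨U, ⟨⟨Lp.memLp U, fun i => ⟨_, hw i, hfi i⟩⟩, ?_⟩,
    (weakGrad_ae_eq fun i => (hw i).weakDeriv_ae hΓ).symm⟩
  -- Vanishing in the left half survives the limit: there the distance from U to each potential in
  -- the sequence is the norm of U.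
  set N : Set (ℝ × ℝ) := {x | x.1 ≤ 0} with hN
  have hNm : MeasurableSet N := (isClosed_le continuous_fst continuous_const).measurableSet
  have h0 : l2sq ((volume.restrict Γ).restrict N) U = 0 := by
    refine nonpos_iff_eq_zero.1 (ge_of_tendsto' t1 fun n => ?_)
    refine le_trans ?_ (lintegral_mono' (Measure.restrict_le_self (s := N)) le_rfl)
    refine l2sq_mono ?_
    rw [ae_restrict_iff' hNm]
    filter_upwards [(hp n).2] with x hx hxN
    rw [hx hxN]
    simp
  have h1 := ae_eq_zero_of_l2sq_eq_zero (Lp.aestronglyMeasurable U).restrict h0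
  rw [Filter.EventuallyEq, ae_restrict_iff' hNm] at h1
  exact h1

end EnergySpace

/-! ### Compactness of the trace on the cross-section -/

section SteklovCompact

variable {Γ : Set (ℝ × ℝ)} {l : ℝ} {Θ : Set (ℝ × ℝ × ℝ)}

theorem measurePreserving_refl :
    MeasurePreserving (ContinuousLinearEquiv.refl ℝ (ℝ × ℝ)) := MeasurePreserving.id _

theorem tr_eq_sectionTrace (D : SectionBoundary Γ l) (u : ℝ × ℝ → ℂ) :
    FlatBoundary.tr D u = sectionTrace Γ l u := rfl

theorem memLp_sectionTrace (hG : IsCanalWithBody Γ l Θ) {u : ℝ × ℝ → ℂ} (hu : MemH1 Γ e2 u) :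
    MemLp (sectionTrace Γ l u) 2 (volume.restrict (Ioo (-l) l)) := by
  obtain ⟨D, -⟩ := exists_sectionBoundary hG one_pos
  exact D.memLp_tr measurePreserving_refl exists_sum_e2 hu

theorem sectionTrace_congr (hG : IsCanalWithBody Γ l Θ) {u u' : ℝ × ℝ → ℂ} (hu : MemH1 Γ e2 u)
    (h : u =ᵐ[volume.restrict Γ] u') :
    sectionTrace Γ l u =ᵐ[volume.restrict (Ioo (-l) l)] sectionTrace Γ l u' := by
  obtain ⟨D, -⟩ := exists_sectionBoundary hG one_pos
  exact D.tr_congr measurePreserving_refl exists_sum_e2 hu h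

/-- The trace on the surface, as a linear map on the energy space. -/
noncomputable def traceLM (hG : IsCanalWithBody Γ l Θ) :
    energySpace hG.isOpen_section →ₗ[ℂ] Lp ℂ 2 (volume.restrict (Ioo (-l) l)) where
  toFun f := (memLp_sectionTrace hG (potential_mem hG.isOpen_section f).1).toLp _
  map_add' f g := by
    rw [← MemLp.toLp_add]
    obtain ⟨D, -⟩ := exists_sectionBoundary hG one_pos
    exact MemLp.toLp_congr _ _ ((sectionTrace_congr hG (potential_mem _ _).1
      (potential_add hG f g)).trans (D.tr_add measurePreserving_refl exists_sum_e2
        (potential_mem _ f).1 (potential_mem _ g).1))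
  map_smul' c f := by
    rw [RingHom.id_apply, ← MemLp.toLp_const_smul]
    obtain ⟨D, -⟩ := exists_sectionBoundary hG one_pos
    exact MemLp.toLp_congr _ _ ((sectionTrace_congr hG (potential_mem _ _).1
      (potential_smul hG c f)).trans (D.tr_const_smul measurePreserving_refl exists_sum_e2
        (potential_mem _ f).1 c))

theorem traceLM_ae_eq (hG : IsCanalWithBody Γ l Θ) (f : energySpace hG.isOpen_section) :
    traceLM hG f =ᵐ[volume.restrict (Ioo (-l) l)]
      sectionTrace Γ l (potential hG.isOpen_section f) :=
  MemLp.coeFn_toLp (memLp_sectionTrace hG (potential_mem hG.isOpen_section f).1)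

theorem lintegral_sq_ne_top {a : ℝ → ℝ} (ha : Continuous a) (h : ℝ) :
    ∫⁻ s in Ioo 0 h, ‖a s‖ₑ ^ 2 ≠ ⊤ := (l2sq_lt_top (memLp_two_Ioo ha h)).ne

theorem exists_layerMean_potential_le (hG : IsCanalWithBody Γ l Θ) (D : SectionBoundary Γ l)
    (i : Fin D.N) {a : ℝ → ℝ} (ha : Continuous a) : ∃ C : ℝ≥0, ∀ f,
      l2sq volume (D.layerMean i a (potential hG.isOpen_section f)) ≤
        C * ENNReal.ofReal (‖f‖ ^ 2) := by
  obtain ⟨C, hC⟩ := exists_section_poincare hG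
  refine ⟨(∫⁻ s in Ioo 0 D.depth, ‖a s‖ₑ ^ 2).toNNReal * C, fun f => ?_⟩
  have hp := potential_mem hG.isOpen_section f
  refine (D.layerMean_memLp measurePreserving_refl i ha hp.1.1).2.trans ?_
  rw [ENNReal.coe_mul, ENNReal.coe_toNNReal (lintegral_sq_ne_top ha _), mul_assoc,
    ← l2sq_weakGrad_potential]
  gcongr
  exact hC _ hp

/-- With one fixed depth cutoff, the trace is bounded by the gradient and by layer means of the
potential; the latter are bounded by the gradient through Poincaré's inequality. -/
theorem exists_traceLM_le (hG : IsCanalWithBody Γ l Θ) :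
    ∃ C : ℝ, ∀ f, ‖traceLM hG f‖ ≤ C * ‖f‖ := by
  obtain ⟨D, -⟩ := exists_sectionBoundary hG one_pos
  obtain ⟨k, hk⟩ := exists_isDepthCutoff D.depth_pos
  obtain ⟨C, hC⟩ := D.exists_l2sq_tr_le measurePreserving_refl exists_sum_e2
  have hk' : Continuous (deriv k) := hk.1.continuous_deriv (by simp)
  choose C' hC' using fun i => exists_layerMean_potential_le hG D i hk'
  refine ⟨Real.sqrt (C * (∫⁻ s in Ioo 0 D.depth, ‖k s‖ₑ ^ 2).toNNReal + C * ∑ i, C' i : ℝ≥0),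
    fun f => norm_le_of_ofReal_sq_le (norm_nonneg _) ?_⟩
  have hp := potential_mem hG.isOpen_section f
  rw [← l2sq_coe_Lp, l2sq_congr (traceLM_ae_eq hG f)]
  refine (hC k hk _ hp.1).trans ?_
  rw [l2sq_weakGrad_potential]
  push_cast
  rw [ENNReal.coe_toNNReal (lintegral_sq_ne_top hk.1.continuous _), add_mul, mul_assoc (C : ℝ≥0∞) (∑ i, _), Finset.sum_mul]
  gcongr with i _
  exact hC' i f

/-- The integral of the average over a layer, as a linear functional. -/
noncomputable def cellLM (hG : IsCanalWithBody Γ l Θ) (D : SectionBoundary Γ l) (i : Fin D.N)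
    {a : ℝ → ℝ} (ha : Continuous a) {I : Set ℝ} (hI : volume I < ⊤) :
    energySpace hG.isOpen_section →ₗ[ℂ] ℂ where
  toFun f := ∫ y in I, D.layerMean i a (potential hG.isOpen_section f) y
  map_add' f g := by
    haveI : IsFiniteMeasure (volume.restrict I) := ⟨by simpa using hI⟩
    have hf := (potential_mem hG.isOpen_section f).1.1
    have hg := (potential_mem hG.isOpen_section g).1.1
    have hint : ∀ {w}, MemLp w 2 (volume.restrict Γ) →
        Integrable (D.layerMean i a w) (volume.restrict I) := fun hw =>
      ((D.layerMean_memLp measurePreserving_refl i ha hw).1.restrict I).integrable (by norm_num)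
    rw [← integral_add (hint hf) (hint hg)]
    exact integral_congr_ae (ae_restrict_of_ae ((D.layerMean_congr measurePreserving_refl i ha
      (potential_mem _ _).1.1 (potential_add hG f g)).trans
      (D.layerMean_add measurePreserving_refl i ha hf hg)))
  map_smul' c f := by
    rw [RingHom.id_apply, ← integral_smul]
    have h := (D.layerMean_congr measurePreserving_refl i ha (potential_mem _ _).1.1
      (potential_smul hG c f))
    rw [D.layerMean_const_smul] at h
    exact integral_congr_ae (ae_restrict_of_ae h)

theorem exists_cellLM_le (hG : IsCanalWithBody Γ l Θ) (D : SectionBoundary Γ l) (i : Fin D.N)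
    {a : ℝ → ℝ} (ha : Continuous a) {I : Set ℝ} (hI : volume I < ⊤) :
    ∃ C : ℝ, ∀ f, ‖cellLM hG D i ha hI f‖ ≤ C * ‖f‖ := by
  obtain ⟨C, hC⟩ := exists_layerMean_potential_le hG D i ha
  refine ⟨Real.sqrt ((volume I).toNNReal * C : ℝ≥0),
    fun f => norm_le_of_ofReal_sq_le (norm_nonneg _) ?_⟩
  have hm := (D.layerMean_memLp measurePreserving_refl i ha
    (potential_mem hG.isOpen_section f).1.1).1
  rw [ENNReal.ofReal_pow (norm_nonneg _), ofReal_norm]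
  refine (enorm_integral_sq_le hm.1.restrict).trans ?_
  rw [Measure.restrict_apply_univ, ENNReal.coe_mul, ENNReal.coe_toNNReal hI.ne, mul_assoc]
  gcongr
  exact (lintegral_mono' Measure.restrict_le_self le_rfl).trans (hC f)

theorem IsDepthCutoff.lintegral_sq_le {h d : ℝ} {k : ℝ → ℝ} (hk : IsDepthCutoff h k) :
    ∫⁻ s in Ioo 0 d, ‖k s‖ₑ ^ 2 ≤ ENNReal.ofReal h := by
  have h1 : ∀ s ∈ Ioo 0 d, ‖k s‖ₑ ^ 2 ≤ (Ioo 0 h).indicator (fun _ => 1) s := by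
    intro s hs
    by_cases hsh : s ∈ Ioo 0 h
    · rw [indicator_of_mem hsh]
      refine pow_le_one₀ zero_le ?_
      rw [← ofReal_norm, ENNReal.ofReal_le_one]
      exact hk.2.2.2 s
    · rw [indicator_of_notMem hsh, image_eq_zero_of_notMem_tsupport fun hs' => hsh
        ⟨hs.1, (hk.2.2.1 hs').2⟩]
      simp
  refine (setLIntegral_mono' measurableSet_Ioo h1).trans ((setLIntegral_le_lintegral _ _).trans ?_)
  rw [lintegral_indicator measurableSet_Ioo]
  simp

/-- Two approximations: a thin layer makes the direct gradient term in the trace bound small, and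
then, with this layer fixed, fine cells reduce the remaining layer means to finitely many numbers
plus a small multiple of the gradient. The order matters, since the derivative of the cutoff grows
when the layer gets thin. -/
theorem exists_traceCLM (hG : IsCanalWithBody Γ l Θ) :
    ∃ t : energySpace hG.isOpen_section →L[ℂ] Lp ℂ 2 (volume.restrict (Ioo (-l) l)),
      (∀ f, t f = traceLM hG f) ∧ IsCompactOperator t := by
  obtain ⟨Ct, hCt⟩ := exists_traceLM_le hG
  refine ⟨(traceLM hG).mkContinuous Ct hCt, fun f => rfl, isCompactOperator_of_approx _ fun ε hε => ?_⟩
  obtain ⟨D, -, hD⟩ := exists_sectionBoundary hG one_pos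
  obtain ⟨C, hC⟩ := D.exists_l2sq_tr_le measurePreserving_refl exists_sum_e2
  -- Squared norms are estimated, and each of the two approximations contributes at most δ ‖f‖².
  set δ : ℝ := ε ^ 2 / 2 with hδ
  have hδ0 : 0 < δ := by positivity
  -- As |k| ≤ 1, its square integral is at most the thickness, so C times it is at most δ.
  obtain ⟨k, hk⟩ := exists_isDepthCutoff (lt_min D.depth_pos (show 0 < δ / (C + 1) by positivity))
  have hk' : Continuous (deriv k) := hk.1.continuous_deriv (by simp)
  have hJ : ∀ i, ∃ α β, Ioo (-l) l ∩ D.dom i = Ioo α β := fun i => by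
    obtain ⟨a, b, h⟩ := hD i
    exact ⟨_, _, by rw [h, Ioo_inter_Ioo]⟩
  choose α β hJ using hJ
  -- The tolerance is divided so that the sum over the `D.N` charts, multiplied by C, stays below δ;
  -- adding 1 prevents division by zero.
  choose n I c hI hc using fun i => exists_layerMean_cells D i (hJ i) hk'
    (show 0 < δ / ((C + 1) * (D.N + 1)) by positivity)
  choose B hB using fun i m => exists_cellLM_le hG D i hk' (hI i m)
  set p : energySpace hG.isOpen_section →L[ℂ] (Σ i, Fin (n i)) → ℂ :=
    ContinuousLinearMap.pi fun im => (cellLM hG D im.1 hk' (hI im.1 im.2)).mkContinuous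
      (B im.1 im.2) (hB im.1 im.2) with hp
  -- The target of p carries the maximum norm, so each of the n i cell averages of chart i is
  -- bounded by ‖p f‖.
  set M : ℝ≥0 := C * ∑ i, c i * n i with hM
  refine ⟨_, inferInstance, ((Real.sqrt M : ℝ) : ℂ) • p, fun f => ?_⟩
  have hf := potential_mem hG.isOpen_section f
  have hcell : ∀ i m, ‖∫ y in I i m, D.layerMean i (deriv k) (potential hG.isOpen_section f) y‖ₑ ^ 2
      ≤ ENNReal.ofReal (‖p f‖ ^ 2) := by
    intro i m
    rw [← ofReal_norm, ← ENNReal.ofReal_pow (norm_nonneg _)]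
    refine ENNReal.ofReal_le_ofReal (pow_le_pow_left₀ (norm_nonneg _) ?_ 2)
    exact norm_le_pi_norm (p f) ⟨i, m⟩
  have h1 : ENNReal.ofReal (‖traceLM hG f‖ ^ 2) ≤
      ENNReal.ofReal (ε ^ 2 * ‖f‖ ^ 2 + M * ‖p f‖ ^ 2) := by
    rw [← l2sq_coe_Lp, l2sq_congr (traceLM_ae_eq hG f)]
    refine (hC k (hk.mono (min_le_left _ _)) _ hf.1).trans ?_
    have a1 : (C : ℝ≥0∞) * (∫⁻ s in Ioo 0 D.depth, ‖k s‖ₑ ^ 2) ≤ ENNReal.ofReal δ := by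
      refine (mul_le_mul_right hk.lintegral_sq_le _).trans ?_
      rw [← ENNReal.ofReal_coe_nnreal, ← ENNReal.ofReal_mul C.coe_nonneg]
      refine ENNReal.ofReal_le_ofReal ?_
      calc (C : ℝ) * min D.depth (δ / (C + 1)) ≤ (C + 1) * (δ / (C + 1)) := by
            have := C.coe_nonneg
            exact mul_le_mul (by linarith) (min_le_right _ _) (le_min D.depth_pos.le (by positivity))
              (by linarith)
        _ = δ := by field_simp
    have a2 : (C : ℝ≥0∞) * ∑ i, l2sq volume (D.layerMean i (deriv k)
        (potential hG.isOpen_section f)) ≤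
        ENNReal.ofReal δ * ENNReal.ofReal (‖f‖ ^ 2) + M * ENNReal.ofReal (‖p f‖ ^ 2) := by
      have b1 : ∀ i, l2sq volume (D.layerMean i (deriv k) (potential hG.isOpen_section f)) ≤
          ENNReal.ofReal (δ / ((C + 1) * (D.N + 1))) * ENNReal.ofReal (‖f‖ ^ 2) +
          (c i * n i : ℝ≥0) * ENNReal.ofReal (‖p f‖ ^ 2) := fun i => by
        refine (hc i _ hf.1).trans ?_
        rw [l2sq_weakGrad_potential]
        push_cast
        rw [mul_assoc (c i : ℝ≥0∞)]
        gcongr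
        refine (Finset.sum_le_sum fun m _ => hcell i m).trans ?_
        simp
      refine (mul_le_mul_right (Finset.sum_le_sum fun i _ => b1 i) _).trans ?_
      rw [Finset.sum_add_distrib, ← Finset.sum_mul, mul_add, Finset.sum_const, Finset.card_univ,
        Fintype.card_fin, hM]
      push_cast
      refine add_le_add ?_ (by rw [mul_assoc, Finset.sum_mul])
      rw [nsmul_eq_mul, ← mul_assoc, ← mul_assoc]
      gcongr
      rw [← ENNReal.ofReal_coe_nnreal, ← ENNReal.ofReal_natCast, ← ENNReal.ofReal_mul C.coe_nonneg,
        ← ENNReal.ofReal_mul (by positivity)]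
      refine ENNReal.ofReal_le_ofReal ?_
      calc (C : ℝ) * D.N * (δ / ((C + 1) * (D.N + 1)))
          ≤ (C + 1) * (D.N + 1) * (δ / ((C + 1) * (D.N + 1))) := by
            gcongr <;> linarith
        _ = δ := by field_simp
    rw [l2sq_weakGrad_potential]
    refine (add_le_add (mul_le_mul_left a1 _) a2).trans (le_of_eq ?_)
    rw [← ENNReal.ofReal_coe_nnreal, ← ENNReal.ofReal_mul hδ0.le, ← ENNReal.ofReal_mul M.coe_nonneg,
      ← ENNReal.ofReal_add (by positivity) (by positivity),
      ← ENNReal.ofReal_add (by positivity) (by positivity)]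
    congr 1
    rw [hδ]
    ring
  rw [ENNReal.ofReal_le_ofReal_iff (by positivity)] at h1
  have h2 : ‖(((Real.sqrt M : ℝ) : ℂ) • p) f‖ = Real.sqrt M * ‖p f‖ := by
    rw [smul_apply, norm_smul, Complex.norm_real, Real.norm_of_nonneg (Real.sqrt_nonneg _)]
  rw [h2]
  change ‖traceLM hG f‖ ≤ _
  refine abs_le_of_sq_le_sq' ?_ (by positivity) |>.2
  have h3 := Real.sq_sqrt M.coe_nonneg
  have h4 : 0 ≤ ε * ‖f‖ * (Real.sqrt M * ‖p f‖) := by positivity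
  calc ‖traceLM hG f‖ ^ 2 ≤ ε ^ 2 * ‖f‖ ^ 2 + Real.sqrt M ^ 2 * ‖p f‖ ^ 2 := by rw [h3]; exact h1
    _ ≤ _ := by nlinarith

end SteklovCompact

/-! ### The Steklov inequality on the cross-section -/

section SteklovInequality

variable {Γ : Set (ℝ × ℝ)} {l : ℝ} {Θ : Set (ℝ × ℝ × ℝ)}

theorem ae_fst_ne_zero : ∀ᵐ x : ℝ × ℝ, x.1 ≠ 0 := by
  have h : {x : ℝ × ℝ | ¬ x.1 ≠ 0} = {0} ×ˢ univ := by
    ext x; simp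
  rw [ae_iff, h, Measure.volume_eq_prod, Measure.prod_prod]
  simp

/-- The function vanishes in the open left half, and weak derivatives are local; the line x₂ = 0 is
a null set. -/
theorem MemSection0.weakDeriv_eq_zero (hG : IsCanalWithBody Γ l Θ) {φ : ℝ × ℝ → ℂ}
    (hφ : MemSection0 Γ φ) (i : Fin 2) :
    ∀ᵐ x ∂(volume.restrict Γ), ¬ 0 < x.1 → weakDeriv Γ (e2 i) φ x = 0 := by
  have hO : IsOpen {x : ℝ × ℝ | x.1 < 0} := isOpen_lt continuous_fst continuous_const
  have h1 := (memLp_weakDeriv hG.isOpen_section hφ.1 i).1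
  -- The zero function is represented as 0 • φ, which comes with its weak derivative.
  have h2 := h1.ae_eq_of_ae_eq hG.isOpen_section hO (h1.const_smul 0)
    (hφ.2.mono fun x hx hxO => by simp [hx (le_of_lt hxO)])
  filter_upwards [h2, ae_restrict_of_ae ae_fst_ne_zero] with x hx hx0 hxn
  have := hx (lt_of_le_of_ne (not_lt.1 hxn) hx0)
  simpa using this

theorem MemSection0.sectionTrace_eq_zero (hG : IsCanalWithBody Γ l Θ) {φ : ℝ × ℝ → ℂ}
    (hφ : MemSection0 Γ φ) :
    ∀ᵐ y ∂(volume.restrict (Ioo (-l) l)), y ∉ Ioo 0 l → sectionTrace Γ l φ y = 0 := by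
  obtain ⟨D, -⟩ := exists_sectionBoundary hG one_pos
  have hO : IsOpen {x : ℝ × ℝ | x.1 < 0} := isOpen_lt continuous_fst continuous_const
  have h1 := D.tr_ae_eq_of_ae_eq measurePreserving_refl exists_sum_e2 hφ.1 (hφ.1.const_smul 0) hO
    (hφ.2.mono fun x hx hxO => by simp [hx (le_of_lt hxO)])
  have h2 := D.tr_const_smul measurePreserving_refl exists_sum_e2 hφ.1 0
  have h3 : ∀ᵐ y : ℝ, y ≠ 0 := by simp [ae_iff]
  filter_upwards [ae_restrict_of_ae h1, h2, ae_restrict_of_ae h3,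
    ae_restrict_mem measurableSet_Ioo] with y h1 h2 h3 hy hyn
  have hy0 : y < 0 := lt_of_le_of_ne (not_lt.1 fun h => hyn ⟨h, hy.2⟩) h3
  have h4 := (h1 hy hy0).trans h2
  rw [Pi.smul_apply, zero_smul] at h4
  exact h4

theorem gradInner_self {E ι : Type*} [NormedAddCommGroup E] [NormedSpace ℝ E] [MeasureSpace E]
    [Fintype ι] (Ω A : Set E) (b : ι → E) (u : E → ℂ) :
    gradInner Ω b A u u = ((∫ x in A, ‖weakGrad Ω b u x‖ ^ 2 : ℝ) : ℂ) := by
  rw [gradInner, ← integral_complex_ofReal]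
  refine integral_congr_ae (Eventually.of_forall fun x => ?_)
  simp only [weakGrad, EuclideanSpace.norm_sq_eq, Complex.mul_conj, Complex.normSq_eq_norm_sq]
  push_cast
  rfl

theorem ofReal_integral_norm_sq {α G : Type*} [MeasurableSpace α] {μ : Measure α}
    [NormedAddCommGroup G] {f : α → G} (hf : MemLp f 2 μ) :
    ENNReal.ofReal (∫ x, ‖f x‖ ^ 2 ∂μ) = l2sq μ f := by
  rw [ofReal_integral_eq_lintegral_ofReal ((memLp_two_iff_integrable_sq_norm hf.1).1 hf)
    (Eventually.of_forall fun x => by positivity)]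
  refine lintegral_congr fun x => ?_
  rw [ENNReal.ofReal_pow (norm_nonneg _), ofReal_norm]

theorem setIntegral_right (hG : IsCanalWithBody Γ l Θ) {φ ψ : ℝ × ℝ → ℂ}
    (hφ : MemSection0 Γ φ) :
    gradInner Γ e2 (Γ ∩ {x | 0 < x.1}) φ ψ = gradInner Γ e2 Γ φ ψ := by
  have hN : MeasurableSet {x : ℝ × ℝ | 0 < x.1} :=
    (isOpen_lt continuous_const continuous_fst).measurableSet
  have h := hφ.weakDeriv_eq_zero hG
  rw [gradInner, gradInner, inter_comm, ← Measure.restrict_restrict hN]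
  refine setIntegral_eq_integral_of_ae_compl_eq_zero ?_
  filter_upwards [h 0, h 1] with x h0 h1 hx
  simp [Fin.sum_univ_two, h0 hx, h1 hx]

theorem setIntegral_trace_right (hG : IsCanalWithBody Γ l Θ) {φ ψ : ℝ × ℝ → ℂ}
    (hφ : MemSection0 Γ φ) :
    ∫ y in Ioo 0 l, sectionTrace Γ l φ y * conj (sectionTrace Γ l ψ y) =
      ∫ y in Ioo (-l) l, sectionTrace Γ l φ y * conj (sectionTrace Γ l ψ y) := by
  have hl := hG.l_pos
  have : (volume : Measure ℝ).restrict (Ioo 0 l) = (volume.restrict (Ioo (-l) l)).restrict (Ioo 0 l) := by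
    rw [Measure.restrict_restrict measurableSet_Ioo,
      inter_eq_left.2 (Ioo_subset_Ioo (by linarith) le_rfl)]
  rw [this]
  refine setIntegral_eq_integral_of_ae_compl_eq_zero ?_
  filter_upwards [hφ.sectionTrace_eq_zero hG] with y hy hyn
  simp [hy hyn]

/-- Test the eigenvalue equation with φ itself: a negative eigenvalue forces a zero gradient, hence
φ = 0 by Poincaré. This makes the infimum that defines λ_Γ⁰ a genuine lower bound of the
eigenvalues. -/
theorem nonneg_of_mem_steklovEigenvalues (hG : IsCanalWithBody Γ l Θ) {lam : ℝ}
    (h : lam ∈ steklovEigenvalues Γ l) : 0 ≤ lam := by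
  obtain ⟨φ, hφ, hne, H⟩ := h
  by_contra! hlam
  have h1 := H φ hφ
  rw [setIntegral_right hG hφ, gradInner_self] at h1
  have h2 : ∫ y in Ioo 0 l, sectionTrace Γ l φ y * conj (sectionTrace Γ l φ y) =
      ((∫ y in Ioo 0 l, ‖sectionTrace Γ l φ y‖ ^ 2 : ℝ) : ℂ) := by
    rw [← integral_complex_ofReal]
    refine integral_congr_ae (Eventually.of_forall fun x => ?_)
    simp only [Complex.mul_conj, Complex.normSq_eq_norm_sq]
  rw [h2] at h1
  norm_cast at h1
  have h3 : 0 ≤ ∫ y in Ioo 0 l, ‖sectionTrace Γ l φ y‖ ^ 2 := integral_nonneg fun y => by positivity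
  have h4 : 0 ≤ ∫ x in Γ, ‖weakGrad Γ e2 φ x‖ ^ 2 := integral_nonneg fun y => by positivity
  have h5 : ∫ x in Γ, ‖weakGrad Γ e2 φ x‖ ^ 2 = 0 :=
    le_antisymm (h1 ▸ mul_nonpos_of_nonpos_of_nonneg hlam.le h3) h4
  have h6 := ofReal_integral_norm_sq (memLp_weakGrad hG.isOpen_section hφ.1)
  rw [h5, ENNReal.ofReal_zero] at h6
  obtain ⟨C, hC⟩ := exists_section_poincare hG
  have h7 := hC φ hφ
  rw [← h6, mul_zero, nonpos_iff_eq_zero] at h7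
  exact hne (ae_eq_zero_of_l2sq_eq_zero hφ.1.1.1 h7)

theorem lambdaGamma_nonneg (hG : IsCanalWithBody Γ l Θ) : 0 ≤ lambdaGamma Γ l :=
  Real.sInf_nonneg fun _ h => nonneg_of_mem_steklovEigenvalues hG h

theorem lambdaGamma_le (hG : IsCanalWithBody Γ l Θ) {lam : ℝ}
    (h : lam ∈ steklovEigenvalues Γ l) : lambdaGamma Γ l ≤ lam :=
  csInf_le ⟨0, fun _ h => nonneg_of_mem_steklovEigenvalues hG h⟩ h

/-- The gradient of a potential, as an element of the energy space. -/
noncomputable def toEnergy (hG : IsCanalWithBody Γ l Θ) {φ : ℝ × ℝ → ℂ} (hφ : MemSection0 Γ φ) :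
    energySpace hG.isOpen_section :=
  ⟨(memLp_weakGrad hG.isOpen_section hφ.1).toLp _, φ, hφ, MemLp.coeFn_toLp _⟩

theorem potential_toEnergy (hG : IsCanalWithBody Γ l Θ) {φ : ℝ × ℝ → ℂ} (hφ : MemSection0 Γ φ) :
    potential hG.isOpen_section (toEnergy hG hφ) =ᵐ[volume.restrict Γ] φ :=
  potential_unique hG _ hφ (MemLp.coeFn_toLp (memLp_weakGrad hG.isOpen_section hφ.1))

theorem traceLM_toEnergy (hG : IsCanalWithBody Γ l Θ) {φ : ℝ × ℝ → ℂ} (hφ : MemSection0 Γ φ) :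
    traceLM hG (toEnergy hG hφ) =ᵐ[volume.restrict (Ioo (-l) l)] sectionTrace Γ l φ :=
  (traceLM_ae_eq hG _).trans (sectionTrace_congr hG (potential_mem _ _).1 (potential_toEnergy hG hφ))

/-- The variational characterization of the first Steklov eigenvalue. -/
theorem lambdaGamma_mul_le (hG : IsCanalWithBody Γ l Θ) {φ : ℝ × ℝ → ℂ} (hφ : MemSection0 Γ φ) :
    ENNReal.ofReal (lambdaGamma Γ l) *
      l2sq (volume.restrict (Ioo (-l) l)) (sectionTrace Γ l φ) ≤
      l2sq (volume.restrict Γ) (weakGrad Γ e2 φ) := by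
  have hΓ := hG.isOpen_section
  haveI : CompleteSpace (energySpace hΓ) := (isClosed_energySpace hG).completeSpace_coe
  obtain ⟨t, ht, htc⟩ := exists_traceCLM hG
  have h1 : l2sq (volume.restrict (Ioo (-l) l)) (sectionTrace Γ l φ) =
      ENNReal.ofReal (‖t (toEnergy hG hφ)‖ ^ 2) := by
    rw [ht, ← l2sq_coe_Lp, l2sq_congr (traceLM_toEnergy hG hφ)]
  have h2 : l2sq (volume.restrict Γ) (weakGrad Γ e2 φ) = ENNReal.ofReal (‖toEnergy hG hφ‖ ^ 2) :=
    (l2sq_toLp (memLp_weakGrad hΓ hφ.1)).symm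
  rw [h1, h2, ← ENNReal.ofReal_mul (lambdaGamma_nonneg hG)]
  refine ENNReal.ofReal_le_ofReal ?_
  rcases eq_or_ne t 0 with h0 | h0
  · rw [h0]
    simp
  obtain ⟨htn, f, hf, hev⟩ := exists_eigenvector_of_compact t htc h0
  -- The eigenvector of t* t is a gradient whose potential solves the Steklov problem; its
  -- eigenvalue ‖t‖⁻² bounds λ_Γ⁰ from above, which is the only direction needed.
  have hmem : (‖t‖ ^ 2)⁻¹ ∈ steklovEigenvalues Γ l := by
    refine ⟨potential hΓ f, potential_mem hΓ f, fun h => hf ?_, fun ψ hψ => ?_⟩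
    · have e1 := potential_grad hΓ f
      have e2' := weakGrad_const_smul hΓ (potential_mem hΓ f).1 (0 : ℂ)
      have e3 : weakGrad Γ e2 (potential hΓ f) =ᵐ[volume.restrict Γ]
          weakGrad Γ e2 ((0 : ℂ) • potential hΓ f) :=
        weakGrad_ae_eq fun i => weakDeriv_congr hΓ i (potential_mem hΓ f).1 (by simpa using h)
      have : f.1 = 0 := by
        rw [Lp.eq_zero_iff_ae_eq_zero]
        filter_upwards [e1, e2', e3] with x h1 h2 h3
        rw [h1, h3, h2]
        simp
      exact Subtype.ext this
    · rw [setIntegral_right hG (potential_mem hΓ f),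
        setIntegral_trace_right hG (potential_mem hΓ f)]
      have e1 := hev (toEnergy hG hψ)
      have e2' : inner ℂ (toEnergy hG hψ) f = gradInner Γ e2 Γ (potential hΓ f) ψ := by
        change inner ℂ (toEnergy hG hψ).1 f.1 = _
        rw [L2.inner_def, gradInner]
        refine integral_congr_ae ?_
        filter_upwards [potential_grad hΓ f,
          MemLp.coeFn_toLp (memLp_weakGrad hG.isOpen_section hψ.1)] with x h1 h2
        rw [h1, show (toEnergy hG hψ).1 x = _ from h2, PiLp.inner_apply]
        simp [weakGrad, RCLike.inner_apply]
      have e3 : inner ℂ (t (toEnergy hG hψ)) (t f) =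
          ∫ y in Ioo (-l) l, sectionTrace Γ l (potential hΓ f) y * conj (sectionTrace Γ l ψ y) := by
        rw [L2.inner_def, ht, ht]
        refine integral_congr_ae ?_
        filter_upwards [traceLM_ae_eq hG f, traceLM_toEnergy hG hψ] with y h1 h2
        rw [h1, h2, RCLike.inner_apply]
      rw [← e3, ← e1, e2', ← mul_assoc]
      push_cast
      rw [inv_mul_cancel₀ (by exact_mod_cast (pow_pos htn 2).ne'), one_mul]
  calc lambdaGamma Γ l * ‖t (toEnergy hG hφ)‖ ^ 2
      ≤ (‖t‖ ^ 2)⁻¹ * (‖t‖ * ‖toEnergy hG hφ‖) ^ 2 := by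
        gcongr
        · exact lambdaGamma_le hG hmem
        · exact t.le_opNorm _
    _ = _ := by field_simp

end SteklovInequality

/-! ### Odd functions and their restriction to the right half -/

section Reflection

/-- The reflection `x₂ ↦ -x₂`, as a linear map. -/
noncomputable def reflL : (ℝ × ℝ × ℝ) ≃L[ℝ] (ℝ × ℝ × ℝ) :=
  (ContinuousLinearEquiv.refl ℝ ℝ).prodCongr
    ((ContinuousLinearEquiv.neg ℝ).prodCongr (ContinuousLinearEquiv.refl ℝ ℝ))

@[simp] theorem reflL_apply (x : ℝ × ℝ × ℝ) : reflL x = (x.1, -x.2.1, x.2.2) := rfl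

@[simp] theorem reflL_symm_apply (x : ℝ × ℝ × ℝ) : reflL.symm x = (x.1, -x.2.1, x.2.2) := rfl

theorem measurePreserving_reflL : MeasurePreserving reflL :=
  (MeasurePreserving.id (volume : Measure ℝ)).prod
    ((Measure.measurePreserving_neg (volume : Measure ℝ)).prod
      (MeasurePreserving.id (volume : Measure ℝ)))

/-- The coordinate `x₂`. -/
noncomputable def coordTwo : (ℝ × ℝ × ℝ) →L[ℝ] ℝ :=
  (ContinuousLinearMap.fst ℝ ℝ ℝ).comp (ContinuousLinearMap.snd ℝ ℝ (ℝ × ℝ))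

@[simp] theorem coordTwo_apply (x : ℝ × ℝ × ℝ) : coordTwo x = x.2.1 := rfl

theorem isOpen_rightHalf : IsOpen rightHalf := isOpen_lt continuous_const coordTwo.continuous

theorem ae_snd_fst_ne_zero : ∀ᵐ x : ℝ × ℝ × ℝ, x.2.1 ≠ 0 := by
  have h : {x : ℝ × ℝ × ℝ | ¬ x.2.1 ≠ 0} = univ ×ˢ ({0} ×ˢ univ) := by
    ext x; simp
  rw [ae_iff, h, Measure.volume_eq_prod, Measure.prod_prod, Measure.volume_eq_prod,
    Measure.prod_prod]
  simp

variable {Γ : Set (ℝ × ℝ)} {l : ℝ} {Θ : Set (ℝ × ℝ × ℝ)}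

/-- A point and its mirror image are at distance 2 |x₂|, and φ is Lipschitz. So φ minus its
reflection is small enough near the plane for the vanishing of the flux. -/
theorem IsTest.exists_abs_sub_refl_le {φ : ℝ × ℝ × ℝ → ℝ} (hφ : IsTest φ) :
    ∃ M, ∀ x, |φ x - φ (reflL x)| ≤ M * |coordTwo x| := by
  obtain ⟨C, hC⟩ := ContDiff.lipschitzWith_of_hasCompactSupport hφ.2 hφ.1 (by simp)
  refine ⟨2 * C, fun x => ?_⟩
  have h := hC.dist_le_mul x (reflL x)
  rw [Real.dist_eq, dist_eq_norm] at h
  refine h.trans (le_of_eq ?_)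
  have : x - reflL x = (0, 2 * x.2.1, 0) := by
    ext <;> simp; ring
  rw [this, Prod.norm_def, Prod.norm_def]
  simp
  ring

theorem setIntegral_comp_reflL (f : ℝ × ℝ × ℝ → ℂ) (s : Set (ℝ × ℝ × ℝ)) :
    ∫ x in reflL ⁻¹' s, f (reflL x) = ∫ x in s, f x :=
  measurePreserving_reflL.setIntegral_preimage_emb reflL.toHomeomorph.measurableEmbedding f s

theorem preimage_reflL_water (hG : IsCanalWithBody Γ l Θ) :
    reflL ⁻¹' water Γ Θ = water Γ Θ := by
  ext x
  exact hG.symmetric x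

theorem preimage_reflL_water_sdiff (hG : IsCanalWithBody Γ l Θ) :
    (reflL ⁻¹' (water Γ Θ \ rightHalf) : Set _) =ᵐ[volume] (water Γ Θ ∩ rightHalf : Set _) := by
  filter_upwards [ae_snd_fst_ne_zero] with x hx
  have h1 : x ∈ reflL ⁻¹' water Γ Θ ↔ x ∈ water Γ Θ := by rw [preimage_reflL_water hG]
  have h2 : reflL x ∈ rightHalf ↔ ¬ x ∈ rightHalf := by
    simp only [rightHalf, mem_ofPred_eq, reflL_apply, not_lt, Left.neg_pos_iff]
    exact ⟨le_of_lt, fun h => lt_of_le_of_ne h hx⟩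
  refine propext ?_
  change (reflL x ∈ water Γ Θ ∧ ¬ reflL x ∈ rightHalf) ↔ (x ∈ water Γ Θ ∧ x ∈ rightHalf)
  rw [h2, not_not, ← h1]
  rfl

theorem fderiv_comp_reflL {φ : ℝ × ℝ × ℝ → ℝ} (hφ : IsTest φ) (x v : ℝ × ℝ × ℝ) :
    fderiv ℝ (fun x => φ (reflL x)) x v = fderiv ℝ φ (reflL x) (reflL v) := by
  have := (hφ.differentiable (reflL x)).hasFDerivAt.comp x reflL.hasFDerivAt
  rw [HasFDerivAt.fderiv (f := fun x => φ (reflL x)) this]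
  rfl

theorem isTest_comp_reflL {φ : ℝ × ℝ × ℝ → ℝ} (hφ : IsTest φ) : IsTest fun x => φ (reflL x) :=
  ⟨hφ.1.comp reflL.contDiff, hφ.2.comp_homeomorph reflL.toHomeomorph⟩

theorem tsupport_comp_reflL (φ : ℝ × ℝ × ℝ → ℝ) :
    tsupport (fun x => φ (reflL x)) = reflL ⁻¹' tsupport φ := by
  simpa using! tsupport_comp_eq_preimage φ reflL.toHomeomorph

/-- The normal derivative of an odd function is even. -/
theorem ae_weakDeriv_reflL (hG : IsCanalWithBody Γ l Θ) {u g : ℝ × ℝ × ℝ → ℂ}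
    (hu : IsOdd (water Γ Θ) u) (h : IsWeakDeriv (water Γ Θ) (e3 1) u g) :
    ∀ᵐ x ∂(volume.restrict (water Γ Θ)), g (reflL x) = g x := by
  have h1 := h.comp_equiv reflL measurePreserving_reflL
  rw [preimage_reflL_water hG] at h1
  have h2 := (h1.smul_dir (-1)).congr (u' := -u) hu (ae_eq_refl _)
  have e : (-1 : ℝ) • reflL.symm (e3 1) = e3 1 := by simp [e3]
  rw [e] at h2
  have h3 := h2.ae_unique (isOpen_water hG) h.neg
  filter_upwards [h3] with x hx
  simp only [Pi.smul_apply, Function.comp_apply, Pi.neg_apply] at hx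
  push_cast at hx
  rw [neg_smul, one_smul, neg_inj] at hx
  exact hx

/-- The restriction of an odd function to the right half vanishes on the plane of symmetry. -/
theorem IsWeakDeriv.cut (hG : IsCanalWithBody Γ l Θ) {u g : ℝ × ℝ × ℝ → ℂ}
    (hu : IsOdd (water Γ Θ) u) {i : Fin 3} (h : IsWeakDeriv (water Γ Θ) (e3 i) u g)
    (hu2 : MemLp u 2 (volume.restrict (water Γ Θ)))
    (hg2 : MemLp g 2 (volume.restrict (water Γ Θ))) :
    IsWeakDeriv (water Γ Θ) (e3 i) (rightHalf.indicator u) (rightHalf.indicator g) := by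
  set Ω := water Γ Θ with hΩdef
  have hΩ : IsOpen Ω := isOpen_water hG
  have hHm : MeasurableSet rightHalf := isOpen_rightHalf.measurableSet
  have hind : ∀ f : ℝ × ℝ × ℝ → ℂ, MemLp f 2 (volume.restrict Ω) →
      LocallyIntegrableOn (rightHalf.indicator f) Ω := fun f hf =>
    locallyIntegrableOn_of_memLp (hf.indicator hHm)
  refine ⟨hind u hu2, hind g hg2, fun φ hφ hs => ?_⟩
  have hint : ∀ {f : ℝ × ℝ × ℝ → ℝ}, IsTest f →
      IntegrableOn (fun x => f x • g x + fderiv ℝ f x (e3 i) • u x) Ω := fun hf =>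
    (integrableOn_test_smul hg2 hf).add (integrableOn_test_smul hu2 (hf.fderiv_apply _))
  have hfr : ∀ {f : ℝ × ℝ × ℝ → ℝ}, tsupport f ⊆ Ω → ∀ x ∈ tsupport f, x ∈ frontier Ω →
      coordTwo x ≤ 0 := fun hf x hx hxf => by
    rw [hΩ.frontier_eq] at hxf
    exact absurd (hf hx) hxf.2
  have key : ∫ x in Ω ∩ rightHalf, (φ x • g x + fderiv ℝ φ x (e3 i) • u x) = 0 := by
    by_cases hi : i = 1
    · subst hi
      -- In the normal direction φ alone need not be small at the plane. The difference φ - φ' is,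
      -- so φ and φ' give the same integral over the right half; by oddness of u the integral of φ
      -- over the left half equals that of φ' over the right half. The two halves are therefore
      -- equal and add up to zero.
      set φ' : ℝ × ℝ × ℝ → ℝ := fun x => φ (reflL x) with hφ'
      have hφT' : IsTest φ' := isTest_comp_reflL hφ
      have hs' : tsupport φ' ⊆ Ω := by
        rw [hφ', tsupport_comp_reflL]
        exact (preimage_mono hs).trans (preimage_reflL_water hG).le
      have hsd : tsupport (fun x => φ x - φ' x) ⊆ Ω :=
        (tsupport_sub φ φ').trans (union_subset hs hs')
      obtain ⟨M, hM⟩ := hφ.exists_abs_sub_refl_le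
      have a1 : ∫ x in Ω ∩ rightHalf, ((φ x - φ' x) • g x +
          fderiv ℝ (fun x => φ x - φ' x) x (e3 1) • u x) = 0 :=
        flux_eq_zero hΩ h hu2 hg2 coordTwo (hφ.sub hφT') (hfr hsd) (M := M) (fun x _ => by
          have : coordTwo (e3 1) = 1 := by simp [e3]
          rw [this, abs_one, mul_one]
          exact hM x)
      have a2 : ∫ x in Ω ∩ rightHalf, (φ x • g x + fderiv ℝ φ x (e3 1) • u x) =
          ∫ x in Ω ∩ rightHalf, (φ' x • g x + fderiv ℝ φ' x (e3 1) • u x) := by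
        rw [← sub_eq_zero, ← integral_sub ((hint hφ).mono_set inter_subset_left)
          ((hint hφT').mono_set inter_subset_left), ← a1]
        refine integral_congr_ae (Eventually.of_forall fun x => ?_)
        have : fderiv ℝ (fun x => φ x - φ' x) x = fderiv ℝ φ x - fderiv ℝ φ' x :=
          fderiv_fun_sub (hφ.differentiable x) (hφT'.differentiable x)
        simp only [this, sub_apply, sub_smul]
        ring
      have a3 : ∫ x in Ω \ rightHalf, (φ x • g x + fderiv ℝ φ x (e3 1) • u x) =
          ∫ x in Ω ∩ rightHalf, (φ' x • g x + fderiv ℝ φ' x (e3 1) • u x) := by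
        rw [← setIntegral_comp_reflL _ (Ω \ rightHalf)]
        rw [setIntegral_congr_set (preimage_reflL_water_sdiff hG)]
        refine integral_congr_ae ?_
        have hsub : (volume.restrict (Ω ∩ rightHalf)) ≤ volume.restrict Ω :=
          Measure.restrict_mono inter_subset_left le_rfl
        filter_upwards [ae_mono hsub (ae_weakDeriv_reflL hG hu h), ae_mono hsub hu] with x h1 h2
        have e2 : fderiv ℝ φ' x (e3 1) = - fderiv ℝ φ (reflL x) (e3 1) := by
          rw [hφ', fderiv_comp_reflL hφ, ← map_neg]
          congr 1
          simp [e3]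
        have e3 : φ (reflL x) = φ' x := rfl
        rw [h1, show u (reflL x) = _ from h2, e2, e3, neg_smul, smul_neg]
      have a4 : ∫ x in Ω, (φ x • g x + fderiv ℝ φ x (e3 1) • u x) = 0 := by
        rw [integral_add (integrableOn_test_smul hg2 hφ)
          (integrableOn_test_smul hu2 (hφ.fderiv_apply _)), h.2.2 φ hφ hs]
        ring
      rw [← integral_inter_add_sdiff hHm (hint hφ), a3, ← a2] at a4
      have : (2 : ℂ) * ∫ x in Ω ∩ rightHalf, (φ x • g x + fderiv ℝ φ x (e3 1) • u x) = 0 := by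
        linear_combination a4
      simpa using this
    -- The other two directions are tangential to the plane of symmetry and produce no flux through
    -- it.
    · refine flux_eq_zero hΩ h hu2 hg2 coordTwo hφ (hfr hs) (M := 0) (fun x _ => ?_)
      have : coordTwo (e3 i) = 0 := by
        fin_cases i <;> simp [e3] at hi ⊢
      simp [this]
  have e1 : ∀ (f : ℝ × ℝ × ℝ → ℝ) (w : ℝ × ℝ × ℝ → ℂ),
      ∫ x in Ω, f x • rightHalf.indicator w x = ∫ x in Ω ∩ rightHalf, f x • w x := fun f w => by
    rw [inter_comm, ← Measure.restrict_restrict hHm, ← integral_indicator hHm]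
    refine integral_congr_ae (Eventually.of_forall fun x => ?_)
    by_cases hx : x ∈ rightHalf <;> simp [hx]
  rw [e1, e1, eq_neg_iff_add_eq_zero, ← key, integral_add, add_comm]
  · exact (integrableOn_test_smul hg2 hφ).mono_measure (Measure.restrict_mono inter_subset_left le_rfl)
  · exact (integrableOn_test_smul hu2 (hφ.fderiv_apply _)).mono_measure
      (Measure.restrict_mono inter_subset_left le_rfl)

/-- The restriction of a function to the right half. -/
noncomputable def cut (u : ℝ × ℝ × ℝ → ℂ) : ℝ × ℝ × ℝ → ℂ := rightHalf.indicator u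

/-- Oddness plays the role of a Dirichlet condition on the plane of symmetry. Hence the weak form in
the whole domain may be tested with functions supported in one half. -/
theorem MemH0.cut (hG : IsCanalWithBody Γ l Θ) {u : ℝ × ℝ × ℝ → ℂ} (hu : MemH0 (water Γ Θ) u) :
    MemH (water Γ Θ) (cut u) :=
  ⟨hu.1.1.indicator isOpen_rightHalf.measurableSet, fun i => by
    obtain ⟨g, hg, hg2⟩ := hu.1.2 i
    exact ⟨_, hg.cut hG hu.2 hu.1.1 hg2, hg2.indicator isOpen_rightHalf.measurableSet⟩⟩

theorem weakDeriv_cut (hG : IsCanalWithBody Γ l Θ) {u : ℝ × ℝ × ℝ → ℂ} (hu : MemH0 (water Γ Θ) u)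
    (i : Fin 3) : weakDeriv (water Γ Θ) (e3 i) (cut u) =ᵐ[volume.restrict (water Γ Θ)]
      rightHalf.indicator (weakDeriv (water Γ Θ) (e3 i) u) := by
  obtain ⟨h1, h2⟩ := memLp_weakDeriv (isOpen_water hG) hu.1 i
  exact (h1.cut hG hu.2 hu.1.1 h2).weakDeriv_ae (isOpen_water hG)

theorem exists_boundaries (hG : IsCanalWithBody Γ l Θ) : ∃ D : SectionBoundary Γ l,
    ∀ x ∈ closure Θ, x.2.2 ≤ -D.depth := by
  obtain ⟨h, hh, H⟩ := exists_body_depth hG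
  obtain ⟨D, hD, -⟩ := exists_sectionBoundary hG hh
  exact ⟨D, fun x hx => (H x hx).trans (neg_le_neg hD)⟩

theorem exists_waterBoundary (hG : IsCanalWithBody Γ l Θ) : Nonempty (WaterBoundary Γ l Θ) := by
  obtain ⟨D, hD⟩ := exists_boundaries hG
  exact ⟨D.toWater hG hD⟩

theorem tr_eq_surfaceTrace (D : WaterBoundary Γ l Θ) (u : ℝ × ℝ × ℝ → ℂ) :
    FlatBoundary.tr D u = surfaceTrace (water Γ Θ) l u := rfl

theorem memLp_surfaceTrace (hG : IsCanalWithBody Γ l Θ) {u : ℝ × ℝ × ℝ → ℂ}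
    (hu : MemH (water Γ Θ) u) :
    MemLp (surfaceTrace (water Γ Θ) l u) 2 (volume.restrict (surface l)) := by
  obtain ⟨D⟩ := exists_waterBoundary hG
  exact D.memLp_tr measurePreserving_spaceCoord exists_sum_e3 hu

theorem ae_snd_ne_zero : ∀ᵐ x : ℝ × ℝ, x.2 ≠ 0 := by
  have h : {x : ℝ × ℝ | ¬ x.2 ≠ 0} = univ ×ˢ {0} := by
    ext x; simp
  rw [ae_iff, h, Measure.volume_eq_prod, Measure.prod_prod]
  simp

/-- Traces are local: to the right of the plane `cut u` agrees with u, to the left with zero, and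
the line x₂ = 0 is a null set of the surface. -/
theorem surfaceTrace_cut (hG : IsCanalWithBody Γ l Θ) {u : ℝ × ℝ × ℝ → ℂ}
    (hu : MemH0 (water Γ Θ) u) :
    surfaceTrace (water Γ Θ) l (cut u) =ᵐ[volume.restrict (surface l)]
      {y | 0 < y.2}.indicator (surfaceTrace (water Γ Θ) l u) := by
  obtain ⟨D⟩ := exists_waterBoundary hG
  have hc := hu.cut hG
  have h1 := D.tr_ae_eq_of_ae_eq measurePreserving_spaceCoord exists_sum_e3 hc hu.1
    isOpen_rightHalf (Eventually.of_forall fun x hx => by simp [cut, hx])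
  have hO : IsOpen {x : ℝ × ℝ × ℝ | x.2.1 < 0} := isOpen_lt coordTwo.continuous continuous_const
  have h2 := D.tr_ae_eq_of_ae_eq measurePreserving_spaceCoord exists_sum_e3 hc (hu.1.const_smul 0)
    hO (Eventually.of_forall fun x hx => by
      have : x ∉ rightHalf := not_lt.2 (le_of_lt (show x.2.1 < 0 from hx))
      simp [cut, this])
  have h3 := D.tr_const_smul measurePreserving_spaceCoord exists_sum_e3 hu.1 0
  filter_upwards [ae_restrict_of_ae h1, ae_restrict_of_ae h2, h3, ae_restrict_of_ae ae_snd_ne_zero,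
    ae_restrict_mem (isOpen_surface l).measurableSet] with y h1 h2 h3 h0 hy
  rcases lt_or_gt_of_ne h0 with h | h
  · have hn : y ∉ {y : ℝ × ℝ | 0 < y.2} := not_lt.2 h.le
    rw [indicator_of_notMem hn]
    have h4 := (h2 hy h).trans h3
    rw [Pi.smul_apply, zero_smul] at h4
    exact h4
  · rw [indicator_of_mem (show y ∈ {y : ℝ × ℝ | 0 < y.2} from h)]
    exact h1 hy h

end Reflection

/-! ### Weighted means and mollification in one variable -/

section Mollifier

variable {α : Type*} [MeasurableSpace α] {ν : Measure α} [SFinite ν]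

/-- The weighted mean of a function with respect to the first variable. -/
noncomputable def avg (η : ℝ → ℝ) (f : ℝ × α → ℂ) (a : α) : ℂ := ∫ s, η s • f (s, a)

/-- Fubini for null sets. The exceptional set does not depend on η, which is essential because
mollification uses a different weight at each point. -/
theorem avg_congr {f f' : ℝ × α → ℂ} (h : f =ᵐ[(volume : Measure ℝ).prod ν] f') :
    ∀ᵐ a ∂ν, ∀ η, avg η f a = avg η f' a := by
  have h1 : ∀ᵐ p ∂(ν.prod (volume : Measure ℝ)), f (p.2, p.1) = f' (p.2, p.1) :=
    (Measure.measurePreserving_swap (μ := ν) (ν := (volume : Measure ℝ))).quasiMeasurePreserving.ae h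
  filter_upwards [Measure.ae_ae_of_ae_prod h1] with a ha η
  exact integral_congr_ae (ha.mono fun s hs => by simp only [hs])

theorem memLp_avg {η : ℝ → ℝ} (hη : MemLp η 2) {f : ℝ × α → ℂ}
    (hf : MemLp f 2 ((volume : Measure ℝ).prod ν)) : MemLp (avg η f) 2 ν := by
  have hm : AEStronglyMeasurable (fun p : ℝ × α => η p.1 • f p) ((volume : Measure ℝ).prod ν) :=
    hη.1.comp_fst.smul hf.1
  refine memLp_two_iff_l2sq.2 ⟨hm.prod_swap.integral_prod_right', ?_⟩
  calc l2sq ν (avg η f) ≤ ∫⁻ a, (l2sq volume η * ∫⁻ s, ‖f (s, a)‖ₑ ^ 2) ∂ν := by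
        have h2 : ∀ᵐ a ∂ν, AEStronglyMeasurable (fun s => f (s, a)) := by
          filter_upwards [hf.1.prod_swap.prodMk_left] with a ha using ha
        refine lintegral_mono_ae (h2.mono fun a ha => ?_)
        refine le_trans ?_ (sq_lintegral_mul_le hη.1.enorm ha.enorm)
        gcongr
        refine (enorm_integral_le_lintegral_enorm _).trans (le_of_eq ?_)
        exact lintegral_congr fun s => enorm_smul _ _
    _ = l2sq volume η * l2sq ((volume : Measure ℝ).prod ν) f := by
        rw [lintegral_const_mul' _ _ (l2sq_lt_top hη).ne, l2sq, l2sq,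
          lintegral_prod_symm _ (hf.1.enorm.pow_const 2)]
    _ < ⊤ := ENNReal.mul_lt_top (l2sq_lt_top hη) (l2sq_lt_top hf)

theorem memLp_mul_prod {η : ℝ → ℝ} (hη : MemLp η 2) {φ : α → ℝ} (hφ : MemLp φ 2 ν) :
    MemLp (fun p : ℝ × α => η p.1 * φ p.2) 2 ((volume : Measure ℝ).prod ν) := by
  refine memLp_two_iff_l2sq.2 ⟨hη.1.comp_fst.mul hφ.1.comp_snd, ?_⟩
  have : l2sq ((volume : Measure ℝ).prod ν) (fun p : ℝ × α => η p.1 * φ p.2) =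
      l2sq volume η * l2sq ν φ := by
    simp only [l2sq, enorm_mul, mul_pow]
    exact lintegral_prod_mul (hη.1.enorm.pow_const 2) (hφ.1.enorm.pow_const 2)
  rw [this]
  exact ENNReal.mul_lt_top (l2sq_lt_top hη) (l2sq_lt_top hφ)

theorem integral_smul_avg {η : ℝ → ℝ} (hη : MemLp η 2) {f : ℝ × α → ℂ}
    (hf : MemLp f 2 ((volume : Measure ℝ).prod ν)) {φ : α → ℝ} (hφ : MemLp φ 2 ν) :
    ∫ a, φ a • avg η f a ∂ν = ∫ p, (η p.1 * φ p.2) • f p ∂((volume : Measure ℝ).prod ν) := by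
  rw [integral_prod_symm _ (integrable_smul_of_memLp_two (memLp_mul_prod hη hφ) hf)]
  refine integral_congr_ae (Eventually.of_forall fun a => ?_)
  simp only [avg, ← integral_smul, smul_smul, mul_comm]

/-- A sequence of bump functions that shrinks to the origin. -/
noncomputable def bump (n : ℕ) : ContDiffBump (0 : ℝ) where
  rIn := 1 / (n + 1) / 2
  rOut := 1 / (n + 1)
  rIn_pos := by positivity
  rIn_lt_rOut := half_lt_self (by positivity)

/-- The normalized bump functions. -/
noncomputable def kern (n : ℕ) (s : ℝ) : ℝ := (bump n).normed volume s

theorem contDiff_kern (n : ℕ) : ContDiff ℝ ∞ (kern n) := (bump n).contDiff_normed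

theorem kern_nonneg (n : ℕ) (s : ℝ) : 0 ≤ kern n s := (bump n).nonneg_normed s

theorem tsupport_kern (n : ℕ) : tsupport (kern n) ⊆ Icc (-1) 1 := by
  refine ((bump n).tsupport_normed_eq (μ := volume)).le.trans ?_
  rw [Real.closedBall_eq_Icc, zero_sub, zero_add]
  have : (bump n).rOut ≤ 1 := by
    simp only [bump]
    rw [div_le_one (by positivity)]
    linarith [n.cast_nonneg (α := ℝ)]
  exact Icc_subset_Icc (neg_le_neg this) this

theorem lintegral_kern (n : ℕ) : ∫⁻ s, ‖kern n s‖ₑ = 1 := by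
  have h1 : Integrable (kern n) := (bump n).integrable_normed
  have h2 : ∫ s, kern n s = 1 := (bump n).integral_normed
  rw [← ofReal_integral_norm_eq_lintegral_enorm h1]
  simp only [Real.norm_of_nonneg (kern_nonneg n _), h2, ENNReal.ofReal_one]

/-- Mollification in the first variable. -/
noncomputable def mollify (n : ℕ) (f : ℝ × α → ℂ) (p : ℝ × α) : ℂ :=
  avg (fun s => kern n (p.1 - s)) f p.2

theorem mollify_congr (n : ℕ) {f f' : ℝ × α → ℂ} (h : f =ᵐ[(volume : Measure ℝ).prod ν] f')
    {μ : Measure ℝ} [SFinite μ] : mollify n f =ᵐ[μ.prod ν] mollify n f' :=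
  (Measure.quasiMeasurePreserving_snd.ae (avg_congr h)).mono fun _ hp => hp _

theorem measurable_kern_sub (n : ℕ) : Measurable fun q : (ℝ × α) × ℝ => kern n (q.1.1 - q.2) :=
  (contDiff_kern n).continuous.measurable.comp (by fun_prop)

theorem stronglyMeasurable_mollify (n : ℕ) {f : ℝ × α → ℂ} (hf : Measurable f) :
    StronglyMeasurable (mollify n f) := by
  have : Measurable fun q : (ℝ × α) × ℝ => kern n (q.1.1 - q.2) • f (q.2, q.1.2) :=
    (measurable_kern_sub n).smul (hf.comp (by fun_prop))
  exact this.stronglyMeasurable.integral_prod_right'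

/-- Jensen's inequality for the probability density `kern n`, obtained from Cauchy–Schwarz by
splitting the kernel into two square roots. -/
theorem enorm_mollify_sq_le (n : ℕ) {f : ℝ × α → ℂ} (hf : Measurable f) (p : ℝ × α) :
    ‖mollify n f p‖ₑ ^ 2 ≤ ∫⁻ s, ‖kern n (p.1 - s)‖ₑ * ‖f (s, p.2)‖ₑ ^ 2 := by
  have hk : Measurable fun s => ‖kern n (p.1 - s)‖ₑ ^ (1 / 2 : ℝ) :=
    ((contDiff_kern n).continuous.measurable.comp (by fun_prop)).enorm.pow_const _
  have hfm : Measurable fun s => ‖f (s, p.2)‖ₑ := (hf.comp (by fun_prop)).enorm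
  have hs : ∀ s, (‖kern n (p.1 - s)‖ₑ ^ (1 / 2 : ℝ)) ^ 2 = ‖kern n (p.1 - s)‖ₑ := fun s => by
    rw [← ENNReal.rpow_natCast, ← ENNReal.rpow_mul]
    simp
  calc ‖mollify n f p‖ₑ ^ 2
      ≤ (∫⁻ s, ‖kern n (p.1 - s)‖ₑ ^ (1 / 2 : ℝ) *
          (‖kern n (p.1 - s)‖ₑ ^ (1 / 2 : ℝ) * ‖f (s, p.2)‖ₑ)) ^ 2 := by
        gcongr
        refine (enorm_integral_le_lintegral_enorm _).trans (le_of_eq ?_)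
        refine lintegral_congr fun s => ?_
        rw [enorm_smul, ← mul_assoc, ← sq, hs]
    _ ≤ _ := (sq_lintegral_mul_le hk.aemeasurable (hk.mul hfm).aemeasurable)
    _ = _ := by
        simp only [mul_pow, hs]
        rw [lintegral_sub_left_eq_self (fun s => ‖kern n s‖ₑ), lintegral_kern, one_mul]

/-- Young's inequality: integrate the pointwise Jensen bound and exchange the order, using that the
kernel has integral one. A measurable representative is needed for Tonelli. -/
theorem l2sq_mollify_le (n : ℕ) {f : ℝ × α → ℂ}
    (hf : AEStronglyMeasurable f ((volume : Measure ℝ).prod ν)) :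
    l2sq ((volume : Measure ℝ).prod ν) (mollify n f) ≤ l2sq ((volume : Measure ℝ).prod ν) f := by
  rw [l2sq_congr (mollify_congr n hf.ae_eq_mk), l2sq_congr hf.ae_eq_mk]
  set g := hf.mk f
  have hg : Measurable g := hf.stronglyMeasurable_mk.measurable
  have hm : Measurable fun q : (ℝ × α) × ℝ => ‖kern n (q.1.1 - q.2)‖ₑ * ‖g (q.2, q.1.2)‖ₑ ^ 2 :=
    (measurable_kern_sub n).enorm.mul ((hg.comp (by fun_prop)).enorm.pow_const 2)
  calc l2sq ((volume : Measure ℝ).prod ν) (mollify n g)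
      ≤ ∫⁻ p, (∫⁻ s, ‖kern n (p.1 - s)‖ₑ * ‖g (s, p.2)‖ₑ ^ 2) ∂((volume : Measure ℝ).prod ν) :=
        lintegral_mono fun p => enorm_mollify_sq_le n hg p
    _ = ∫⁻ a, (∫⁻ t, ∫⁻ s, ‖kern n (t - s)‖ₑ * ‖g (s, a)‖ₑ ^ 2) ∂ν :=
        lintegral_prod_symm _ hm.lintegral_prod_right'.aemeasurable
    _ = ∫⁻ a, (∫⁻ s, ‖g (s, a)‖ₑ ^ 2) ∂ν := by
        refine lintegral_congr fun a => ?_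
        have ha : Measurable fun q : ℝ × ℝ => ‖kern n (q.1 - q.2)‖ₑ * ‖g (q.2, a)‖ₑ ^ 2 :=
          ((contDiff_kern n).continuous.measurable.comp (measurable_fst.sub measurable_snd)).enorm.mul
            ((hg.comp (measurable_snd.prodMk measurable_const)).enorm.pow_const 2)
        rw [lintegral_lintegral_swap ha.aemeasurable]
        refine lintegral_congr fun s => ?_
        rw [lintegral_mul_const' _ _ (by simp), lintegral_sub_right_eq_self (fun t => ‖kern n t‖ₑ),
          lintegral_kern, one_mul]
    _ = _ := (lintegral_prod_symm _ (hg.enorm.pow_const 2).aemeasurable).symm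

theorem ae_tendsto_kern_integral {f : ℝ → ℂ} (hf : LocallyIntegrable f) :
    ∀ᵐ t, Tendsto (fun n => ∫ s, kern n (t - s) • f s) atTop (𝓝 (f t)) := by
  have h := ContDiffBump.ae_convolution_tendsto_right_of_locallyIntegrable (φ := bump) (l := atTop)
    (K := 2) tendsto_one_div_add_atTop_nhds_zero_nat (Eventually.of_forall fun n => by
      simp only [bump]; linarith) hf
  filter_upwards [h] with t ht
  refine ht.congr fun n => ?_
  rw [convolution_lsmul_swap]
  rfl

/-- On almost every line the mollifications converge almost everywhere to the function, and Fatou's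
lemma, used first on the lines and then across them, transfers the uniform bound. -/
theorem l2sq_le_of_mollify_le {f : ℝ × α → ℂ} (hf : MemLp f 2 ((volume : Measure ℝ).prod ν))
    {A : Set ℝ} {C : ℝ≥0∞} (h : ∀ n, l2sq ((volume.restrict A).prod ν) (mollify n f) ≤ C) :
    l2sq ((volume.restrict A).prod ν) f ≤ C := by
  set g := hf.1.mk f
  have hg : Measurable g := hf.1.stronglyMeasurable_mk.measurable
  have hfg : f =ᵐ[(volume : Measure ℝ).prod ν] g := hf.1.ae_eq_mk
  have hac : (volume.restrict A).prod ν ≤ (volume : Measure ℝ).prod ν :=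
    by
    rw [Measure.restrict_prod_eq_prod_univ]
    exact Measure.restrict_le_self
  simp only [fun n => l2sq_congr (mollify_congr n hfg (μ := volume.restrict A))] at h
  rw [l2sq_congr (ae_mono hac hfg)]
  have hg2 : MemLp g 2 ((volume : Measure ℝ).prod ν) := (memLp_congr_ae hfg).1 hf
  have hloc : ∀ᵐ a ∂ν, LocallyIntegrable (fun t => g (t, a)) := by
    have h1 : ∫⁻ a, (∫⁻ t, ‖g (t, a)‖ₑ ^ 2) ∂ν < ⊤ := by
      rw [← lintegral_prod_symm _ (hg.enorm.pow_const 2).aemeasurable]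
      exact l2sq_lt_top hg2
    filter_upwards [ae_lt_top (hg.comp measurable_swap |>.enorm.pow_const 2).lintegral_prod_right'
      h1.ne] with a ha
    exact (memLp_two_iff_l2sq.2 ⟨(hg.comp (by fun_prop)).aestronglyMeasurable, ha⟩).locallyIntegrable
      (by norm_num)
  have key : ∀ᵐ a ∂ν, ∫⁻ t in A, ‖g (t, a)‖ₑ ^ 2 ≤
      liminf (fun n => ∫⁻ t in A, ‖mollify n g (t, a)‖ₑ ^ 2) atTop := by
    filter_upwards [hloc] with a ha
    refine le_trans (lintegral_mono_ae ?_) (lintegral_liminf_le fun n =>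
      ((stronglyMeasurable_mollify n hg).measurable.comp (by fun_prop)).enorm.pow_const 2)
    filter_upwards [ae_restrict_of_ae (ae_tendsto_kern_integral ha)] with t ht
    have := ((ENNReal.continuous_pow 2).comp continuous_enorm).tendsto _ |>.comp ht
    exact this.liminf_eq.symm.le
  calc l2sq ((volume.restrict A).prod ν) g = ∫⁻ a, (∫⁻ t in A, ‖g (t, a)‖ₑ ^ 2) ∂ν :=
        lintegral_prod_symm _ (hg.enorm.pow_const 2).aemeasurable
    _ ≤ ∫⁻ a, liminf (fun n => ∫⁻ t in A, ‖mollify n g (t, a)‖ₑ ^ 2) atTop ∂ν :=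
        lintegral_mono_ae key
    _ ≤ liminf (fun n => ∫⁻ a, (∫⁻ t in A, ‖mollify n g (t, a)‖ₑ ^ 2) ∂ν) atTop :=
        lintegral_liminf_le fun n => Measurable.lintegral_prod_right'
          (f := fun q : α × ℝ => ‖mollify n g (q.2, q.1)‖ₑ ^ 2)
          (((stronglyMeasurable_mollify n hg).measurable.comp measurable_swap).enorm.pow_const 2)
    _ ≤ C := by
        refine liminf_le_of_le (by isBoundedDefault) fun b hb => ?_
        obtain ⟨n, hn⟩ := hb.exists
        refine hn.trans (le_trans (le_of_eq ?_) (h n))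
        exact (lintegral_prod_symm _
          ((stronglyMeasurable_mollify n hg).measurable.enorm.pow_const 2).aemeasurable).symm

end Mollifier

/-! ### Weighted means over the cylindrical part of the canal -/

section Slab

variable {Γ : Set (ℝ × ℝ)} {l : ℝ} {Θ : Set (ℝ × ℝ × ℝ)} {R : ℝ}

/-- The points outside the interval `[-R, R]`. -/
def far (R : ℝ) : Set ℝ := {s | R < |s|}

theorem isOpen_far (R : ℝ) : IsOpen (far R) := isOpen_lt continuous_const continuous_abs

/-- The product of a function of `x₁` and a function of the other variables. -/
noncomputable def tensor (η : ℝ → ℝ) (φ : ℝ × ℝ → ℝ) (x : ℝ × ℝ × ℝ) : ℝ := η x.1 * φ x.2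

theorem tsupport_tensor (η : ℝ → ℝ) (φ : ℝ × ℝ → ℝ) :
    tsupport (tensor η φ) ⊆ tsupport η ×ˢ tsupport φ :=
  closure_minimal (fun _ hx => ⟨subset_tsupport _ (left_ne_zero_of_mul hx),
    subset_tsupport _ (right_ne_zero_of_mul hx)⟩)
    ((isClosed_tsupport η).prod (isClosed_tsupport φ))

theorem isTest_tensor {η : ℝ → ℝ} (hη : IsTest η) {φ : ℝ × ℝ → ℝ} (hφ : IsTest φ) :
    IsTest (tensor η φ) := by
  refine ⟨(hη.1.comp contDiff_fst).mul (hφ.1.comp contDiff_snd), ?_⟩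
  exact (hη.2.isCompact.prod hφ.2.isCompact).of_isClosed_subset (isClosed_tsupport _)
    (tsupport_tensor η φ)

theorem fderiv_tensor {η : ℝ → ℝ} (hη : IsTest η) {φ : ℝ × ℝ → ℝ} (hφ : IsTest φ)
    (x : ℝ × ℝ × ℝ) (v : ℝ × ℝ) :
    fderiv ℝ (tensor η φ) x (0, v) = tensor η (fun x => fderiv ℝ φ x v) x := by
  have h1 : HasFDerivAt (fun x : ℝ × ℝ × ℝ => η x.1)
      ((fderiv ℝ η x.1).comp (ContinuousLinearMap.fst ℝ ℝ (ℝ × ℝ))) x :=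
    (hη.differentiable x.1).hasFDerivAt.comp x hasFDerivAt_fst
  have h2 : HasFDerivAt (fun x : ℝ × ℝ × ℝ => φ x.2)
      ((fderiv ℝ φ x.2).comp (ContinuousLinearMap.snd ℝ ℝ (ℝ × ℝ))) x :=
    (hφ.differentiable x.2).hasFDerivAt.comp x hasFDerivAt_snd
  have h3 := (h1.mul h2).fderiv
  change fderiv ℝ (tensor η φ) x = _ at h3
  rw [h3]
  simp [tensor]

/-- The restriction of a function to `|x₁| > R`. -/
noncomputable def farPart (R : ℝ) {α : Type*} (u : ℝ × α → ℂ) : ℝ × α → ℂ :=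
  (Prod.fst ⁻¹' far R).indicator u

theorem measurableSet_far {α : Type*} [MeasurableSpace α] :
    MeasurableSet (Prod.fst ⁻¹' far R : Set (ℝ × α)) :=
  measurable_fst (isOpen_far R).measurableSet

theorem prod_restrict_section (Γ : Set (ℝ × ℝ)) :
    (volume : Measure ℝ).prod (volume.restrict Γ) = volume.restrict (canal Γ) := by
  have : canal Γ = univ ×ˢ Γ := by ext; simp [canal]
  rw [this, Measure.volume_eq_prod ℝ (ℝ × ℝ), ← Measure.prod_restrict, Measure.restrict_univ]

theorem water_inter_far (hR : ∀ x ∈ closure Θ, |x.1| < R) :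
    canal Γ ∩ Prod.fst ⁻¹' far R = water Γ Θ ∩ Prod.fst ⁻¹' far R := by
  ext x
  refine ⟨fun h => ⟨⟨h.1, fun hx => ?_⟩, h.2⟩, fun h => ⟨h.1.1, h.2⟩⟩
  exact lt_asymm (hR x hx) h.2

theorem restrict_far (hR : ∀ x ∈ closure Θ, |x.1| < R) :
    ((volume : Measure ℝ).prod (volume.restrict Γ)).restrict (Prod.fst ⁻¹' far R) =
      (volume.restrict (water Γ Θ)).restrict (Prod.fst ⁻¹' far R) := by
  rw [prod_restrict_section, Measure.restrict_restrict measurableSet_far,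
    Measure.restrict_restrict measurableSet_far, inter_comm, water_inter_far hR, inter_comm]

theorem memLp_farPart (hR : ∀ x ∈ closure Θ, |x.1| < R) {u : ℝ × ℝ × ℝ → ℂ}
    (hu : MemLp u 2 (volume.restrict (water Γ Θ))) :
    MemLp (farPart R u) 2 ((volume : Measure ℝ).prod (volume.restrict Γ)) := by
  rw [farPart, memLp_indicator_iff_restrict measurableSet_far, restrict_far hR]
  exact hu.restrict _

theorem l2sq_farPart (hR : ∀ x ∈ closure Θ, |x.1| < R) (u : ℝ × ℝ × ℝ → ℂ) :
    l2sq ((volume : Measure ℝ).prod (volume.restrict Γ)) (farPart R u) =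
      l2sq (volume.restrict (water Γ Θ ∩ Prod.fst ⁻¹' far R)) u := by
  rw [inter_comm, ← Measure.restrict_restrict measurableSet_far, ← restrict_far hR, l2sq, l2sq,
    ← lintegral_indicator measurableSet_far]
  refine lintegral_congr fun x => ?_
  by_cases hx : x ∈ (Prod.fst ⁻¹' far R : Set (ℝ × ℝ × ℝ)) <;> simp [farPart, hx]

theorem setIntegral_tensor_smul (hR : ∀ x ∈ closure Θ, |x.1| < R) {η : ℝ → ℝ}
    (hη : tsupport η ⊆ far R) (φ : ℝ × ℝ → ℝ) (u : ℝ × ℝ × ℝ → ℂ) :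
    ∫ x in water Γ Θ, tensor η φ x • u x = ∫ x, (η x.1 * φ x.2) • farPart R u x
      ∂((volume : Measure ℝ).prod (volume.restrict Γ)) := by
  have h0 : ∀ (μ : Measure (ℝ × ℝ × ℝ)), ∫ x, tensor η φ x • farPart R u x ∂μ =
      ∫ x, tensor η φ x • u x ∂(μ.restrict (Prod.fst ⁻¹' far R)) := fun μ => by
    rw [← integral_indicator measurableSet_far]
    refine integral_congr_ae (Eventually.of_forall fun x => ?_)
    by_cases hx : x ∈ (Prod.fst ⁻¹' far R : Set (ℝ × ℝ × ℝ)) <;> simp [farPart, hx]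
  change _ = ∫ x, tensor η φ x • farPart R u x ∂_
  rw [h0, restrict_far hR, ← h0]
  refine integral_congr_ae (Eventually.of_forall fun x => ?_)
  by_cases hx : x.1 ∈ far R
  · have : x ∈ (Prod.fst ⁻¹' far R : Set (ℝ × ℝ × ℝ)) := hx
    simp [farPart, this]
  · simp [tensor, image_eq_zero_of_notMem_tsupport fun h => hx (hη h)]

theorem setIntegral_tensor_smul_eq (hR : ∀ x ∈ closure Θ, |x.1| < R) {η : ℝ → ℝ} (hη : IsTest η)
    (hs : tsupport η ⊆ far R) {φ : ℝ × ℝ → ℝ} (hφ : IsTest φ) {u : ℝ × ℝ × ℝ → ℂ}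
    (hu : MemLp u 2 (volume.restrict (water Γ Θ))) :
    ∫ x in water Γ Θ, tensor η φ x • u x = ∫ x in Γ, φ x • avg η (farPart R u) x := by
  rw [setIntegral_tensor_smul hR hs,
    integral_smul_avg (hη.memLp 2 _) (memLp_farPart hR hu) (hφ.memLp 2 _)]

/-- Test with the product of η and φ: it is supported in the part of the water that is a cylinder.
Weighted means in x₁ are thus functions of x' with honest weak derivatives, so individual slices of
an H¹ function need not be considered. -/
theorem isWeakDeriv_avg (hR : ∀ x ∈ closure Θ, |x.1| < R) {η : ℝ → ℝ} (hη : IsTest η)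
    (hs : tsupport η ⊆ far R) {u g : ℝ × ℝ × ℝ → ℂ} {v : ℝ × ℝ}
    (hu : MemLp u 2 (volume.restrict (water Γ Θ))) (hg : MemLp g 2 (volume.restrict (water Γ Θ)))
    (h : IsWeakDeriv (water Γ Θ) (0, v) u g) :
    IsWeakDeriv Γ v (avg η (farPart R u)) (avg η (farPart R g)) := by
  refine ⟨locallyIntegrableOn_of_memLp (memLp_avg (hη.memLp 2 _) (memLp_farPart hR hu)),
    locallyIntegrableOn_of_memLp (memLp_avg (hη.memLp 2 _) (memLp_farPart hR hg)),
    fun φ hφ hφs => ?_⟩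
  rw [← setIntegral_tensor_smul_eq hR hη hs hφ hg,
    ← setIntegral_tensor_smul_eq hR hη hs (hφ.fderiv_apply v) hu,
    ← h.2.2 _ (isTest_tensor hη hφ) fun x hx => ?_]
  · simp only [fderiv_tensor hη hφ]
  · obtain ⟨h1, h2⟩ := tsupport_tensor η φ hx
    exact ((water_inter_far hR).le ⟨hφs h2, hs h1⟩).1

theorem e3_succ (i : Fin 2) : e3 i.succ = (0, e2 i) := by
  fin_cases i <;> rfl

theorem memSection0_avg (hR : ∀ x ∈ closure Θ, |x.1| < R) {η : ℝ → ℝ}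
    (hη : IsTest η) (hs : tsupport η ⊆ far R) {u : ℝ × ℝ × ℝ → ℂ} (hu : MemH (water Γ Θ) u)
    (h0 : ∀ᵐ x ∂(volume.restrict (water Γ Θ)), x ∉ rightHalf → u x = 0) :
    MemSection0 Γ (avg η (farPart R u)) := by
  refine ⟨⟨memLp_avg (hη.memLp 2 _) (memLp_farPart hR hu.1), fun i => ?_⟩, ?_⟩
  · obtain ⟨g, hg, hg2⟩ := hu.2 i.succ
    rw [e3_succ] at hg
    exact ⟨_, isWeakDeriv_avg hR hη hs hu.1 hg2 hg, memLp_avg (hη.memLp 2 _) (memLp_farPart hR hg2)⟩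
  · have h1 : ∀ᵐ x ∂((volume : Measure ℝ).prod (volume.restrict Γ)),
        x ∉ rightHalf → farPart R u x = 0 := by
      have h2 := ae_restrict_of_ae (s := Prod.fst ⁻¹' far R) h0
      rw [← restrict_far hR, ae_restrict_iff' measurableSet_far] at h2
      filter_upwards [h2] with x hx hxr
      by_cases hxf : x ∈ (Prod.fst ⁻¹' far R : Set (ℝ × ℝ × ℝ))
      · simp [farPart, hxf, hx hxf hxr]
      · simp [farPart, hxf]
    have h2 : farPart R u =ᵐ[(volume : Measure ℝ).prod (volume.restrict Γ)]
        rightHalf.indicator (farPart R u) := by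
      filter_upwards [h1] with x hx
      by_cases hxr : x ∈ rightHalf <;> simp [hxr, hx]
    filter_upwards [avg_congr h2] with a ha h3
    rw [ha]
    refine integral_eq_zero_of_ae (Eventually.of_forall fun s => ?_)
    have : (s, a) ∉ rightHalf := not_lt.2 h3
    simp [this]

theorem weakDeriv_avg (hG : IsCanalWithBody Γ l Θ) (hR : ∀ x ∈ closure Θ, |x.1| < R) {η : ℝ → ℝ}
    (hη : IsTest η) (hs : tsupport η ⊆ far R) {u : ℝ × ℝ × ℝ → ℂ} (hu : MemH (water Γ Θ) u)
    (i : Fin 2) : weakDeriv Γ (e2 i) (avg η (farPart R u)) =ᵐ[volume.restrict Γ]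
      avg η (farPart R (weakDeriv (water Γ Θ) (e3 i.succ) u)) := by
  obtain ⟨h1, h2⟩ := memLp_weakDeriv (isOpen_water hG) hu i.succ
  rw [e3_succ] at h1 h2 ⊢
  exact (isWeakDeriv_avg hR hη hs hu.1 h2 h1).weakDeriv_ae hG.isOpen_section

theorem surface_eq (l : ℝ) : (volume : Measure ℝ).prod (volume.restrict (Ioo (-l) l)) =
    volume.restrict (surface l) := by
  rw [surface, Measure.volume_eq_prod, ← Measure.prod_restrict, Measure.restrict_univ]

/-- The trace formula of the canal, tested with the product of η and φ, becomes after Fubini the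
trace formula of the cross-section for the mean. -/
theorem sectionTrace_avg (hG : IsCanalWithBody Γ l Θ) (hR : ∀ x ∈ closure Θ, |x.1| < R) {η : ℝ → ℝ}
    (hη : IsTest η) (hs : tsupport η ⊆ far R) {u : ℝ × ℝ × ℝ → ℂ} (hu : MemH (water Γ Θ) u)
    (hv : MemH1 Γ e2 (avg η (farPart R u))) :
    sectionTrace Γ l (avg η (farPart R u)) =ᵐ[volume.restrict (Ioo (-l) l)]
      avg η (surfaceTrace (water Γ Θ) l u) := by
  obtain ⟨D₂, -⟩ := exists_boundaries hG
  obtain ⟨D⟩ := exists_waterBoundary hG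
  have htr := memLp_surfaceTrace hG hu
  rw [← surface_eq] at htr
  have hT := D.isTrace_tr measurePreserving_spaceCoord exists_sum_e3 hu
  refine D₂.tr_ae_eq (MeasurePreserving.id _) exists_sum_e2 hv
    ⟨locallyIntegrableOn_of_memLp (memLp_avg (hη.memLp 2 _) htr), fun φ hφ hd => ?_⟩
  have hj : Continuous fun y : ℝ => ((y, 0) : ℝ × ℝ) := by fun_prop
  have hdir : spaceCoord ((0, 0), 1) = (0, ((0 : ℝ), (1 : ℝ))) := rfl
  -- Within the support of η the boundary of the water domain is that of the cylinder, so
  -- admissibility of φ on the cross-section is inherited.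
  have hadm : Disjoint (tsupport (tensor η φ))
      (frontier (water Γ Θ) \ (fun y => spaceCoord (y, 0)) '' surface l) := by
    refine disjoint_left.2 fun x hx hxf => ?_
    obtain ⟨h1, h2⟩ := tsupport_tensor η φ hx
    refine disjoint_left.1 hd h2 ⟨?_, ?_⟩
    · rw [(isOpen_water hG).frontier_eq] at hxf
      rw [hG.isOpen_section.frontier_eq]
      refine ⟨?_, fun h => hxf.1.2 ((water_inter_far hR).le ⟨h, hs h1⟩).1⟩
      exact closure_minimal (t := Prod.snd ⁻¹' closure Γ) (fun y hy => subset_closure hy.1)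
        (isClosed_closure.preimage continuous_snd) hxf.1.1
    · rintro ⟨y, hy, hyx⟩
      refine hxf.2 ⟨(x.1, y), ⟨trivial, hy⟩, ?_⟩
      have : x.2 = (y, 0) := hyx.symm
      ext <;> simp [this]
  have key := hT.2 (tensor η φ) (isTest_tensor hη hφ) hadm
  obtain ⟨h1, h2⟩ := memLp_weakDeriv (isOpen_water hG) hu (Fin.succ 1)
  have e1 : spaceCoord ((0 : ℝ × ℝ), (1 : ℝ)) = e3 (Fin.succ 1) := rfl
  rw [e1] at key
  have hfd : ∀ x, fderiv ℝ (tensor η φ) x (e3 (Fin.succ 1)) =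
      tensor η (fun x => fderiv ℝ φ x (e2 1)) x := fun x => fderiv_tensor hη hφ x _
  rw [integral_add (integrableOn_test_smul h2 (isTest_tensor hη hφ))
    (integrableOn_test_smul hu.1 ((isTest_tensor hη hφ).fderiv_apply _))] at key
  simp only [hfd] at key
  rw [setIntegral_tensor_smul_eq hR hη hs hφ h2,
    setIntegral_tensor_smul_eq hR hη hs (hφ.fderiv_apply _) hu.1] at key
  have hA := memLp_avg (hη.memLp 2 _) (memLp_farPart hR h2)
  have hB := memLp_avg (hη.memLp 2 _) (memLp_farPart hR hu.1)
  rw [← integral_add (integrableOn_test_smul hA hφ)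
    (integrableOn_test_smul hB (hφ.fderiv_apply _))] at key
  have hw := weakDeriv_avg hG hR hη hs hu 1
  have e2 : ∫ x in Γ, (φ x • weakDeriv Γ (e2 1) (avg η (farPart R u)) x +
      fderiv ℝ φ x (e2 1) • avg η (farPart R u) x) = _ :=
    (integral_congr_ae (hw.mono fun x hx => by simp only [hx])).trans key
  refine e2.trans ?_
  have hφj : MemLp (fun y : ℝ => φ (y, 0)) 2 (volume.restrict (Ioo (-l) l)) := by
    obtain ⟨C, hC⟩ := hφ.exists_bound
    exact MemLp.of_bound (hφ.continuous.comp hj).aestronglyMeasurable C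
      (Eventually.of_forall fun y => hC _)
  rw [← surface_eq]
  exact (integral_smul_avg (hη.memLp 2 _) htr hφj).symm

end Slab

/-! ### Steklov and Poincaré inequalities beyond the body -/

section SlabInequality

theorem isTest_kern_sub (n : ℕ) (t : ℝ) : IsTest fun s => kern n (t - s) := by
  refine ⟨(contDiff_kern n).comp (contDiff_const.sub contDiff_id), ?_⟩
  have h : HasCompactSupport (kern n) :=
    isCompact_Icc.of_isClosed_subset (isClosed_tsupport _) (tsupport_kern n)
  exact h.comp_homeomorph (Homeomorph.subLeft t)

/-- All kernels have radius at most 1. This is why the resulting inequalities compare the region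
|x₁| > R + 1 with |x₁| > R. -/
theorem tsupport_kern_sub (n : ℕ) {t R : ℝ} (ht : t ∈ far (R + 1)) :
    tsupport (fun s => kern n (t - s)) ⊆ far R := by
  intro s hs
  have h1 : t - s ∈ tsupport (kern n) :=
    tsupport_comp_subset_preimage (kern n) (f := fun s => t - s) (by fun_prop) hs
  have h2 := abs_le.2 (tsupport_kern n h1)
  have h3 : |t| ≤ |t - s| + |s| := by simpa using abs_add_le (t - s) s
  have h4 : R + 1 < |t| := ht
  change R < |s|
  linarith

variable {α β ι : Type*} [MeasurableSpace α] [MeasurableSpace β] {ν : Measure α} {ν' : Measure β}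
  [SFinite ν] [SFinite ν']

theorem aestronglyMeasurable_mollify (n : ℕ) {f : ℝ × α → ℂ}
    (hf : AEStronglyMeasurable f ((volume : Measure ℝ).prod ν)) (μ : Measure ℝ) [SFinite μ] :
    AEStronglyMeasurable (mollify n f) (μ.prod ν) :=
  ⟨_, stronglyMeasurable_mollify n hf.stronglyMeasurable_mk.measurable,
    mollify_congr n hf.ae_eq_mk⟩

theorem l2sq_mollify_eq (n : ℕ) {f : ℝ × α → ℂ}
    (hf : AEStronglyMeasurable f ((volume : Measure ℝ).prod ν)) (μ : Measure ℝ) [SFinite μ] :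
    l2sq (μ.prod ν) (mollify n f) = ∫⁻ t, l2sq ν (avg (fun s => kern n (t - s)) f) ∂μ := by
  rw [l2sq, lintegral_prod _ ((aestronglyMeasurable_mollify n hf μ).enorm.pow_const 2)]
  rfl

theorem aemeasurable_l2sq_avg (n : ℕ) {f : ℝ × α → ℂ}
    (hf : AEStronglyMeasurable f ((volume : Measure ℝ).prod ν)) (μ : Measure ℝ) [SFinite μ] :
    AEMeasurable (fun t => l2sq ν (avg (fun s => kern n (t - s)) f)) μ :=
  ((aestronglyMeasurable_mollify n hf μ).enorm.pow_const 2).lintegral_prod_right'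

theorem prod_restrict_le (A : Set ℝ) :
    (volume.restrict A).prod ν ≤ (volume : Measure ℝ).prod ν := by
  rw [Measure.restrict_prod_eq_prod_univ]
  exact Measure.restrict_le_self

/-- An inequality between square integrals of weighted means is inherited by square integrals. -/
theorem l2sq_le_of_avg_le {R : ℝ} {c : ℝ≥0∞} (hc : c ≠ ⊤) {f : ℝ × α → ℂ}
    (hf : MemLp f 2 ((volume : Measure ℝ).prod ν)) (s : Finset ι) {A : ι → ℝ × β → ℂ}
    (hA : ∀ i, MemLp (A i) 2 ((volume : Measure ℝ).prod ν'))
    (h : ∀ η, IsTest η → tsupport η ⊆ far R →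
      c * l2sq ν (avg η f) ≤ ∑ i ∈ s, l2sq ν' (avg η (A i))) :
    c * l2sq ((volume.restrict (far (R + 1))).prod ν) f ≤
      ∑ i ∈ s, l2sq ((volume : Measure ℝ).prod ν') (A i) := by
  rcases eq_or_ne c 0 with rfl | hc0
  · simp
  rw [mul_comm, ← ENNReal.le_div_iff_mul_le (Or.inl hc0) (Or.inl hc)]
  -- It suffices to bound every mollification. The hypothesis is used with the kernel centred at t
  -- as η and integrated over t; on the right Young's inequality removes the mollification.
  refine l2sq_le_of_mollify_le hf fun n => ?_
  rw [ENNReal.le_div_iff_mul_le (Or.inl hc0) (Or.inl hc), mul_comm,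
    l2sq_mollify_eq n hf.1, ← lintegral_const_mul' _ _ hc]
  have h1 : ∫⁻ t in far (R + 1), c * l2sq ν (avg (fun s => kern n (t - s)) f) ≤
      ∫⁻ t in far (R + 1), ∑ i ∈ s, l2sq ν' (avg (fun s => kern n (t - s)) (A i)) :=
    setLIntegral_mono' (isOpen_far _).measurableSet fun t ht =>
      h _ (isTest_kern_sub n t) (tsupport_kern_sub n ht)
  refine h1.trans ?_
  rw [lintegral_finsetSum' _ fun i _ => aemeasurable_l2sq_avg n (hA i).1 _]
  refine Finset.sum_le_sum fun i _ => ?_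
  rw [← l2sq_mollify_eq n (hA i).1]
  exact (lintegral_mono' (prod_restrict_le _) le_rfl).trans (l2sq_mollify_le n (hA i).1)

variable {Γ : Set (ℝ × ℝ)} {l : ℝ} {Θ : Set (ℝ × ℝ × ℝ)} {R : ℝ}

theorem l2sq_weakGrad_avg (hG : IsCanalWithBody Γ l Θ) (hR : ∀ x ∈ closure Θ, |x.1| < R)
    {η : ℝ → ℝ} (hη : IsTest η) (hs : tsupport η ⊆ far R) {u : ℝ × ℝ × ℝ → ℂ}
    (hu : MemH (water Γ Θ) u) (hv : MemH1 Γ e2 (avg η (farPart R u))) :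
    l2sq (volume.restrict Γ) (weakGrad Γ e2 (avg η (farPart R u))) = ∑ i : Fin 2,
      l2sq (volume.restrict Γ) (avg η (farPart R (weakDeriv (water Γ Θ) (e3 i.succ) u))) := by
  rw [l2sq_weakGrad, lintegral_finsetSum' _ fun i _ =>
    ((memLp_weakDeriv hG.isOpen_section hv i).2.1.enorm.pow_const 2)]
  exact Finset.sum_congr rfl fun i _ => l2sq_congr (weakDeriv_avg hG hR hη hs hu i)

/-- The Steklov inequality in the cylindrical part of the canal. -/
theorem lambdaGamma_mul_surfaceTrace_le (hG : IsCanalWithBody Γ l Θ)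
    (hR : ∀ x ∈ closure Θ, |x.1| < R) {u : ℝ × ℝ × ℝ → ℂ} (hu : MemH (water Γ Θ) u)
    (h0 : ∀ᵐ x ∂(volume.restrict (water Γ Θ)), x ∉ rightHalf → u x = 0) :
    ENNReal.ofReal (lambdaGamma Γ l) *
      l2sq (volume.restrict (surface l ∩ Prod.fst ⁻¹' far (R + 1))) (surfaceTrace (water Γ Θ) l u) ≤
      ∑ i : Fin 2, l2sq (volume.restrict (water Γ Θ ∩ Prod.fst ⁻¹' far R))
        (weakDeriv (water Γ Θ) (e3 i.succ) u) := by
  have htr := memLp_surfaceTrace hG hu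
  rw [← surface_eq] at htr
  have h := l2sq_le_of_avg_le (R := R) (c := ENNReal.ofReal (lambdaGamma Γ l))
    ENNReal.ofReal_ne_top htr Finset.univ
    (A := fun i : Fin 2 => farPart R (weakDeriv (water Γ Θ) (e3 i.succ) u))
    (fun i => memLp_farPart hR (memLp_weakDeriv (isOpen_water hG) hu i.succ).2)
    fun η hη hs => by
      have hS := memSection0_avg hR hη hs hu h0
      have := lambdaGamma_mul_le hG hS
      rwa [l2sq_congr (sectionTrace_avg hG hR hη hs hu hS.1),
        l2sq_weakGrad_avg hG hR hη hs hu hS.1] at this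
  simp only [l2sq_farPart hR] at h
  rw [Measure.restrict_prod_eq_prod_univ, surface_eq,
    Measure.restrict_restrict ((isOpen_far _).measurableSet.prod MeasurableSet.univ)] at h
  rw [inter_comm, ← prod_univ]
  exact h

/-- Poincaré's inequality in the cylindrical part of the canal. -/
theorem exists_poincare_far (hG : IsCanalWithBody Γ l Θ) (hR : ∀ x ∈ closure Θ, |x.1| < R) :
    ∃ C : ℝ≥0, ∀ u, MemH (water Γ Θ) u →
      (∀ᵐ x ∂(volume.restrict (water Γ Θ)), x ∉ rightHalf → u x = 0) →
      l2sq (volume.restrict (water Γ Θ ∩ Prod.fst ⁻¹' far (R + 1))) u ≤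
        C * ∑ i : Fin 2, l2sq (volume.restrict (water Γ Θ ∩ Prod.fst ⁻¹' far R))
          (weakDeriv (water Γ Θ) (e3 i.succ) u) := by
  obtain ⟨C, hC⟩ := exists_section_poincare hG
  -- Adding 1 makes the constant nonzero, so that its inverse can serve as the factor c on the left.
  refine ⟨C + 1, fun u hu h0 => ?_⟩
  have hR' : ∀ x ∈ closure Θ, |x.1| < R + 1 := fun x hx => (hR x hx).trans (lt_add_one R)
  have hc0 : ((C + 1 : ℝ≥0) : ℝ≥0∞) ≠ 0 := by simp
  have h := l2sq_le_of_avg_le (R := R) (c := ((C + 1 : ℝ≥0) : ℝ≥0∞)⁻¹)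
    (ENNReal.inv_ne_top.2 hc0) (memLp_farPart hR hu.1) Finset.univ
    (A := fun i : Fin 2 => farPart R (weakDeriv (water Γ Θ) (e3 i.succ) u))
    (fun i => memLp_farPart hR (memLp_weakDeriv (isOpen_water hG) hu i.succ).2)
    fun η hη hs => by
      have hS := memSection0_avg hR hη hs hu h0
      have := hC _ hS
      rw [l2sq_weakGrad_avg hG hR hη hs hu hS.1] at this
      rw [ENNReal.inv_mul_le_iff hc0 ENNReal.coe_ne_top]
      refine this.trans ?_
      gcongr
      simp
  simp only [l2sq_farPart hR] at h
  rw [ENNReal.inv_mul_le_iff hc0 ENNReal.coe_ne_top] at h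
  refine le_trans (le_of_eq ?_) h
  rw [Measure.restrict_prod_eq_prod_univ, prod_univ, restrict_far hR',
    Measure.restrict_restrict measurableSet_far, inter_comm]
  refine lintegral_congr_ae ?_
  filter_upwards [ae_restrict_mem (measurableSet_far.inter (isOpen_water hG).measurableSet)]
    with x hx
  have : x ∈ (Prod.fst ⁻¹' far R : Set (ℝ × ℝ × ℝ)) := by
    have h1 : R + 1 < |x.1| := hx.1
    change R < |x.1|
    linarith
  simp [farPart, this]

end SlabInequality

/-! ### The weak form of the eigenvalue problem -/

section WeakForm

variable {Γ : Set (ℝ × ℝ)} {l : ℝ} {Θ : Set (ℝ × ℝ × ℝ)} {μ : ℝ}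

theorem muGamma_pos (hG : IsCanalWithBody Γ l Θ) : 0 < muGamma Γ l :=
  inv_pos.2 (by linarith [lambdaGamma_nonneg hG])

/-- Inversion reverses the order: μ above the threshold means that λ = μ⁻¹ - 1 lies strictly below
λ_Γ⁰. All smallness in the decay estimate comes from this gap. -/
theorem steklov_parameter (hG : IsCanalWithBody Γ l Θ) (hμ : μ ∈ Ioc (muGamma Γ l) 1) :
    0 < μ ∧ 0 ≤ μ⁻¹ - 1 ∧ μ⁻¹ - 1 < lambdaGamma Γ l := by
  have h0 : 0 < μ := (muGamma_pos hG).trans hμ.1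
  refine ⟨h0, sub_nonneg.2 ((one_le_inv₀ h0).2 hμ.2), ?_⟩
  have h1 := inv_strictAnti₀ (muGamma_pos hG) hμ.1
  rw [muGamma, inv_inv] at h1
  linarith

theorem gradInner_const_smul (hG : IsCanalWithBody Γ l Θ) {Φ : ℝ × ℝ × ℝ → ℂ}
    (hΦ : MemH (water Γ Θ) Φ) (c : ℂ) (Ψ : ℝ × ℝ × ℝ → ℂ) :
    gradInner (water Γ Θ) e3 (water Γ Θ) (c • Φ) Ψ =
      c * gradInner (water Γ Θ) e3 (water Γ Θ) Φ Ψ := by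
  rw [gradInner, gradInner, ← integral_const_mul]
  refine integral_congr_ae ?_
  filter_upwards [ae_all_iff.2 fun i => weakDeriv_const_smul (isOpen_water hG) i hΦ c] with x hx
  simp only [hx, Pi.smul_apply, smul_eq_mul, Finset.mul_sum, mul_assoc]

theorem surfaceInner_const_smul (hG : IsCanalWithBody Γ l Θ) {Φ : ℝ × ℝ × ℝ → ℂ}
    (hΦ : MemH (water Γ Θ) Φ) (c : ℂ) (Ψ : ℝ × ℝ × ℝ → ℂ) :
    surfaceInner (water Γ Θ) l (surface l) (c • Φ) Ψ =
      c * surfaceInner (water Γ Θ) l (surface l) Φ Ψ := by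
  obtain ⟨D⟩ := exists_waterBoundary hG
  have h := D.tr_const_smul measurePreserving_spaceCoord exists_sum_e3 hΦ c
  rw [surfaceInner, surfaceInner, ← integral_const_mul]
  refine integral_congr_ae ?_
  filter_upwards [h] with y hy
  have hy' : surfaceTrace (water Γ Θ) l (c • Φ) y = c * surfaceTrace (water Γ Θ) l Φ y := hy
  rw [hy', mul_assoc]

/-- The weak form of the water wave problem. -/
theorem IsEigenfunctionT0.weak_form (hG : IsCanalWithBody Γ l Θ) (hμ : 0 < μ) {Φ : ℝ × ℝ × ℝ → ℂ}
    (h : IsEigenfunctionT0 (water Γ Θ) l μ Φ) {Ψ : ℝ × ℝ × ℝ → ℂ} (hΨ : MemH (water Γ Θ) Ψ) :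
    gradInner (water Γ Θ) e3 (water Γ Θ) Φ Ψ =
      ((μ⁻¹ - 1 : ℝ) : ℂ) * surfaceInner (water Γ Θ) l (surface l) Φ Ψ := by
  have h1 := h.2.2.2.2 Ψ hΨ
  rw [innerH, gradInner_const_smul hG h.2.1.1, surfaceInner_const_smul hG h.2.1.1] at h1
  have h2 : (μ : ℂ) ≠ 0 := by exact_mod_cast hμ.ne'
  push_cast
  field_simp
  linear_combination h1

theorem gradInner_cut (hG : IsCanalWithBody Γ l Θ) (Φ : ℝ × ℝ × ℝ → ℂ) {Ψ : ℝ × ℝ × ℝ → ℂ}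
    (hΨ : MemH0 (water Γ Θ) Ψ) : gradInner (water Γ Θ) e3 (water Γ Θ) Φ (cut Ψ) =
      gradInner (water Γ Θ) e3 (water Γ Θ ∩ rightHalf) Φ Ψ := by
  have hm := isOpen_rightHalf.measurableSet
  rw [gradInner, gradInner, inter_comm, ← Measure.restrict_restrict hm, ← integral_indicator hm]
  refine integral_congr_ae ?_
  filter_upwards [ae_all_iff.2 fun i => weakDeriv_cut hG hΨ i] with x hx
  by_cases hxr : x ∈ rightHalf <;> simp [hx, hxr]

theorem surfaceInner_cut (hG : IsCanalWithBody Γ l Θ) (Φ : ℝ × ℝ × ℝ → ℂ) {Ψ : ℝ × ℝ × ℝ → ℂ}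
    (hΨ : MemH0 (water Γ Θ) Ψ) : surfaceInner (water Γ Θ) l (surface l) Φ (cut Ψ) =
      surfaceInner (water Γ Θ) l (univ ×ˢ Ioo 0 l) Φ Ψ := by
  have hm : MeasurableSet {y : ℝ × ℝ | 0 < y.2} :=
    (isOpen_lt continuous_const continuous_snd).measurableSet
  have hs : (univ ×ˢ Ioo 0 l : Set (ℝ × ℝ)) = {y | 0 < y.2} ∩ surface l := by
    ext y
    simp only [surface, mem_prod, mem_univ, true_and, mem_Ioo, mem_inter_iff, mem_ofPred_eq]
    have := hG.l_pos
    constructor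
    · exact fun h => ⟨h.1, by linarith [h.1], h.2⟩
    · exact fun h => ⟨h.1, h.2.2⟩
  rw [surfaceInner, surfaceInner, hs, ← Measure.restrict_restrict hm, ← integral_indicator hm]
  refine integral_congr_ae ?_
  filter_upwards [surfaceTrace_cut hG hΨ] with x hx
  by_cases hxr : x ∈ {y : ℝ × ℝ | 0 < y.2}
  · simp only [hx, indicator_of_mem hxr]
  · simp only [hx, indicator_of_notMem hxr, map_zero, mul_zero]

/-- The weak form of the water wave problem in the half of the water domain. -/
theorem IsEigenfunctionT0.half_form (hG : IsCanalWithBody Γ l Θ) (hμ : 0 < μ) {Φ : ℝ × ℝ × ℝ → ℂ}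
    (h : IsEigenfunctionT0 (water Γ Θ) l μ Φ) {Ψ : ℝ × ℝ × ℝ → ℂ} (hΨ : MemH0 (water Γ Θ) Ψ) :
    gradInner (water Γ Θ) e3 (water Γ Θ ∩ rightHalf) Φ Ψ =
      ((μ⁻¹ - 1 : ℝ) : ℂ) * surfaceInner (water Γ Θ) l (univ ×ˢ Ioo 0 l) Φ Ψ := by
  -- Integrals over the right half against Ψ are integrals over the whole domain against `cut Ψ`,
  -- which is in ℋ.
  rw [← gradInner_cut hG Φ hΨ, ← surfaceInner_cut hG Φ hΨ, h.weak_form hG hμ (hΨ.cut hG)]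

end WeakForm

/-! ### The exponential weight and its bounded regularization -/

section Weight

variable {θ ε : ℝ}

/-- The regularization `(R_{-θ} + ε)⁻¹` of the weight `R_θ`, as a function of `x₁`. -/
noncomputable def regWeight (θ ε t : ℝ) : ℝ := (Real.exp (-θ * Real.sqrt (1 + t ^ 2)) + ε)⁻¹

theorem one_add_sq_pos (t : ℝ) : 0 < 1 + t ^ 2 := by positivity

theorem regWeight_zero (θ : ℝ) (x : ℝ × ℝ × ℝ) : regWeight θ 0 x.1 = weight θ x := by
  rw [regWeight, weight, add_zero, ← Real.exp_neg]
  simp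

theorem regWeight_pos (hε : 0 ≤ ε) (t : ℝ) : 0 < regWeight θ ε t := by
  unfold regWeight
  positivity

theorem contDiff_regWeight (θ : ℝ) (hε : 0 ≤ ε) : ContDiff ℝ ∞ (regWeight θ ε) := by
  have h1 : ContDiff ℝ ∞ fun t : ℝ => Real.sqrt (1 + t ^ 2) :=
    (contDiff_const.add (contDiff_id.pow 2)).sqrt fun t => (one_add_sq_pos t).ne'
  exact ((Real.contDiff_exp.comp (contDiff_const.mul h1)).add contDiff_const).inv
    fun t => (add_pos_of_pos_of_nonneg (Real.exp_pos _) hε).ne'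

theorem hasDerivAt_regWeight (θ : ℝ) (hε : 0 ≤ ε) (t : ℝ) :
    HasDerivAt (regWeight θ ε) (θ * (t / Real.sqrt (1 + t ^ 2)) *
      Real.exp (-θ * Real.sqrt (1 + t ^ 2)) * regWeight θ ε t ^ 2) t := by
  have h1 : HasDerivAt (fun t : ℝ => 1 + t ^ 2) (2 * t) t := by
    simpa using ((hasDerivAt_id t).pow 2).const_add (1 : ℝ)
  have h2 := h1.sqrt (one_add_sq_pos t).ne'
  have h3 := ((h2.const_mul (-θ)).exp.add_const ε).inv (by positivity)
  have h4 : HasDerivAt (regWeight θ ε) _ t := h3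
  refine h4.congr_deriv ?_
  have := Real.sqrt_pos.2 (one_add_sq_pos t)
  simp only [regWeight]
  field_simp

/-- The derivative is θ ρ times two factors of modulus at most 1, namely t / (1 + t²)^(1/2) and
e^{-θ(1+t²)^{1/2}} ρ. The bound is uniform in ε, which is the reason for this form of the
regularization. -/
theorem abs_deriv_regWeight_le (hθ : 0 ≤ θ) (hε : 0 ≤ ε) (t : ℝ) :
    |deriv (regWeight θ ε) t| ≤ θ * regWeight θ ε t := by
  rw [(hasDerivAt_regWeight θ hε t).deriv]
  have h1 : |t / Real.sqrt (1 + t ^ 2)| ≤ 1 := by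
    rw [abs_div, abs_of_pos (Real.sqrt_pos.2 (one_add_sq_pos t)),
      div_le_one (Real.sqrt_pos.2 (one_add_sq_pos t))]
    exact Real.abs_le_sqrt (by linarith)
  have hp := regWeight_pos (θ := θ) hε t
  have h2 : Real.exp (-θ * Real.sqrt (1 + t ^ 2)) * regWeight θ ε t ≤ 1 := by
    rw [regWeight, ← div_eq_mul_inv, div_le_one (by positivity)]
    linarith
  rw [abs_mul, abs_mul, abs_mul, abs_of_nonneg hθ, abs_of_pos (Real.exp_pos _),
    abs_of_nonneg (sq_nonneg (regWeight θ ε t))]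
  calc θ * |t / Real.sqrt (1 + t ^ 2)| * Real.exp (-θ * Real.sqrt (1 + t ^ 2)) *
        regWeight θ ε t ^ 2
      = θ * |t / Real.sqrt (1 + t ^ 2)| * (Real.exp (-θ * Real.sqrt (1 + t ^ 2)) *
        regWeight θ ε t) * regWeight θ ε t := by ring
    _ ≤ θ * 1 * 1 * regWeight θ ε t := by gcongr
    _ = _ := by ring

theorem regWeight_le (hε : 0 ≤ ε) (t : ℝ) : regWeight θ ε t ≤ regWeight θ 0 t := by
  unfold regWeight
  gcongr

theorem regWeight_le_inv (hε : 0 < ε) (t : ℝ) : regWeight θ ε t ≤ ε⁻¹ := by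
  unfold regWeight
  gcongr
  linarith [Real.exp_pos (-θ * Real.sqrt (1 + t ^ 2))]

theorem regWeight_zero_le (hθ : 0 ≤ θ) {t L : ℝ} (h : |t| ≤ L) :
    regWeight θ 0 t ≤ regWeight θ 0 L := by
  unfold regWeight
  have : t ^ 2 ≤ L ^ 2 := sq_le_sq' (abs_le.1 h).1 (abs_le.1 h).2
  have h2 : Real.sqrt (1 + t ^ 2) ≤ Real.sqrt (1 + L ^ 2) := Real.sqrt_le_sqrt (by linarith)
  have h3 := mul_le_mul_of_nonneg_left h2 hθ
  gcongr ?_⁻¹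
  simp only [add_zero]
  exact Real.exp_le_exp.2 (by linarith)

theorem exp_le_regWeight_zero (hθ : 0 ≤ θ) {t r : ℝ} (h : r ≤ |t|) :
    Real.exp (θ * r) ≤ regWeight θ 0 t := by
  have h2 : r ≤ Real.sqrt (1 + t ^ 2) := h.trans (Real.abs_le_sqrt (by linarith))
  rw [regWeight, add_zero, ← Real.exp_neg]
  refine Real.exp_le_exp.2 ?_
  have h3 := mul_le_mul_of_nonneg_left h2 hθ
  linarith

theorem tendsto_regWeight (θ t : ℝ) :
    Tendsto (fun n : ℕ => regWeight θ (1 / (n + 1)) t) atTop (𝓝 (regWeight θ 0 t)) := by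
  unfold regWeight
  exact (tendsto_const_nhds.add tendsto_one_div_add_atTop_nhds_zero_nat).inv₀ (by positivity)

theorem tendsto_deriv_regWeight (θ t : ℝ) :
    Tendsto (fun n : ℕ => deriv (regWeight θ (1 / (n + 1))) t) atTop
      (𝓝 (deriv (regWeight θ 0) t)) := by
  rw [(hasDerivAt_regWeight θ le_rfl t).deriv]
  refine (tendsto_const_nhds.mul ((tendsto_regWeight θ t).pow 2)).congr fun n => ?_
  rw [(hasDerivAt_regWeight θ (by positivity) t).deriv]

theorem contDiff_comp_fst {ρ : ℝ → ℝ} (hρ : ContDiff ℝ ∞ ρ) :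
    ContDiff ℝ ∞ fun x : ℝ × ℝ × ℝ => ρ x.1 := hρ.comp contDiff_fst

theorem fderiv_comp_fst {ρ : ℝ → ℝ} (hρ : ContDiff ℝ ∞ ρ) (x v : ℝ × ℝ × ℝ) :
    fderiv ℝ (fun x : ℝ × ℝ × ℝ => ρ x.1) x v = v.1 * deriv ρ x.1 := by
  have h := ((hρ.differentiable (by simp)) x.1).hasDerivAt.comp_hasFDerivAt x
    (hasFDerivAt_fst (𝕜 := ℝ) (E := ℝ) (F := ℝ × ℝ) (p := x))
  change HasFDerivAt (fun x : ℝ × ℝ × ℝ => ρ x.1) _ x at h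
  rw [h.fderiv]
  simp [mul_comm]

end Weight

/-! ### The weighted energy identity -/

section Energy

variable {Γ : Set (ℝ × ℝ)} {l : ℝ} {Θ : Set (ℝ × ℝ × ℝ)} {μ : ℝ}

/-- The product with a function of `x₁`. -/
noncomputable def axial (ρ : ℝ → ℝ) {α : Type*} (u : ℝ × α → ℂ) : ℝ × α → ℂ := fun x => ρ x.1 • u x

theorem weakDeriv_axial (hG : IsCanalWithBody Γ l Θ) {ρ : ℝ → ℝ} (hρ : ContDiff ℝ ∞ ρ)
    {u : ℝ × ℝ × ℝ → ℂ} (hu : MemH (water Γ Θ) u) (i : Fin 3) :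
    weakDeriv (water Γ Θ) (e3 i) (axial ρ u) =ᵐ[volume.restrict (water Γ Θ)] fun x =>
      ρ x.1 • weakDeriv (water Γ Θ) (e3 i) u x + ((e3 i).1 * deriv ρ x.1) • u x := by
  have h := ((memLp_weakDeriv (isOpen_water hG) hu i).1.smul_smooth (isOpen_water hG)
    (contDiff_comp_fst hρ)).weakDeriv_ae (isOpen_water hG)
  simp only [fderiv_comp_fst hρ] at h
  exact h

theorem abs_e3_fst_le (i : Fin 3) : |(e3 i).1| ≤ 1 := by
  fin_cases i <;> simp [e3]

theorem memH_axial (hG : IsCanalWithBody Γ l Θ) {ρ : ℝ → ℝ} (hρ : ContDiff ℝ ∞ ρ) {C C' : ℝ}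
    (hC : ∀ t, |ρ t| ≤ C) (hC' : ∀ t, |deriv ρ t| ≤ C') {u : ℝ × ℝ × ℝ → ℂ}
    (hu : MemH (water Γ Θ) u) : MemH (water Γ Θ) (axial ρ u) := by
  refine MemH1.smul_smooth (isOpen_water hG) hu (contDiff_comp_fst hρ) (fun x => hC x.1)
    fun i => ⟨C', fun x => ?_⟩
  rw [fderiv_comp_fst hρ, Real.norm_eq_abs, abs_mul]
  calc _ ≤ 1 * C' := mul_le_mul (abs_e3_fst_le i) (hC' _) (abs_nonneg _) zero_le_one
    _ = C' := one_mul _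

theorem surfaceTrace_axial (hG : IsCanalWithBody Γ l Θ) {ρ : ℝ → ℝ} (hρ : ContDiff ℝ ∞ ρ)
    {u : ℝ × ℝ × ℝ → ℂ} (hu : MemH (water Γ Θ) u) :
    surfaceTrace (water Γ Θ) l (axial ρ u) =ᵐ[volume.restrict (surface l)]
      axial ρ (surfaceTrace (water Γ Θ) l u) := by
  obtain ⟨D⟩ := exists_waterBoundary hG
  exact D.tr_smul_smooth measurePreserving_spaceCoord exists_sum_e3 hu (contDiff_comp_fst hρ)

theorem integrable_mul_conj {α : Type*} [MeasurableSpace α] {m : Measure α} {f g : α → ℂ}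
    (hf : MemLp f 2 m) (hg : MemLp g 2 m) : Integrable (fun x => f x * conj (g x)) m :=
  hf.integrable_mul hg.star

theorem integrable_grad_mul_conj (hG : IsCanalWithBody Γ l Θ) {u v : ℝ × ℝ × ℝ → ℂ}
    (hu : MemH (water Γ Θ) u) (hv : MemH (water Γ Θ) v) :
    Integrable (fun x => ∑ i, weakDeriv (water Γ Θ) (e3 i) u x *
      conj (weakDeriv (water Γ Θ) (e3 i) v x)) (volume.restrict (water Γ Θ)) :=
  integrable_finsetSum _ fun i _ => integrable_mul_conj (memLp_weakDeriv (isOpen_water hG) hu i).2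
    (memLp_weakDeriv (isOpen_water hG) hv i).2

/-- The pointwise identity Re ∇u · conj ∇(ρ² u) = |∇(ρ u)|² - |ρ'|² |u|² for real ρ = ρ(x₁). Here r,
s and d stand for ρ, ρ' and ∇u; the cross terms cancel in the real part. -/
theorem re_energy (d f : Fin 3 → ℂ) (r s : ℝ) (u : ℂ)
    (hf : ∀ i, f i = (r ^ 2) • d i + ((e3 i).1 * (2 * r * s)) • u) :
    (∑ i, d i * conj (f i)).re = ∑ i, ‖r • d i + ((e3 i).1 * s) • u‖ ^ 2 - ‖s • u‖ ^ 2 := by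
  simp only [Fin.sum_univ_three, hf, ← Complex.normSq_eq_norm_sq, Complex.normSq_apply]
  simp [e3, sq]
  ring

/-- Test the weak form with ρ² cut Φ and take real parts. Bounded ρ and ρ' keep the test function in
ℋ, which is why the weight had to be regularized. -/
theorem energy_identity (hG : IsCanalWithBody Γ l Θ) (hμ : 0 < μ) (hμ' : 0 ≤ μ⁻¹ - 1)
    {Φ : ℝ × ℝ × ℝ → ℂ} (h : IsEigenfunctionT0 (water Γ Θ) l μ Φ) {ρ : ℝ → ℝ}
    (hρ : ContDiff ℝ ∞ ρ) {C C' : ℝ} (hC : ∀ t, |ρ t| ≤ C) (hC' : ∀ t, |deriv ρ t| ≤ C') :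
    ∑ i, l2sq (volume.restrict (water Γ Θ)) (weakDeriv (water Γ Θ) (e3 i) (axial ρ (cut Φ))) =
      ENNReal.ofReal (μ⁻¹ - 1) * l2sq (volume.restrict (surface l))
        (surfaceTrace (water Γ Θ) l (axial ρ (cut Φ))) +
      l2sq (volume.restrict (water Γ Θ)) (axial (deriv ρ) (cut Φ)) := by
  set Ω := water Γ Θ
  have hc : MemH Ω (cut Φ) := h.2.1.cut hG
  have hw : MemH Ω (axial ρ (cut Φ)) := memH_axial hG hρ hC hC' hc
  have hρ2 : ContDiff ℝ ∞ fun t => ρ t ^ 2 := hρ.pow 2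
  have hd2 : ∀ t, deriv (fun t => ρ t ^ 2) t = 2 * ρ t * deriv ρ t := fun t => by
    have := ((hρ.differentiable (by simp) t).hasDerivAt.pow 2).deriv
    simpa using! this
  have hC0 : 0 ≤ C := (abs_nonneg _).trans (hC 0)
  have hv : MemH Ω (axial (fun t => ρ t ^ 2) (cut Φ)) := by
    refine memH_axial hG hρ2 (C := C ^ 2) (C' := 2 * C * C') (fun t => ?_) (fun t => ?_) hc
    · rw [abs_pow]
      exact pow_le_pow_left₀ (abs_nonneg _) (hC t) 2
    · rw [hd2, abs_mul, abs_mul, abs_two]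
      exact mul_le_mul (mul_le_mul_of_nonneg_left (hC t) zero_le_two) (hC' t) (abs_nonneg _)
        (by positivity)
  have hρ'L : MemLp (axial (deriv ρ) (cut Φ)) 2 (volume.restrict Ω) :=
    memLp_real_smul (ρ := fun x : ℝ × ℝ × ℝ => deriv ρ x.1)
      ((hρ.continuous_deriv (by simp)).comp continuous_fst) (fun x => hC' x.1) hc.1
  have hwt := memLp_surfaceTrace hG hw
  have key := congrArg Complex.re (h.weak_form hG hμ hv)
  rw [Complex.re_ofReal_mul, gradInner, surfaceInner] at key
  have e1 : (∫ x in Ω, ∑ i, weakDeriv Ω (e3 i) Φ x *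
      conj (weakDeriv Ω (e3 i) (axial (fun t => ρ t ^ 2) (cut Φ)) x)).re =
      ∑ i, (∫ x in Ω, ‖weakDeriv Ω (e3 i) (axial ρ (cut Φ)) x‖ ^ 2) -
        ∫ x in Ω, ‖axial (deriv ρ) (cut Φ) x‖ ^ 2 := by
    have h1 := integral_re (integrable_grad_mul_conj hG h.2.1.1 hv)
    rw [← integral_finsetSum _ fun i _ => (memLp_weakDeriv (isOpen_water hG) hw i).2.integrable_norm_pow
      (by norm_num), ← integral_sub (integrable_finsetSum _ fun i _ =>
      (memLp_weakDeriv (isOpen_water hG) hw i).2.integrable_norm_pow (by norm_num))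
      (hρ'L.integrable_norm_pow (by norm_num))]
    refine h1.symm.trans (integral_congr_ae ?_)
    filter_upwards [ae_all_iff.2 fun i => weakDeriv_axial hG hρ hc i,
      ae_all_iff.2 fun i => weakDeriv_axial hG hρ2 hc i,
      ae_all_iff.2 fun i => weakDeriv_cut hG h.2.1 i] with x hx1 hx2 hx3
    have hx4 : ∀ i, weakDeriv Ω (e3 i) (axial (fun t => ρ t ^ 2) (cut Φ)) x =
        (ρ x.1 ^ 2) • weakDeriv Ω (e3 i) (cut Φ) x +
          ((e3 i).1 * (2 * ρ x.1 * deriv ρ x.1)) • cut Φ x := fun i => by rw [hx2, hd2]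
    have hx5 := re_energy (fun i => weakDeriv Ω (e3 i) (cut Φ) x) _ (ρ x.1) (deriv ρ x.1) (cut Φ x) hx4
    simp only [hx1]
    refine Eq.trans ?_ hx5
    refine congrArg Complex.re (Finset.sum_congr rfl fun i _ => ?_)
    -- In the right half the gradients of Φ and `cut Φ` agree; in the left half the test function
    -- and its gradient vanish.
    by_cases hxr : x ∈ rightHalf
    · rw [hx3 i, indicator_of_mem hxr]
    · rw [hx4, hx3]
      simp [hxr, cut]
  have e2 : (∫ y in surface l, surfaceTrace Ω l Φ y *
      conj (surfaceTrace Ω l (axial (fun t => ρ t ^ 2) (cut Φ)) y)).re =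
      ∫ y in surface l, ‖surfaceTrace Ω l (axial ρ (cut Φ)) y‖ ^ 2 := by
    have h1 := integral_re (integrable_mul_conj (memLp_surfaceTrace hG h.2.1.1)
      (memLp_surfaceTrace hG hv))
    refine h1.symm.trans (integral_congr_ae ?_)
    filter_upwards [surfaceTrace_axial hG hρ hc, surfaceTrace_axial hG hρ2 hc,
      surfaceTrace_cut hG h.2.1] with y hy1 hy2 hy3
    rw [hy1, hy2, axial, axial, hy3]
    by_cases hyr : y ∈ {y : ℝ × ℝ | 0 < y.2}
    · rw [indicator_of_mem hyr, ← Complex.normSq_eq_norm_sq, Complex.normSq_apply]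
      simp [sq]
      ring
    · rw [indicator_of_notMem hyr]
      simp
  rw [e1, e2, sub_eq_iff_eq_add] at key
  have h3 := congrArg ENNReal.ofReal key
  rw [ENNReal.ofReal_sum_of_nonneg fun i _ => integral_nonneg fun _ => sq_nonneg _,
    ENNReal.ofReal_add (mul_nonneg hμ' (integral_nonneg fun _ => sq_nonneg _))
      (integral_nonneg fun _ => sq_nonneg _), ENNReal.ofReal_mul hμ'] at h3
  rw [ofReal_integral_norm_sq hwt, ofReal_integral_norm_sq hρ'L,
    Finset.sum_congr rfl fun i _ =>
      ofReal_integral_norm_sq (memLp_weakDeriv (isOpen_water hG) hw i).2] at h3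
  exact h3

end Energy

/-! ### Exponential decay of eigenfunctions -/

section Decay

variable {Γ : Set (ℝ × ℝ)} {l : ℝ} {Θ : Set (ℝ × ℝ × ℝ)} {μ θ ε : ℝ}

theorem weighted_eq_axial (θ : ℝ) (Φ : ℝ × ℝ × ℝ → ℂ) :
    weighted θ Φ = axial (regWeight θ 0) Φ := by
  ext x
  rw [weighted, axial, regWeight_zero]

theorem norm_axial_deriv_le {α : Type*} (hθ : 0 ≤ θ) (hε : 0 ≤ ε) (u : ℝ × α → ℂ) (x : ℝ × α) :
    ‖axial (deriv (regWeight θ ε)) u x‖ ≤ ‖θ • axial (regWeight θ ε) u x‖ := by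
  rw [axial, axial, norm_smul, norm_smul, norm_smul, ← mul_assoc, Real.norm_of_nonneg hθ,
    Real.norm_of_nonneg (regWeight_pos hε _).le]
  exact mul_le_mul_of_nonneg_right (abs_deriv_regWeight_le hθ hε _) (norm_nonneg _)

theorem l2sq_axial_deriv_le {α : Type*} [MeasurableSpace α] {m : Measure (ℝ × α)} (hθ : 0 ≤ θ)
    (hε : 0 ≤ ε) (u : ℝ × α → ℂ) : l2sq m (axial (deriv (regWeight θ ε)) u) ≤
      ENNReal.ofReal θ ^ 2 * l2sq m (axial (regWeight θ ε) u) := by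
  have := l2sq_mono (μ := m) (Eventually.of_forall fun x => norm_axial_deriv_le hθ hε u x)
  refine this.trans (le_of_eq ?_)
  rw [l2sq_const_smul, Real.enorm_eq_ofReal hθ]

theorem abs_regWeight_le_inv (hε : 0 < ε) (t : ℝ) : |regWeight θ ε t| ≤ ε⁻¹ := by
  rw [abs_of_pos (regWeight_pos hε.le t)]
  exact regWeight_le_inv hε t

theorem abs_deriv_regWeight_le_inv (hθ : 0 ≤ θ) (hε : 0 < ε) (t : ℝ) :
    |deriv (regWeight θ ε) t| ≤ θ * ε⁻¹ :=
  (abs_deriv_regWeight_le hθ hε.le t).trans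
    (mul_le_mul_of_nonneg_left (regWeight_le_inv hε t) hθ)

theorem memH_axial_regWeight (hG : IsCanalWithBody Γ l Θ) (hθ : 0 ≤ θ) (hε : 0 < ε)
    {u : ℝ × ℝ × ℝ → ℂ} (hu : MemH (water Γ Θ) u) : MemH (water Γ Θ) (axial (regWeight θ ε) u) :=
  memH_axial hG (contDiff_regWeight θ hε.le) (abs_regWeight_le_inv hε)
    (abs_deriv_regWeight_le_inv hθ hε) hu

/-- The weighted square integral is controlled by its part over `|x₁| > L`. -/
theorem l2sq_axial_le {α : Type*} [MeasurableSpace α] {s : Set (ℝ × α)} {m : Measure (ℝ × α)}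
    (hθ : 0 ≤ θ) (hε : 0 ≤ ε) (L : ℝ) (u : ℝ × α → ℂ) :
    l2sq (m.restrict s) (axial (regWeight θ ε) u) ≤
      l2sq (m.restrict (s ∩ Prod.fst ⁻¹' far L)) (axial (regWeight θ ε) u) +
        ENNReal.ofReal (regWeight θ 0 L) ^ 2 * l2sq (m.restrict s) u := by
  rw [l2sq, ← lintegral_inter_add_sdiff _ s (measurableSet_far (R := L))]
  refine add_le_add le_rfl ?_
  have h1 : l2sq (m.restrict (s \ Prod.fst ⁻¹' far L)) (axial (regWeight θ ε) u) ≤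
      l2sq (m.restrict (s \ Prod.fst ⁻¹' far L)) (fun x => regWeight θ 0 L • u x) := by
    refine lintegral_mono_ae ?_
    have hm : MeasurableSet (Prod.fst ⁻¹' far L : Set (ℝ × α))ᶜ := measurableSet_far.compl
    have : ∀ᵐ x ∂(m.restrict (s \ Prod.fst ⁻¹' far L)), x ∈ (Prod.fst ⁻¹' far L : Set (ℝ × α))ᶜ := by
      rw [sdiff_eq, inter_comm, ← Measure.restrict_restrict hm]
      exact ae_restrict_mem hm
    filter_upwards [this] with x hx
    have hx' : |x.1| ≤ L := not_lt.1 hx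
    gcongr
    rw [enorm_le_iff_norm_le, axial, norm_smul, norm_smul,
      Real.norm_of_nonneg (regWeight_pos hε _).le, Real.norm_of_nonneg (regWeight_pos le_rfl _).le]
    gcongr
    exact (regWeight_le hε _).trans (regWeight_zero_le hθ hx')
  refine h1.trans ?_
  rw [l2sq_const_smul, Real.enorm_eq_ofReal (regWeight_pos le_rfl _).le]
  gcongr
  exact l2sq_restrict_mono sdiff_subset

/-- Here a, b, m are the squared norms of ∇w in the domain, of w on the surface and of w in the
domain, c is the term with the derivative of the weight, t = θ², and B, B' come from the bounded
part of the canal. The surface term takes the fraction lam / lg of a, and half of the remaining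
fraction is reserved for t C a; the other half is the divisor in the conclusion. -/
theorem absorb {a b c m B B' t C lam lg : ℝ} (hlam : 0 ≤ lam) (hlg : lam < lg) (ha : 0 ≤ a)
    (h1 : a = lam * b + c) (h2 : c ≤ t * m) (h3 : lg * b ≤ a + lg * B) (h4 : m ≤ C * a + B')
    (ht : 0 ≤ t) (htC : t * C ≤ (1 - lam / lg) / 2) :
    a ≤ (lam * B + t * B') / ((1 - lam / lg) / 2) := by
  have hlg0 : 0 < lg := hlam.trans_lt hlg
  have hq : lam / lg < 1 := (div_lt_one hlg0).2 hlg
  rw [le_div_iff₀ (by linarith)]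
  have e1 : lam * b ≤ lam / lg * a + lam * B := by
    have := mul_le_mul_of_nonneg_left h3 (div_nonneg hlam hlg0.le)
    have e : lam / lg * (lg * b) = lam * b := by field_simp
    have e' : lam / lg * (a + lg * B) = lam / lg * a + lam * B := by field_simp
    rwa [e, e'] at this
  have e2 : t * m ≤ t * C * a + t * B' := by
    have := mul_le_mul_of_nonneg_left h4 ht
    linarith
  have e3 : t * C * a ≤ (1 - lam / lg) / 2 * a := mul_le_mul_of_nonneg_right htC ha
  linarith

theorem cut_eq_zero (u : ℝ × ℝ × ℝ → ℂ) {x : ℝ × ℝ × ℝ} (hx : x ∉ rightHalf) : cut u x = 0 :=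
  indicator_of_notMem hx _

/-- The basic energy estimate, uniform with respect to the regularization of the weight. -/
theorem exists_energy_bound (hG : IsCanalWithBody Γ l Θ) (hμ : μ ∈ Ioc (muGamma Γ l) 1) :
    ∃ θ₀ : ℝ, 0 < θ₀ ∧ ∀ θ : ℝ, 0 < θ → θ ≤ θ₀ → ∀ Φ, IsEigenfunctionT0 (water Γ Θ) l μ Φ →
      ∃ K : ℝ≥0∞, K ≠ ⊤ ∧ ∀ ε, 0 < ε →
        ∑ i, l2sq (volume.restrict (water Γ Θ))
          (weakDeriv (water Γ Θ) (e3 i) (axial (regWeight θ ε) (cut Φ))) ≤ K ∧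
        l2sq (volume.restrict (water Γ Θ)) (axial (regWeight θ ε) (cut Φ)) ≤ K := by
  obtain ⟨hμ0, hlam, hlg⟩ := steklov_parameter hG hμ
  obtain ⟨R, hR0, hR⟩ := exists_body_length hG
  obtain ⟨C, hC⟩ := exists_poincare_far hG hR
  set lam := μ⁻¹ - 1
  set lg := lambdaGamma Γ l
  have hlg0 : 0 < lg := hlam.trans_lt hlg
  have hq : 0 < (1 - lam / lg) / 2 := by
    have := (div_lt_one hlg0).2 hlg
    linarith
  -- Chosen so that θ² C ≤ (1 - lam / lg) / 2; adding 1 to C avoids division by zero.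
  refine ⟨Real.sqrt ((1 - lam / lg) / 2 / (C + 1)), by positivity, fun θ hθ hθ₀ Φ hΦ => ?_⟩
  have hθC : θ ^ 2 * C ≤ (1 - lam / lg) / 2 := by
    have h1 : θ ^ 2 ≤ (1 - lam / lg) / 2 / (C + 1) := by
      rw [← Real.sq_sqrt (show 0 ≤ (1 - lam / lg) / 2 / (C + 1) by positivity)]
      exact pow_le_pow_left₀ hθ.le hθ₀ 2
    rw [le_div_iff₀ (by positivity)] at h1
    linarith [sq_nonneg θ]
  set Ω := water Γ Θ with hΩ
  have hc : MemH Ω (cut Φ) := hΦ.2.1.cut hG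
  set M := ENNReal.ofReal (regWeight θ 0 (R + 1)) ^ 2
  set B := M * l2sq (volume.restrict (surface l)) (surfaceTrace Ω l (cut Φ))
  set B' := M * l2sq (volume.restrict Ω) (cut Φ)
  have hM : M ≠ ⊤ := by simp [M]
  have hB : B ≠ ⊤ := ENNReal.mul_ne_top hM (l2sq_lt_top (memLp_surfaceTrace hG hc)).ne
  have hB' : B' ≠ ⊤ := ENNReal.mul_ne_top hM (l2sq_lt_top hc.1).ne
  set K := (lam * B.toReal + θ ^ 2 * B'.toReal) / ((1 - lam / lg) / 2)
  -- The first summand bounds the gradient, the second the function itself through Poincaré's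
  -- inequality. None of them depends on ε.
  refine ⟨ENNReal.ofReal K + (C * ENNReal.ofReal K + B'), by finiteness, fun ε hε => ?_⟩
  set w := axial (regWeight θ ε) (cut Φ)
  have hw : MemH Ω w := memH_axial_regWeight hG hθ.le hε hc
  have hw0 : ∀ᵐ x ∂(volume.restrict Ω), x ∉ rightHalf → w x = 0 :=
    Eventually.of_forall fun x hx => by simp [w, axial, cut_eq_zero Φ hx]
  set a := ∑ i, l2sq (volume.restrict Ω) (weakDeriv Ω (e3 i) w)
  set b := l2sq (volume.restrict (surface l)) (surfaceTrace Ω l w)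
  set c := l2sq (volume.restrict Ω) (axial (deriv (regWeight θ ε)) (cut Φ))
  set m := l2sq (volume.restrict Ω) w
  have h1 : a = ENNReal.ofReal lam * b + c := energy_identity hG hμ0 hlam hΦ
    (contDiff_regWeight θ hε.le) (abs_regWeight_le_inv hε) (abs_deriv_regWeight_le_inv hθ.le hε)
  have h2 : c ≤ ENNReal.ofReal θ ^ 2 * m := l2sq_axial_deriv_le hθ.le hε.le _
  have ha' : ∑ i : Fin 2, l2sq (volume.restrict (Ω ∩ Prod.fst ⁻¹' far R))
      (weakDeriv Ω (e3 i.succ) w) ≤ a := by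
    have e : a = _ + ∑ i : Fin 2, l2sq (volume.restrict Ω) (weakDeriv Ω (e3 i.succ) w) :=
      Fin.sum_univ_succ _
    rw [e]
    refine le_trans (Finset.sum_le_sum fun i _ => ?_) (le_add_left le_rfl)
    exact l2sq_restrict_mono inter_subset_left
  have h3 : ENNReal.ofReal lg * b ≤ a + ENNReal.ofReal lg * B := by
    have e1 := surfaceTrace_axial hG (contDiff_regWeight θ hε.le) hc
    have e2 : l2sq (volume.restrict (surface l ∩ Prod.fst ⁻¹' far (R + 1))) (surfaceTrace Ω l w) =
        l2sq (volume.restrict (surface l ∩ Prod.fst ⁻¹' far (R + 1)))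
          (axial (regWeight θ ε) (surfaceTrace Ω l (cut Φ))) :=
      l2sq_congr (ae_mono (Measure.restrict_mono inter_subset_left le_rfl) e1)
    have e3 := l2sq_axial_le (m := volume) (s := surface l) hθ.le hε.le (R + 1)
      (surfaceTrace Ω l (cut Φ))
    have e4 := (lambdaGamma_mul_surfaceTrace_le hG hR hw hw0).trans ha'
    rw [← l2sq_congr e1, ← e2] at e3
    calc ENNReal.ofReal lg * b ≤ ENNReal.ofReal lg * (_ + B) := by gcongr
      _ ≤ _ := by rw [mul_add]; gcongr
  have h4 : m ≤ C * a + B' := by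
    refine (l2sq_axial_le (m := volume) (s := Ω) hθ.le hε.le (R + 1) (cut Φ)).trans ?_
    gcongr
    exact (hC w hw hw0).trans (by gcongr)
  have ha : a ≠ ⊤ := (ENNReal.sum_lt_top.2 fun i _ =>
    l2sq_lt_top (memLp_weakDeriv (isOpen_water hG) hw i).2).ne
  have hb : b ≠ ⊤ := (l2sq_lt_top (memLp_surfaceTrace hG hw)).ne
  have hm : m ≠ ⊤ := (l2sq_lt_top hw.1).ne
  have hcc : c ≠ ⊤ := ne_top_of_le_ne_top (by finiteness) h2
  -- Absorption subtracts multiples of a, which is legitimate since for ε > 0 the function w is in ℋ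
  -- and all quantities are finite.
  have haK : a ≤ ENNReal.ofReal K := by
    rw [← ENNReal.ofReal_toReal ha]
    refine ENNReal.ofReal_le_ofReal (absorb (b := b.toReal) (c := c.toReal) (m := m.toReal)
      (C := C) hlam hlg ENNReal.toReal_nonneg ?_ ?_ ?_ ?_ (sq_nonneg θ) hθC)
    · have := congrArg ENNReal.toReal h1
      rwa [ENNReal.toReal_add (by finiteness) hcc, ENNReal.toReal_mul,
        ENNReal.toReal_ofReal hlam] at this
    · have := ENNReal.toReal_mono (by finiteness) h2
      rwa [ENNReal.toReal_mul, ENNReal.toReal_pow, ENNReal.toReal_ofReal hθ.le] at this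
    · have := ENNReal.toReal_mono (by finiteness) h3
      rwa [ENNReal.toReal_add ha (by finiteness), ENNReal.toReal_mul, ENNReal.toReal_mul,
        ENNReal.toReal_ofReal hlg0.le] at this
    · have := ENNReal.toReal_mono (by finiteness) h4
      rwa [ENNReal.toReal_add (by finiteness) hB', ENNReal.toReal_mul, ENNReal.coe_toReal] at this
  refine ⟨haK.trans (le_add_right le_rfl), (h4.trans ?_).trans (le_add_left le_rfl)⟩
  gcongr

/-- Fatou's lemma along ε = 1 / (n + 1), as the regularized weights converge pointwise to the full
one. -/
theorem memLp_axial_of_bounded {m : Measure (ℝ × ℝ × ℝ)} {f : ℝ × ℝ × ℝ → ℂ}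
    (hf : AEStronglyMeasurable f m) {K : ℝ≥0∞} (hK : K ≠ ⊤)
    (h : ∀ ε, 0 < ε → l2sq m (axial (regWeight θ ε) f) ≤ K) :
    MemLp (axial (regWeight θ 0) f) 2 m := by
  have hm : ∀ {ε}, 0 ≤ ε → AEStronglyMeasurable (axial (regWeight θ ε) f) m := fun hε =>
    ((contDiff_regWeight θ hε).continuous.comp continuous_fst).aestronglyMeasurable.smul hf
  refine memLp_two_iff_l2sq.2 ⟨hm le_rfl, lt_of_le_of_lt ?_ hK.lt_top⟩
  calc l2sq m (axial (regWeight θ 0) f)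
      ≤ ∫⁻ x, liminf (fun n : ℕ => ‖axial (regWeight θ (1 / (n + 1))) f x‖ₑ ^ 2) atTop ∂m := by
        refine lintegral_mono fun x => ?_
        have h1 : Tendsto (fun n : ℕ => axial (regWeight θ (1 / (n + 1))) f x) atTop
            (𝓝 (axial (regWeight θ 0) f x)) := (tendsto_regWeight θ x.1).smul_const _
        exact (((ENNReal.continuous_pow 2).comp continuous_enorm).tendsto _ |>.comp
          h1).liminf_eq.symm.le
    _ ≤ liminf (fun n : ℕ => l2sq m (axial (regWeight θ (1 / (n + 1))) f)) atTop :=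
        lintegral_liminf_le' fun n => (hm (by positivity)).enorm.pow_const 2
    _ ≤ K := by
        refine liminf_le_of_le (by isBoundedDefault) fun b hb => ?_
        obtain ⟨n, hn⟩ := hb.exists
        exact hn.trans (h _ (by positivity))

/-- The modulus is invariant under the reflection, which exchanges the two halves of the domain up
to a null set; so the right half decides. -/
theorem memLp_of_cut (hG : IsCanalWithBody Γ l Θ) {f : ℝ × ℝ × ℝ → ℂ}
    (hf : AEStronglyMeasurable f (volume.restrict (water Γ Θ)))
    (hr : ∀ᵐ x ∂(volume.restrict (water Γ Θ)), ‖f (reflL x)‖ = ‖f x‖)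
    (h : MemLp (cut f) 2 (volume.restrict (water Γ Θ))) :
    MemLp f 2 (volume.restrict (water Γ Θ)) := by
  set Ω := water Γ Θ
  have hm : MeasurableSet rightHalf := isOpen_rightHalf.measurableSet
  have h1 : ∫⁻ x in Ω ∩ rightHalf, ‖f x‖ₑ ^ 2 < ⊤ := by
    have h' : MemLp (rightHalf.indicator f) 2 (volume.restrict Ω) := h
    rw [memLp_indicator_iff_restrict hm, Measure.restrict_restrict hm, inter_comm] at h'
    exact l2sq_lt_top h'
  refine memLp_two_iff_l2sq.2 ⟨hf, ?_⟩
  rw [l2sq, ← lintegral_inter_add_sdiff _ Ω hm]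
  refine ENNReal.add_lt_top.2 ⟨h1, ?_⟩
  have h2 : ∫⁻ x in Ω \ rightHalf, ‖f x‖ₑ ^ 2 =
      ∫⁻ x in reflL ⁻¹' (Ω \ rightHalf), ‖f (reflL x)‖ₑ ^ 2 :=
    (measurePreserving_reflL.setLIntegral_comp_preimage_emb
      reflL.toHomeomorph.measurableEmbedding (fun x => ‖f x‖ₑ ^ 2) _).symm
  have h3 : (reflL ⁻¹' (Ω \ rightHalf) : Set _) =ᵐ[volume] (Ω ∩ rightHalf : Set _) :=
    preimage_reflL_water_sdiff hG
  rw [h2, setLIntegral_congr h3]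
  refine lt_of_le_of_lt (le_of_eq (lintegral_congr_ae ?_)) h1
  filter_upwards [ae_mono (Measure.restrict_mono inter_subset_left le_rfl) hr] with x hx
  rw [← ofReal_norm, hx, ofReal_norm]

theorem norm_weakDeriv_reflL (hG : IsCanalWithBody Γ l Θ) {u : ℝ × ℝ × ℝ → ℂ}
    (hu : MemH0 (water Γ Θ) u) (i : Fin 3) : ∀ᵐ x ∂(volume.restrict (water Γ Θ)),
      ‖weakDeriv (water Γ Θ) (e3 i) u (reflL x)‖ = ‖weakDeriv (water Γ Θ) (e3 i) u x‖ := by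
  have h := (memLp_weakDeriv (isOpen_water hG) hu.1 i).1
  obtain ⟨s, hs, hsi⟩ : ∃ s : ℝ, |s| = 1 ∧ s • reflL.symm (e3 i) = e3 i := by
    fin_cases i
    · exact ⟨1, by simp, by simp [e3]⟩
    · exact ⟨-1, by simp, by simp [e3]⟩
    · exact ⟨1, by simp, by simp [e3]⟩
  have h1 := h.comp_equiv reflL measurePreserving_reflL
  rw [preimage_reflL_water hG] at h1
  have h2 := (h1.smul_dir s).congr (u' := -u) hu.2 (ae_eq_refl _)
  rw [hsi] at h2
  have h3 := h2.ae_unique (isOpen_water hG) h.neg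
  filter_upwards [h3] with x hx
  have hx' := congrArg norm hx
  simp only [Pi.smul_apply, Function.comp_apply, Pi.neg_apply, norm_smul, norm_neg,
    Complex.norm_real, Real.norm_eq_abs, hs, one_mul] at hx'
  exact hx'

theorem cut_axial (ρ : ℝ → ℝ) (u : ℝ × ℝ × ℝ → ℂ) : cut (axial ρ u) = axial ρ (cut u) := by
  ext x
  by_cases hx : x ∈ rightHalf <;> simp [cut, axial, hx]

/-- Eigenfunctions below the threshold decay exponentially. -/
theorem exists_memLp_axial (hG : IsCanalWithBody Γ l Θ) (hμ : μ ∈ Ioc (muGamma Γ l) 1) :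
    ∃ θ₀ : ℝ, 0 < θ₀ ∧ ∀ θ : ℝ, 0 < θ → θ ≤ θ₀ → ∀ Φ, IsEigenfunctionT0 (water Γ Θ) l μ Φ →
      MemLp (axial (regWeight θ 0) Φ) 2 (volume.restrict (water Γ Θ)) ∧
      ∀ i, MemLp (axial (regWeight θ 0) (weakDeriv (water Γ Θ) (e3 i) Φ)) 2
        (volume.restrict (water Γ Θ)) := by
  obtain ⟨θ₀, hθ₀, H⟩ := exists_energy_bound hG hμ
  refine ⟨θ₀, hθ₀, fun θ hθ hθ' Φ hΦ => ?_⟩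
  obtain ⟨K, hK, hb⟩ := H θ hθ hθ' Φ hΦ
  set Ω := water Γ Θ
  have hc : MemH Ω (cut Φ) := hΦ.2.1.cut hG
  have hmeas : ∀ {f : ℝ × ℝ × ℝ → ℂ}, AEStronglyMeasurable f (volume.restrict Ω) →
      AEStronglyMeasurable (axial (regWeight θ 0) f) (volume.restrict Ω) := fun hf =>
    ((contDiff_regWeight θ le_rfl).continuous.comp continuous_fst).aestronglyMeasurable.smul hf
  refine ⟨memLp_of_cut hG (hmeas hΦ.2.1.1.1.1) ?_ ?_, fun i => memLp_of_cut hG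
    (hmeas (memLp_weakDeriv (isOpen_water hG) hΦ.2.1.1 i).2.1) ?_ ?_⟩
  · filter_upwards [hΦ.2.1.2] with x hx
    have : Φ (reflL x) = -Φ x := hx
    rw [axial, axial, norm_smul, norm_smul, this, norm_neg]
    rfl
  · rw [cut_axial]
    exact memLp_axial_of_bounded hc.1.1 hK fun ε hε => (hb ε hε).2
  · filter_upwards [norm_weakDeriv_reflL hG hΦ.2.1 i] with x hx
    rw [axial, axial, norm_smul, norm_smul, hx]
    rfl
  · have hd := (memLp_weakDeriv (isOpen_water hG) hc i).2
    have e1 : cut (axial (regWeight θ 0) (weakDeriv Ω (e3 i) Φ)) =ᵐ[volume.restrict Ω]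
        axial (regWeight θ 0) (weakDeriv Ω (e3 i) (cut Φ)) := by
      filter_upwards [weakDeriv_cut hG hΦ.2.1 i] with x hx
      rw [cut_axial, axial, axial, hx]
      rfl
    refine (memLp_congr_ae e1).2 (memLp_axial_of_bounded hd.1
      (K := 2 * K + 2 * (ENNReal.ofReal θ ^ 2 * K)) (by finiteness) fun ε hε => ?_)
    -- The energy estimate bounds ∇(ρu), while ρ∇u is wanted. They differ by ρ'u, whose square
    -- integral is at most θ² times that of ρu.
    have hρ := contDiff_regWeight θ hε.le
    have hw : MemH Ω (axial (regWeight θ ε) (cut Φ)) := memH_axial_regWeight hG hθ.le hε hc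
    have e2 : axial (regWeight θ ε) (weakDeriv Ω (e3 i) (cut Φ)) =ᵐ[volume.restrict Ω] fun x =>
        weakDeriv Ω (e3 i) (axial (regWeight θ ε) (cut Φ)) x -
          ((e3 i).1 * deriv (regWeight θ ε) x.1) • cut Φ x := by
      filter_upwards [weakDeriv_axial hG hρ hc i] with x hx
      rw [hx, add_sub_cancel_right, axial]
    rw [l2sq_congr e2]
    refine (l2sq_sub_le (memLp_weakDeriv (isOpen_water hG) hw i).2.1).trans ?_
    gcongr
    · exact (Finset.single_le_sum (f := fun i => l2sq (volume.restrict Ω)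
        (weakDeriv Ω (e3 i) (axial (regWeight θ ε) (cut Φ)))) (fun _ _ => zero_le)
        (Finset.mem_univ i)).trans (hb ε hε).1
    · refine le_trans (l2sq_mono (Eventually.of_forall fun x => ?_))
        ((l2sq_axial_deriv_le hθ.le hε.le (cut Φ)).trans (by gcongr; exact (hb ε hε).2))
      rw [axial, norm_smul, norm_smul, norm_mul]
      have := abs_e3_fst_le i
      rw [← Real.norm_eq_abs] at this
      exact mul_le_mul_of_nonneg_right (mul_le_of_le_one_left (norm_nonneg _) this) (norm_nonneg _)

end Decay

/-! ### Weighted weak form, tail estimate and continuity of the functional -/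

section Corollary

variable {Γ : Set (ℝ × ℝ)} {l : ℝ} {Θ : Set (ℝ × ℝ × ℝ)} {μ θ : ℝ}

theorem memLp_axial_deriv {u : ℝ × ℝ × ℝ → ℂ} {m : Measure (ℝ × ℝ × ℝ)} (hθ : 0 ≤ θ)
    (hu : AEStronglyMeasurable u m) (h : MemLp (axial (regWeight θ 0) u) 2 m) :
    MemLp (axial (deriv (regWeight θ 0)) u) 2 m :=
  (h.const_smul θ).mono ((((contDiff_regWeight θ le_rfl).continuous_deriv (by simp)).comp
    continuous_fst).aestronglyMeasurable.smul hu)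
    (Eventually.of_forall fun x => norm_axial_deriv_le hθ le_rfl u x)

theorem memH_weighted (hG : IsCanalWithBody Γ l Θ) (hθ : 0 ≤ θ) {u : ℝ × ℝ × ℝ → ℂ}
    (hu : MemH (water Γ Θ) u)
    (h : MemLp (axial (regWeight θ 0) u) 2 (volume.restrict (water Γ Θ)))
    (hd : ∀ i, MemLp (axial (regWeight θ 0) (weakDeriv (water Γ Θ) (e3 i) u)) 2
      (volume.restrict (water Γ Θ))) : MemH (water Γ Θ) (weighted θ u) := by
  rw [weighted_eq_axial]
  refine ⟨h, fun i => ⟨_, (memLp_weakDeriv (isOpen_water hG) hu i).1.smul_smooth (isOpen_water hG)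
    (contDiff_comp_fst (contDiff_regWeight θ le_rfl)), (hd i).add ?_⟩⟩
  have h1 := (memLp_axial_deriv hθ hu.1.1 h).const_smul (e3 i).1
  refine (memLp_congr_ae (Eventually.of_forall fun x => ?_)).1 h1
  simp only [fderiv_comp_fst (contDiff_regWeight θ le_rfl), Pi.smul_apply, axial, smul_smul]

theorem isOdd_axial (ρ : ℝ → ℝ) {Ω : Set (ℝ × ℝ × ℝ)} {u : ℝ × ℝ × ℝ → ℂ} (hu : IsOdd Ω u) :
    IsOdd Ω (axial ρ u) := by
  filter_upwards [hu] with x hx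
  rw [axial, axial, hx, smul_neg]
  rfl

/-- R_θ² = R_{2θ}. The weighted test function is R_θ times an element of ℋ, so only this one factor
has to be regularized. -/
theorem weighted_two_mul (θ : ℝ) (u : ℝ × ℝ × ℝ → ℂ) :
    weighted (2 * θ) u = axial (regWeight θ 0) (weighted θ u) := by
  ext x
  rw [axial, regWeight_zero, weighted, weighted, smul_smul, weight, weight, ← Real.exp_add]
  ring_nf

theorem norm_axial_le {α : Type*} (n : ℕ) (u : ℝ × α → ℂ) (x : ℝ × α) :
    ‖axial (regWeight θ (1 / (n + 1))) u x‖ ≤ ‖axial (regWeight θ 0) u x‖ := by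
  have hn : (0 : ℝ) ≤ 1 / (n + 1) := by positivity
  rw [axial, axial, norm_smul, norm_smul, Real.norm_of_nonneg (regWeight_pos hn _).le,
    Real.norm_of_nonneg (regWeight_pos le_rfl _).le]
  exact mul_le_mul_of_nonneg_right (regWeight_le hn _) (norm_nonneg _)

theorem axial_mul_conj {α : Type*} (ρ : ℝ → ℝ) (f g : ℝ × α → ℂ) (x : ℝ × α) :
    f x * conj (axial ρ g x) = axial ρ f x * conj (g x) := by
  simp only [axial, Complex.real_smul, map_mul, Complex.conj_ofReal]
  ring

/-- The weight is real and may be moved from g to f, where R_θ f is square integrable; this gives a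
majorant independent of the regularization. -/
theorem tendsto_integral_axial {α : Type*} [MeasurableSpace α] {m : Measure (ℝ × α)}
    {f g : ℝ × α → ℂ} (hf : AEStronglyMeasurable f m)
    (hfw : MemLp (axial (regWeight θ 0) f) 2 m) (hg : MemLp g 2 m) :
    Tendsto (fun n : ℕ => ∫ x, f x * conj (axial (regWeight θ (1 / (n + 1))) g x) ∂m) atTop
      (𝓝 (∫ x, f x * conj (axial (regWeight θ 0) g x) ∂m)) := by
  refine tendsto_integral_of_dominated_convergence
    (fun x => ‖axial (regWeight θ 0) f x * conj (g x)‖) (fun n => ?_)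
    (integrable_mul_conj hfw hg).norm (fun n => Eventually.of_forall fun x => ?_)
    (Eventually.of_forall fun x => ?_)
  · exact hf.mul (Complex.continuous_conj.comp_aestronglyMeasurable
      (((contDiff_regWeight θ (by positivity)).continuous.measurable.comp
        measurable_fst).aestronglyMeasurable.smul hg.1))
  · rw [axial_mul_conj, norm_mul, norm_mul]
    exact mul_le_mul_of_nonneg_right (norm_axial_le n f x) (norm_nonneg _)
  · exact ((Complex.continuous_conj.tendsto _).comp
      ((tendsto_regWeight θ x.1).smul_const (g x))).const_mul _

theorem tendsto_integral_axial_deriv {α : Type*} [MeasurableSpace α] {m : Measure (ℝ × α)}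
    (hθ : 0 ≤ θ) {f g : ℝ × α → ℂ} (hf : AEStronglyMeasurable f m)
    (hfw : MemLp (axial (regWeight θ 0) f) 2 m) (hg : MemLp g 2 m) :
    Tendsto (fun n : ℕ => ∫ x, f x * conj (axial (deriv (regWeight θ (1 / (n + 1)))) g x) ∂m) atTop
      (𝓝 (∫ x, f x * conj (axial (deriv (regWeight θ 0)) g x) ∂m)) := by
  refine tendsto_integral_of_dominated_convergence
    (fun x => θ * ‖axial (regWeight θ 0) f x * conj (g x)‖) (fun n => ?_)
    ((integrable_mul_conj hfw hg).norm.const_mul θ) (fun n => Eventually.of_forall fun x => ?_)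
    (Eventually.of_forall fun x => ?_)
  · exact hf.mul (Complex.continuous_conj.comp_aestronglyMeasurable
      ((((contDiff_regWeight θ (by positivity)).continuous_deriv (by simp)).measurable.comp
        measurable_fst).aestronglyMeasurable.smul hg.1))
  · rw [axial_mul_conj, norm_mul, norm_mul, ← mul_assoc]
    refine mul_le_mul_of_nonneg_right ?_ (norm_nonneg _)
    have h1 := norm_axial_deriv_le hθ (show (0 : ℝ) ≤ 1 / (n + 1) by positivity) f x
    rw [norm_smul, Real.norm_of_nonneg hθ] at h1
    exact h1.trans (mul_le_mul_of_nonneg_left (norm_axial_le n f x) hθ)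
  · exact ((Complex.continuous_conj.tendsto _).comp
      ((tendsto_deriv_regWeight θ x.1).smul_const (g x))).const_mul _

theorem gradInner_axial (hG : IsCanalWithBody Γ l Θ) {Φ u : ℝ × ℝ × ℝ → ℂ}
    (hu : MemH (water Γ Θ) u) {ρ : ℝ → ℝ} (hρ : ContDiff ℝ ∞ ρ)
    (h1 : ∀ i, Integrable (fun x => weakDeriv (water Γ Θ) (e3 i) Φ x *
      conj (axial ρ (weakDeriv (water Γ Θ) (e3 i) u) x)) (volume.restrict (water Γ Θ)))
    (h2 : ∀ i, Integrable (fun x => weakDeriv (water Γ Θ) (e3 i) Φ x *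
      conj (axial (deriv ρ) u x)) (volume.restrict (water Γ Θ))) :
    gradInner (water Γ Θ) e3 (water Γ Θ ∩ rightHalf) Φ (axial ρ u) =
      ∑ i, ((∫ x in water Γ Θ ∩ rightHalf, weakDeriv (water Γ Θ) (e3 i) Φ x *
        conj (axial ρ (weakDeriv (water Γ Θ) (e3 i) u) x)) +
      (e3 i).1 * ∫ x in water Γ Θ ∩ rightHalf, weakDeriv (water Γ Θ) (e3 i) Φ x *
        conj (axial (deriv ρ) u x)) := by
  have hle : volume.restrict (water Γ Θ ∩ rightHalf) ≤ volume.restrict (water Γ Θ) :=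
    Measure.restrict_mono inter_subset_left le_rfl
  simp only [← integral_const_mul]
  rw [gradInner, Finset.sum_congr rfl fun i _ => (integral_add ((h1 i).mono_measure hle)
    (((h2 i).mono_measure hle).const_mul _)).symm, ← integral_finsetSum]
  · refine integral_congr_ae ?_
    filter_upwards [ae_mono hle (ae_all_iff.2 fun i => weakDeriv_axial hG hρ hu i)] with x hx
    refine Finset.sum_congr rfl fun i _ => ?_
    rw [hx]
    simp only [axial, Complex.real_smul, map_add, map_mul, Complex.conj_ofReal, Complex.ofReal_mul]
    ring
  · exact fun i _ => ((h1 i).mono_measure hle).add (((h2 i).mono_measure hle).const_mul _)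

theorem integrable_mul_axial {α : Type*} [MeasurableSpace α] {m : Measure (ℝ × α)} {ρ : ℝ → ℝ}
    {f g : ℝ × α → ℂ} (hf : MemLp (axial ρ f) 2 m) (hg : MemLp g 2 m) :
    Integrable (fun x => f x * conj (axial ρ g x)) m := by
  simp only [axial_mul_conj]
  exact integrable_mul_conj hf hg

/-- The weak form is also satisfied for exponentially growing test functions. -/
theorem IsEigenfunctionT0.weighted_form (hG : IsCanalWithBody Γ l Θ) (hμ : 0 < μ) (hθ : 0 ≤ θ)
    {Φ : ℝ × ℝ × ℝ → ℂ} (h : IsEigenfunctionT0 (water Γ Θ) l μ Φ)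
    (hΦw : MemLp (axial (regWeight θ 0) Φ) 2 (volume.restrict (water Γ Θ)))
    (hΦd : ∀ i, MemLp (axial (regWeight θ 0) (weakDeriv (water Γ Θ) (e3 i) Φ)) 2
      (volume.restrict (water Γ Θ))) {Ψ : ℝ × ℝ × ℝ → ℂ} (hΨ : MemW0 (water Γ Θ) θ Ψ) :
    gradInner (water Γ Θ) e3 (water Γ Θ ∩ rightHalf) Φ (weighted (2 * θ) Ψ) =
      ((μ⁻¹ - 1 : ℝ) : ℂ) * surfaceInner (water Γ Θ) l (univ ×ˢ Ioo 0 l) Φ (weighted (2 * θ) Ψ) := by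
  rw [weighted_two_mul]
  set u := weighted θ Ψ with hu
  set Ω := water Γ Θ
  have hle : volume.restrict (Ω ∩ rightHalf) ≤ volume.restrict Ω :=
    Measure.restrict_mono inter_subset_left le_rfl
  have hles : volume.restrict (univ ×ˢ Ioo 0 l : Set (ℝ × ℝ)) ≤ volume.restrict (surface l) :=
    Measure.restrict_mono (Set.prod_mono le_rfl
      (Ioo_subset_Ioo_left (by linarith [hG.l_pos]))) le_rfl
  have huH : MemH0 Ω u := ⟨hΨ.1, by rw [hu, weighted_eq_axial]; exact isOdd_axial _ hΨ.2⟩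
  have hdΦ := fun i => (memLp_weakDeriv (isOpen_water hG) h.2.1.1 i).2
  have hdu := fun i => (memLp_weakDeriv (isOpen_water hG) huH.1 i).2
  have hn : ∀ n : ℕ, (0 : ℝ) < 1 / (n + 1) := fun n => by positivity
  have hw : ∀ n : ℕ, MemH0 Ω (axial (regWeight θ (1 / (n + 1))) u) := fun n =>
    ⟨memH_axial_regWeight hG hθ (hn n) huH.1, isOdd_axial _ huH.2⟩
  have hb : ∀ (n : ℕ) {f : ℝ × ℝ × ℝ → ℂ}, MemLp f 2 (volume.restrict Ω) →
      MemLp (axial (regWeight θ (1 / (n + 1))) f) 2 (volume.restrict Ω) ∧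
      MemLp (axial (deriv (regWeight θ (1 / (n + 1)))) f) 2 (volume.restrict Ω) := fun n f hf =>
    ⟨memLp_real_smul (ρ := fun x : ℝ × ℝ × ℝ => regWeight θ (1 / (n + 1)) x.1)
      ((contDiff_regWeight θ (hn n).le).continuous.comp continuous_fst)
      (fun x => abs_regWeight_le_inv (hn n) x.1) hf,
    memLp_real_smul (ρ := fun x : ℝ × ℝ × ℝ => deriv (regWeight θ (1 / (n + 1))) x.1)
      (((contDiff_regWeight θ (hn n).le).continuous_deriv (by simp)).comp continuous_fst)
      (fun x => abs_deriv_regWeight_le_inv hθ (hn n) x.1) hf⟩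
  -- The half form holds for the regularized test functions, which belong to ℋ⁰. Both of its sides
  -- converge, the gradient side after separating the derivative of the weight.
  have t1 : Tendsto (fun n : ℕ => gradInner Ω e3 (Ω ∩ rightHalf) Φ
      (axial (regWeight θ (1 / (n + 1))) u)) atTop
      (𝓝 (gradInner Ω e3 (Ω ∩ rightHalf) Φ (axial (regWeight θ 0) u))) := by
    rw [gradInner_axial hG huH.1 (contDiff_regWeight θ le_rfl)
      (fun i => integrable_mul_axial (hΦd i) (hdu i))
      (fun i => integrable_mul_axial (memLp_axial_deriv hθ (hdΦ i).1 (hΦd i)) huH.1.1)]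
    refine Tendsto.congr (fun n => (gradInner_axial hG huH.1 (contDiff_regWeight θ (hn n).le)
      (fun i => integrable_mul_axial (hb n (hdΦ i)).1 (hdu i))
      (fun i => integrable_mul_axial (hb n (hdΦ i)).2 huH.1.1)).symm) ?_
    refine tendsto_finsetSum _ fun i _ => ?_
    have hf := ((hdΦ i).1.mono_measure hle)
    have hfw := ((hΦd i).mono_measure hle)
    exact (tendsto_integral_axial hf hfw ((hdu i).mono_measure hle)).add
      ((tendsto_integral_axial_deriv hθ hf hfw (huH.1.1.mono_measure hle)).const_mul _)
  have htΦ := memLp_surfaceTrace hG h.2.1.1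
  have htu := memLp_surfaceTrace hG huH.1
  -- The weighted trace of Φ is the trace of R_θ Φ, which is in ℋ; this gives the majorant on the
  -- surface.
  have htw : MemLp (axial (regWeight θ 0) (surfaceTrace Ω l Φ)) 2 (volume.restrict (surface l)) := by
    refine (memLp_congr_ae (surfaceTrace_axial hG (contDiff_regWeight θ le_rfl) h.2.1.1)).1
      (memLp_surfaceTrace hG ?_)
    rw [← weighted_eq_axial]
    exact memH_weighted hG hθ h.2.1.1 hΦw hΦd
  have hs : ∀ {ε : ℝ}, 0 ≤ ε → surfaceInner Ω l (univ ×ˢ Ioo 0 l) Φ (axial (regWeight θ ε) u) =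
      ∫ y in univ ×ˢ Ioo 0 l, surfaceTrace Ω l Φ y *
        conj (axial (regWeight θ ε) (surfaceTrace Ω l u) y) := fun hε => by
    refine integral_congr_ae ?_
    filter_upwards [ae_mono hles (surfaceTrace_axial hG (contDiff_regWeight θ hε) huH.1)] with y hy
    rw [hy]
  have t2 : Tendsto (fun n : ℕ => surfaceInner Ω l (univ ×ˢ Ioo 0 l) Φ
      (axial (regWeight θ (1 / (n + 1))) u)) atTop
      (𝓝 (surfaceInner Ω l (univ ×ˢ Ioo 0 l) Φ (axial (regWeight θ 0) u))) := by
    rw [hs le_rfl]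
    refine Tendsto.congr (fun n => (hs (hn n).le).symm) ?_
    exact tendsto_integral_axial (htΦ.1.mono_measure hles) (htw.mono_measure hles)
      (htu.mono_measure hles)
  exact tendsto_nhds_unique t1 ((t2.const_mul _).congr fun n => (h.half_form hG hμ (hw n)).symm)

theorem enorm_sq_le_axial {α : Type*} (hθ : 0 ≤ θ) {r : ℝ} (f : ℝ × α → ℂ) {x : ℝ × α}
    (hx : r ≤ |x.1|) : ‖f x‖ₑ ^ 2 ≤
      ENNReal.ofReal (Real.exp (-(2 * θ * r))) * ‖axial (regWeight θ 0) f x‖ₑ ^ 2 := by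
  rw [← ofReal_norm, ← ofReal_norm, ← ENNReal.ofReal_pow (norm_nonneg _),
    ← ENNReal.ofReal_pow (norm_nonneg _), ← ENNReal.ofReal_mul (Real.exp_pos _).le]
  refine ENNReal.ofReal_le_ofReal ?_
  have h1 := exp_le_regWeight_zero hθ hx
  rw [axial, norm_smul, Real.norm_of_nonneg (regWeight_pos le_rfl _).le, mul_pow, ← mul_assoc]
  refine le_mul_of_one_le_left (sq_nonneg _) ?_
  have h2 : Real.exp (θ * r) ^ 2 ≤ regWeight θ 0 x.1 ^ 2 :=
    pow_le_pow_left₀ (Real.exp_pos _).le h1 2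
  calc (1 : ℝ) = Real.exp (-(2 * θ * r)) * Real.exp (θ * r) ^ 2 := by
        rw [← Real.exp_nat_mul, ← Real.exp_add, ← Real.exp_zero]
        congr 1
        push_cast
        ring
    _ ≤ _ := by gcongr

/-- For |x₁| ≥ r the factor R_θ² is at least e^{2θr}, so C may be taken as the full weighted energy,
which is finite because R_θ Φ, R_θ ∇Φ and the weighted trace are square integrable. -/
theorem exists_tailEnergy_le (hG : IsCanalWithBody Γ l Θ) (hθ : 0 ≤ θ) {Φ : ℝ × ℝ × ℝ → ℂ}
    (h : MemH (water Γ Θ) Φ)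
    (hΦw : MemLp (axial (regWeight θ 0) Φ) 2 (volume.restrict (water Γ Θ)))
    (hΦd : ∀ i, MemLp (axial (regWeight θ 0) (weakDeriv (water Γ Θ) (e3 i) Φ)) 2
      (volume.restrict (water Γ Θ))) : ∃ C : ℝ, ∀ r : ℝ,
        tailEnergy (water Γ Θ) l r Φ ≤ ENNReal.ofReal (C * Real.exp (-(2 * θ * r))) := by
  set Ω := water Γ Θ
  have htw : MemLp (axial (regWeight θ 0) (surfaceTrace Ω l Φ)) 2 (volume.restrict (surface l)) := by
    refine (memLp_congr_ae (surfaceTrace_axial hG (contDiff_regWeight θ le_rfl) h)).1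
      (memLp_surfaceTrace hG ?_)
    rw [← weighted_eq_axial]
    exact memH_weighted hG hθ h hΦw hΦd
  set T := (∫⁻ x in Ω, (‖axial (regWeight θ 0) Φ x‖ₑ ^ 2 +
    ∑ i, ‖axial (regWeight θ 0) (weakDeriv Ω (e3 i) Φ) x‖ₑ ^ 2)) +
    ∫⁻ y in surface l, ‖axial (regWeight θ 0) (surfaceTrace Ω l Φ) y‖ₑ ^ 2 with hT
  have hTt : T ≠ ⊤ := by
    rw [hT, lintegral_add_left' (hΦw.1.enorm.pow_const 2),
      lintegral_finsetSum' _ fun i _ => ((hΦd i).1.enorm.pow_const 2)]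
    exact ENNReal.add_ne_top.2 ⟨ENNReal.add_ne_top.2 ⟨(l2sq_lt_top hΦw).ne,
      (ENNReal.sum_lt_top.2 fun i _ => l2sq_lt_top (hΦd i)).ne⟩, (l2sq_lt_top htw).ne⟩
  refine ⟨T.toReal, fun r => ?_⟩
  rw [mul_comm, ENNReal.ofReal_mul (Real.exp_pos _).le, ENNReal.ofReal_toReal hTt, hT, mul_add,
    ← lintegral_const_mul' _ _ ENNReal.ofReal_ne_top,
    ← lintegral_const_mul' _ _ ENNReal.ofReal_ne_top, tailEnergy]
  have hm : ∀ {α : Type} [MeasurableSpace α] {s : Set (ℝ × α)}, MeasurableSet s →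
      MeasurableSet (s ∩ {x | r ≤ |x.1|}) := fun hs =>
    hs.inter (measurableSet_le measurable_const (by fun_prop))
  refine add_le_add ?_ ?_
  · refine (setLIntegral_mono' (hm (isOpen_water hG).measurableSet) fun x hx => ?_).trans
      (lintegral_mono_set inter_subset_left)
    rw [mul_add, Finset.mul_sum]
    exact add_le_add (enorm_sq_le_axial hθ _ hx.2)
      (Finset.sum_le_sum fun i _ => enorm_sq_le_axial hθ _ hx.2)
  · exact (setLIntegral_mono' (hm (isOpen_surface l).measurableSet) fun y hy =>
      enorm_sq_le_axial hθ _ hy.2).trans (lintegral_mono_set inter_subset_left)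

theorem l2sq_weakGrad_cut_le (hG : IsCanalWithBody Γ l Θ) {u : ℝ × ℝ × ℝ → ℂ}
    (hu : MemH0 (water Γ Θ) u) : l2sq (volume.restrict (water Γ Θ)) (weakGrad (water Γ Θ) e3 (cut u)) ≤
      ENNReal.ofReal (normH (water Γ Θ) l u ^ 2) := by
  rw [normH, Real.sq_sqrt (add_nonneg (integral_nonneg fun x => Finset.sum_nonneg fun i _ =>
    sq_nonneg _) (integral_nonneg fun _ => sq_nonneg _))]
  refine le_trans ?_ (ENNReal.ofReal_le_ofReal (le_add_of_nonneg_right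
    (integral_nonneg fun _ => sq_nonneg _)))
  have h1 : ∫ x in water Γ Θ, ∑ i, ‖weakDeriv (water Γ Θ) (e3 i) u x‖ ^ 2 =
      ∫ x in water Γ Θ, ‖weakGrad (water Γ Θ) e3 u x‖ ^ 2 := by
    simp only [weakGrad, EuclideanSpace.norm_sq_eq]
  rw [h1, ofReal_integral_norm_sq (memLp_weakGrad (isOpen_water hG) hu.1), l2sq_weakGrad,
    l2sq_weakGrad]
  refine lintegral_mono_ae ?_
  filter_upwards [ae_all_iff.2 fun i => weakDeriv_cut hG hu i] with x hx
  refine Finset.sum_le_sum fun i _ => ?_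
  rw [hx]
  gcongr
  exact enorm_indicator_le_enorm_self _ _

/-- On |x₁| < L the weight is bounded above and below, so only a local L² bound for v = R_{-θ} Ψ is
missing. The norm of ℋ contains no such term; since v is odd, `cut v` is in ℋ and vanishes in the
left half, and Friedrichs' inequality provides the bound. -/
theorem exists_perturbation_le (hG : IsCanalWithBody Γ l Θ) {Φ : ℝ × ℝ × ℝ → ℂ}
    (hΦ : MemLp Φ 2 (volume.restrict (water Γ Θ))) (lam M L θ : ℝ) :
    ∃ C : ℝ, ∀ Ψ, MemW0 (water Γ Θ) (-θ) Ψ →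
      ‖perturbation (water Γ Θ) lam M L Φ Ψ‖ ≤ C * normW (water Γ Θ) l (-θ) Ψ := by
  obtain ⟨Cf, hCf⟩ := exists_water_friedrichs hG L
  set Ω := water Γ Θ
  -- An upper bound for the inverse weight R_θ on |x₁| < L; the absolute value covers both signs of
  -- θ.
  set B := Real.exp (|θ| * Real.sqrt (1 + L ^ 2))
  set N := (l2sq (volume.restrict Ω) Φ).toReal
  have hN : l2sq (volume.restrict Ω) Φ = ENNReal.ofReal N :=
    (ENNReal.ofReal_toReal (l2sq_lt_top hΦ).ne).symm
  refine ⟨|lam * M| * (B * Real.sqrt (N * Cf)), fun Ψ hΨ => ?_⟩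
  set v := weighted (-θ) Ψ with hv
  have hvH : MemH0 Ω v := ⟨hΨ.1, by rw [hv, weighted_eq_axial]; exact isOdd_axial _ hΨ.2⟩
  have hc : MemH Ω (cut v) := hvH.cut hG
  have hA : truncHalf Ω L ⊆ Ω ∩ {x | |x.1| ≤ L} := fun x hx => ⟨hx.1.1, (show |x.1| < L from hx.2).le⟩
  have hAm : MeasurableSet (truncHalf Ω L) :=
    ((isOpen_water hG).inter isOpen_rightHalf).measurableSet.inter
      (measurableSet_lt (by fun_prop) measurable_const)
  have hle : volume.restrict (truncHalf Ω L) ≤ volume.restrict Ω :=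
    Measure.restrict_mono (hA.trans inter_subset_left) le_rfl
  have h1 : l2sq (volume.restrict (truncHalf Ω L)) (cut v) ≤
      Cf * ENNReal.ofReal (normH Ω l v ^ 2) := by
    refine (l2sq_restrict_mono hA).trans ((hCf _ hc (Eventually.of_forall fun x hx =>
      cut_eq_zero v hx)).trans ?_)
    gcongr
    exact l2sq_weakGrad_cut_le hG hvH
  have h2 : ‖∫ x in truncHalf Ω L, Φ x * conj (Ψ x)‖ₑ ≤
      ENNReal.ofReal B * ∫⁻ x in truncHalf Ω L, ‖Φ x‖ₑ * ‖cut v x‖ₑ := by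
    refine (enorm_integral_le_lintegral_enorm _).trans ?_
    rw [← lintegral_const_mul' _ _ ENNReal.ofReal_ne_top]
    refine setLIntegral_mono' hAm fun x hx => ?_
    have e1 : cut v x = weight (-θ) x • Ψ x := indicator_of_mem hx.1.2 _
    have e2 : 1 ≤ B * weight (-θ) x := by
      rw [weight, ← Real.exp_add]
      refine Real.one_le_exp ?_
      have h3 : x.1 ^ 2 ≤ L ^ 2 := sq_le_sq' (abs_lt.1 hx.2).1.le (abs_lt.1 hx.2).2.le
      have h4 : Real.sqrt (1 + x.1 ^ 2) ≤ Real.sqrt (1 + L ^ 2) :=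
        Real.sqrt_le_sqrt (by linarith)
      have h5 := mul_le_mul (le_abs_self θ) h4 (Real.sqrt_nonneg _) (abs_nonneg θ)
      linarith
    have hw : 0 ≤ weight (-θ) x := (Real.exp_pos _).le
    rw [e1, ← ofReal_norm, ← ofReal_norm, ← ofReal_norm, ← ENNReal.ofReal_mul (norm_nonneg _),
      ← ENNReal.ofReal_mul (Real.exp_pos _).le]
    refine ENNReal.ofReal_le_ofReal ?_
    rw [norm_mul, RCLike.norm_conj, norm_smul, Real.norm_of_nonneg hw]
    calc ‖Φ x‖ * ‖Ψ x‖ ≤ (B * weight (-θ) x) * (‖Φ x‖ * ‖Ψ x‖) :=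
          le_mul_of_one_le_left (by positivity) e2
      _ = _ := by ring
  have h3 : (∫⁻ x in truncHalf Ω L, ‖Φ x‖ₑ * ‖cut v x‖ₑ) ^ 2 ≤
      ENNReal.ofReal (N * Cf * normH Ω l v ^ 2) := by
    refine (sq_lintegral_mul_le (hΦ.1.mono_measure hle).enorm (hc.1.1.mono_measure hle).enorm).trans ?_
    rw [mul_assoc, ENNReal.ofReal_mul ENNReal.toReal_nonneg, ENNReal.ofReal_mul Cf.coe_nonneg,
      ENNReal.ofReal_coe_nnreal, ← hN]
    exact mul_le_mul' (lintegral_mono' hle le_rfl) h1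
  have hn : 0 ≤ normH Ω l v := Real.sqrt_nonneg _
  have h4 : ∫⁻ x in truncHalf Ω L, ‖Φ x‖ₑ * ‖cut v x‖ₑ ≤
      ENNReal.ofReal (Real.sqrt (N * Cf) * normH Ω l v) := by
    refine (ENNReal.pow_le_pow_left_iff two_ne_zero).1 (h3.trans (le_of_eq ?_))
    rw [← ENNReal.ofReal_pow (by positivity), mul_pow, Real.sq_sqrt
      (mul_nonneg ENNReal.toReal_nonneg Cf.coe_nonneg)]
  have h5 : ‖∫ x in truncHalf Ω L, Φ x * conj (Ψ x)‖ ≤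
      B * (Real.sqrt (N * Cf) * normH Ω l v) := by
    have := h2.trans (mul_le_mul_right h4 _)
    rw [← ENNReal.ofReal_mul (Real.exp_pos _).le, ← ofReal_norm] at this
    exact (ENNReal.ofReal_le_ofReal_iff (by positivity)).1 this
  rw [perturbation, norm_mul, ← Complex.ofReal_mul, Complex.norm_real, Real.norm_eq_abs, mul_assoc,
    mul_assoc B]
  exact mul_le_mul_of_nonneg_left h5 (abs_nonneg _)

end Corollary

end WaterCanal

theorem corollary3p4 (Γ : Set (ℝ × ℝ)) (l : ℝ) (Θ : Set (ℝ × ℝ × ℝ))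
    (hG : IsCanalWithBody Γ l Θ) (μ : ℝ) (hμ : μ ∈ Ioc (muGamma Γ l) 1) :
    (∀ Φ, IsEigenfunctionT0 (water Γ Θ) l μ Φ → ∀ M L : ℝ,
      (∀ Ψ, MemH0 (water Γ Θ) Ψ →
        perturbedForm (water Γ Θ) l (μ⁻¹ - 1) M L Φ Ψ =
          perturbation (water Γ Θ) (μ⁻¹ - 1) M L Φ Ψ) ∧
      (∀ θ : ℝ, ∃ C : ℝ, ∀ Ψ, MemW0 (water Γ Θ) (-θ) Ψ →
        ‖perturbation (water Γ Θ) (μ⁻¹ - 1) M L Φ Ψ‖ ≤ C * normW (water Γ Θ) l (-θ) Ψ)) ∧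
    (∃ θ₀ : ℝ, 0 < θ₀ ∧ ∀ θ : ℝ, 0 < θ → θ ≤ θ₀ →
      ∀ Φ, IsEigenfunctionT0 (water Γ Θ) l μ Φ →
        MemW0 (water Γ Θ) θ Φ ∧
        (∀ M L : ℝ, ∀ Ψ, MemW0 (water Γ Θ) θ Ψ →
          perturbedForm (water Γ Θ) l (μ⁻¹ - 1) M L Φ (weighted (2 * θ) Ψ) =
            perturbation (water Γ Θ) (μ⁻¹ - 1) M L Φ (weighted (2 * θ) Ψ)) ∧
        ∃ C : ℝ, ∀ r : ℝ, 0 ≤ r →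
          tailEnergy (water Γ Θ) l r Φ ≤ ENNReal.ofReal (C * Real.exp (-(2 * θ * r)))) := by
  obtain ⟨hμ0, -, -⟩ := steklov_parameter hG hμ
  refine ⟨fun Φ hΦ M L => ⟨fun Ψ hΨ => ?_, fun θ => exists_perturbation_le hG hΦ.2.1.1.1 _ M L θ⟩, ?_⟩
  -- The perturbation occurs on both sides, so what remains is the half form for Φ.
  · rw [perturbedForm, hΦ.half_form hG hμ0 hΨ]
    ring
  · obtain ⟨θ₀, hθ₀, H⟩ := exists_memLp_axial hG hμ
    refine ⟨θ₀, hθ₀, fun θ hθ hθ' Φ hΦ => ?_⟩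
    obtain ⟨h1, h2⟩ := H θ hθ hθ' Φ hΦ
    -- Square integrability of R_θ Φ and R_θ ∇Φ yields membership in the weighted space by Leibniz'
    -- rule, the term with the derivative of the weight being at most θ R_θ |Φ|. The other two
    -- claims rest on the same two facts.
    refine ⟨⟨memH_weighted hG hθ.le hΦ.2.1.1 h1 h2, hΦ.2.1.2⟩, fun M L Ψ hΨ => ?_, ?_⟩
    · rw [perturbedForm, hΦ.weighted_form hG hμ0 hθ.le h1 h2 hΨ]
      ring
    · obtain ⟨C, hC⟩ := exists_tailEnergy_le (l := l) hG hθ.le hΦ.2.1.1 h1 h2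
      exact ⟨C, fun r _ => hC r⟩
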